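/- Sectored radial sweep efficiency. Let $m\ge 0$, $n=(2m+1)^2$, and consider a grid terrain with rows and columns numbered from $-m$ to $m$; the grid point $p(i,j)$ in row $i$ and column $j$ lies above the point $(x,y)=(j,-i)$ of the plane and has elevation $Z_{ij}\in\mathbb R$. The viewpoint $v$ is $(0,0,0)$. For $(i,j)\ne(0,0)$ let $\mathrm{ElevAngle}(p(i,j))=\arctan\bigl(Z_{ij}/\sqrt{i^2+j^2}\bigr)$, and let $D(p(i,j))$ be the closed unit square centred at $(j,-i)$. A grid point $p\neq p(0,0)$ is visible if $\mathrm{ElevAngle}(q)<\mathrm{ElevAngle}(p)$ for every grid point $q\notin\{p,p(0,0)\}$ such that $D(q)$ meets the horizontal segment from $(0,0)$ to the location of $p$. Let $t$ be the number of visible grid points. The visibility map is the matrix $V$ with $V_{ij}=1$ if $p(i,j)$ is visible and $V_{ij}=0$ otherwise (in particular $V_{00}=0$). The computation takes place in the external-memory model of Aggarwal and Vitter with unit-cost real arithmetic: the internal memory holds $M$ records, a disk block holds $B$ records, $1\le B\le M/2$, a record is a constant number of numbers, and one I/O transfers one block (at most $B$ records) between disk and internal memory. Write $\mathsf{scan}(n)=\lceil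 n/B\rceil$ and $\mathsf{sort}(t)=\frac tB\log_{M/B}\frac tB$, where logarithms smaller than $1$ are replaced by $1$ (here and in $n\log n$). The matrices $Z$ and $V$ are stored on disk row by row, in consecutive blocks. The algorithm SectoredSweep has three phases. (1) It computes azimuth angles $0=\alpha_0<\dots<\alpha_s=2\pi$ such that for each $k$ the grid points whose cells are entered, by a ray that rotates counterclockwise around $v$, at an azimuth in $[\alpha_{k-1},\alpha_k)$ number $\Theta(M)$ (or fewer, if this is the last sector), by running through these enter events in order with a priority queue, without access to elevations; then it scans $Z$ and distributes the records $\langle i,j,Z_{ij}\rangle$ of the points other than $v$ to one list $E_k$ per sector, by binary search among the $\alpha_k$, and those of the points straight to the right of $v$ also to a list $E_0$. (2) It rotates the ray once around $v$. The events (a cell is entered, its centre is passed, a cell is left) are generated on the fly with a priority queue; at equal azimuths, cells are entered first and left last. Each list $E_k$ is loaded and sorted in memory when its first element is needed; the cells that meet the ray are kept in a balanced binary search tree, ordered by distance from $v$ and augmented with the highest elevation angle in each subtree, which is queried when a grid point is passed; the coordinates of the visible points are written to a list $L$. (3) It sorts $L$ by row and column with an external multiway merge sort and scans it to write $V$. Then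 there are constants $c,C>0$ such that for all $m$, all $Z$, and all $M,B$ with $1\le B\le M/2$ and $M^2/B\ge c\,n$, algorithm SectoredSweep writes the visibility map $V$, never holds more than $M$ records in internal memory, and uses at most $C\,n\log n$ computational steps and at most $C\,(\mathsf{scan}(n)+\mathsf{sort}(t))$ I/Os. -/

import Mathlib

noncomputable section

namespace SectoredSweep

/-! ## The terrain model

The grid has `2 * m + 1` rows and columns, both numbered from `-m` to `m`, rows from north to south.
The point in row `i` and column `j` has horizontal coordinates `(x, y) = (j, -i)` and elevation
`Z i j`; the viewpoint is `(0, 0, 0)`. -/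

/-- The number `n` of grid points. -/
def gridSize (m : ℕ) : ℕ := (2 * m + 1) ^ 2

/-- Row and column of the `idx`-th grid point, counted from `0` in row-by-row order. -/
def pointAt (m idx : ℕ) : ℤ × ℤ :=
  (((idx / (2 * m + 1) : ℕ) : ℤ) - m, ((idx % (2 * m + 1) : ℕ) : ℤ) - m)

/-- The grid points in row-by-row order. -/
def gridPoints (m : ℕ) : List (ℤ × ℤ) := (List.range (gridSize m)).map (pointAt m)

/-- Horizontal distance from the viewpoint. -/
def hdist (i j : ℤ) : ℝ := Real.sqrt ((j : ℝ) ^ 2 + (i : ℝ) ^ 2)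

/-- Elevation angle of a point of elevation `z` above row `i`, column `j`. -/
def elevAngle (i j : ℤ) (z : ℝ) : ℝ := Real.arctan (z / hdist i j)

/-- Horizontal location of a grid point. -/
def location (p : ℤ × ℤ) : ℝ × ℝ := ((p.2 : ℝ), -(p.1 : ℝ))

/-- The closed unit square centred at a grid point. -/
def cell (p : ℤ × ℤ) : Set (ℝ × ℝ) :=
  Set.Icc ((location p).1 - 1 / 2) ((location p).1 + 1 / 2) ×ˢ
    Set.Icc ((location p).2 - 1 / 2) ((location p).2 + 1 / 2)

/-- The grid point `p`, other than the viewpoint, is visible: each other grid point whose cell meets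
the horizontal segment from the viewpoint to `p` has a smaller elevation angle. (The viewpoint has
no elevation angle; its own cell never blocks a line of sight.) -/
def Visible (m : ℕ) (Z : ℤ → ℤ → ℝ) (p : ℤ × ℤ) : Prop :=
  p ∈ gridPoints m ∧ p ≠ (0, 0) ∧
    ∀ q ∈ gridPoints m, q ≠ (0, 0) → q ≠ p →
      (cell q ∩ segment ℝ ((0, 0) : ℝ × ℝ) (location p)).Nonempty →
        elevAngle q.1 q.2 (Z q.1 q.2) < elevAngle p.1 p.2 (Z p.1 p.2)

/-- The number `t` of visible grid points. -/
def visibleCount (m : ℕ) (Z : ℤ → ℤ → ℝ) : ℕ := {p : ℤ × ℤ | Visible m Z p}.ncard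

/-! ## The machine model

A computer with an internal memory of `M` records and a disk in blocks of `B` records. A record is a
constant number of numbers. One I/O transfers one block. Each call of a function below that makes a
constant number of elementary operations, apart from calls that are charged themselves, is charged
one step of time, and so is each iteration of a loop and each I/O. Comparisons and arithmetic
on numbers (including `arctan`) and reading or storing one cell of an array are elementary.
Lists stand for arrays. Internal memory is measured phase by phase, as the number of records in the
data structures, stream buffers and arrays that the phase keeps. -/

/-- What one cell of a file can hold. -/
inductive Rec where
  | elev (z : ℝ)
  | point (i j : ℤ) (z : ℝ)
  | coord (i j : ℤ)
  | bit (b : Bool)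

/-- The row and column stored in a record. -/
def Rec.pos : Rec → ℤ × ℤ
  | .elev _ => (0, 0)
  | .point i j _ => (i, j)
  | .coord i j => (i, j)
  | .bit _ => (0, 0)

/-- The elevation stored in a record. -/
def Rec.height : Rec → ℝ
  | .elev z => z
  | .point _ _ z => z
  | .coord _ _ => 0
  | .bit _ => 0

/-- File names: the input matrix `Z`, the sector lists `E_k`, the list `L` of visible points, the
runs of the external merge sort (by level and number), and the output matrix `V`. -/
inductive File where
  | input
  | sector (k : ℕ)
  | visible
  | run (level k : ℕ)
  | output
  deriving DecidableEq

/-- The disk (each file is a sequence of blocks), and the counters: steps made, I/Os made, and the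
largest number of records that were in internal memory at the same time. -/
structure Machine where
  disk : File → List (List Rec)
  time : ℕ
  ios : ℕ
  peak : ℕ

/-- Programs of the machine. -/
abbrev EM (α : Type) : Type := StateM Machine α

/-- What the algorithm knows in advance: the half width of the grid, the memory size and the block
size. -/
structure Params where
  m : ℕ
  M : ℕ
  B : ℕ

/-- Number of grid points. -/
def Params.n (P : Params) : ℕ := gridSize P.m

/-- Number of grid points per sector, up to ties: a suitable constant fraction of the memory. -/
def Params.sectorCap (P : Params) : ℕ := P.M / 16

/-- Number of blocks per initial run of the external merge sort. -/
def Params.runBlocks (P : Params) : ℕ := max 1 (P.M / 16 / P.B)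

/-- Number of runs that the external merge sort merges at a time. -/
def Params.fanIn (P : Params) : ℕ := max 2 (P.M / (16 * P.B))

/-- Charge one step. -/
def step : EM Unit := modify fun s => { s with time := s.time + 1 }

/-- Record that `k` records are in internal memory now, besides a constant number of scalar
variables (which are charged 16 records). -/
def use (k : ℕ) : EM Unit := modify fun s => { s with peak := max s.peak (k + 16) }

/-- Copy a block from disk to memory; behind the end of the file the result is empty. -/
def readBlock (f : File) (b : ℕ) : EM (List Rec) := do
  modify fun s => { s with time := s.time + 1, ios := s.ios + 1 }
  let s ← get
  pure ((s.disk f).getD b [])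

/-- Copy at most `B` records from memory to a new block at the end of a file. -/
def appendBlock (P : Params) (f : File) (blk : List Rec) : EM Unit :=
  modify fun s =>
    { s with
      disk := Function.update s.disk f (s.disk f ++ [blk.take P.B])
      time := s.time + 1
      ios := s.ios + 1 }

/-- `for k ← 0 to count - 1 do s ← body k s`. -/
def forLoop {σ : Type} : ℕ → (ℕ → σ → EM σ) → σ → EM σ
  | 0, _, s => pure s
  | k + 1, body, s => do
    let s ← forLoop k body s
    step
    body k s

/-- `while cond s do s ← body s`, stopped after `fuel` iterations at the latest. -/
def whileLoop {σ : Type} (cond : σ → Bool) (body : σ → EM σ) : ℕ → σ → EM σ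
  | 0, s => pure s
  | fuel + 1, s => do
    step
    if cond s then
      let s ← body s
      whileLoop cond body fuel s
    else pure s

/-- A computation in internal memory, with the number of its steps. -/
structure Timed (α : Type) where
  val : α
  cost : ℕ

instance : Monad Timed where
  pure a := ⟨a, 0⟩
  bind x f := ⟨(f x.val).val, x.cost + (f x.val).cost⟩

/-- Charge one step. -/
def tick : Timed Unit := ⟨(), 1⟩

/-- Run a computation in internal memory. -/
def internal {α : Type} (x : Timed α) : EM α := do
  modify fun s => { s with time := s.time + x.cost }
  pure x.val

/-! ### Sequential files -/

/-- Sequential reading with one block in memory. -/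
structure ReadStream where
  file : File
  next : ℕ
  buf : List Rec
  eof : Bool

/-- Start reading a file. -/
def ReadStream.ofFile (f : File) : ReadStream := ⟨f, 0, [], false⟩

/-- Make the next record (if there is one) the head of the buffer. -/
def ReadStream.fill (r : ReadStream) : EM ReadStream := do
  step
  if r.buf.isEmpty && !r.eof then
    let blk ← readBlock r.file r.next
    pure { r with next := r.next + 1, buf := blk, eof := blk.isEmpty }
  else pure r

/-- Move behind the record at the head of the buffer. -/
def ReadStream.skip (r : ReadStream) : ReadStream := { r with buf := r.buf.tail }

/-- Sequential writing with one block in memory. -/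
structure WriteStream where
  file : File
  buf : List Rec

/-- Write one record. -/
def WriteStream.push (P : Params) (w : WriteStream) (x : Rec) : EM WriteStream := do
  step
  if P.B ≤ w.buf.length + 1 then
    appendBlock P w.file (w.buf ++ [x])
    pure { w with buf := [] }
  else pure { w with buf := w.buf ++ [x] }

/-- Write the records of a list. -/
def WriteStream.pushAll (P : Params) (w : WriteStream) : List Rec → EM WriteStream
  | [] => pure w
  | x :: xs => do
    let w ← w.push P x
    w.pushAll P xs

/-- Write the last, incomplete block. -/
def WriteStream.close (P : Params) (w : WriteStream) : EM Unit := do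
  step
  if w.buf.isEmpty then pure () else appendBlock P w.file w.buf

/-! ### Priority queues and sorting in memory -/

/-- Leftist heaps; `rank` is the length of the rightmost path. -/
inductive Heap (α : Type) where
  | leaf
  | node (rank : ℕ) (l : Heap α) (x : α) (r : Heap α)

namespace Heap

variable {α : Type}

/-- The sum of a function over the elements. -/
def total (f : α → ℕ) : Heap α → ℕ
  | leaf => 0
  | node _ l x r => l.total f + f x + r.total f

/-- Number of elements. -/
def size (h : Heap α) : ℕ := h.total fun _ => 1

/-- Emptiness test. -/
def isEmpty : Heap α → Bool
  | leaf => true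
  | node _ _ _ _ => false

/-- The stored rank. -/
def rk : Heap α → ℕ
  | leaf => 0
  | node k _ _ _ => k

/-- Make a node whose left child has the larger rank. -/
def mk (x : α) (a b : Heap α) : Heap α :=
  if b.rk ≤ a.rk then node (b.rk + 1) a x b else node (a.rk + 1) b x a

/-- Merge two heaps. -/
def merge (le : α → α → Bool) : Heap α → Heap α → Timed (Heap α)
  | leaf, h => do tick; pure h
  | node k l x r, leaf => do tick; pure (node k l x r)
  | node k₁ l₁ x₁ r₁, node k₂ l₂ x₂ r₂ => do
    tick
    if le x₁ x₂ then
      let h ← merge le r₁ (node k₂ l₂ x₂ r₂)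
      pure (mk x₁ l₁ h)
    else
      let h ← merge le (node k₁ l₁ x₁ r₁) r₂
      pure (mk x₂ l₂ h)
  termination_by a b => sizeOf a + sizeOf b

/-- Insert an element. -/
def insert (le : α → α → Bool) (x : α) (h : Heap α) : Timed (Heap α) := do
  tick
  merge le (node 1 leaf x leaf) h

/-- Extract a smallest element. -/
def deleteMin (le : α → α → Bool) : Heap α → Timed (Option (α × Heap α))
  | leaf => do tick; pure none
  | node _ l x r => do
    tick
    let h ← merge le l r
    pure (some (x, h))

/-- Insert the elements of a list. -/
def insertAll (le : α → α → Bool) : List α → Heap α → Timed (Heap α)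
  | [], h => pure h
  | x :: xs, h => do
    let h ← insert le x h
    insertAll le xs h

/-- Extract `k` elements in order. -/
def drain (le : α → α → Bool) : ℕ → Heap α → Timed (List α)
  | 0, _ => pure []
  | k + 1, h => do
    match ← deleteMin le h with
    | none => pure []
    | some (x, h) =>
      let xs ← drain le k h
      pure (x :: xs)

end Heap

/-- Sort a list in memory. -/
def sortList {α : Type} (le : α → α → Bool) (l : List α) : Timed (List α) := do
  let h ← Heap.insertAll le l Heap.leaf
  Heap.drain le l.length h

/-- Lexicographic comparison of lists of the same length. -/
def lexLt : List ℤ → List ℤ → Bool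
  | a :: as, b :: bs => if a < b then true else if b < a then false else lexLt as bs
  | _, _ => false

/-! ### The active structure -/

/-- Squared distance of a grid point from the viewpoint. -/
def dist2 (p : ℤ × ℤ) : ℤ := p.1 ^ 2 + p.2 ^ 2

/-- Order of increasing distance from the viewpoint, with ties broken by row and column. -/
def nearer (p q : ℤ × ℤ) : Bool := lexLt [dist2 p, p.1, p.2] [dist2 q, q.1, q.2]

/-- AVL trees of grid points with their elevation angles, ordered by `nearer`; each node stores the
highest elevation angle and the height of its subtree. -/
inductive Active where
  | leaf
  | node (l : Active) (p : ℤ × ℤ) (β : ℝ) (top : WithBot ℝ) (h : ℕ) (r : Active)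

namespace Active

/-- Number of nodes. -/
def size : Active → ℕ
  | leaf => 0
  | node l _ _ _ _ r => l.size + 1 + r.size

/-- Stored height. -/
def ht : Active → ℕ
  | leaf => 0
  | node _ _ _ _ h _ => h

/-- Stored highest elevation angle. -/
def highest : Active → WithBot ℝ
  | leaf => ⊥
  | node _ _ _ top _ _ => top

/-- Make a node. -/
def mk (l : Active) (p : ℤ × ℤ) (β : ℝ) (r : Active) : Active :=
  node l p β (max l.highest (max (β : WithBot ℝ) r.highest)) (max l.ht r.ht + 1) r

/-- Make a node, with a rotation if the heights of the children differ by two. -/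
def balance (l : Active) (p : ℤ × ℤ) (β : ℝ) (r : Active) : Active :=
  if r.ht + 1 < l.ht then
    match l with
    | leaf => mk l p β r
    | node ll lp lβ _ _ lr =>
      if lr.ht ≤ ll.ht then mk ll lp lβ (mk lr p β r)
      else
        match lr with
        | leaf => mk l p β r
        | node a q γ _ _ b => mk (mk ll lp lβ a) q γ (mk b p β r)
  else if l.ht + 1 < r.ht then
    match r with
    | leaf => mk l p β r
    | node rl rp rβ _ _ rr =>
      if rl.ht ≤ rr.ht then mk (mk l p β rl) rp rβ rr
      else
        match rl with
        | leaf => mk l p β r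
        | node a q γ _ _ b => mk (mk l p β a) q γ (mk b rp rβ rr)
  else mk l p β r

/-- Insert a grid point with its elevation angle. -/
def insert (p : ℤ × ℤ) (β : ℝ) : Active → Timed Active
  | leaf => do tick; pure (mk leaf p β leaf)
  | node l q γ _ _ r => do
    tick
    if nearer p q then
      let l ← insert p β l
      pure (balance l q γ r)
    else if nearer q p then
      let r ← insert p β r
      pure (balance l q γ r)
    else pure (mk l p β r)

/-- Remove the nearest grid point of a nonempty tree. -/
def popNearest : Active → Timed (Option ((ℤ × ℤ) × ℝ × Active))
  | leaf => do tick; pure none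
  | node l q γ _ _ r => do
    tick
    match ← popNearest l with
    | none => pure (some (q, γ, r))
    | some (p, β, l) => pure (some (p, β, balance l q γ r))

/-- Delete a grid point. -/
def delete (p : ℤ × ℤ) : Active → Timed Active
  | leaf => do tick; pure leaf
  | node l q γ _ _ r => do
    tick
    if nearer p q then
      let l ← delete p l
      pure (balance l q γ r)
    else if nearer q p then
      let r ← delete p r
      pure (balance l q γ r)
    else
      match ← popNearest r with
      | none => pure l
      | some (q, γ, r) => pure (balance l q γ r)

/-- The elevation angle stored with a grid point. -/
def lookup (p : ℤ × ℤ) : Active → Timed (WithBot ℝ)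
  | leaf => do tick; pure ⊥
  | node l q γ _ _ r => do
    tick
    if nearer p q then lookup p l else if nearer q p then lookup p r else pure (γ : WithBot ℝ)

/-- The highest elevation angle of the grid points that lie closer to the viewpoint than `p`. -/
def highestCloser (p : ℤ × ℤ) : Active → Timed (WithBot ℝ)
  | leaf => do tick; pure ⊥
  | node l q γ _ _ r => do
    tick
    if dist2 q < dist2 p then
      let b ← highestCloser p r
      pure (max l.highest (max (γ : WithBot ℝ) b))
    else highestCloser p l

/-- Is the elevation angle of `p` higher than that of all active cells closer to the viewpoint? -/
def isVisible (p : ℤ × ℤ) (A : Active) : Timed Bool := do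
  tick
  let β ← lookup p A
  let top ← highestCloser p A
  pure (decide (top < β))

end Active

/-! ### Azimuth angles and events -/

/-- An azimuth angle, in exact representation: `half * π + θ`, where `θ ∈ [0, π)` is the angle
between the vector `(x, y)` and the ray with azimuth `0` or `π` on which it or clockwise from which
it lies, according to the parity of `half`. -/
structure Azimuth where
  half : ℤ
  x : ℤ
  y : ℤ

/-- The azimuth angle, between `2 * π * turn` and `2 * π * (turn + 1)`, of a nonzero vector. -/
def Azimuth.ofVector (turn : ℤ) (v : ℤ × ℤ) : Azimuth :=
  ⟨2 * turn + (if 0 < v.2 ∨ v.2 = 0 ∧ 0 < v.1 then 0 else 1), v.1, v.2⟩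

/-- Comparison of azimuth angles. -/
def Azimuth.lt (a b : Azimuth) : Bool :=
  decide (a.half < b.half ∨ a.half = b.half ∧ 0 < a.x * b.y - a.y * b.x)

/-- Twice the vector from the viewpoint to the corner where a counterclockwise sweep starts to
intersect the cell. -/
def enterCorner (p : ℤ × ℤ) : ℤ × ℤ :=
  let x := p.2
  let y := -p.1
  (2 * x + (if y = 0 then -x.sign else y.sign), 2 * y + (if x = 0 then -y.sign else -x.sign))

/-- Twice the vector from the viewpoint to the corner where a counterclockwise sweep stops to
intersect the cell. -/
def exitCorner (p : ℤ × ℤ) : ℤ × ℤ :=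
  let x := p.2
  let y := -p.1
  (2 * x + (if y = 0 then -x.sign else -y.sign), 2 * y + (if x = 0 then -y.sign else x.sign))

/-- The three types of events. -/
inductive Kind where
  | enter
  | center
  | exit
  deriving DecidableEq

/-- At the same azimuth, cells are entered first and left last, since cells are closed. -/
def Kind.order : Kind → ℤ
  | .enter => 0
  | .center => 1
  | .exit => 2

/-- An event of the sweep; `turn` tells in which round of the sweep line it is, so that `-1` stands
for the azimuth angle minus `2π`. -/
structure Event where
  kind : Kind
  pos : ℤ × ℤ
  turn : ℤ

/-- The azimuth angle of an event. -/
def Event.azimuth (e : Event) : Azimuth :=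
  match e.kind with
  | .enter => Azimuth.ofVector e.turn (enterCorner e.pos)
  | .center => Azimuth.ofVector e.turn (e.pos.2, -e.pos.1)
  | .exit => Azimuth.ofVector e.turn (exitCorner e.pos)

/-- Order of the events: by azimuth angle, then by type, then by distance. -/
def Event.le (e f : Event) : Bool :=
  if e.azimuth.lt f.azimuth then true
  else if f.azimuth.lt e.azimuth then false
  else !(lexLt [f.kind.order, dist2 f.pos, f.pos.1, f.pos.2]
    [e.kind.order, dist2 e.pos, e.pos.1, e.pos.2])

/-- The event that a cell is entered in the main round. -/
def enterEvent (p : ℤ × ℤ) : Event := ⟨.enter, p, 0⟩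

/-- The cell that comes next, in counterclockwise order, in the same layer of the grid. -/
def nextCell (p : ℤ × ℤ) : ℤ × ℤ :=
  let i := p.1
  let j := p.2
  if |i| < j ∨ i = j ∧ 0 < j then (i - 1, j)
  else if |j| < -i ∨ j = -i ∧ 0 < j then (i, j - 1)
  else if |i| < -j ∨ i = j ∧ j < 0 then (i + 1, j)
  else (i, j + 1)

/-- The round in which the sweep line is when it has passed the enter event `e`: cells straight to
the right of the viewpoint are entered just before a round starts. -/
def turnAfter (e : Event) : ℤ := if e.pos.1 = 0 ∧ 0 < e.pos.2 then e.turn + 1 else e.turn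

/-- Insert an event in a priority queue. -/
def schedule (e : Event) (Q : Heap Event) : EM (Heap Event) := internal (Heap.insert Event.le e Q)

/-- The priority queue with the enter events of all cells straight to the right. -/
def initialQueue (P : Params) : EM (Heap Event) :=
  forLoop P.m (fun k Q => schedule ⟨.enter, (0, (k : ℤ) + 1), -1⟩ Q) Heap.leaf

/-! ## The algorithm -/

/-! ### First phase: distribution into sectors -/

/-- State of the computation of the sector boundaries: the enter events in front of the sweep line,
the number of cells that were entered at azimuth `0` or later, and the boundaries found, except
`0` and `2π`. -/
structure BoundaryState where
  queue : Heap Event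
  count : ℕ
  bounds : List Azimuth

/-- Number of records in memory; the factor `2` leaves room for the recursion stack. -/
def BoundaryState.footprint (s : BoundaryState) : ℕ := 2 * s.queue.size + s.bounds.length

/-- Compute sector boundaries such that each sector has about `sectorCap` points: visit the cells in
the order of their enter events, without access to their elevations, and let a sector start at
each `sectorCap`-th of them. -/
def sectorBounds (P : Params) : EM (List Azimuth) := do
  let Q ← initialQueue P
  let s ← forLoop (P.m + (P.n - 1)) (fun _ s => do
      use s.footprint
      match ← internal (Heap.deleteMin Event.le s.queue) with
      | none => pure s
      | some (e, Q) =>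
        let Q ← schedule ⟨.enter, nextCell e.pos, turnAfter e⟩ Q
        if e.turn < 0 then pure { s with queue := Q }
        else
          let bounds :=
            if 0 < s.count ∧ s.count % P.sectorCap = 0 then s.bounds ++ [e.azimuth] else s.bounds
          pure ⟨Q, s.count + 1, bounds⟩)
    (⟨Q, 0, []⟩ : BoundaryState)
  pure s.bounds

/-- Binary search: how many of the boundaries are at most `a`, if the number is between `lo` and
`lo + len`? -/
def countBounds (bounds : List Azimuth) (a : Azimuth) (lo len : ℕ) : Timed ℕ := do
  tick
  if len = 0 then pure lo
  else
    if a.lt (bounds.getD (lo + len / 2) a) then countBounds bounds a lo (len / 2)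
    else countBounds bounds a (lo + len / 2 + 1) (len - len / 2 - 1)
  termination_by len
  decreasing_by all_goals omega

/-- State of the distribution: the input stream and, for each sector, a write buffer. -/
structure DistState where
  input : ReadStream
  bufs : ℕ → List Rec

/-- Number of records in memory, if there are the boundaries `bounds`. -/
def DistState.footprint (bounds : List Azimuth) (s : DistState) : ℕ :=
  s.input.buf.length + bounds.length +
    ∑ k ∈ Finset.range (bounds.length + 2), (s.bufs k).length

/-- Write a record to `E_k`. -/
def DistState.send (P : Params) (s : DistState) (k : ℕ) (x : Rec) : EM DistState := do
  let w ← (⟨.sector k, s.bufs k⟩ : WriteStream).push P x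
  pure { s with bufs := Function.update s.bufs k w.buf }

/-- Read the grid row by row and write each point, except the viewpoint, to the list of its sector,
and the points straight to the right also to `E_0`. -/
def distribute (P : Params) (bounds : List Azimuth) : EM Unit := do
  let s ← forLoop P.n (fun idx s => do
      let p := pointAt P.m idx
      let r ← s.input.fill
      let s := { s with input := r }
      use (s.footprint bounds)
      match r.buf with
      | [] => pure s
      | z :: _ =>
        let s := { s with input := r.skip }
        if p = (0, 0) then pure s
        else
          let c ← internal (countBounds bounds (enterEvent p).azimuth 0 bounds.length)
          let s ← s.send P (c + 1) (.point p.1 p.2 z.height)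
          if p.1 = 0 ∧ 0 < p.2 then s.send P 0 (.point p.1 p.2 z.height) else pure s)
    (⟨.ofFile .input, fun _ => []⟩ : DistState)
  forLoop (bounds.length + 2)
    (fun k _ => (⟨.sector k, s.bufs k⟩ : WriteStream).close P) ()

/-! ### Second phase: sweep -/

/-- State of the sweep: the events in front of the sweep line, the active cells, the current sector
with its unread records, the list of visible points, and the number of points whose visibility is
not known yet. -/
structure SweepState where
  queue : Heap Event
  active : Active
  sector : ℕ
  unread : List Rec
  out : WriteStream
  remaining : ℕ

/-- Number of records in memory; the factors `2` leave room for recursion stacks and sorting. -/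
def SweepState.footprint (s : SweepState) : ℕ :=
  2 * s.queue.size + 2 * s.active.size + 2 * s.unread.length + s.out.buf.length

/-- Load all records of `E_k`. -/
def loadSector (P : Params) (k : ℕ) (s : SweepState) : EM SweepState := do
  let r ← whileLoop (fun x : SweepState × ℕ × Bool => !x.2.2) (fun x => do
      let blk ← readBlock (.sector k) x.2.1
      let s := { x.1 with unread := x.1.unread ++ blk }
      use s.footprint
      pure (s, x.2.1 + 1, blk.isEmpty))
    (P.n + 2) ({ s with sector := k, unread := [] }, 0, false)
  let l ← internal
    (sortList (fun a b => Event.le (enterEvent a.pos) (enterEvent b.pos)) r.1.unread)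
  pure { r.1 with unread := l }

/-- Process an enter event. -/
def processEnter (P : Params) (e : Event) (s : SweepState) : EM SweepState := do
  step
  let s ← if s.unread.isEmpty then loadSector P (s.sector + 1) s else pure s
  match s.unread with
  | [] => pure s
  | z :: rest =>
    let β := elevAngle e.pos.1 e.pos.2 z.height
    let A ← internal (s.active.insert e.pos β)
    let τ := turnAfter e
    let Q ← schedule ⟨.center, e.pos, τ⟩ s.queue
    let Q ← schedule ⟨.exit, e.pos, τ⟩ Q
    let Q ← schedule ⟨.enter, nextCell e.pos, τ⟩ Q
    pure { s with queue := Q, active := A, unread := rest }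

/-- Process a center event. -/
def processCenter (P : Params) (e : Event) (s : SweepState) : EM SweepState := do
  step
  let vis ← internal (s.active.isVisible e.pos)
  let w ← if vis then s.out.push P (.coord e.pos.1 e.pos.2) else pure s.out
  pure { s with out := w, remaining := s.remaining - 1 }

/-- Process an exit event. -/
def processExit (e : Event) (s : SweepState) : EM SweepState := do
  step
  let A ← internal (s.active.delete e.pos)
  pure { s with active := A }

/-- Process the next event. -/
def sweepStep (P : Params) (s : SweepState) : EM SweepState := do
  use s.footprint
  match ← internal (Heap.deleteMin Event.le s.queue) with
  | none => pure s
  | some (e, Q) =>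
    let s := { s with queue := Q }
    let s ← match e.kind with
      | .enter => processEnter P e s
      | .center => processCenter P e s
      | .exit => processExit e s
    use s.footprint
    pure s

/-- Sweep until the visibility of all points is known. -/
def sweep (P : Params) : EM Unit := do
  let Q ← initialQueue P
  let s ← loadSector P 0 ⟨Q, .leaf, 0, [], ⟨.visible, []⟩, P.n - 1⟩
  let s ← whileLoop (fun s : SweepState => decide (0 < s.remaining)) (sweepStep P) (4 * P.n) s
  s.out.close P

/-! ### Third phase: produce the visibility map -/

/-- Lexicographic order by row and column. -/
def coordLe (a b : Rec) : Bool := !(lexLt [b.pos.1, b.pos.2] [a.pos.1, a.pos.2])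

/-- Form sorted runs, each from `runBlocks` blocks of the list of visible points; returns their
number. -/
def formRuns (P : Params) : EM ℕ := do
  let x ← whileLoop (fun x : ℕ × Bool => !x.2) (fun x => do
      let y ← whileLoop
        (fun y : List Rec × ℕ × Bool => decide (y.2.1 < P.runBlocks) && !y.2.2) (fun y => do
          let blk ← readBlock .visible (x.1 * P.runBlocks + y.2.1)
          let l := y.1 ++ blk
          use (2 * l.length)
          pure (l, y.2.1 + 1, decide (blk.length < P.B)))
        (P.n + 2) ([], 0, false)
      let l := y.1
      if l.isEmpty then pure (x.1, true)
      else
        let l ← internal (sortList coordLe l)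
        let w ← (⟨.run 0 x.1, []⟩ : WriteStream).pushAll P l
        w.close P
        pure (x.1 + 1, false))
    (P.n + 2) (0, false)
  pure x.1

/-- State of a merge: the input streams, in a priority queue by their first records, and the
output. -/
structure MergeState where
  heads : Heap ReadStream
  out : WriteStream

/-- Number of records in memory. -/
def MergeState.footprint (s : MergeState) : ℕ :=
  s.heads.total (fun r => r.buf.length + 2) + s.out.buf.length

/-- Order of streams with nonempty buffers by their first records. -/
def headLe (a b : ReadStream) : Bool :=
  match a.buf, b.buf with
  | x :: _, y :: _ => coordLe x y
  | _, _ => true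

/-- Put a stream in the priority queue, unless it has ended. -/
def MergeState.add (s : MergeState) (r : ReadStream) : EM MergeState := do
  let r ← r.fill
  if r.buf.isEmpty then pure s
  else
    let h ← internal (Heap.insert headLe r s.heads)
    let s := { s with heads := h }
    use s.footprint
    pure s

/-- Merge the runs `first, …, first + count - 1` of a level into the run `k` of the next level. -/
def mergeRuns (P : Params) (level first count k : ℕ) : EM Unit := do
  let s ← forLoop count (fun a s => s.add (.ofFile (.run level (first + a))))
    (⟨.leaf, ⟨.run (level + 1) k, []⟩⟩ : MergeState)
  let s ← whileLoop (fun s : MergeState => !s.heads.isEmpty) (fun s => do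
      match ← internal (Heap.deleteMin headLe s.heads) with
      | none => pure s
      | some (r, h) =>
        match r.buf with
        | [] => pure { s with heads := h }
        | x :: _ =>
          let w ← s.out.push P x
          (⟨h, w⟩ : MergeState).add r.skip)
    (P.n + 1) s
  s.out.close P

/-- External merge sort of the list of visible points; returns the name of the sorted file. -/
def sortVisible (P : Params) : EM File := do
  let k ← formRuns P
  let x ← whileLoop (fun x : ℕ × ℕ => decide (1 < x.2)) (fun x => do
      let groups := (x.2 + P.fanIn - 1) / P.fanIn
      forLoop groups
        (fun g _ => mergeRuns P x.1 (g * P.fanIn) (min P.fanIn (x.2 - g * P.fanIn)) g) ()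
      pure (x.1 + 1, groups))
    (P.n + 1) (0, k)
  pure (.run x.1 0)

/-- Scan the sorted list of visible points and write the visibility map, row by row. -/
def produceMap (P : Params) (sorted : File) : EM Unit := do
  let s ← forLoop P.n (fun idx s => do
      let p := pointAt P.m idx
      let r ← s.1.fill
      use (r.buf.length + s.2.buf.length)
      match r.buf with
      | [] =>
        let w ← s.2.push P (.bit false)
        pure (r, w)
      | x :: _ =>
        if x.pos = p then
          let w ← s.2.push P (.bit true)
          pure (r.skip, w)
        else
          let w ← s.2.push P (.bit false)
          pure (r, w))
    ((.ofFile sorted, ⟨.output, []⟩) : ReadStream × WriteStream)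
  s.2.close P

/-- The radial sweep in sectors. -/
def sectoredSweep (P : Params) : EM Unit := do
  let bounds ← sectorBounds P
  distribute P bounds
  sweep P
  let sorted ← sortVisible P
  produceMap P sorted

/-! ## Input, output and cost -/

/-- The machine at the start: the only file on disk is the elevation matrix, stored row by row in
blocks of `B` elevations. -/
def initialMachine (m B : ℕ) (Z : ℤ → ℤ → ℝ) : Machine where
  disk f :=
    match f with
    | .input => ((gridPoints m).map fun p => Rec.elev (Z p.1 p.2)).toChunks B
    | _ => []
  time := 0
  ios := 0
  peak := 0

/-- The machine after the algorithm. -/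
def finalMachine (m M B : ℕ) (Z : ℤ → ℤ → ℝ) : Machine :=
  ((sectoredSweep ⟨m, M, B⟩).run (initialMachine m B Z)).2

open Classical in
/-- The visibility map, stored row by row in blocks of `B` entries. -/
def visibilityMapFile (m B : ℕ) (Z : ℤ → ℤ → ℝ) : List (List Rec) :=
  ((gridPoints m).map fun p => Rec.bit (decide (Visible m Z p))).toChunks B

/-- `scan(n)`, the number of blocks of `n` consecutive records. -/
def scanIOs (B n : ℕ) : ℝ := (⌈(n : ℝ) / B⌉₊ : ℝ)

/-- `sort(t) = (t / B) log_{M/B} (t / B)`, where a logarithm less than `1` counts as `1`. -/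
def sortIOs (M B t : ℕ) : ℝ := (t : ℝ) / B * max 1 (Real.logb ((M : ℝ) / B) ((t : ℝ) / B))

end SectoredSweep

end

noncomputable section

namespace SectoredSweep

/-! ## Timed computations, heaps and sorting -/

/-! Correctness rests on one fact of plane geometry (`blocks_iff`): a cell `q` meets the line of
sight to `p` exactly when the ray through `p` meets the cell and `q` is strictly closer to the
viewpoint. If a point of that ray at parameter `s ≤ 1` lies within half a unit of `q` in both
coordinates, then integrality forces the coordinates of `q` to be at most those of `p` in absolute
value; for `s ≥ 1` it is the other way round. Hence, if the tree holds the cells that meet the ray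
when the ray passes `p` (`activeAt_center_iff`), one query for the highest angle among strictly
closer cells decides visibility (`ActiveInv.isVisible`).

The events arrive in order without being sorted in advance. The rational number `dirKey` replaces
the azimuth, so events carry an exact linear order. Every event up to one full turn is either
initial or is put in the queue by a unique event with a smaller key, and what is scheduled beyond
the full turn is larger than everything else. In any such `EventSystem` a priority queue delivers
the events in sorted order (`EventSystem.next`, `EventSystem.step`). An enter event schedules the
next enter event of its own layer, so the queue holds one enter event per layer besides the centers
and exits of active cells.

For the memory bound, a ray meets at most `3 * (2 * m + 1)` cells (`card_inCone_le`), so queue and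
tree have size of order `√n`, while `M ^ 2 / B ≥ c * n` and `B ≥ 1` make `M` a large multiple of
`√n`. Sectors start at every `M / 16`-th enter event. At most `4 * m + 3` cells are entered at the
same azimuth (`card_enter_eq_le`), so ties neither make a sector too large for memory nor make it
empty. There are of order `n / M` boundaries, and write buffers for all lists take of order `n * B /
M` records besides a constant number of blocks, a small fraction of `M`. If `B` is comparable with
`M`, then `M` is much larger than `n` and the buffers cannot fill up.

For the I/Os, distribution and sweep transfer each record a constant number of times, plus a
constant number of blocks per sector; as `B ≤ M / 2`, this is of order `n / B + 1`. The hypothesis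
on `M ^ 2 / B` also implies that the initial runs of the merge sort do not outnumber its fan-in
(`Params.Admissible.run_count`), so there is at most one merge pass and the third phase is linear in
`n / B` as well. The term `sort(t)` of the bound therefore enters only through being nonnegative.

For the time, each of the `O(n)` events and records causes a constant number of operations on
leftist heaps and AVL trees of logarithmic cost, or one binary search. All program statements are
postconditions in the sense of `Holds`, proved with loop invariants; I/Os are amortised by tracking
`B * ios` together with buffer lengths and the potential of the read streams. -/

@[simp] theorem Timed.val_pure {α : Type} (a : α) : (pure a : Timed α).val = a := rfl
@[simp] theorem Timed.cost_pure {α : Type} (a : α) : (pure a : Timed α).cost = 0 := rfl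
@[simp] theorem Timed.val_bind {α β : Type} (x : Timed α) (f : α → Timed β) :
    (x >>= f).val = (f x.val).val := rfl
@[simp] theorem Timed.cost_bind {α β : Type} (x : Timed α) (f : α → Timed β) :
    (x >>= f).cost = x.cost + (f x.val).cost := rfl
@[simp] theorem tick_cost : tick.cost = 1 := rfl

/-- A Boolean comparison is a total preorder on the elements that satisfy `S`. -/
structure TotalOn {α : Type} (le : α → α → Bool) (S : α → Prop) : Prop where
  total : ∀ x y, S x → S y → le x y = false → le y x = true
  trans : ∀ x y z, S x → S y → S z → le x y = true → le y z = true → le x z = true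

theorem TotalOn.of_key {α κ : Type} [LinearOrder κ] {le : α → α → Bool} {S : α → Prop}
    (key : α → κ) (h : ∀ x y, S x → S y → (le x y = true ↔ key x ≤ key y)) : TotalOn le S where
  total x y hx hy hxy := by
    rw [h y x hy hx]
    by_contra hc
    have := (h x y hx hy).2 (le_of_lt (not_le.1 hc))
    simp [this] at hxy
  trans x y z hx hy hz hxy hyz := by
    rw [h x z hx hz]
    exact ((h x y hx hy).1 hxy).trans ((h y z hy hz).1 hyz)

theorem TotalOn.refl {α : Type} {le : α → α → Bool} {S : α → Prop} (h : TotalOn le S) {x : α}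
    (hx : S x) : le x x = true := by
  by_contra hc
  exact hc (h.total x x hx hx (by simpa using hc))

/-! ### Leftist heaps. -/

namespace Heap

variable {α : Type}

/-- The multiset of elements. -/
def elems : Heap α → Multiset α
  | leaf => 0
  | node _ l x r => x ::ₘ (l.elems + r.elems)

/-- Ranks are correct, and the left child has at least the rank of the right child. -/
def Leftist : Heap α → Prop
  | leaf => True
  | node k l _ r => k = r.rk + 1 ∧ r.rk ≤ l.rk ∧ l.Leftist ∧ r.Leftist

/-- The heap property. -/
def Ordered (le : α → α → Bool) : Heap α → Prop
  | leaf => True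
  | node _ l x r => (∀ y ∈ l.elems + r.elems, le x y = true) ∧ l.Ordered le ∧ r.Ordered le

@[simp] theorem rk_leaf : (leaf : Heap α).rk = 0 := rfl
@[simp] theorem rk_node (k : ℕ) (l : Heap α) (x : α) (r : Heap α) : (node k l x r).rk = k := rfl
@[simp] theorem elems_leaf : (leaf : Heap α).elems = 0 := rfl

theorem total_eq (f : α → ℕ) (h : Heap α) : h.total f = (h.elems.map f).sum := by
  induction h with
  | leaf => rfl
  | node k l x r ihl ihr => simp [total, elems, ihl, ihr]; ring

theorem size_eq (h : Heap α) : h.size = Multiset.card h.elems := by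
  simp [size, total_eq]

theorem isEmpty_iff (h : Heap α) : h.isEmpty = true ↔ h.elems = 0 := by
  cases h <;> simp [isEmpty, elems]

theorem elems_mk (x : α) (a b : Heap α) : (mk x a b).elems = x ::ₘ (a.elems + b.elems) := by
  unfold mk
  split <;> simp [elems, add_comm]

theorem leftist_mk {x : α} {a b : Heap α} (ha : a.Leftist) (hb : b.Leftist) :
    (mk x a b).Leftist := by
  unfold mk
  split
  · exact ⟨rfl, by assumption, ha, hb⟩
  · exact ⟨rfl, by omega, hb, ha⟩

theorem ordered_mk {le : α → α → Bool} {x : α} {a b : Heap α} (ha : a.Ordered le)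
    (hb : b.Ordered le) (hx : ∀ y ∈ a.elems + b.elems, le x y = true) :
    (mk x a b).Ordered le := by
  unfold mk
  split
  · exact ⟨hx, ha, hb⟩
  · exact ⟨by rwa [add_comm], hb, ha⟩

/-- The left child has at least the rank of the right child, so by induction both contain at least
`2 ^ r.rk - 1` elements. Ranks are therefore logarithmic. -/
theorem two_pow_rk_le {h : Heap α} (hh : h.Leftist) : 2 ^ h.rk ≤ Multiset.card h.elems + 1 := by
  induction h with
  | leaf => simp
  | node k l x r ihl ihr =>
    obtain ⟨rfl, hle, hl, hr⟩ := hh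
    have h1 := ihl hl
    have h2 := ihr hr
    have h3 : 2 ^ r.rk ≤ 2 ^ l.rk := Nat.pow_le_pow_right (by norm_num) hle
    simp only [rk_node, elems, Multiset.card_cons, Multiset.card_add, pow_succ]
    omega

theorem rk_le_log {h : Heap α} (hh : h.Leftist) {s : ℕ} (hs : Multiset.card h.elems + 1 ≤ s) :
    h.rk ≤ Nat.log 2 s :=
  Nat.le_log_of_pow_le (by norm_num) ((two_pow_rk_le hh).trans hs)

theorem elems_merge (le : α → α → Bool) (a b : Heap α) :
    (merge le a b).val.elems = a.elems + b.elems := by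
  induction a, b using merge.induct with
  | case1 h => simp [merge]
  | case2 k l x r => simp [merge]
  | case3 k₁ l₁ x₁ r₁ k₂ l₂ x₂ r₂ ih₁ ih₂ =>
    by_cases hle : le x₁ x₂ = true
    · have ih := ih₁
      rw [merge]
      simp only [hle, if_true, Timed.val_bind, Timed.val_pure, elems_mk, ih]
      simp only [elems, Multiset.cons_add, add_assoc]
    · have ih := ih₂
      rw [merge]
      simp only [hle, Bool.false_eq_true, if_false, Timed.val_bind, Timed.val_pure, elems_mk, ih]
      simp only [elems, Multiset.cons_add, Multiset.add_cons, add_assoc]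
      congr 2
      ac_rfl

/-- Each recursive call descends one step along the right spine of one of the heaps and lowers the
rank of that heap by one. -/
theorem leftist_merge (le : α → α → Bool) {a b : Heap α} (ha : a.Leftist) (hb : b.Leftist) :
    (merge le a b).val.Leftist ∧ (merge le a b).cost ≤ a.rk + b.rk + 1 := by
  induction a, b using merge.induct with
  | case1 h => simp [merge, hb]
  | case2 k l x r => simp [merge, ha]
  | case3 k₁ l₁ x₁ r₁ k₂ l₂ x₂ r₂ ih₁ ih₂ =>
    by_cases hle : le x₁ x₂ = true
    · have ih := ih₁
      obtain ⟨h1, h2⟩ := ih ha.2.2.2 hb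
      rw [merge]
      simp only [hle, if_true, Timed.val_bind, Timed.val_pure, Timed.cost_bind, Timed.cost_pure,
        tick_cost]
      refine ⟨leftist_mk ha.2.2.1 h1, ?_⟩
      have := ha.1
      simp only [rk_node] at h2 ⊢
      omega
    · have ih := ih₂
      obtain ⟨h1, h2⟩ := ih ha hb.2.2.2
      rw [merge]
      simp only [hle, Bool.false_eq_true, if_false, Timed.val_bind, Timed.val_pure, Timed.cost_bind, Timed.cost_pure,
        tick_cost]
      refine ⟨leftist_mk hb.2.2.1 h1, ?_⟩
      have := hb.1
      simp only [rk_node] at h2 ⊢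
      omega

/-- The comparison is known to be total and transitive only on the elements with `S`: events must
not be at the viewpoint, and streams must have nonempty buffers. -/
theorem ordered_merge {le : α → α → Bool} {S : α → Prop} (hS : TotalOn le S) {a b : Heap α}
    (ha : a.Ordered le) (hb : b.Ordered le) (hSa : ∀ x ∈ a.elems, S x)
    (hSb : ∀ x ∈ b.elems, S x) : (merge le a b).val.Ordered le := by
  induction a, b using merge.induct with
  | case1 h => simpa [merge] using hb
  | case2 k l x r => simpa [merge] using ha
  | case3 k₁ l₁ x₁ r₁ k₂ l₂ x₂ r₂ ih₁ ih₂ =>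
    by_cases hle : le x₁ x₂ = true
    · have ih := ih₁
      rw [merge]
      simp only [hle, if_true, Timed.val_bind, Timed.val_pure]
      refine ordered_mk ha.2.1 (ih ha.2.2 hb (fun x hx => hSa x (by simp [elems, hx])) hSb) ?_
      intro y hy
      rw [elems_merge, ← add_assoc, Multiset.mem_add] at hy
      rcases hy with hy | hy
      · exact ha.1 y hy
      · have hy' := hy
        simp only [elems, Multiset.mem_cons] at hy
        rcases hy with rfl | hy
        · exact hle
        · exact hS.trans _ x₂ _ (hSa _ (by simp [elems])) (hSb _ (by simp [elems])) (hSb _ hy') hle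
            (hb.1 y hy)
    · have ih := ih₂
      rw [merge]
      simp only [hle, Bool.false_eq_true, if_false, Timed.val_bind, Timed.val_pure]
      refine ordered_mk hb.2.1 (ih ha hb.2.2 hSa (fun x hx => hSb x (by simp [elems, hx]))) ?_
      have hle' : le x₂ x₁ = true :=
        hS.total _ _ (hSa _ (by simp [elems])) (hSb _ (by simp [elems])) (by simpa using hle)
      intro y hy
      rw [elems_merge, add_left_comm, Multiset.mem_add] at hy
      rcases hy with hy | hy
      · have hy' := hy
        simp only [elems, Multiset.mem_cons] at hy
        rcases hy with rfl | hy
        · exact hle'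
        · exact hS.trans _ x₁ _ (hSb _ (by simp [elems])) (hSa _ (by simp [elems])) (hSa _ hy') hle'
            (ha.1 y hy)
      · exact hb.1 y hy

/-- The invariant of a priority queue. -/
structure Good (le : α → α → Bool) (S : α → Prop) (h : Heap α) : Prop where
  leftist : h.Leftist
  ordered : h.Ordered le
  valid : ∀ x ∈ h.elems, S x

theorem good_leaf (le : α → α → Bool) (S : α → Prop) : (leaf : Heap α).Good le S :=
  ⟨trivial, trivial, by simp⟩

/-- The size enters through an arbitrary upper bound `s`, so that callers can measure all structures
with one common logarithm. -/
theorem insert_spec {le : α → α → Bool} {S : α → Prop} (hS : TotalOn le S) {h : Heap α} {x : α}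
    (hh : h.Good le S) (hx : S x) :
    (insert le x h).val.Good le S ∧ (insert le x h).val.elems = x ::ₘ h.elems ∧
      ∀ s, Multiset.card h.elems + 1 ≤ s → (insert le x h).cost ≤ Nat.log 2 s + 3 := by
  have hl : (node 1 leaf x leaf).Leftist := ⟨rfl, le_rfl, trivial, trivial⟩
  have he : (insert le x h).val.elems = x ::ₘ h.elems := by
    simp [insert, elems_merge, elems]
  refine ⟨⟨?_, ?_, ?_⟩, he, ?_⟩
  · exact (leftist_merge le hl hh.leftist).1
  · refine ordered_merge hS (by simp [Ordered]) hh.ordered ?_ hh.valid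
    simpa [elems] using hx
  · intro y hy
    rw [he, Multiset.mem_cons] at hy
    rcases hy with rfl | hy
    · exact hx
    · exact hh.valid y hy
  · intro s hs
    have := (leftist_merge le hl hh.leftist).2
    have h2 := rk_le_log hh.leftist hs
    simp only [insert, Timed.cost_bind, tick_cost, rk_node] at this ⊢
    omega

/-- The children of the root are merged, and either may have logarithmic rank; hence the factor `2`.
-/
theorem deleteMin_spec {le : α → α → Bool} {S : α → Prop} (hS : TotalOn le S) {h : Heap α}
    (hh : h.Good le S) :
    ((h.elems = 0 ∧ (deleteMin le h).val = none) ∨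
      ∃ x h', (deleteMin le h).val = some (x, h') ∧ h.elems = x ::ₘ h'.elems ∧ h'.Good le S ∧
        S x ∧ ∀ y ∈ h.elems, le x y = true) ∧
      ∀ s, Multiset.card h.elems + 1 ≤ s → (deleteMin le h).cost ≤ 2 * Nat.log 2 s + 2 := by
  cases h with
  | leaf => simp [deleteMin]
  | node k l x r =>
    have hv := hh.valid
    have hl := hh.leftist
    have ho := hh.ordered
    refine ⟨Or.inr ⟨x, (merge le l r).val, rfl, ?_, ⟨?_, ?_, ?_⟩, ?_, ?_⟩, ?_⟩
    · simp [elems, elems_merge]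
    · exact (leftist_merge le hl.2.2.1 hl.2.2.2).1
    · exact ordered_merge hS ho.2.1 ho.2.2 (fun y hy => hv y (by simp [elems, hy]))
        (fun y hy => hv y (by simp [elems, hy]))
    · intro y hy
      rw [elems_merge] at hy
      exact hv y (by rw [elems]; exact Multiset.mem_cons_of_mem hy)
    · exact hv x (by simp [elems])
    · intro y hy
      rw [elems, Multiset.mem_cons] at hy
      rcases hy with rfl | hy
      · exact hS.refl (hv _ (by simp [elems]))
      · exact ho.1 y hy
    · intro s hs
      simp only [elems, Multiset.card_cons, Multiset.card_add] at hs
      have h1 := rk_le_log hl.2.2.1 (s := s) (by omega)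
      have h2 := rk_le_log hl.2.2.2 (s := s) (by omega)
      have h3 := (leftist_merge le hl.2.2.1 hl.2.2.2).2
      simp only [deleteMin, Timed.cost_bind, tick_cost, Timed.cost_pure]
      omega

theorem insertAll_spec {le : α → α → Bool} {S : α → Prop} (hS : TotalOn le S) (xs : List α)
    (h : Heap α) (hh : h.Good le S) (hx : ∀ x ∈ xs, S x) :
    (insertAll le xs h).val.Good le S ∧ (insertAll le xs h).val.elems = xs + h.elems ∧
      ∀ s, Multiset.card h.elems + xs.length + 1 ≤ s →
        (insertAll le xs h).cost ≤ xs.length * (Nat.log 2 s + 3) := by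
  induction xs generalizing h with
  | nil => simp [insertAll, hh]
  | cons x xs ih =>
    obtain ⟨h1, h2, h3⟩ := insert_spec hS hh (hx x (by simp))
    obtain ⟨h4, h5, h6⟩ := ih _ h1 (fun y hy => hx y (by simp [hy]))
    refine ⟨h4, ?_, ?_⟩
    · simp only [insertAll, Timed.val_bind, h5, h2]
      rw [← Multiset.cons_coe, Multiset.add_cons, Multiset.cons_add]
    · intro s hs
      simp only [List.length_cons] at hs
      have h7 := h3 s (by omega)
      have h8 := h6 s (by rw [h2, Multiset.card_cons]; omega)
      simp only [insertAll, Timed.cost_bind, List.length_cons, add_mul, one_mul]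
      omega

theorem drain_spec {le : α → α → Bool} {S : α → Prop} (hS : TotalOn le S) (k : ℕ)
    (h : Heap α) (hh : h.Good le S) (hk : Multiset.card h.elems = k) :
    ((drain le k h).val : Multiset α) = h.elems ∧
      (drain le k h).val.Pairwise (fun x y => le x y = true) ∧
      ∀ s, k + 1 ≤ s → (drain le k h).cost ≤ k * (2 * Nat.log 2 s + 2) := by
  induction k generalizing h with
  | zero =>
    rw [Multiset.card_eq_zero] at hk
    simp [drain, hk]
  | succ k ih =>
    obtain ⟨h1 | ⟨x, h', h1, h2, h3, h4, h5⟩, hc⟩ := deleteMin_spec hS hh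
    · rw [h1.1] at hk
      simp at hk
    · have hk' : Multiset.card h'.elems = k := by
        rw [h2, Multiset.card_cons] at hk
        omega
      obtain ⟨h6, h7, h8⟩ := ih h' h3 hk'
      simp only [drain, Timed.val_bind, Timed.cost_bind, h1, Timed.val_pure, Timed.cost_pure]
      refine ⟨?_, ?_, ?_⟩
      · rw [← Multiset.cons_coe, h6, h2]
      · rw [List.pairwise_cons]
        refine ⟨fun y hy => h5 y ?_, h7⟩
        rw [h2, ← h6]
        simp [hy]
      · intro s hs
        have h9 := h8 s (by omega)
        have h10 := hc s (by omega)
        simp only [add_mul, one_mul]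
        omega

end Heap

/-- Heap sort: each element pays `log + 3` for its insertion and `2 * log + 2` for its extraction.
-/
theorem sortList_spec {α : Type} {le : α → α → Bool} {S : α → Prop} (hS : TotalOn le S)
    (l : List α) (hl : ∀ x ∈ l, S x) :
    (sortList le l).val.Perm l ∧ (sortList le l).val.Pairwise (fun x y => le x y = true) ∧
      ∀ s, l.length + 1 ≤ s → (sortList le l).cost ≤ l.length * (3 * Nat.log 2 s + 5) := by
  obtain ⟨h1, h2, h3⟩ := Heap.insertAll_spec hS l .leaf (Heap.good_leaf le S) hl
  simp only [Heap.elems_leaf, add_zero] at h2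
  obtain ⟨h4, h5, h6⟩ := Heap.drain_spec hS l.length _ h1 (by rw [h2]; simp)
  refine ⟨?_, h5, ?_⟩
  · rw [← Multiset.coe_eq_coe, ← h2, ← h4]
    rfl
  · intro s hs
    have h7 := h3 s (by simpa using hs)
    have h8 := h6 s hs
    simp only [sortList, Timed.cost_bind]
    calc _ ≤ l.length * (Nat.log 2 s + 3) + l.length * (2 * Nat.log 2 s + 2) := by omega
      _ = _ := by ring

/-! ## The active structure -/

theorem lexLt_cons (a b : ℤ) (as bs : List ℤ) :
    lexLt (a :: as) (b :: bs) = true ↔ a < b ∨ a = b ∧ lexLt as bs = true := by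
  rw [lexLt]
  rcases lt_trichotomy a b with h | rfl | h
  · simp [h]
  · simp
  · simp [h, h.not_gt, h.ne']

theorem lexLt_nil (bs : List ℤ) : lexLt [] bs = false := by
  unfold lexLt
  rfl

/-- The sort key of the order by distance. -/
def nearKey (p : ℤ × ℤ) : ℤ ×ₗ ℤ ×ₗ ℤ := toLex (dist2 p, toLex (p.1, p.2))

theorem nearKey_injective : Function.Injective nearKey := by
  intro p q h
  have h1 := congrArg ofLex h
  simp only [nearKey, ofLex_toLex, Prod.mk.injEq] at h1
  have h2 := congrArg ofLex h1.2
  simp only [ofLex_toLex, Prod.mk.injEq] at h2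
  exact Prod.ext h2.1 h2.2

theorem nearer_iff (p q : ℤ × ℤ) : nearer p q = true ↔ nearKey p < nearKey q := by
  simp [nearer, nearKey, lexLt_cons, lexLt_nil, Prod.Lex.toLex_lt_toLex]

theorem dist2_le_of_nearKey_lt {p q : ℤ × ℤ} (h : nearKey p < nearKey q) : dist2 p ≤ dist2 q := by
  simp only [nearKey, Prod.Lex.toLex_lt_toLex] at h
  rcases h with h | h
  · exact h.le
  · exact h.1.le

namespace Active

/-- The nodes from left to right. -/
def toList : Active → List ((ℤ × ℤ) × ℝ)
  | leaf => []
  | node l p β _ _ r => l.toList ++ (p, β) :: r.toList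

/-- Correct heights and balance. -/
def Balanced : Active → Prop
  | leaf => True
  | node l _ _ _ h r =>
    h = max l.ht r.ht + 1 ∧ l.ht ≤ r.ht + 1 ∧ r.ht ≤ l.ht + 1 ∧ l.Balanced ∧ r.Balanced

/-- The stored highest angles are correct. -/
def Topped : Active → Prop
  | leaf => True
  | node l _ β top _ r =>
    top = max l.highest (max (β : WithBot ℝ) r.highest) ∧ l.Topped ∧ r.Topped

/-- The nodes are ordered by distance. -/
def Sorted (A : Active) : Prop := A.toList.Pairwise fun a b => nearKey a.1 < nearKey b.1

@[simp] theorem ht_leaf : leaf.ht = 0 := rfl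
@[simp] theorem ht_node (l : Active) (p : ℤ × ℤ) (β : ℝ) (t : WithBot ℝ) (h : ℕ) (r : Active) :
    (node l p β t h r).ht = h := rfl
@[simp] theorem highest_node (l : Active) (p : ℤ × ℤ) (β : ℝ) (t : WithBot ℝ) (h : ℕ) (r : Active) :
    (node l p β t h r).highest = t := rfl
@[simp] theorem ht_mk (l : Active) (p : ℤ × ℤ) (β : ℝ) (r : Active) :
    (mk l p β r).ht = max l.ht r.ht + 1 := rfl
@[simp] theorem toList_mk (l : Active) (p : ℤ × ℤ) (β : ℝ) (r : Active) :
    (mk l p β r).toList = l.toList ++ (p, β) :: r.toList := rfl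
@[simp] theorem toList_leaf : leaf.toList = [] := rfl
@[simp] theorem toList_node (l : Active) (p : ℤ × ℤ) (β : ℝ) (t : WithBot ℝ) (h : ℕ) (r : Active) :
    (node l p β t h r).toList = l.toList ++ (p, β) :: r.toList := rfl

theorem balanced_mk {l r : Active} {p : ℤ × ℤ} {β : ℝ} (hl : l.Balanced) (hr : r.Balanced)
    (h1 : l.ht ≤ r.ht + 1) (h2 : r.ht ≤ l.ht + 1) : (mk l p β r).Balanced :=
  ⟨rfl, h1, h2, hl, hr⟩

theorem topped_mk {l r : Active} {p : ℤ × ℤ} {β : ℝ} (hl : l.Topped) (hr : r.Topped) :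
    (mk l p β r).Topped := ⟨rfl, hl, hr⟩

theorem size_eq (A : Active) : A.size = A.toList.length := by
  induction A with
  | leaf => rfl
  | node l p β t h r ihl ihr => simp [size, ihl, ihr]; omega

/-- In a tree of height `k + 2` both subtrees have height at least `k`. If `a` and `b` are their
sizes plus one, then `a ^ 2` and `b ^ 2` are at least `2 ^ k`, so `(a + b) ^ 2 ≥ 4 * 2 ^ k`. The
square costs only a factor `2` in the height. -/
theorem two_pow_ht_le {A : Active} (hA : A.Balanced) : 2 ^ A.ht ≤ (A.toList.length + 1) ^ 2 := by
  induction A with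
  | leaf => simp
  | node l p β t h r ihl ihr =>
    obtain ⟨rfl, h1, h2, hl, hr⟩ := hA
    have il := ihl hl
    have ir := ihr hr
    simp only [ht_node, toList_node, List.length_append, List.length_cons]
    set a := l.toList.length + 1
    set b := r.toList.length + 1
    have hab : l.toList.length + (r.toList.length + 1) + 1 = a + b := by omega
    rw [hab]
    rcases Nat.eq_zero_or_pos (max l.ht r.ht) with h0 | h0
    · rw [h0]
      have h2 : 2 * 2 ≤ (a + b) * (a + b) := Nat.mul_le_mul (by omega) (by omega)
      rw [sq]
      omega
    · obtain ⟨k, hk⟩ : ∃ k, max l.ht r.ht = k + 1 := ⟨_, (Nat.succ_pred_eq_of_pos h0).symm⟩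
      have ha : 2 ^ k ≤ a ^ 2 := (Nat.pow_le_pow_right (by norm_num) (by omega)).trans il
      have hb : 2 ^ k ≤ b ^ 2 := (Nat.pow_le_pow_right (by norm_num) (by omega)).trans ir
      rw [hk, pow_succ, pow_succ]
      rcases le_total a b with h | h
      · nlinarith
      · nlinarith

theorem ht_le_log {A : Active} (hA : A.Balanced) {s : ℕ} (hs : A.toList.length + 1 ≤ s) :
    A.ht ≤ 2 * (Nat.log 2 s + 1) := by
  have h1 : A.toList.length + 1 < 2 ^ (Nat.log 2 s + 1) :=
    hs.trans_lt (Nat.lt_pow_succ_log_self (by norm_num) s)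
  have h2 := two_pow_ht_le hA
  have h3 : 2 ^ A.ht < 2 ^ (2 * (Nat.log 2 s + 1)) := by
    rw [mul_comm 2, pow_mul]
    exact h2.trans_lt (Nat.pow_lt_pow_left h1 (by norm_num))
  exact ((Nat.pow_lt_pow_iff_right (by norm_num)).1 h3).le

theorem toList_balance (l : Active) (p : ℤ × ℤ) (β : ℝ) (r : Active) :
    (balance l p β r).toList = l.toList ++ (p, β) :: r.toList := by
  unfold balance
  split_ifs
  · cases l with
    | leaf => simp
    | node ll lp lβ _ _ lr =>
      dsimp only
      split_ifs
      · simp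
      · cases lr <;> simp
  · cases r with
    | leaf => simp
    | node rl rp rβ _ _ rr =>
      dsimp only
      split_ifs
      · simp
      · cases rl <;> simp
  · simp

theorem topped_balance {l r : Active} {p : ℤ × ℤ} {β : ℝ} (hl : l.Topped) (hr : r.Topped) :
    (balance l p β r).Topped := by
  unfold balance
  split_ifs
  · cases l with
    | leaf => exact topped_mk hl hr
    | node ll lp lβ _ _ lr =>
      dsimp only
      split_ifs
      · exact topped_mk hl.2.1 (topped_mk hl.2.2 hr)
      · cases lr with
        | leaf => exact topped_mk hl hr
        | node a q γ _ _ b =>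
          exact topped_mk (topped_mk hl.2.1 hl.2.2.2.1) (topped_mk hl.2.2.2.2 hr)
  · cases r with
    | leaf => exact topped_mk hl hr
    | node rl rp rβ _ _ rr =>
      dsimp only
      split_ifs
      · exact topped_mk (topped_mk hl hr.2.1) hr.2.2
      · cases rl with
        | leaf => exact topped_mk hl hr
        | node a q γ _ _ b =>
          exact topped_mk (topped_mk hl hr.2.1.2.1) (topped_mk hr.2.1.2.2 hr.2.2)
  · exact topped_mk hl hr

/-- A difference of two is what one insertion or deletion in a subtree can cause. The last clause,
the exact height when no rotation takes place, gives the lower bounds on the new height in the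
inductions for insertion and deletion. -/
theorem balanced_balance {l r : Active} {p : ℤ × ℤ} {β : ℝ} (hl : l.Balanced) (hr : r.Balanced)
    (h1 : l.ht ≤ r.ht + 2) (h2 : r.ht ≤ l.ht + 2) :
    (balance l p β r).Balanced ∧ max l.ht r.ht ≤ (balance l p β r).ht ∧
      (balance l p β r).ht ≤ max l.ht r.ht + 1 ∧
      (l.ht ≤ r.ht + 1 → r.ht ≤ l.ht + 1 → (balance l p β r).ht = max l.ht r.ht + 1) := by
  unfold balance
  split_ifs with hc hd
  · cases l with
    | leaf => simp at hc
    | node ll lp lβ lt lh lr =>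
      obtain ⟨rfl, hl1, hl2, hll, hlr⟩ := hl
      simp only [ht_node] at *
      split_ifs with he
      · refine ⟨balanced_mk hll (balanced_mk hlr hr ?_ ?_) ?_ ?_, ?_, ?_, ?_⟩ <;>
          (try simp only [ht_mk]) <;> intros <;> omega
      · cases lr with
        | leaf => simp at he
        | node a q γ _ _ b =>
          obtain ⟨rfl, hb1, hb2, ha, hb⟩ := hlr
          simp only [ht_node] at *
          refine ⟨balanced_mk (balanced_mk hll ha ?_ ?_) (balanced_mk hb hr ?_ ?_) ?_ ?_,
            ?_, ?_, ?_⟩ <;> intros <;> (try simp only [ht_mk]) <;> omega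
  · cases r with
    | leaf => simp at hd
    | node rl rp rβ rt rh rr =>
      obtain ⟨rfl, hr1, hr2, hrl, hrr⟩ := hr
      simp only [ht_node] at *
      split_ifs with he
      · refine ⟨balanced_mk (balanced_mk hl hrl ?_ ?_) hrr ?_ ?_, ?_, ?_, ?_⟩ <;>
          (try simp only [ht_mk]) <;> intros <;> omega
      · cases rl with
        | leaf => simp at he
        | node a q γ _ _ b =>
          obtain ⟨rfl, hb1, hb2, ha, hb⟩ := hrl
          simp only [ht_node] at *
          refine ⟨balanced_mk (balanced_mk hl ha ?_ ?_) (balanced_mk hb hrr ?_ ?_) ?_ ?_,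
            ?_, ?_, ?_⟩ <;> intros <;> (try simp only [ht_mk]) <;> omega
  · refine ⟨balanced_mk hl hr (by omega) (by omega), ?_, ?_, ?_⟩ <;> intros <;> (try simp only [ht_mk]) <;> omega

/-- The invariant of the active structure. -/
structure Good (A : Active) : Prop where
  balanced : A.Balanced
  topped : A.Topped
  sorted : A.Sorted

theorem good_leaf : leaf.Good := ⟨trivial, trivial, List.Pairwise.nil⟩

theorem sorted_node {l r : Active} {p : ℤ × ℤ} {β : ℝ} {t : WithBot ℝ} {h : ℕ} :
    (node l p β t h r).Sorted ↔ l.Sorted ∧ r.Sorted ∧ (∀ x ∈ l.toList, nearKey x.1 < nearKey p) ∧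
      (∀ x ∈ r.toList, nearKey p < nearKey x.1) := by
  simp only [Sorted, toList_node, List.pairwise_append, List.pairwise_cons, List.mem_cons,
    forall_eq_or_imp]
  constructor
  · rintro ⟨h1, ⟨h2, h3⟩, h4⟩
    exact ⟨h1, h3, fun x hx => (h4 x hx).1, h2⟩
  · rintro ⟨h1, h2, h3, h4⟩
    exact ⟨h1, ⟨h4, h2⟩, fun x hx => ⟨h3 x hx, fun y hy => (h3 x hx).trans (h4 y hy)⟩⟩

theorem good_node {l r : Active} {p : ℤ × ℤ} {β : ℝ} {t : WithBot ℝ} {h : ℕ}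
    (hA : (node l p β t h r).Good) : l.Good ∧ r.Good := by
  have h1 := hA.balanced
  have h2 := hA.topped
  have h3 := sorted_node.1 hA.sorted
  exact ⟨⟨h1.2.2.2.1, h2.2.1, h3.1⟩, ⟨h1.2.2.2.2, h2.2.2, h3.2.1⟩⟩

theorem sorted_balance {l r : Active} {p : ℤ × ℤ} {β : ℝ} (hl : l.Sorted) (hr : r.Sorted)
    (h1 : ∀ x ∈ l.toList, nearKey x.1 < nearKey p) (h2 : ∀ x ∈ r.toList, nearKey p < nearKey x.1) :
    (balance l p β r).Sorted := by
  have := (sorted_node (l := l) (r := r) (p := p) (β := β) (t := ⊥) (h := 0)).2 ⟨hl, hr, h1, h2⟩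
  unfold Sorted at this ⊢
  rw [toList_balance]
  exact this

/-- Stored maxima are only tested for being below a real number. This form treats the empty tree,
with highest angle `⊥`, like all others. -/
theorem highest_lt_iff {A : Active} (hA : A.Topped) (b : ℝ) :
    A.highest < (b : WithBot ℝ) ↔ ∀ x ∈ A.toList, x.2 < b := by
  induction A with
  | leaf => simp [highest]
  | node l p β t h r ihl ihr =>
    obtain ⟨rfl, hl, hr⟩ := hA
    simp only [highest_node, max_lt_iff, ihl hl, ihr hr, toList_node, List.mem_append, List.mem_cons,
      WithBot.coe_lt_coe]
    constructor
    · rintro ⟨h1, h2, h3⟩ x (hx | rfl | hx)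
      exacts [h1 x hx, h2, h3 x hx]
    · intro h
      exact ⟨fun x hx => h x (Or.inl hx), h (p, β) (Or.inr (Or.inl rfl)),
        fun x hx => h x (Or.inr (Or.inr hx))⟩

theorem insert_spec (p : ℤ × ℤ) (β : ℝ) (A : Active) (hA : A.Good)
    (hp : ∀ x ∈ A.toList, x.1 ≠ p) :
    (insert p β A).val.Good ∧ (insert p β A).val.toList.Perm ((p, β) :: A.toList) ∧
      A.ht ≤ (insert p β A).val.ht ∧ (insert p β A).val.ht ≤ A.ht + 1 ∧
      (insert p β A).cost ≤ A.ht + 1 := by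
  induction A with
  | leaf =>
    refine ⟨⟨balanced_mk trivial trivial (by simp) (by simp), topped_mk trivial trivial, ?_⟩,
      ?_, ?_, ?_, ?_⟩ <;> simp [insert, Sorted]
  | node l q γ t h r ihl ihr =>
    obtain ⟨hl, hr⟩ := good_node hA
    have hs := sorted_node.1 hA.sorted
    have hb := hA.balanced
    simp only [toList_node, List.mem_append, List.mem_cons] at hp
    by_cases h1 : nearer p q = true
    · obtain ⟨i1, i2, i3, i4, i5⟩ := ihl hl fun x hx => hp x (Or.inl hx)
      obtain ⟨b1, b2, b3, b4⟩ := balanced_balance (p := q) (β := γ) i1.balanced hr.balanced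
        (by have := hb.2.1; omega) (by have := hb.2.2.1; omega)
      have he : (insert p β (node l q γ t h r)).val = balance (insert p β l).val q γ r := by
        simp [insert, h1]
      rw [he]
      refine ⟨⟨b1, topped_balance i1.topped hr.topped, sorted_balance i1.sorted hs.2.1 ?_ hs.2.2.2⟩,
        ?_, ?_, ?_, ?_⟩
      · intro x hx
        rcases List.mem_cons.1 (i2.mem_iff.1 hx) with rfl | hx
        · exact (nearer_iff _ _).1 h1
        · exact hs.2.2.1 x hx
      · rw [toList_balance]
        exact i2.append_right _
      · have := hb.1; have := hb.2.1; have := hb.2.2.1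
        simp only [ht_node]
        omega
      · have := hb.1; have := hb.2.1; have := hb.2.2.1
        simp only [ht_node]
        omega
      · have := hb.1
        simp only [insert, h1, if_true, Timed.cost_bind, tick_cost, Timed.cost_pure, ht_node]
        omega
    · have h2 : nearer q p = true := by
        rw [nearer_iff] at h1 ⊢
        refine lt_of_le_of_ne (not_lt.1 h1) fun hc => ?_
        exact hp (q, γ) (Or.inr (Or.inl rfl)) (nearKey_injective hc)
      obtain ⟨i1, i2, i3, i4, i5⟩ := ihr hr fun x hx => hp x (Or.inr (Or.inr hx))
      obtain ⟨b1, b2, b3, b4⟩ := balanced_balance (p := q) (β := γ) hl.balanced i1.balanced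
        (by have := hb.2.1; omega) (by have := hb.2.2.1; omega)
      have he : (insert p β (node l q γ t h r)).val = balance l q γ (insert p β r).val := by
        simp [insert, h1, h2]
      rw [he]
      refine ⟨⟨b1, topped_balance hl.topped i1.topped, sorted_balance hs.1 i1.sorted hs.2.2.1 ?_⟩,
        ?_, ?_, ?_, ?_⟩
      · intro x hx
        rcases List.mem_cons.1 (i2.mem_iff.1 hx) with rfl | hx
        · exact (nearer_iff _ _).1 h2
        · exact hs.2.2.2 x hx
      · rw [toList_balance, toList_node]
        refine ((i2.cons _).append_left _).trans ?_
        refine (((List.Perm.swap _ _ _).append_left _)).trans ?_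
        exact List.perm_middle
      · have := hb.1; have := hb.2.1; have := hb.2.2.1
        simp only [ht_node]
        omega
      · have := hb.1; have := hb.2.1; have := hb.2.2.1
        simp only [ht_node]
        omega
      · have := hb.1
        simp only [insert, h1, h2, Bool.false_eq_true, if_false, if_true, Timed.cost_bind, tick_cost,
          Timed.cost_pure, ht_node]
        omega

theorem popNearest_spec (A : Active) (hA : A.Good) :
    ((A = leaf ∧ (popNearest A).val = none) ∨
      ∃ p β A', (popNearest A).val = some (p, β, A') ∧ A.toList = (p, β) :: A'.toList ∧ A'.Good ∧
        A'.ht ≤ A.ht ∧ A.ht ≤ A'.ht + 1) ∧ (popNearest A).cost ≤ A.ht + 1 := by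
  induction A with
  | leaf => simp [popNearest]
  | node l q γ t h r ihl ihr =>
    obtain ⟨hl, hr⟩ := good_node hA
    have hs := sorted_node.1 hA.sorted
    have hb := hA.balanced
    have hb1 := hb.1
    have hb2 := hb.2.1
    have hb3 := hb.2.2.1
    obtain ⟨i1, i2⟩ := ihl hl
    rcases i1 with ⟨rfl, i1⟩ | ⟨p, β, l', i3, i4, i5, i6, i7⟩
    · simp only [ht_leaf] at *
      refine ⟨Or.inr ⟨q, γ, r, ?_, ?_, hr, ?_, ?_⟩, ?_⟩
      · simp [popNearest]
      · simp
      · simp only [ht_node]; omega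
      · simp only [ht_node]; omega
      · simp only [popNearest, Timed.cost_bind, tick_cost, Timed.cost_pure, Timed.val_bind,
          Timed.val_pure, ht_node] at i2 ⊢
        omega
    · obtain ⟨b1, b2, b3, b4⟩ := balanced_balance (p := q) (β := γ) i5.balanced hr.balanced
        (by omega) (by omega)
      refine ⟨Or.inr ⟨p, β, balance l' q γ r, ?_, ?_, ?_, ?_, ?_⟩, ?_⟩
      · simp [popNearest, i3]
      · simp [toList_balance, i4]
      · refine ⟨b1, topped_balance i5.topped hr.topped, sorted_balance i5.sorted hr.sorted ?_
          hs.2.2.2⟩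
        intro x hx
        exact hs.2.2.1 x (by rw [i4]; exact List.mem_cons_of_mem _ hx)
      · simp only [ht_node]; omega
      · simp only [ht_node]; omega
      · simp only [popNearest, Timed.cost_bind, tick_cost, i3, Timed.cost_pure, ht_node]
        omega

theorem delete_spec (p : ℤ × ℤ) (β : ℝ) (A : Active) (hA : A.Good) (hp : (p, β) ∈ A.toList) :
    (delete p A).val.Good ∧ A.toList.Perm ((p, β) :: (delete p A).val.toList) ∧
      (delete p A).val.ht ≤ A.ht ∧ A.ht ≤ (delete p A).val.ht + 1 ∧
      (delete p A).cost ≤ A.ht + 1 := by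
  induction A with
  | leaf => simp at hp
  | node l q γ t h r ihl ihr =>
    obtain ⟨hl, hr⟩ := good_node hA
    have hs := sorted_node.1 hA.sorted
    have hb := hA.balanced
    have hb1 := hb.1
    have hb2 := hb.2.1
    have hb3 := hb.2.2.1
    simp only [toList_node, List.mem_append, List.mem_cons] at hp
    by_cases h1 : nearer p q = true
    · have h1' := (nearer_iff _ _).1 h1
      have hpl : (p, β) ∈ l.toList := by
        rcases hp with hp | hp | hp
        · exact hp
        · simp only [Prod.mk.injEq] at hp
          rw [hp.1] at h1'
          exact absurd h1' (lt_irrefl _)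
        · exact absurd (hs.2.2.2 _ hp) h1'.not_gt
      obtain ⟨i1, i2, i3, i4, i5⟩ := ihl hl hpl
      obtain ⟨b1, b2, b3, b4⟩ := balanced_balance (p := q) (β := γ) i1.balanced hr.balanced
        (by omega) (by omega)
      have he : (delete p (node l q γ t h r)).val = balance (delete p l).val q γ r := by
        simp [delete, h1]
      rw [he]
      refine ⟨⟨b1, topped_balance i1.topped hr.topped, sorted_balance i1.sorted hs.2.1 ?_ hs.2.2.2⟩,
        ?_, ?_, ?_, ?_⟩
      · intro x hx
        exact hs.2.2.1 x (i2.mem_iff.2 (List.mem_cons_of_mem _ hx))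
      · rw [toList_balance]
        exact i2.append_right _
      · simp only [ht_node]
        omega
      · simp only [ht_node]
        omega
      · simp only [delete, h1, if_true, Timed.cost_bind, tick_cost, Timed.cost_pure, ht_node]
        omega
    · by_cases h2 : nearer q p = true
      · have h2' := (nearer_iff _ _).1 h2
        have hpr : (p, β) ∈ r.toList := by
          rcases hp with hp | hp | hp
          · exact absurd (hs.2.2.1 _ hp) h2'.not_gt
          · simp only [Prod.mk.injEq] at hp
            rw [hp.1] at h2'
            exact absurd h2' (lt_irrefl _)
          · exact hp
        obtain ⟨i1, i2, i3, i4, i5⟩ := ihr hr hpr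
        obtain ⟨b1, b2, b3, b4⟩ := balanced_balance (p := q) (β := γ) hl.balanced i1.balanced
          (by omega) (by omega)
        have he : (delete p (node l q γ t h r)).val = balance l q γ (delete p r).val := by
          simp [delete, h1, h2]
        rw [he]
        refine ⟨⟨b1, topped_balance hl.topped i1.topped, sorted_balance hs.1 i1.sorted hs.2.2.1 ?_⟩,
          ?_, ?_, ?_, ?_⟩
        · intro x hx
          exact hs.2.2.2 x (i2.mem_iff.2 (List.mem_cons_of_mem _ hx))
        · rw [toList_balance, toList_node]
          refine ((i2.cons _).append_left _).trans ?_
          refine (((List.Perm.swap _ _ _).append_left _)).trans ?_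
          exact List.perm_middle
        · simp only [ht_node]
          omega
        · simp only [ht_node]
          omega
        · simp only [delete, h1, h2, Bool.false_eq_true, if_false, if_true, Timed.cost_bind,
            tick_cost, Timed.cost_pure, ht_node]
          omega
      · have hpq : p = q := by
          rw [nearer_iff] at h1 h2
          exact nearKey_injective (le_antisymm (not_lt.1 h2) (not_lt.1 h1))
        subst hpq
        have hβ : β = γ := by
          rcases hp with hp | hp | hp
          · exact absurd (hs.2.2.1 _ hp) (lt_irrefl _)
          · simpa using hp
          · exact absurd (hs.2.2.2 _ hp) (lt_irrefl _)
        subst hβ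
        obtain ⟨i1, i2⟩ := popNearest_spec r hr
        rcases i1 with ⟨rfl, i1⟩ | ⟨q, γ, r', i3, i4, i5, i6, i7⟩
        · have he : (delete p (node l p β t h leaf)).val = l := by
            simp [delete, h1, popNearest]
          rw [he]
          simp only [ht_leaf] at *
          refine ⟨hl, ?_, ?_, ?_, ?_⟩
          · rw [toList_node]
            exact List.perm_append_comm
          · simp only [ht_node]; omega
          · simp only [ht_node]; omega
          · simp only [delete, h1, Bool.false_eq_true, if_false, popNearest, Timed.cost_bind,
              tick_cost, Timed.cost_pure, Timed.val_bind, Timed.val_pure, ht_node]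
            omega
        · have he : (delete p (node l p β t h r)).val = balance l q γ r' := by
            simp [delete, h1, i3]
          have hss := hr.sorted
          unfold Sorted at hss
          rw [i4, List.pairwise_cons] at hss
          obtain ⟨b1, b2, b3, b4⟩ := balanced_balance (p := q) (β := γ) hl.balanced i5.balanced
            (by omega) (by omega)
          rw [he]
          refine ⟨⟨b1, topped_balance hl.topped i5.topped, sorted_balance hs.1 i5.sorted ?_ ?_⟩,
            ?_, ?_, ?_, ?_⟩
          · intro x hx
            exact (hs.2.2.1 x hx).trans (hs.2.2.2 (q, γ) (by rw [i4]; simp))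
          · intro x hx
            exact hss.1 x hx
          · rw [toList_balance, toList_node, i4]
            exact List.perm_middle
          · simp only [ht_node]; omega
          · simp only [ht_node]; omega
          · simp only [delete, h1, Bool.false_eq_true, if_false, Timed.cost_bind,
              tick_cost, i3, Timed.cost_pure, ht_node]
            omega

theorem lookup_spec (p : ℤ × ℤ) (β : ℝ) (A : Active) (hA : A.Good) (hp : (p, β) ∈ A.toList) :
    (lookup p A).val = (β : WithBot ℝ) ∧ (lookup p A).cost ≤ A.ht + 1 := by
  induction A with
  | leaf => simp at hp
  | node l q γ t h r ihl ihr =>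
    obtain ⟨hl, hr⟩ := good_node hA
    have hs := sorted_node.1 hA.sorted
    have hb1 := hA.balanced.1
    simp only [toList_node, List.mem_append, List.mem_cons] at hp
    by_cases h1 : nearer p q = true
    · have h1' := (nearer_iff _ _).1 h1
      have hpl : (p, β) ∈ l.toList := by
        rcases hp with hp | hp | hp
        · exact hp
        · simp only [Prod.mk.injEq] at hp
          rw [hp.1] at h1'
          exact absurd h1' (lt_irrefl _)
        · exact absurd (hs.2.2.2 _ hp) h1'.not_gt
      obtain ⟨i1, i2⟩ := ihl hl hpl
      refine ⟨by simp [lookup, h1, i1], ?_⟩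
      simp only [lookup, h1, if_true, Timed.cost_bind, tick_cost, ht_node]
      omega
    · by_cases h2 : nearer q p = true
      · have h2' := (nearer_iff _ _).1 h2
        have hpr : (p, β) ∈ r.toList := by
          rcases hp with hp | hp | hp
          · exact absurd (hs.2.2.1 _ hp) h2'.not_gt
          · simp only [Prod.mk.injEq] at hp
            rw [hp.1] at h2'
            exact absurd h2' (lt_irrefl _)
          · exact hp
        obtain ⟨i1, i2⟩ := ihr hr hpr
        refine ⟨by simp [lookup, h1, h2, i1], ?_⟩
        simp only [lookup, h1, h2, Bool.false_eq_true, if_false, if_true, Timed.cost_bind, tick_cost,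
          ht_node]
        omega
      · have hpq : p = q := by
          rw [nearer_iff] at h1 h2
          exact nearKey_injective (le_antisymm (not_lt.1 h2) (not_lt.1 h1))
        subst hpq
        have hβ : β = γ := by
          rcases hp with hp | hp | hp
          · exact absurd (hs.2.2.1 _ hp) (lt_irrefl _)
          · simpa using hp
          · exact absurd (hs.2.2.2 _ hp) (lt_irrefl _)
        subst hβ
        refine ⟨by simp [lookup, h1], ?_⟩
        simp only [lookup, h1, Bool.false_eq_true, if_false, Timed.cost_bind, tick_cost,
          Timed.cost_pure, ht_node]
        omega

/-- The order of the tree refines the order by distance. If the root is closer than `p`, so is its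
whole left subtree, and the stored maximum answers for it; otherwise neither the root nor the right
subtree contributes. Points at the same distance as `p` are excluded in either case. -/
theorem highestCloser_spec (p : ℤ × ℤ) (b : ℝ) (A : Active) (hA : A.Good) :
    ((highestCloser p A).val < (b : WithBot ℝ) ↔
      ∀ x ∈ A.toList, dist2 x.1 < dist2 p → x.2 < b) ∧ (highestCloser p A).cost ≤ A.ht + 1 := by
  induction A with
  | leaf => simp [highestCloser]
  | node l q γ t h r ihl ihr =>
    obtain ⟨hl, hr⟩ := good_node hA
    have hs := sorted_node.1 hA.sorted
    have hb1 := hA.balanced.1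
    simp only [toList_node, List.mem_append, List.mem_cons]
    by_cases h1 : dist2 q < dist2 p
    · obtain ⟨i1, i2⟩ := ihr hr
      constructor
      · simp only [highestCloser, h1, if_true, Timed.val_bind, Timed.val_pure, max_lt_iff,
          highest_lt_iff hl.topped, i1, WithBot.coe_lt_coe]
        constructor
        · rintro ⟨g1, g2, g3⟩ x (hx | rfl | hx) hd
          exacts [g1 x hx, g2, g3 x hx hd]
        · intro g
          refine ⟨fun x hx => g x (Or.inl hx) ?_, g (q, γ) (Or.inr (Or.inl rfl)) h1,
            fun x hx hd => g x (Or.inr (Or.inr hx)) hd⟩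
          exact (dist2_le_of_nearKey_lt (hs.2.2.1 x hx)).trans_lt h1
      · simp only [highestCloser, h1, if_true, Timed.cost_bind, Timed.cost_pure, tick_cost, ht_node]
        omega
    · obtain ⟨i1, i2⟩ := ihl hl
      constructor
      · simp only [highestCloser, h1, if_false, Timed.val_bind, i1]
        constructor
        · rintro g x (hx | rfl | hx) hd
          · exact g x hx hd
          · exact absurd hd h1
          · exact absurd ((dist2_le_of_nearKey_lt (hs.2.2.2 x hx)).trans_lt hd) h1
        · exact fun g x hx hd => g x (Or.inl hx) hd
      · simp only [highestCloser, h1, if_false, Timed.cost_bind, tick_cost, ht_node]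
        omega

theorem isVisible_spec (p : ℤ × ℤ) (β : ℝ) (A : Active) (hA : A.Good) (hp : (p, β) ∈ A.toList) :
    ((isVisible p A).val = true ↔ ∀ x ∈ A.toList, dist2 x.1 < dist2 p → x.2 < β) ∧
      (isVisible p A).cost ≤ 2 * A.ht + 3 := by
  obtain ⟨h1, h2⟩ := lookup_spec p β A hA hp
  obtain ⟨h3, h4⟩ := highestCloser_spec p β A hA
  constructor
  · simp only [isVisible, Timed.val_bind, Timed.val_pure, h1, decide_eq_true_eq, h3]
  · simp only [isVisible, Timed.cost_bind, Timed.cost_pure, tick_cost]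
    omega

end Active

/-! ## Directions and events -/

/-- The cross product of two vectors of the plane. -/
def cross (v w : ℤ × ℤ) : ℤ := v.1 * w.2 - v.2 * w.1

theorem cross_swap (v w : ℤ × ℤ) : cross w v = -cross v w := by
  simp only [cross]; ring

/-- The vector points into the upper half plane, or straight to the right. -/
def Upper (v : ℤ × ℤ) : Prop := 0 < v.2 ∨ v.2 = 0 ∧ 0 < v.1

instance (v : ℤ × ℤ) : Decidable (Upper v) := inferInstanceAs (Decidable (_ ∨ _))

/-- The abscissa of the projection of the vector on the unit circle of the `1`-norm. -/
def abscissa (v : ℤ × ℤ) : ℚ := (v.1 : ℚ) / ((|v.1| + |v.2| : ℤ) : ℚ)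

/-- A strictly increasing function of the azimuth angle of a vector, with values in `[0, 4)`. -/
def dirKey (v : ℤ × ℤ) : ℚ := if Upper v then 1 - abscissa v else 3 + abscissa v

theorem upper_neg {v : ℤ × ℤ} (hv : v ≠ 0) (h : ¬Upper v) : Upper (-v) := by
  have : v.1 ≠ 0 ∨ v.2 ≠ 0 := by
    by_contra hc
    push Not at hc
    exact hv (Prod.ext hc.1 hc.2)
  simp only [Upper, Prod.fst_neg, Prod.snd_neg] at *
  omega

theorem norm_pos_of_ne {v : ℤ × ℤ} (hv : v ≠ 0) : 0 < |v.1| + |v.2| := by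
  by_contra hc
  have h1 := abs_nonneg v.1
  have h2 := abs_nonneg v.2
  exact hv (Prod.ext (abs_eq_zero.1 (by omega)) (abs_eq_zero.1 (by omega)))

theorem abscissa_neg (v : ℤ × ℤ) : abscissa (-v) = -abscissa v := by
  simp [abscissa, neg_div]

theorem abscissa_le_one (v : ℤ × ℤ) : abscissa v ≤ 1 := by
  unfold abscissa
  apply div_le_one_of_le₀
  · have h1 := le_abs_self v.1
    have h2 := abs_nonneg v.2
    exact_mod_cast (by omega : v.1 ≤ |v.1| + |v.2|)
  · exact_mod_cast add_nonneg (abs_nonneg v.1) (abs_nonneg v.2)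

theorem Upper.ne_zero {v : ℤ × ℤ} (h : Upper v) : v ≠ 0 := by
  rintro rfl
  simp [Upper] at h

theorem Upper.neg_one_lt_abscissa {v : ℤ × ℤ} (h : Upper v) : -1 < abscissa v := by
  have hn := norm_pos_of_ne h.ne_zero
  unfold abscissa
  rw [lt_div_iff₀ (by exact_mod_cast hn)]
  have h1 := neg_abs_le v.1
  have h2 := le_abs_self v.2
  have h3 := abs_nonneg v.2
  have h4 := abs_nonneg v.1
  have : -1 * (|v.1| + |v.2|) < v.1 := by
    unfold Upper at h
    omega
  exact_mod_cast this

/-- On the upper half of the unit circle of the `1`-norm the abscissa decreases counterclockwise.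
Clearing denominators leaves a polynomial inequality for each choice of signs of the two first
coordinates. -/
theorem Upper.cross_pos_iff {v w : ℤ × ℤ} (hv : Upper v) (hw : Upper w) :
    0 < cross v w ↔ abscissa w < abscissa v := by
  unfold abscissa
  rw [div_lt_div_iff₀ (by exact_mod_cast norm_pos_of_ne hw.ne_zero)
    (by exact_mod_cast norm_pos_of_ne hv.ne_zero)]
  obtain ⟨a, b⟩ := v
  obtain ⟨c, d⟩ := w
  simp only [Upper] at hv hw
  have hb : 0 ≤ b := by omega
  have hd : 0 ≤ d := by omega
  simp only [cross, abs_of_nonneg hb, abs_of_nonneg hd]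
  norm_cast
  rcases le_total 0 a with ha | ha <;> rcases le_total 0 c with hc | hc
  · rw [abs_of_nonneg ha, abs_of_nonneg hc]
    constructor <;> intro h <;> nlinarith
  · rw [abs_of_nonneg ha, abs_of_nonpos hc]
    have hd' : 0 < d := by omega
    have h1 := mul_nonneg ha hd
    have h2 := mul_nonneg hb (neg_nonneg.2 hc)
    have h3 := mul_nonneg ha (neg_nonneg.2 hc)
    constructor
    · intro h; nlinarith
    · intro h
      rcases ha.eq_or_lt with rfl | ha
      · nlinarith
      · nlinarith [mul_pos ha hd']
  · rw [abs_of_nonpos ha, abs_of_nonneg hc]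
    have h1 := mul_nonneg (neg_nonneg.2 ha) hd
    have h2 := mul_nonneg hb hc
    have h3 := mul_nonneg (neg_nonneg.2 ha) hc
    constructor <;> intro h <;> nlinarith
  · rw [abs_of_nonpos ha, abs_of_nonpos hc]
    constructor <;> intro h <;> nlinarith

theorem dirKey_upper {v : ℤ × ℤ} (h : Upper v) : 0 ≤ dirKey v ∧ dirKey v < 2 := by
  have h1 := abscissa_le_one v
  have h2 := h.neg_one_lt_abscissa
  simp only [dirKey, h, if_true]
  constructor <;> linarith

/-- Reversing a vector is a rotation by `π`, which is `2` on a scale where a full turn is `4`.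
Statements on the lower half plane are reduced to the upper one in this way. -/
theorem dirKey_neg {v : ℤ × ℤ} (hv : v ≠ 0) (h : ¬Upper v) : dirKey v = dirKey (-v) + 2 := by
  have h1 := upper_neg hv h
  simp only [dirKey, h, h1, if_true, if_false, abscissa_neg]
  ring

theorem dirKey_lower {v : ℤ × ℤ} (hv : v ≠ 0) (h : ¬Upper v) : 2 ≤ dirKey v ∧ dirKey v < 4 := by
  have h1 := dirKey_upper (upper_neg hv h)
  rw [dirKey_neg hv h]
  constructor <;> linarith [h1.1, h1.2]

theorem dirKey_bounds {v : ℤ × ℤ} (hv : v ≠ 0) : 0 ≤ dirKey v ∧ dirKey v < 4 := by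
  by_cases h : Upper v
  · have := dirKey_upper h
    constructor <;> linarith [this.1, this.2]
  · have := dirKey_lower hv h
    constructor <;> linarith [this.1, this.2]

theorem Upper.cross_pos_iff_dirKey {v w : ℤ × ℤ} (hv : Upper v) (hw : Upper w) :
    0 < cross v w ↔ dirKey v < dirKey w := by
  rw [hv.cross_pos_iff hw]
  simp only [dirKey, hv, hw, if_true]
  constructor <;> intro h <;> linarith

/-- A positive cross product means that the counterclockwise turn from `v` to `w` is strictly
between nothing and half a turn. Modulo `4` the difference of the keys is then in `(0, 2)`, and
since it lies in `(-4, 4)`, the only other representatives are those in `(-4, -2)`. -/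
theorem cross_pos_iff {v w : ℤ × ℤ} (hv : v ≠ 0) (hw : w ≠ 0) :
    0 < cross v w ↔
      (0 < dirKey w - dirKey v ∧ dirKey w - dirKey v < 2) ∨ dirKey w - dirKey v < -2 := by
  by_cases h1 : Upper v <;> by_cases h2 : Upper w
  · rw [h1.cross_pos_iff_dirKey h2]
    have a := dirKey_upper h1
    have b := dirKey_upper h2
    constructor
    · intro h
      left
      constructor <;> linarith [a.1, a.2, b.1, b.2]
    · rintro (h | h) <;> linarith [a.1, a.2, b.1, b.2, h]
  · have h2' := upper_neg hw h2
    have e : cross v w = cross (-w) v := by simp only [cross, Prod.fst_neg, Prod.snd_neg]; ring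
    rw [e, h2'.cross_pos_iff_dirKey h1, dirKey_neg hw h2]
    have a := dirKey_upper h1
    have b := dirKey_upper h2'
    constructor
    · intro h
      left
      constructor <;> linarith [a.1, a.2, b.1, b.2]
    · rintro (h | h) <;> linarith [a.1, a.2, b.1, b.2, h]
  · have h1' := upper_neg hv h1
    have e : cross v w = cross w (-v) := by simp only [cross, Prod.fst_neg, Prod.snd_neg]; ring
    rw [e, h2.cross_pos_iff_dirKey h1', dirKey_neg hv h1]
    have a := dirKey_upper h2
    have b := dirKey_upper h1'
    constructor
    · intro h
      right
      linarith [a.1, a.2, b.1, b.2]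
    · rintro (h | h) <;> linarith [a.1, a.2, b.1, b.2, h]
  · have h1' := upper_neg hv h1
    have h2' := upper_neg hw h2
    have e : cross v w = cross (-v) (-w) := by simp only [cross, Prod.fst_neg, Prod.snd_neg]; ring
    rw [e, h1'.cross_pos_iff_dirKey h2', dirKey_neg hv h1, dirKey_neg hw h2]
    have a := dirKey_upper h1'
    have b := dirKey_upper h2'
    constructor
    · intro h
      left
      constructor <;> linarith [a.1, a.2, b.1, b.2]
    · rintro (h | h) <;> linarith [a.1, a.2, b.1, b.2, h]

theorem cross_eq_zero_of_dirKey_eq {v w : ℤ × ℤ} (hv : v ≠ 0) (hw : w ≠ 0)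
    (h : dirKey v = dirKey w) : cross v w = 0 := by
  have h1 := cross_pos_iff hv hw
  have h2 := cross_pos_iff hw hv
  rw [h, sub_self] at h1 h2
  rw [cross_swap v w] at h2
  norm_num at h1 h2
  omega

/-- The comparison made by the algorithm looks at a cross product only for vectors in the same half
turn, where its sign is conclusive. Identifying it with the order of a rational number makes it
total and transitive at once. -/
theorem Azimuth.lt_ofVector {v w : ℤ × ℤ} (hv : v ≠ 0) (hw : w ≠ 0) (s t : ℤ) :
    (Azimuth.ofVector s v).lt (Azimuth.ofVector t w) = true ↔
      4 * (s : ℚ) + dirKey v < 4 * (t : ℚ) + dirKey w := by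
  have key := cross_pos_iff hv hw
  simp only [cross] at key
  unfold Azimuth.lt Azimuth.ofVector
  rw [decide_eq_true_eq]
  change (2 * s + (if Upper v then 0 else 1) < 2 * t + (if Upper w then 0 else 1) ∨
    2 * s + (if Upper v then 0 else 1) = 2 * t + (if Upper w then 0 else 1) ∧ _) ↔ _
  have aux : ∀ a b : ℤ, a + 1 ≤ b → (a : ℚ) + 1 ≤ b := fun a b h => by exact_mod_cast h
  -- Each azimuth is a number of half turns, worth `2` each, plus a remainder in `[0, 2)`; so
  -- lexicographic comparison of the two parts is comparison of the sums.
  have fin : ∀ (a b : ℤ) (d e : ℚ), (0 ≤ d ∧ d < 2) → (0 ≤ e ∧ e < 2) →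
      ((a < b ∨ a = b ∧ d < e) ↔ 2 * (a : ℚ) + d < 2 * b + e) := by
    intro a b d e hd he
    constructor
    · rintro (h | ⟨rfl, h⟩)
      · linarith [aux a b h, hd.2, he.1]
      · linarith
    · intro h
      rcases lt_trichotomy a b with h1 | rfl | h1
      · exact Or.inl h1
      · exact Or.inr ⟨rfl, by linarith⟩
      · linarith [aux b a h1, hd.1, he.2]
  by_cases h1 : Upper v <;> by_cases h2 : Upper w <;> simp only [h1, h2, if_true, if_false]
  · have a := dirKey_upper h1
    have b := dirKey_upper h2
    have := fin (2 * s + 0) (2 * t + 0) _ _ a b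
    push_cast at this
    rw [key]
    constructor
    · rintro (h | ⟨h, h'⟩)
      · linarith [this.1 (Or.inl h)]
      · linarith [this.1 (Or.inr ⟨h, by rcases h' with h' | h' <;> linarith [a.1, b.1, a.2, b.2, h']⟩)]
    · intro h
      rcases this.2 (by linarith) with h' | ⟨h', h''⟩
      · exact Or.inl h'
      · exact Or.inr ⟨h', Or.inl ⟨by linarith, by linarith [a.1, b.2]⟩⟩
  · have a := dirKey_upper h1
    have b := dirKey_upper (upper_neg hw h2)
    have := fin (2 * s + 0) (2 * t + 1) _ _ a b
    push_cast at this
    rw [key, dirKey_neg hw h2]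
    constructor
    · rintro (h | ⟨h, h'⟩)
      · linarith [this.1 (Or.inl h)]
      · omega
    · intro h
      rcases this.2 (by linarith) with h' | ⟨h', h''⟩
      · exact Or.inl h'
      · omega
  · have a := dirKey_upper (upper_neg hv h1)
    have b := dirKey_upper h2
    have := fin (2 * s + 1) (2 * t + 0) _ _ a b
    push_cast at this
    rw [key, dirKey_neg hv h1]
    constructor
    · rintro (h | ⟨h, h'⟩)
      · linarith [this.1 (Or.inl h)]
      · omega
    · intro h
      rcases this.2 (by linarith) with h' | ⟨h', h''⟩
      · exact Or.inl h'
      · omega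
  · have a := dirKey_upper (upper_neg hv h1)
    have b := dirKey_upper (upper_neg hw h2)
    have := fin (2 * s + 1) (2 * t + 1) _ _ a b
    push_cast at this
    rw [key, dirKey_neg hv h1, dirKey_neg hw h2]
    constructor
    · rintro (h | ⟨h, h'⟩)
      · linarith [this.1 (Or.inl h)]
      · linarith [this.1 (Or.inr ⟨h, by rcases h' with h' | h' <;> linarith [a.1, b.1, a.2, b.2, h']⟩)]
    · intro h
      rcases this.2 (by linarith) with h' | ⟨h', h''⟩
      · exact Or.inl h'
      · exact Or.inr ⟨h', Or.inl ⟨by linarith, by linarith [a.1, b.2]⟩⟩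

/-- The vector from the viewpoint to a grid point. -/
def centerVec (p : ℤ × ℤ) : ℤ × ℤ := (p.2, -p.1)

/-- The corners at which a sweep enters and leaves the cell, case by case. -/
theorem corner_cases {p : ℤ × ℤ} (hp : p ≠ 0) :
    (p.1 < 0 ∧ 0 < p.2 ∧ enterCorner p = (2 * p.2 + 1, -2 * p.1 - 1) ∧
      exitCorner p = (2 * p.2 - 1, -2 * p.1 + 1)) ∨
    (p.1 < 0 ∧ p.2 = 0 ∧ enterCorner p = (2 * p.2 + 1, -2 * p.1 - 1) ∧
      exitCorner p = (2 * p.2 - 1, -2 * p.1 - 1)) ∨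
    (p.1 < 0 ∧ p.2 < 0 ∧ enterCorner p = (2 * p.2 + 1, -2 * p.1 + 1) ∧
      exitCorner p = (2 * p.2 - 1, -2 * p.1 - 1)) ∨
    (p.1 = 0 ∧ p.2 < 0 ∧ enterCorner p = (2 * p.2 + 1, -2 * p.1 + 1) ∧
      exitCorner p = (2 * p.2 + 1, -2 * p.1 - 1)) ∨
    (0 < p.1 ∧ p.2 < 0 ∧ enterCorner p = (2 * p.2 - 1, -2 * p.1 + 1) ∧
      exitCorner p = (2 * p.2 + 1, -2 * p.1 - 1)) ∨
    (0 < p.1 ∧ p.2 = 0 ∧ enterCorner p = (2 * p.2 - 1, -2 * p.1 + 1) ∧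
      exitCorner p = (2 * p.2 + 1, -2 * p.1 + 1)) ∨
    (0 < p.1 ∧ 0 < p.2 ∧ enterCorner p = (2 * p.2 - 1, -2 * p.1 - 1) ∧
      exitCorner p = (2 * p.2 + 1, -2 * p.1 + 1)) ∨
    (p.1 = 0 ∧ 0 < p.2 ∧ enterCorner p = (2 * p.2 - 1, -2 * p.1 - 1) ∧
      exitCorner p = (2 * p.2 - 1, -2 * p.1 + 1)) := by
  obtain ⟨i, j⟩ := p
  simp only [enterCorner, exitCorner, Prod.mk.injEq]
  rcases lt_trichotomy i 0 with hi | rfl | hi <;> rcases lt_trichotomy j 0 with hj | rfl | hj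
  all_goals first
    | exact absurd rfl hp
    | simp_all [Int.sign_eq_one_of_pos, Int.sign_eq_neg_one_of_neg, le_of_lt, ne_of_gt,
        ne_of_lt]
      try omega

/-- Twice a corner of a cell has odd coordinates. -/
theorem enterCorner_ne_zero {p : ℤ × ℤ} (hp : p ≠ 0) : enterCorner p ≠ 0 := by
  rcases corner_cases hp with h | h | h | h | h | h | h | h <;> rw [h.2.2.1] <;> intro hc <;>
    have := congrArg Prod.fst hc <;> simp only [Prod.fst_zero] at this <;> omega

theorem exitCorner_ne_zero {p : ℤ × ℤ} (hp : p ≠ 0) : exitCorner p ≠ 0 := by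
  rcases corner_cases hp with h | h | h | h | h | h | h | h <;> rw [h.2.2.2] <;> intro hc <;>
    have := congrArg Prod.fst hc <;> simp only [Prod.fst_zero] at this <;> omega

theorem centerVec_ne_zero {p : ℤ × ℤ} (hp : p ≠ 0) : centerVec p ≠ 0 := by
  intro hc
  have h1 := congrArg Prod.fst hc
  have h2 := congrArg Prod.snd hc
  simp only [centerVec, Prod.fst_zero, Prod.snd_zero] at h1 h2
  exact hp (Prod.ext (by simpa using h2) h1)

/-- The direction of the sweep line at an event. -/
def Event.vec (e : Event) : ℤ × ℤ :=
  match e.kind with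
  | .enter => enterCorner e.pos
  | .center => centerVec e.pos
  | .exit => exitCorner e.pos

theorem Event.vec_ne_zero {e : Event} (he : e.pos ≠ 0) : e.vec ≠ 0 := by
  unfold Event.vec
  cases e.kind
  exacts [enterCorner_ne_zero he, centerVec_ne_zero he, exitCorner_ne_zero he]

theorem Event.azimuth_eq (e : Event) : e.azimuth = Azimuth.ofVector e.turn e.vec := by
  unfold Event.azimuth Event.vec
  cases e.kind <;> rfl

/-- A number that grows with the azimuth angle of an event; a full turn adds `4`. -/
def Event.angle (e : Event) : ℚ := 4 * (e.turn : ℚ) + dirKey e.vec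

/-- The sort key of events. -/
def Event.key (e : Event) : ℚ ×ₗ ℤ ×ₗ ℤ ×ₗ ℤ ×ₗ ℤ :=
  toLex (e.angle, toLex (e.kind.order, toLex (dist2 e.pos, toLex (e.pos.1, e.pos.2))))

theorem Event.azimuth_lt_iff {e f : Event} (he : e.pos ≠ 0) (hf : f.pos ≠ 0) :
    e.azimuth.lt f.azimuth = true ↔ e.angle < f.angle := by
  rw [e.azimuth_eq, f.azimuth_eq]
  exact Azimuth.lt_ofVector (Event.vec_ne_zero he) (Event.vec_ne_zero hf) _ _

theorem Event.le_iff {e f : Event} (he : e.pos ≠ 0) (hf : f.pos ≠ 0) :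
    e.le f = true ↔ e.key ≤ f.key := by
  have h1 := Event.azimuth_lt_iff he hf
  have h2 := Event.azimuth_lt_iff hf he
  unfold Event.le
  rw [← not_lt]
  simp only [Event.key, Prod.Lex.toLex_lt_toLex]
  rcases lt_trichotomy e.angle f.angle with h | h | h
  · simp [h1.2 h, h.not_gt, h.ne']
  · have h1' : e.azimuth.lt f.azimuth = false := by simpa [h] using h1
    have h2' : f.azimuth.lt e.azimuth = false := by simpa [h] using h2
    rw [h1', h2', if_neg (by simp), if_neg (by simp), Bool.not_eq_true', ← Bool.not_eq_true, not_iff_not]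
    simp [lexLt_cons, lexLt_nil, h]
  · have h1' : e.azimuth.lt f.azimuth = false := by
      rw [← Bool.not_eq_true, h1]
      exact h.not_gt
    simp [h1', h2.2 h, h]

theorem Kind.order_injective : Function.Injective Kind.order := by
  intro a b h
  cases a <;> cases b <;> simp_all [Kind.order]

/-- Type, row and column can be read off the key. They determine the direction of the event, so the
angle then determines the round. -/
theorem Event.key_injective {e f : Event} (h : e.key = f.key) : e = f := by
  obtain ⟨k, p, t⟩ := e
  obtain ⟨k', p', t'⟩ := f
  have g1 := congrArg ofLex h
  simp only [Event.key, ofLex_toLex, Prod.mk.injEq] at g1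
  have g2 := congrArg ofLex g1.2
  simp only [ofLex_toLex, Prod.mk.injEq] at g2
  have g3 := congrArg ofLex g2.2
  simp only [ofLex_toLex, Prod.mk.injEq] at g3
  have g4 := congrArg ofLex g3.2
  simp only [ofLex_toLex, Prod.mk.injEq] at g4
  have h0 := g1.1
  obtain rfl := Kind.order_injective g2.1
  obtain rfl := Prod.ext g4.1 g4.2
  simp only [Event.angle, Event.vec] at h0
  have : (t : ℚ) = t' := by linarith
  rw [Int.cast_inj] at this
  rw [this]

theorem Event.totalOn_le : TotalOn Event.le (fun e => e.pos ≠ 0) :=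
  TotalOn.of_key Event.key fun _ _ he hf => Event.le_iff he hf

theorem Event.angle_le_of_key_le {e f : Event} (h : e.key ≤ f.key) : e.angle ≤ f.angle := by
  simp only [Event.key, Prod.Lex.toLex_le_toLex] at h
  rcases h with h | h
  · exact h.le
  · exact h.1.le

theorem Event.key_lt_of_angle_lt {e f : Event} (h : e.angle < f.angle) : e.key < f.key := by
  simp only [Event.key, Prod.Lex.toLex_lt_toLex]
  exact Or.inl h

theorem Event.key_lt_of_order_lt {e f : Event} (h : e.angle ≤ f.angle)
    (h' : e.kind.order < f.kind.order) : e.key < f.key := by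
  simp only [Event.key, Prod.Lex.toLex_lt_toLex]
  rcases h.lt_or_eq with h | h
  · exact Or.inl h
  · exact Or.inr ⟨h, Or.inl h'⟩

/-! ## Geometry of cells -/

/-- The grid point lies straight to the right of the viewpoint. -/
def Right (p : ℤ × ℤ) : Prop := p.1 = 0 ∧ 0 < p.2

instance (p : ℤ × ℤ) : Decidable (Right p) := inferInstanceAs (Decidable (_ ∧ _))

/-- The cell of `q` meets the ray in direction `w`. -/
def InCone (q w : ℤ × ℤ) : Prop := 0 ≤ cross (enterCorner q) w ∧ 0 ≤ cross w (exitCorner q)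

/-- A cell other than that of the viewpoint is seen under less than half a turn. This is why the two
sign conditions of `InCone` describe a proper cone. -/
theorem cross_corners_pos {q : ℤ × ℤ} (hq : q ≠ 0) :
    0 < cross (enterCorner q) (exitCorner q) := by
  rcases corner_cases hq with h | h | h | h | h | h | h | h <;> rw [h.2.2.1, h.2.2.2] <;>
    simp only [cross] <;> obtain ⟨h1, h2, -, -⟩ := h <;> nlinarith

theorem cross_enter_center_pos {q : ℤ × ℤ} (hq : q ≠ 0) :
    0 < cross (enterCorner q) (centerVec q) := by
  rcases corner_cases hq with h | h | h | h | h | h | h | h <;> rw [h.2.2.1] <;>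
    simp only [cross, centerVec] <;> obtain ⟨h1, h2, -, -⟩ := h <;> nlinarith

theorem cross_center_exit_pos {q : ℤ × ℤ} (hq : q ≠ 0) :
    0 < cross (centerVec q) (exitCorner q) := by
  rcases corner_cases hq with h | h | h | h | h | h | h | h <;> rw [h.2.2.2] <;>
    simp only [cross, centerVec] <;> obtain ⟨h1, h2, -, -⟩ := h <;> nlinarith

/-- The turn from `v` to `w` is less than half a turn, so the keys can be in the wrong order only if
it passes azimuth `0`, that is, from the lower to the upper half plane. The last hypothesis excludes
this. -/
theorem dirKey_lt_of_cross_pos {v w : ℤ × ℤ} (hv : v ≠ 0) (hw : w ≠ 0) (h : 0 < cross v w)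
    (hh : Upper v ∨ ¬Upper w) : dirKey v < dirKey w := by
  rw [cross_pos_iff hv hw] at h
  have h1 := dirKey_bounds hv
  have h2 := dirKey_bounds hw
  rcases h with h | h
  · linarith [h.1]
  · rcases hh with hh | hh
    · linarith [(dirKey_upper hh).2, h2.1]
    · linarith [(dirKey_lower hw hh).1, h1.2]

theorem dirKey_corners {q : ℤ × ℤ} (hq : q ≠ 0) (hr : ¬Right q) :
    dirKey (enterCorner q) < dirKey (centerVec q) ∧
      dirKey (centerVec q) < dirKey (exitCorner q) := by
  constructor
  · refine dirKey_lt_of_cross_pos (enterCorner_ne_zero hq) (centerVec_ne_zero hq)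
      (cross_enter_center_pos hq) ?_
    rcases corner_cases hq with h | h | h | h | h | h | h | h <;> rw [h.2.2.1] <;>
      simp only [Upper, centerVec, Right] at * <;> omega
  · refine dirKey_lt_of_cross_pos (centerVec_ne_zero hq) (exitCorner_ne_zero hq)
      (cross_center_exit_pos hq) ?_
    rcases corner_cases hq with h | h | h | h | h | h | h | h <;> rw [h.2.2.2] <;>
      simp only [Upper, centerVec, Right] at * <;> omega

/-- These cells straddle azimuth `0`: they are entered at the end of one round, and their centre and
exit belong to the next. -/
theorem dirKey_right {q : ℤ × ℤ} (hr : Right q) :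
    2 ≤ dirKey (enterCorner q) ∧ dirKey (centerVec q) = 0 ∧ 0 < dirKey (exitCorner q) ∧
      dirKey (exitCorner q) < 2 := by
  have hq : q ≠ 0 := by
    rintro rfl
    simp [Right] at hr
  have h1 : ¬Upper (enterCorner q) := by
    rcases corner_cases hq with h | h | h | h | h | h | h | h <;> rw [h.2.2.1] <;>
      simp only [Upper, Right] at * <;> omega
  have h2 : Upper (exitCorner q) := by
    rcases corner_cases hq with h | h | h | h | h | h | h | h <;> rw [h.2.2.2] <;>
      simp only [Upper, Right] at * <;> omega
  have h3 : dirKey (centerVec q) = 0 := by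
    have : Upper (centerVec q) := Or.inr ⟨by simp [centerVec, hr.1], hr.2⟩
    have hne : (q.2 : ℚ) ≠ 0 := by exact_mod_cast hr.2.ne'
    rw [dirKey, if_pos this]
    simp [abscissa, centerVec, hr.1, abs_of_pos hr.2, hne]
  refine ⟨(dirKey_lower (enterCorner_ne_zero hq) h1).1, h3, ?_, (dirKey_upper h2).2⟩
  have := dirKey_lt_of_cross_pos (centerVec_ne_zero hq) (exitCorner_ne_zero hq)
    (cross_center_exit_pos hq) (Or.inl (Or.inr ⟨by simp [centerVec, hr.1], hr.2⟩))
  linarith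

/-- A vector with key `0` is parallel to the horizontal axis, but the second coordinate of an enter
corner is odd. -/
theorem dirKey_enter_pos {q : ℤ × ℤ} (hq : q ≠ 0) : 0 < dirKey (enterCorner q) := by
  have h0 := (dirKey_bounds (enterCorner_ne_zero hq)).1
  refine lt_of_le_of_ne h0 fun hc => ?_
  have h1 : dirKey (1, 0) = 0 := by
    simp [dirKey, Upper, abscissa]
  have h2 := cross_eq_zero_of_dirKey_eq (enterCorner_ne_zero hq)
    (w := (1, 0)) (by simp [Prod.ext_iff]) (by rw [h1, ← hc])
  simp only [cross] at h2
  rcases corner_cases hq with h | h | h | h | h | h | h | h <;> rw [h.2.2.1] at h2 <;>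
    simp only at h2 <;> omega

/-- Without a passage through azimuth `0`, the cone of a cell is an interval of keys. -/
theorem inCone_iff {q w : ℤ × ℤ} (hq : q ≠ 0) (hw : w ≠ 0) (hr : ¬Right q) :
    InCone q w ↔ dirKey (enterCorner q) ≤ dirKey w ∧ dirKey w ≤ dirKey (exitCorner q) := by
  have hE := enterCorner_ne_zero hq
  have hX := exitCorner_ne_zero hq
  have h1 := cross_pos_iff hw hE
  have h2 := cross_pos_iff hX hw
  have h3 := (cross_pos_iff hE hX).1 (cross_corners_pos hq)
  have h4 := dirKey_corners hq hr
  have b1 := dirKey_bounds hE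
  have b2 := dirKey_bounds hX
  have b3 := dirKey_bounds hw
  have e1 : 0 ≤ cross (enterCorner q) w ↔ ¬ 0 < cross w (enterCorner q) := by
    rw [cross_swap w]; omega
  have e2 : 0 ≤ cross w (exitCorner q) ↔ ¬ 0 < cross (exitCorner q) w := by
    rw [cross_swap (exitCorner q)]; omega
  rw [InCone, e1, e2, h1, h2]
  constructor
  · rintro ⟨g1, g2⟩
    push Not at g1 g2
    constructor
    · by_contra hc
      push Not at hc
      have := g1.1 (by linarith)
      rcases h3 with h3 | h3
      · have := g2.2
        linarith
      · linarith [h4.1, h4.2]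
    · by_contra hc
      push Not at hc
      have := g2.1 (by linarith)
      have := g1.2
      rcases h3 with h3 | h3 <;> linarith [h4.1, h4.2]
  · rintro ⟨g1, g2⟩
    rcases h3 with h3 | h3
    · constructor <;> rintro (h | h) <;> linarith [h3.1, h3.2]
    · linarith [h4.1, h4.2]

/-- The cone contains azimuth `0`, so its keys form two pieces, one at each end of `[0, 4)`. They
correspond to the two stays of the sweep line in such a cell. -/
theorem inCone_iff_of_right {q w : ℤ × ℤ} (hw : w ≠ 0) (hr : Right q) :
    InCone q w ↔ dirKey (enterCorner q) ≤ dirKey w ∨ dirKey w ≤ dirKey (exitCorner q) := by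
  have hq : q ≠ 0 := by
    rintro rfl
    simp [Right] at hr
  have hE := enterCorner_ne_zero hq
  have hX := exitCorner_ne_zero hq
  have h1 := cross_pos_iff hw hE
  have h2 := cross_pos_iff hX hw
  have h3 := (cross_pos_iff hE hX).1 (cross_corners_pos hq)
  have h4 := dirKey_right hr
  have b1 := dirKey_bounds hE
  have b2 := dirKey_bounds hX
  have b3 := dirKey_bounds hw
  have e1 : 0 ≤ cross (enterCorner q) w ↔ ¬ 0 < cross w (enterCorner q) := by
    rw [cross_swap w]; omega
  have e2 : 0 ≤ cross w (exitCorner q) ↔ ¬ 0 < cross (exitCorner q) w := by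
    rw [cross_swap (exitCorner q)]; omega
  rw [InCone, e1, e2, h1, h2]
  have h5 : dirKey (exitCorner q) - dirKey (enterCorner q) < -2 := by
    rcases h3 with h3 | h3
    · linarith [h3.1]
    · exact h3
  constructor
  · rintro ⟨g1, g2⟩
    push Not at g1 g2
    by_contra hc
    push Not at hc
    have := g1.1 (by linarith)
    have := g2.1 (by linarith)
    linarith
  · rintro (g | g)
    · constructor <;> rintro (⟨h, h'⟩ | h) <;> linarith
    · constructor <;> rintro (⟨h, h'⟩ | h) <;> linarith

/-! ### Cells against rays and segments. -/

theorem corners_near {q : ℤ × ℤ} (hq : q ≠ 0) :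
    (2 * q.2 - 1 ≤ (enterCorner q).1 ∧ (enterCorner q).1 ≤ 2 * q.2 + 1 ∧
      2 * -q.1 - 1 ≤ (enterCorner q).2 ∧ (enterCorner q).2 ≤ 2 * -q.1 + 1) ∧
    (2 * q.2 - 1 ≤ (exitCorner q).1 ∧ (exitCorner q).1 ≤ 2 * q.2 + 1 ∧
      2 * -q.1 - 1 ≤ (exitCorner q).2 ∧ (exitCorner q).2 ≤ 2 * -q.1 + 1) := by
  rcases corner_cases hq with h | h | h | h | h | h | h | h <;> rw [h.2.2.1, h.2.2.2] <;>
    dsimp only <;> omega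

/-- The point `s • w` lies in the cell of `q`. -/
def Near (q w : ℤ × ℤ) (s : ℝ) : Prop :=
  |s * (w.1 : ℝ) - (q.2 : ℝ)| ≤ 1 / 2 ∧ |s * (w.2 : ℝ) - (-(q.1 : ℝ))| ≤ 1 / 2

/-- With `E`, `X` the doubled corners, `cross E X • w = cross w X • E + cross E w • X`, and both
coefficients on the right are nonnegative. Dividing by twice their sum shows that a positive
multiple of `w` is a convex combination of two corners of the cell, hence a point of the cell. -/
theorem InCone.exists_near {q w : ℤ × ℤ} (hq : q ≠ 0) (hw : w ≠ 0) (h : InCone q w) :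
    ∃ s : ℝ, 0 < s ∧ Near q w s := by
  have hc := cross_corners_pos hq
  obtain ⟨⟨n1, n2, n3, n4⟩, m1, m2, m3, m4⟩ := corners_near hq
  obtain ⟨hβ, hα⟩ := h
  set E := enterCorner q
  set X := exitCorner q
  set α := cross w X
  set β := cross E w
  set γ := cross E X
  have i1 : w.1 * γ = E.1 * α + X.1 * β := by simp only [α, β, γ, cross]; ring
  have i2 : w.2 * γ = E.2 * α + X.2 * β := by simp only [α, β, γ, cross]; ring
  have hpos : 0 < α + β := by
    by_contra hn
    have h1 : α = 0 := by omega
    have h2 : β = 0 := by omega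
    rw [h1, h2] at i1 i2
    simp only [mul_zero, add_zero, mul_eq_zero, hc.ne', or_false] at i1 i2
    exact hw (Prod.ext i1 i2)
  have hposR : (0 : ℝ) < (α : ℝ) + β := by exact_mod_cast hpos
  have hcR : (0 : ℝ) < γ := by exact_mod_cast hc
  have hαR : (0 : ℝ) ≤ α := by exact_mod_cast hα
  have hβR : (0 : ℝ) ≤ β := by exact_mod_cast hβ
  have key : ∀ (a e x : ℤ) (c : ℤ), a * γ = e * α + x * β → 2 * c - 1 ≤ e → e ≤ 2 * c + 1 →
      2 * c - 1 ≤ x → x ≤ 2 * c + 1 →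
      |(γ : ℝ) / (2 * ((α : ℝ) + β)) * (a : ℝ) - (c : ℝ)| ≤ 1 / 2 := by
    intro a e x c h1 h2 h3 h4 h5
    have h1R : (a : ℝ) * γ = e * α + x * β := by exact_mod_cast h1
    have h2R : (2 : ℝ) * c - 1 ≤ e := by exact_mod_cast h2
    have h3R : (e : ℝ) ≤ 2 * c + 1 := by exact_mod_cast h3
    have h4R : (2 : ℝ) * c - 1 ≤ x := by exact_mod_cast h4
    have h5R : (x : ℝ) ≤ 2 * c + 1 := by exact_mod_cast h5
    have h6 : (γ : ℝ) / (2 * ((α : ℝ) + β)) * (a : ℝ) = (e * α + x * β) / (2 * ((α : ℝ) + β)) := by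
      rw [← h1R]; ring
    rw [h6, abs_le]
    constructor
    · rw [le_sub_iff_add_le, le_div_iff₀ (by positivity)]
      nlinarith [mul_nonneg hαR (sub_nonneg.2 h2R), mul_nonneg hβR (sub_nonneg.2 h4R)]
    · rw [sub_le_iff_le_add, div_le_iff₀ (by positivity)]
      nlinarith [mul_nonneg hαR (sub_nonneg.2 h3R), mul_nonneg hβR (sub_nonneg.2 h5R)]
  refine ⟨(γ : ℝ) / (2 * ((α : ℝ) + β)), by positivity, key _ _ _ _ i1 n1 n2 m1 m2, ?_⟩
  have := key _ _ _ _ i2 n3 n4 m3 m4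
  push_cast at this
  exact this

/-- The lines from the viewpoint through the two corners support the cell: the signs of the
coordinates of a corner tell on which edges of the square it lies. -/
theorem corners_supporting {q : ℤ × ℤ} (hq : q ≠ 0) :
    ((0 ≤ (enterCorner q).1 ∧ (enterCorner q).2 = 2 * -q.1 - 1 ∨
        (enterCorner q).1 ≤ 0 ∧ (enterCorner q).2 = 2 * -q.1 + 1) ∧
      (0 ≤ (enterCorner q).2 ∧ (enterCorner q).1 = 2 * q.2 + 1 ∨
        (enterCorner q).2 ≤ 0 ∧ (enterCorner q).1 = 2 * q.2 - 1)) ∧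
    ((0 ≤ (exitCorner q).1 ∧ (exitCorner q).2 = 2 * -q.1 + 1 ∨
        (exitCorner q).1 ≤ 0 ∧ (exitCorner q).2 = 2 * -q.1 - 1) ∧
      (0 ≤ (exitCorner q).2 ∧ (exitCorner q).1 = 2 * q.2 - 1 ∨
        (exitCorner q).2 ≤ 0 ∧ (exitCorner q).1 = 2 * q.2 + 1)) := by
  rcases corner_cases hq with h | h | h | h | h | h | h | h <;> rw [h.2.2.1, h.2.2.2] <;>
    dsimp only <;> omega

theorem Near.inCone {q w : ℤ × ℤ} {s : ℝ} (hq : q ≠ 0) (hs : 0 < s) (h : Near q w s) :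
    InCone q w := by
  obtain ⟨⟨h1, h2⟩, ⟨h3, h4⟩⟩ := And.imp abs_le.1 abs_le.1 h
  set u := s * (w.1 : ℝ) with hu
  set v := s * (w.2 : ℝ) with hv
  obtain ⟨⟨a1, a2⟩, b1, b2⟩ := corners_supporting hq
  constructor
  · have h5 : 0 ≤ ((enterCorner q).1 : ℝ) * (v - (enterCorner q).2 / 2) := by
      rcases a1 with ⟨a1, a3⟩ | ⟨a1, a3⟩
      · exact mul_nonneg (by exact_mod_cast a1) (by rw [a3]; push_cast; linarith)
      · exact mul_nonneg_of_nonpos_of_nonpos (by exact_mod_cast a1) (by rw [a3]; push_cast; linarith)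
    have h6 : 0 ≤ ((enterCorner q).2 : ℝ) * ((enterCorner q).1 / 2 - u) := by
      rcases a2 with ⟨a2, a3⟩ | ⟨a2, a3⟩
      · exact mul_nonneg (by exact_mod_cast a2) (by rw [a3]; push_cast; linarith)
      · exact mul_nonneg_of_nonpos_of_nonpos (by exact_mod_cast a2) (by rw [a3]; push_cast; linarith)
    have h7 : 0 ≤ s * ((cross (enterCorner q) w : ℤ) : ℝ) := by
      simp only [cross]; push_cast
      nlinarith
    exact_mod_cast nonneg_of_mul_nonneg_right h7 hs
  · have h5 : 0 ≤ ((exitCorner q).1 : ℝ) * ((exitCorner q).2 / 2 - v) := by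
      rcases b1 with ⟨a1, a3⟩ | ⟨a1, a3⟩
      · exact mul_nonneg (by exact_mod_cast a1) (by rw [a3]; push_cast; linarith)
      · exact mul_nonneg_of_nonpos_of_nonpos (by exact_mod_cast a1) (by rw [a3]; push_cast; linarith)
    have h6 : 0 ≤ ((exitCorner q).2 : ℝ) * (u - (exitCorner q).1 / 2) := by
      rcases b2 with ⟨a2, a3⟩ | ⟨a2, a3⟩
      · exact mul_nonneg (by exact_mod_cast a2) (by rw [a3]; push_cast; linarith)
      · exact mul_nonneg_of_nonpos_of_nonpos (by exact_mod_cast a2) (by rw [a3]; push_cast; linarith)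
    have h7 : 0 ≤ s * ((cross w (exitCorner q) : ℤ) : ℝ) := by
      simp only [cross]; push_cast
      nlinarith
    exact_mod_cast nonneg_of_mul_nonneg_right h7 hs

/-- Otherwise `|b| ≥ |a| + 1` by integrality, which is incompatible with `|s * a| ≤ |a|` and a
distance of at most `1 / 2`. -/
theorem abs_le_abs_of_near {a b : ℤ} {s : ℝ} (h0 : 0 ≤ s) (h1 : s ≤ 1)
    (h : |s * (a : ℝ) - b| ≤ 1 / 2) : |b| ≤ |a| := by
  by_contra hc
  have h2 : (|a| : ℝ) + 1 ≤ |(b : ℝ)| := by exact_mod_cast (by omega : |a| + 1 ≤ |b|)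
  have h3 : |s * (a : ℝ)| ≤ |(a : ℝ)| := by
    rw [abs_mul, abs_of_nonneg h0]
    exact mul_le_of_le_one_left (abs_nonneg _) h1
  have h4 : |(b : ℝ)| - |s * (a : ℝ)| ≤ |s * (a : ℝ) - b| := by
    rw [abs_sub_comm]
    exact abs_sub_abs_le_abs_sub _ _
  linarith

theorem abs_le_abs_of_near' {a b : ℤ} {s : ℝ} (h1 : 1 ≤ s)
    (h : |s * (a : ℝ) - b| ≤ 1 / 2) : |a| ≤ |b| := by
  by_contra hc
  have h2 : (|b| : ℝ) + 1 ≤ |(a : ℝ)| := by exact_mod_cast (by omega : |b| + 1 ≤ |a|)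
  have h3 : |(a : ℝ)| ≤ |s * (a : ℝ)| := by
    rw [abs_mul, abs_of_nonneg (by linarith : (0 : ℝ) ≤ s)]
    exact le_mul_of_one_le_left (abs_nonneg _) h1
  have h4 : |s * (a : ℝ)| - |(b : ℝ)| ≤ |s * (a : ℝ) - b| := abs_sub_abs_le_abs_sub _ _
  linarith

/-- If `b = -a ≠ 0`, the distance between `s * a` and `b` is `(s + 1) * |a| ≥ 1`. -/
theorem eq_of_near_of_abs_eq {a b : ℤ} {s : ℝ} (h0 : 0 ≤ s)
    (h : |s * (a : ℝ) - b| ≤ 1 / 2) (hab : |b| = |a|) : b = a := by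
  rcases abs_eq_abs.1 hab with hab | hab
  · exact hab
  · by_cases ha : a = 0
    · simp [hab, ha]
    · exfalso
      have h1 : (1 : ℝ) ≤ |(a : ℝ)| := by exact_mod_cast Int.one_le_abs ha
      have h2 : s * (a : ℝ) - b = (s + 1) * a := by rw [hab]; push_cast; ring
      rw [h2, abs_mul, abs_of_nonneg (by linarith : 0 ≤ s + 1)] at h
      nlinarith

/-- Both coordinates of `q` are at most those of `p` in absolute value. Equal distances would make
both absolute values equal, and then also the signs agree, so `q = p`. -/
theorem dist2_lt_of_near {p q : ℤ × ℤ} {s : ℝ} (hne : q ≠ p) (h0 : 0 ≤ s) (h1 : s ≤ 1)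
    (h : Near q (centerVec p) s) : dist2 q < dist2 p := by
  have a1 : |s * ((p.2 : ℤ) : ℝ) - (q.2 : ℤ)| ≤ 1 / 2 := h.1
  have a2 : |s * ((-p.1 : ℤ) : ℝ) - (-q.1 : ℤ)| ≤ 1 / 2 := by
    have := h.2
    simp only [centerVec] at this
    push_cast at this ⊢
    exact this
  have b1 := abs_le_abs_of_near h0 h1 a1
  have b2 := abs_le_abs_of_near h0 h1 a2
  simp only [abs_neg] at b2
  have c1 : q.2 ^ 2 ≤ p.2 ^ 2 := sq_le_sq.2 b1
  have c2 : q.1 ^ 2 ≤ p.1 ^ 2 := sq_le_sq.2 b2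
  unfold dist2
  by_contra hc
  have d1 : |q.2| = |p.2| := (sq_eq_sq_iff_abs_eq_abs _ _).1 (by linarith)
  have d2 : |q.1| = |p.1| := (sq_eq_sq_iff_abs_eq_abs _ _).1 (by linarith)
  have e1 := eq_of_near_of_abs_eq h0 a1 d1
  have e2 := eq_of_near_of_abs_eq h0 a2 (by simpa using d2)
  exact hne (Prod.ext (by simpa using e2) e1)

theorem dist2_le_of_near' {p q : ℤ × ℤ} {s : ℝ} (h1 : 1 ≤ s)
    (h : Near q (centerVec p) s) : dist2 p ≤ dist2 q := by
  have a1 : |s * ((p.2 : ℤ) : ℝ) - (q.2 : ℤ)| ≤ 1 / 2 := h.1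
  have a2 : |s * ((-p.1 : ℤ) : ℝ) - (-q.1 : ℤ)| ≤ 1 / 2 := by
    have := h.2
    simp only [centerVec] at this
    push_cast at this ⊢
    exact this
  have b1 := abs_le_abs_of_near' h1 a1
  have b2 := abs_le_abs_of_near' h1 a2
  simp only [abs_neg] at b2
  exact add_le_add (sq_le_sq.2 b2) (sq_le_sq.2 b1)

theorem cell_inter_segment_nonempty_iff (p q : ℤ × ℤ) :
    (cell q ∩ segment ℝ ((0, 0) : ℝ × ℝ) (location p)).Nonempty ↔
      ∃ s : ℝ, 0 ≤ s ∧ s ≤ 1 ∧ Near q (centerVec p) s := by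
  have aux : ∀ a b : ℝ, |a - b| ≤ 1 / 2 ↔ b - 1 / 2 ≤ a ∧ a ≤ b + 1 / 2 := by
    intro a b
    rw [abs_le]
    constructor <;> rintro ⟨h1, h2⟩ <;> constructor <;> linarith
  rw [segment_eq_image]
  constructor
  · rintro ⟨_, hx, s, ⟨h0, h1⟩, rfl⟩
    refine ⟨s, h0, h1, ?_⟩
    simp only [cell, location, Set.mem_prod, Set.mem_Icc, Prod.fst_add, Prod.smul_fst, Prod.snd_add,
      Prod.smul_snd, smul_eq_mul, mul_zero, zero_add] at hx
    simp only [Near, centerVec, aux, Int.cast_neg]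
    exact hx
  · rintro ⟨s, h0, h1, h⟩
    refine ⟨_, ?_, s, ⟨h0, h1⟩, rfl⟩
    simp only [Near, centerVec, aux, Int.cast_neg] at h
    simp only [cell, location, Set.mem_prod, Set.mem_Icc, Prod.fst_add, Prod.smul_fst, Prod.snd_add,
      Prod.smul_snd, smul_eq_mul, mul_zero, zero_add]
    exact h

/-- Which cells meet the line of sight. -/
theorem blocks_iff {p q : ℤ × ℤ} (hp : p ≠ 0) (hq : q ≠ 0) (hne : q ≠ p) :
    (cell q ∩ segment ℝ ((0, 0) : ℝ × ℝ) (location p)).Nonempty ↔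
      InCone q (centerVec p) ∧ dist2 q < dist2 p := by
  rw [cell_inter_segment_nonempty_iff]
  constructor
  · rintro ⟨s, h0, h1, h⟩
    refine ⟨?_, dist2_lt_of_near hne h0 h1 h⟩
    -- The parameter `0` would put the viewpoint into the cell of `q`, and then the integer
    -- coordinates of `q` vanish.
    rcases h0.eq_or_lt with rfl | h0
    · exfalso
      obtain ⟨h2, h3⟩ := h
      simp only [zero_mul, zero_sub, abs_neg] at h2 h3
      have : ∀ a : ℤ, |(a : ℝ)| ≤ 1 / 2 → a = 0 := by
        intro a ha
        by_contra hc
        have : (1 : ℝ) ≤ |(a : ℝ)| := by exact_mod_cast Int.one_le_abs hc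
        linarith
      exact hq (Prod.ext (this _ h3) (this _ h2))
    · exact h.inCone hq h0
  · rintro ⟨h1, h2⟩
    obtain ⟨s, h3, h4⟩ := h1.exists_near hq (centerVec_ne_zero hp)
    refine ⟨s, h3.le, ?_, h4⟩
    -- If the cell were met only beyond `p`, then `q` would be at least as far away as `p`.
    by_contra hc
    exact absurd h2 (dist2_le_of_near' (not_le.1 hc).le h4).not_gt

/-! ### Counting cells -/

/-- The cross product with `w` does not change when a multiple of `w` is subtracted from the centre,
so the centre can be replaced by its offset from a point of the ray in the cell. That offset has
coordinates of size at most `1 / 2`. -/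
theorem InCone.abs_cross_le {q w : ℤ × ℤ} (hq : q ≠ 0) (hw : w ≠ 0) (h : InCone q w) :
    2 * |cross w (centerVec q)| ≤ |w.1| + |w.2| := by
  obtain ⟨s, -, h1, h2⟩ := h.exists_near hq hw
  have h3 : ((cross w (centerVec q) : ℤ) : ℝ) =
      w.2 * (s * w.1 - q.2) - w.1 * (s * w.2 - (-(q.1 : ℝ))) := by
    simp only [cross, centerVec]
    push_cast
    ring
  have h4 : |((cross w (centerVec q) : ℤ) : ℝ)| ≤ |(w.2 : ℝ)| * (1 / 2) + |(w.1 : ℝ)| * (1 / 2) := by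
    rw [h3]
    refine (abs_sub _ _).trans ?_
    rw [abs_mul, abs_mul]
    exact add_le_add (mul_le_mul_of_nonneg_left h1 (abs_nonneg _))
      (mul_le_mul_of_nonneg_left h2 (abs_nonneg _))
  have h5 : (2 : ℝ) * |((cross w (centerVec q) : ℤ) : ℝ)| ≤ |(w.1 : ℝ)| + |(w.2 : ℝ)| := by linarith
  exact_mod_cast h5

theorem card_le_three {T : Finset ℤ} (h : ∀ a ∈ T, ∀ b ∈ T, b ≤ a + 2) : T.card ≤ 3 := by
  rcases T.eq_empty_or_nonempty with rfl | hT
  · simp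
  · have : T ⊆ Finset.Icc (T.min' hT) (T.min' hT + 2) := by
      intro x hx
      rw [Finset.mem_Icc]
      exact ⟨T.min'_le x hx, h _ (T.min'_mem hT) _ hx⟩
    refine (Finset.card_le_card this).trans ?_
    rw [Int.card_Icc]
    omega

theorem le_add_two_of_abs_mul {a d : ℤ} {x y : ℤ} (ha : a ≠ 0) (hx : |a * x + d| ≤ |a|)
    (hy : |a * y + d| ≤ |a|) : y ≤ x + 2 := by
  have h1 : |a| * |y - x| ≤ |a| * 2 := by
    rw [← abs_mul]
    have : a * (y - x) = (a * y + d) - (a * x + d) := by ring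
    rw [this]
    have := abs_sub (a * y + d) (a * x + d)
    linarith
  have h2 := le_of_mul_le_mul_left h1 (abs_pos.2 ha)
  have := le_abs_self (y - x)
  omega

/-- Suppose that the horizontal component of `w` is the larger one. In a fixed column,
`InCone.abs_cross_le` confines `w.1` times the row number to an interval of length `2 * |w.1|`,
which leaves at most three rows; there are `2 * m + 1` columns. The other case exchanges rows and
columns. -/
theorem card_inCone_le {m : ℕ} {w : ℤ × ℤ} (hw : w ≠ 0) (S : Finset (ℤ × ℤ))
    (hS : ∀ q ∈ S, q ≠ 0 ∧ |q.1| ≤ m ∧ |q.2| ≤ m ∧ InCone q w) : S.card ≤ 3 * (2 * m + 1) := by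
  have hI : (Finset.Icc (-(m : ℤ)) m).card = 2 * m + 1 := by
    rw [Int.card_Icc]; omega
  rw [← hI]
  rcases le_total |w.2| |w.1| with h | h
  · have hw1 : w.1 ≠ 0 := by
      intro hc
      rw [hc, abs_zero, abs_nonpos_iff] at h
      exact hw (Prod.ext hc h)
    refine Finset.card_le_mul_card_image_of_maps_to (f := Prod.snd) ?_ 3 ?_
    · intro q hq
      rw [Finset.mem_Icc]
      exact abs_le.1 (hS q hq).2.2.1
    · intro x _
      rw [← Finset.card_image_of_injOn (f := Prod.fst)]
      · apply card_le_three
        intro a ha b hb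
        simp only [Finset.mem_image, Finset.mem_filter] at ha hb
        obtain ⟨p, ⟨hp, hpx⟩, rfl⟩ := ha
        obtain ⟨q, ⟨hq, hqx⟩, rfl⟩ := hb
        have c1 := (hS p hp).2.2.2.abs_cross_le (hS p hp).1 hw
        have c2 := (hS q hq).2.2.2.abs_cross_le (hS q hq).1 hw
        refine le_add_two_of_abs_mul (a := -w.1) (d := -(w.2 * x)) (neg_ne_zero.2 hw1)
          ?_ ?_
        · rw [abs_neg]
          simp only [cross, centerVec, hpx] at c1
          rw [show -w.1 * p.1 + -(w.2 * x) = w.1 * -p.1 - w.2 * x by ring]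
          linarith
        · rw [abs_neg]
          simp only [cross, centerVec, hqx] at c2
          rw [show -w.1 * q.1 + -(w.2 * x) = w.1 * -q.1 - w.2 * x by ring]
          linarith
      · intro p hp q hq hpq
        simp only [Finset.coe_filter, Set.mem_ofPred_eq] at hp hq
        exact Prod.ext hpq (hp.2.trans hq.2.symm)
  · have hw2 : w.2 ≠ 0 := by
      intro hc
      rw [hc, abs_zero, abs_nonpos_iff] at h
      exact hw (Prod.ext h hc)
    refine Finset.card_le_mul_card_image_of_maps_to (f := Prod.fst) ?_ 3 ?_
    · intro q hq
      rw [Finset.mem_Icc]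
      exact abs_le.1 (hS q hq).2.1
    · intro x _
      rw [← Finset.card_image_of_injOn (f := Prod.snd)]
      · apply card_le_three
        intro a ha b hb
        simp only [Finset.mem_image, Finset.mem_filter] at ha hb
        obtain ⟨p, ⟨hp, hpx⟩, rfl⟩ := ha
        obtain ⟨q, ⟨hq, hqx⟩, rfl⟩ := hb
        have c1 := (hS p hp).2.2.2.abs_cross_le (hS p hp).1 hw
        have c2 := (hS q hq).2.2.2.abs_cross_le (hS q hq).1 hw
        refine le_add_two_of_abs_mul (a := -w.2) (d := -(w.1 * x)) (neg_ne_zero.2 hw2)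
          ?_ ?_
        · rw [abs_neg]
          simp only [cross, centerVec, hpx] at c1
          rw [show -w.2 * p.2 + -(w.1 * x) = w.1 * -x - w.2 * p.2 by ring]
          linarith
        · rw [abs_neg]
          simp only [cross, centerVec, hqx] at c2
          rw [show -w.2 * q.2 + -(w.1 * x) = w.1 * -x - w.2 * q.2 by ring]
          linarith
      · intro p hp q hq hpq
        simp only [Finset.coe_filter, Set.mem_ofPred_eq] at hp hq
        exact Prod.ext (hp.2.trans hq.2.symm) hpq

theorem enterCorner_injective {p q : ℤ × ℤ} (hp : p ≠ 0) (hq : q ≠ 0)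
    (h : enterCorner p = enterCorner q) : p = q := by
  have h1 := congrArg Prod.fst h
  have h2 := congrArg Prod.snd h
  refine Prod.ext ?_ ?_ <;>
  rcases corner_cases hp with g | g | g | g | g | g | g | g <;> rw [g.2.2.1] at h1 h2 <;>
  rcases corner_cases hq with g' | g' | g' | g' | g' | g' | g' | g' <;>
    rw [g'.2.2.1] at h1 h2 <;> dsimp only at h1 h2 <;> omega

/-- Enter corners in one direction lie on a line through the viewpoint. That line is not vertical,
because the first coordinate of a corner is odd; so this coordinate determines the corner and
thereby the cell. It ranges over at most `4 * m + 3` integers. -/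
theorem card_enter_eq_le {m : ℕ} (θ : ℚ) (S : Finset (ℤ × ℤ))
    (hS : ∀ q ∈ S, q ≠ 0 ∧ |q.1| ≤ m ∧ |q.2| ≤ m ∧ dirKey (enterCorner q) = θ) :
    S.card ≤ 4 * m + 3 := by
  have hI : (Finset.Icc (-(2 * m + 1) : ℤ) (2 * m + 1)).card = 4 * m + 3 := by
    rw [Int.card_Icc]; omega
  rw [← hI]
  refine Finset.card_le_card_of_injOn (fun q => (enterCorner q).1) ?_ ?_
  · intro q hq
    obtain ⟨h1, h2, h3, h4⟩ := hS q hq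
    obtain ⟨⟨n1, n2, -, -⟩, -⟩ := corners_near h1
    have := abs_le.1 h3
    simp only [Finset.coe_Icc, Set.mem_Icc]
    omega
  · intro p hp q hq hpq
    obtain ⟨h1, -, -, h4⟩ := hS p hp
    obtain ⟨h1', -, -, h4'⟩ := hS q hq
    apply enterCorner_injective h1 h1'
    have hc := cross_eq_zero_of_dirKey_eq (enterCorner_ne_zero h1) (enterCorner_ne_zero h1')
      (h4.trans h4'.symm)
    dsimp only at hpq
    refine Prod.ext hpq ?_
    simp only [cross] at hc
    rw [← hpq, mul_comm, ← sub_mul, mul_eq_zero] at hc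
    rcases hc with hc | hc
    · omega
    · exfalso
      rcases corner_cases h1 with g | g | g | g | g | g | g | g <;> rw [g.2.2.1] at hc <;>
        dsimp only at hc <;> omega

/-! ### The cells of a layer -/

theorem nextCell_cases (p : ℤ × ℤ) (hp : p ≠ 0) :
    (nextCell p = (p.1 - 1, p.2) ∧ -p.2 < p.1 ∧ p.1 ≤ p.2) ∨
    (nextCell p = (p.1, p.2 - 1) ∧ p.1 < p.2 ∧ p.2 ≤ -p.1) ∨
    (nextCell p = (p.1 + 1, p.2) ∧ p.2 ≤ p.1 ∧ p.1 < -p.2) ∨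
    (nextCell p = (p.1, p.2 + 1) ∧ -p.1 ≤ p.2 ∧ p.2 < p.1) := by
  obtain ⟨i, j⟩ := p
  have h0 : i ≠ 0 ∨ j ≠ 0 := by
    by_contra hc
    push Not at hc
    exact hp (Prod.ext hc.1 hc.2)
  simp only [nextCell, abs_lt]
  split_ifs <;> simp only [Prod.mk.injEq, true_and, and_true] <;> omega

/-- The cell that comes before, in counterclockwise order, in the same layer of the grid. -/
def prevCell (p : ℤ × ℤ) : ℤ × ℤ :=
  let q := nextCell (-p.1, p.2)
  (-q.1, q.2)

theorem prevCell_cases (p : ℤ × ℤ) (hp : p ≠ 0) :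
    (prevCell p = (p.1 + 1, p.2) ∧ p.1 < p.2 ∧ -p.1 ≤ p.2) ∨
    (prevCell p = (p.1, p.2 - 1) ∧ -p.1 < p.2 ∧ p.2 ≤ p.1) ∨
    (prevCell p = (p.1 - 1, p.2) ∧ p.2 ≤ -p.1 ∧ p.2 < p.1) ∨
    (prevCell p = (p.1, p.2 + 1) ∧ p.1 ≤ p.2 ∧ p.2 < -p.1) := by
  have h0 : ((-p.1, p.2) : ℤ × ℤ) ≠ 0 := by
    intro hc
    have h1 := congrArg Prod.fst hc
    have h2 := congrArg Prod.snd hc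
    simp only [Prod.fst_zero, Prod.snd_zero] at h1 h2
    exact hp (Prod.ext (by simpa using h1) h2)
  have e : prevCell p = (-(nextCell (-p.1, p.2)).1, (nextCell (-p.1, p.2)).2) := rfl
  rcases nextCell_cases _ h0 with h | h | h | h <;> rw [e, h.1] <;> have h2 := h.2 <;>
    simp only [Prod.mk.injEq, and_true] at h2 ⊢ <;> omega

/-- Reflection in the horizontal axis reverses the orientation of a layer, hence the definition of
`prevCell`. Invertibility of the step along a layer is what gives each enter event a unique
predecessor. -/
theorem prevCell_nextCell (p : ℤ × ℤ) (hp : p ≠ 0) : nextCell p ≠ 0 ∧ prevCell (nextCell p) = p := by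
  have h0 : nextCell p ≠ 0 := by
    intro hc
    have h1 := congrArg Prod.fst hc
    have h2 := congrArg Prod.snd hc
    rcases nextCell_cases p hp with h | h | h | h <;> rw [h.1] at h1 h2 <;>
      simp only [Prod.fst_zero, Prod.snd_zero] at h1 h2 <;> omega
  refine ⟨h0, Prod.ext ?_ ?_⟩ <;>
  rcases prevCell_cases _ h0 with g | g | g | g <;> rw [g.1] <;> have g2 := g.2 <;> clear g <;>
  rcases nextCell_cases p hp with h | h | h | h <;> rw [h.1] at g2 ⊢ <;> dsimp only at g2 ⊢ <;> omega

theorem nextCell_prevCell (p : ℤ × ℤ) (hp : p ≠ 0) : prevCell p ≠ 0 ∧ nextCell (prevCell p) = p := by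
  have h0 : prevCell p ≠ 0 := by
    intro hc
    have h1 := congrArg Prod.fst hc
    have h2 := congrArg Prod.snd hc
    rcases prevCell_cases p hp with h | h | h | h <;> rw [h.1] at h1 h2 <;>
      simp only [Prod.fst_zero, Prod.snd_zero] at h1 h2 <;> omega
  refine ⟨h0, Prod.ext ?_ ?_⟩ <;>
  rcases nextCell_cases _ h0 with g | g | g | g <;> rw [g.1] <;> have g2 := g.2 <;> clear g <;>
  rcases prevCell_cases p hp with h | h | h | h <;> rw [h.1] at g2 ⊢ <;> dsimp only at g2 ⊢ <;> omega

theorem nextCell_mem {m : ℕ} {p : ℤ × ℤ} (hp : p ≠ 0) (h : |p.1| ≤ m ∧ |p.2| ≤ m) :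
    |(nextCell p).1| ≤ m ∧ |(nextCell p).2| ≤ m := by
  simp only [abs_le] at *
  rcases nextCell_cases p hp with g | g | g | g <;> rw [g.1] <;> dsimp only <;> omega

theorem prevCell_mem {m : ℕ} {p : ℤ × ℤ} (hp : p ≠ 0) (h : |p.1| ≤ m ∧ |p.2| ≤ m) :
    |(prevCell p).1| ≤ m ∧ |(prevCell p).2| ≤ m := by
  simp only [abs_le] at *
  rcases prevCell_cases p hp with g | g | g | g <;> rw [g.1] <;> dsimp only <;> omega

/-- Within a layer, only the step that starts straight to the right crosses azimuth `0`; this is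
exactly where `turnAfter` counts up. The proof checks the positions of the two cells case by case.
-/
theorem dirKey_enter_nextCell {p : ℤ × ℤ} (hp : p ≠ 0) (hr : ¬Right p) :
    dirKey (enterCorner p) < dirKey (enterCorner (nextCell p)) := by
  have hn := (prevCell_nextCell p hp).1
  refine dirKey_lt_of_cross_pos (enterCorner_ne_zero hp) (enterCorner_ne_zero hn) ?_ ?_
  · simp only [cross, Right] at *
    rcases corner_cases hp with h | h | h | h | h | h | h | h <;> rw [h.2.2.1] <;>
    rcases corner_cases hn with g | g | g | g | g | g | g | g <;> rw [g.2.2.1] <;>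
    have g1 := g.1 <;> have g2 := g.2.1 <;> have h1 := h.1 <;> have h2 := h.2.1 <;> clear g h <;>
    rcases nextCell_cases p hp with k | k | k | k <;> rw [k.1] at g1 g2 ⊢ <;>
    dsimp only at g1 g2 ⊢ <;> first | omega | nlinarith
  · simp only [Upper, Right] at *
    rcases corner_cases hp with h | h | h | h | h | h | h | h <;> rw [h.2.2.1] <;>
    rcases corner_cases hn with g | g | g | g | g | g | g | g <;> rw [g.2.2.1] <;>
    have g1 := g.1 <;> have g2 := g.2.1 <;> have h1 := h.1 <;> have h2 := h.2.1 <;> clear g h <;>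
    rcases nextCell_cases p hp with k | k | k | k <;> rw [k.1] at g1 g2 ⊢ <;>
    dsimp only at g1 g2 ⊢ <;> omega

/-! ## The grid -/

/-- A point of the grid other than the viewpoint. -/
def InGrid (m : ℕ) (p : ℤ × ℤ) : Prop := p ≠ 0 ∧ |p.1| ≤ m ∧ |p.2| ≤ m

theorem pointAt_pos (m idx : ℕ) (h : idx < gridSize m) :
    |(pointAt m idx).1| ≤ m ∧ |(pointAt m idx).2| ≤ m := by
  have h1 : idx / (2 * m + 1) < 2 * m + 1 := by
    rw [Nat.div_lt_iff_lt_mul (by omega)]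
    rwa [gridSize, sq] at h
  have h2 := Nat.mod_lt idx (y := 2 * m + 1) (by omega)
  simp only [pointAt, abs_le]
  generalize idx / (2 * m + 1) = a at h1 ⊢
  generalize idx % (2 * m + 1) = b at h2 ⊢
  omega

theorem mem_gridPoints {m : ℕ} {p : ℤ × ℤ} :
    p ∈ gridPoints m ↔ |p.1| ≤ m ∧ |p.2| ≤ m := by
  simp only [gridPoints, List.mem_map, List.mem_range]
  constructor
  · rintro ⟨idx, h, rfl⟩
    exact pointAt_pos m idx h
  · rintro ⟨h1, h2⟩
    rw [abs_le] at h1 h2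
    refine ⟨(p.1 + m).toNat * (2 * m + 1) + (p.2 + m).toNat, ?_, ?_⟩
    · rw [gridSize, sq]
      have : (p.1 + m).toNat + 1 ≤ 2 * m + 1 := by omega
      have := Nat.mul_le_mul_right (2 * m + 1) this
      rw [add_mul] at this
      omega
    · have h3 : (p.2 + m).toNat < 2 * m + 1 := by omega
      simp only [pointAt]
      rw [mul_comm, Nat.mul_add_div (by omega), Nat.div_eq_of_lt h3, Nat.mul_add_mod,
        Nat.mod_eq_of_lt h3]
      refine Prod.ext ?_ ?_ <;> dsimp only <;> omega

/-- Row-by-row order. -/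
def rowLt (p q : ℤ × ℤ) : Prop := p.1 < q.1 ∨ p.1 = q.1 ∧ p.2 < q.2

theorem gridPoints_sorted (m : ℕ) : (gridPoints m).Pairwise rowLt := by
  unfold gridPoints
  rw [List.pairwise_map]
  refine List.pairwise_lt_range.imp ?_
  intro a b hab
  have h1 : a / (2 * m + 1) ≤ b / (2 * m + 1) := Nat.div_le_div_right hab.le
  have h2 := Nat.div_add_mod a (2 * m + 1)
  have h3 := Nat.div_add_mod b (2 * m + 1)
  simp only [rowLt, pointAt]
  rcases h1.lt_or_eq with h | h
  · left; omega
  · right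
    rw [h] at h2 ⊢
    omega

theorem rowLt_irrefl (p : ℤ × ℤ) : ¬rowLt p p := by
  simp [rowLt]

theorem gridPoints_nodup (m : ℕ) : (gridPoints m).Nodup := by
  refine List.Pairwise.imp ?_ (gridPoints_sorted m)
  rintro a _ h rfl
  exact rowLt_irrefl _ h

theorem gridPoints_length (m : ℕ) : (gridPoints m).length = gridSize m := by
  simp [gridPoints]

/-- The grid points other than the viewpoint. -/
def cells (m : ℕ) : List (ℤ × ℤ) := (gridPoints m).filter (· ≠ 0)

theorem mem_cells {m : ℕ} {p : ℤ × ℤ} : p ∈ cells m ↔ InGrid m p := by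
  simp [cells, mem_gridPoints, InGrid, and_comm]

theorem cells_nodup (m : ℕ) : (cells m).Nodup := (gridPoints_nodup m).filter _

theorem cells_length (m : ℕ) : (cells m).length + 1 = gridSize m := by
  rw [← gridPoints_length, cells]
  have h0 : (0 : ℤ × ℤ) ∈ gridPoints m := by simp [mem_gridPoints]
  have h1 : cells m = (gridPoints m).erase 0 := by
    rw [(gridPoints_nodup m).erase_eq_filter]
    unfold cells
    congr 1
    ext p
    by_cases hp : p = 0 <;> simp [hp]
  rw [← cells, h1, List.length_erase_of_mem h0]
  have := List.length_pos_of_mem h0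
  omega

/-! ## Sorted lists of events -/

/-- Increasing order of events. -/
def EventSorted (l : List Event) : Prop := l.Pairwise fun e f => e.key < f.key

theorem EventSorted.nodup {l : List Event} (h : EventSorted l) : l.Nodup := by
  refine List.Pairwise.imp ?_ h
  rintro a _ h rfl
  exact lt_irrefl _ h

theorem EventSorted.eq_of_perm {l l' : List Event} (h : EventSorted l) (h' : EventSorted l')
    (hp : l.Perm l') : l = l' :=
  hp.eq_of_pairwise (fun _ _ _ _ h1 h2 => absurd h2 h1.not_gt) h h'

/-- The sorted list of a list of events. -/
def sortEvents (l : List Event) : List Event := (sortList Event.le l).val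

theorem sortEvents_spec {l : List Event} (h : ∀ e ∈ l, e.pos ≠ 0) (hn : l.Nodup) :
    (sortEvents l).Perm l ∧ EventSorted (sortEvents l) := by
  obtain ⟨h1, h2, -⟩ := sortList_spec Event.totalOn_le l h
  refine ⟨h1, ?_⟩
  have h3 : (sortEvents l).Nodup := h1.nodup_iff.2 hn
  have h4 := List.Pairwise.and h2 h3
  refine List.Pairwise.imp_of_mem ?_ h4
  rintro e f he hf ⟨h5, h6⟩
  rw [Event.le_iff (h e (h1.mem_iff.1 he)) (h f (h1.mem_iff.1 hf))] at h5
  exact lt_of_le_of_ne h5 fun hc => h6 (Event.key_injective hc)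

/-- A discrete event system: the events in order, the initial queue, and the events that each event
puts in the queue. -/
structure EventSystem (U roots : List Event) (children : Event → List Event) : Prop where
  sorted : EventSorted U
  roots_subset : ∀ r ∈ roots, r ∈ U
  roots_nodup : roots.Nodup
  children_nodup : ∀ x ∈ U, (children x).Nodup
  not_root : ∀ x ∈ U, ∀ e ∈ children x, e ∉ roots
  unique : ∀ x ∈ U, ∀ y ∈ U, ∀ e ∈ children x, e ∈ children y → x = y
  parent : ∀ e ∈ U, e ∈ roots ∨ ∃ x ∈ U, x.key < e.key ∧ e ∈ children x
  late : ∀ x ∈ U, ∀ e ∈ children x, e ∉ U → ∀ y ∈ U, y.key < e.key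

/-- The queue of an event system after `N` events. -/
def Pending (U roots : List Event) (children : Event → List Event) (N : ℕ)
    (Q : Multiset Event) : Prop :=
  Q.Nodup ∧ ∀ e, e ∈ Q ↔ e ∉ U.take N ∧ (e ∈ roots ∨ ∃ x ∈ U.take N, e ∈ children x)

theorem EventSorted.key_lt {U : List Event} (h : EventSorted U) {N : ℕ} (hN : N < U.length)
    {e : Event} (he : e ∈ U.take N) : e.key < U[N].key := by
  obtain ⟨a, ha, rfl⟩ := List.mem_take_iff_getElem.1 he
  exact List.pairwise_iff_getElem.1 h _ _ _ _ (by omega)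

theorem EventSorted.mem_take_iff {U : List Event} (h : EventSorted U) {N : ℕ} (hN : N < U.length)
    {e : Event} : e ∈ U.take N ↔ e ∈ U ∧ e.key < U[N].key := by
  constructor
  · exact fun he => ⟨List.mem_of_mem_take he, h.key_lt hN he⟩
  · rintro ⟨he, hk⟩
    obtain ⟨a, ha, rfl⟩ := List.getElem_of_mem he
    rw [List.mem_take_iff_getElem]
    refine ⟨a, ?_, rfl⟩
    by_contra hc
    rcases (by omega : N = a ∨ N < a) with rfl | h1
    · exact lt_irrefl _ hk
    · exact absurd hk (List.pairwise_iff_getElem.1 h _ _ hN ha h1).not_gt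

theorem mem_take_succ {α : Type} {l : List α} {N : ℕ} (hN : N < l.length) {x : α} :
    x ∈ l.take (N + 1) ↔ x ∈ l.take N ∨ x = l[N] := by
  rw [List.take_add_one, List.getElem?_eq_getElem hN, List.mem_append]
  simp

theorem EventSystem.pending_zero {U roots : List Event} {children : Event → List Event}
    (h : EventSystem U roots children) : Pending U roots children 0 roots := by
  refine ⟨by simpa using h.roots_nodup, fun e => ?_⟩
  simp

/-- The parent of the next event has a smaller key, so it has been processed and the event is in the
queue. Nothing in the queue is smaller: queued events of the list are unprocessed, and queued events
outside the list are later than the whole list. -/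
theorem EventSystem.next {U roots : List Event} {children : Event → List Event}
    (h : EventSystem U roots children) {N : ℕ} {Q : Multiset Event}
    (hQ : Pending U roots children N Q) (hN : N < U.length) :
    U[N] ∈ Q ∧ ∀ e ∈ Q, U[N].key ≤ e.key := by
  have h0 : U[N] ∈ U := List.getElem_mem hN
  constructor
  · rw [hQ.2]
    refine ⟨fun hc => lt_irrefl _ (h.sorted.key_lt hN hc), ?_⟩
    rcases h.parent _ h0 with h1 | ⟨x, hx, hxk, hc⟩
    · exact Or.inl h1
    · exact Or.inr ⟨x, (h.sorted.mem_take_iff hN).2 ⟨hx, hxk⟩, hc⟩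
  · intro e he
    obtain ⟨h1, h2⟩ := (hQ.2 e).1 he
    by_cases heU : e ∈ U
    · rw [h.sorted.mem_take_iff hN] at h1
      exact not_lt.1 fun hc => h1 ⟨heU, hc⟩
    · rcases h2 with h2 | ⟨x, hx, hxe⟩
      · exact absurd (h.roots_subset e h2) heU
      · exact (h.late x (List.mem_of_mem_take hx) e hxe heU _ h0).le

/-- The queue is a multiset, so it matters that no event is inserted twice. This follows because a
child is never initial and has only one parent. -/
theorem EventSystem.step {U roots : List Event} {children : Event → List Event}
    (h : EventSystem U roots children) {N : ℕ} {Q : Multiset Event} (hN : N < U.length)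
    (hQ : Pending U roots children N (U[N] ::ₘ Q)) :
    Pending U roots children (N + 1) (Q + children U[N]) := by
  have h0 : U[N] ∈ U := List.getElem_mem hN
  have h00 : U[N] ∉ U.take N := fun hc => lt_irrefl _ (h.sorted.key_lt hN hc)
  obtain ⟨hnd, hmem⟩ := hQ
  rw [Multiset.nodup_cons] at hnd
  constructor
  · rw [Multiset.nodup_add]
    refine ⟨hnd.2, by simpa using h.children_nodup _ h0, ?_⟩
    rw [Multiset.disjoint_left]
    intro e he hc
    rw [Multiset.mem_coe] at hc
    rcases ((hmem e).1 (Multiset.mem_cons_of_mem he)).2 with h1 | ⟨x, hx, hxe⟩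
    · exact h.not_root _ h0 e hc h1
    · rw [h.unique x (List.mem_of_mem_take hx) _ h0 e hxe hc] at hx
      exact h00 hx
  · intro e
    rw [Multiset.mem_add, Multiset.mem_coe, mem_take_succ hN]
    constructor
    · rintro (he | he)
      · obtain ⟨h1, h2⟩ := (hmem e).1 (Multiset.mem_cons_of_mem he)
        refine ⟨?_, ?_⟩
        · rintro (hc | rfl)
          · exact h1 hc
          · exact hnd.1 he
        · rcases h2 with h2 | ⟨x, hx, hxe⟩
          · exact Or.inl h2
          · exact Or.inr ⟨x, (mem_take_succ hN).2 (Or.inl hx), hxe⟩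
      -- A child of the current event cannot have been processed already, as its only parent would
      -- then have to precede it.
      · refine ⟨fun hc => ?_, Or.inr ⟨U[N], (mem_take_succ hN).2 (Or.inr rfl), he⟩⟩
        have heU : e ∈ U := by
          rcases hc with hc | rfl
          · exact List.mem_of_mem_take hc
          · exact h0
        have hle : e.key ≤ U[N].key := by
          rcases hc with hc | hc
          · exact (h.sorted.key_lt hN hc).le
          · rw [hc]
        rcases h.parent e heU with h1 | ⟨x, hx, hxk, hxe⟩
        · exact h.not_root _ h0 e he h1
        · rw [h.unique x hx _ h0 e hxe he] at hxk
          exact absurd hle hxk.not_ge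
    · rintro ⟨h1, h2⟩
      push Not at h1
      have aux : (e ∈ roots ∨ ∃ x ∈ U.take N, e ∈ children x) → e ∈ Q := by
        intro h3
        rcases Multiset.mem_cons.1 ((hmem e).2 ⟨h1.1, h3⟩) with h4 | h4
        · exact absurd h4 h1.2
        · exact h4
      rcases h2 with h2 | ⟨x, hx, hxe⟩
      · exact Or.inl (aux (Or.inl h2))
      · rcases (mem_take_succ hN).1 hx with hx | rfl
        · exact Or.inl (aux (Or.inr ⟨x, hx, hxe⟩))
        · exact Or.inr hxe

/-! ## The events of the sweep -/

theorem turnAfter_eq (e : Event) : turnAfter e = if Right e.pos then e.turn + 1 else e.turn := rfl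

/-- The enter events at the start of the sweep. -/
def rootEvents (m : ℕ) : List Event :=
  (List.range m).map fun k : ℕ => ⟨.enter, (0, (k : ℤ) + 1), -1⟩

/-- The next enter event in the same layer. -/
def nextEnter (e : Event) : Event := ⟨.enter, nextCell e.pos, turnAfter e⟩

/-- The center event that belongs to an enter event. -/
def centerOf (e : Event) : Event := ⟨.center, e.pos, turnAfter e⟩

/-- The exit event that belongs to an enter event. -/
def exitOf (e : Event) : Event := ⟨.exit, e.pos, turnAfter e⟩

/-- The events that an event puts in the queue of the sweep. -/
def sweepChildren (e : Event) : List Event :=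
  if e.kind = .enter then [centerOf e, exitOf e, nextEnter e] else []

/-- The grid points in the order of their enter events. -/
def enterOrder (m : ℕ) : List (ℤ × ℤ) := (sortEvents ((cells m).map enterEvent)).map Event.pos

/-- The enter events up to one full turn, in order. -/
def enterEvents (m : ℕ) : List Event := sortEvents (rootEvents m) ++ (enterOrder m).map enterEvent

/-- The events up to one full turn, in order. -/
def sweepEvents (m : ℕ) : List Event :=
  sortEvents (rootEvents m ++ ((cells m).map enterEvent ++
    ((cells m).map (fun p => ⟨.center, p, 0⟩) ++ (cells m).map (fun p => ⟨.exit, p, 0⟩))))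

theorem mem_rootEvents {m : ℕ} {e : Event} :
    e ∈ rootEvents m ↔ e.kind = .enter ∧ InGrid m e.pos ∧ Right e.pos ∧ e.turn = -1 := by
  obtain ⟨k, p, t⟩ := e
  simp only [rootEvents, List.mem_map, List.mem_range, Event.mk.injEq]
  constructor
  · rintro ⟨a, ha, rfl, rfl, rfl⟩
    refine ⟨rfl, ⟨?_, ?_⟩, ⟨rfl, by dsimp only; omega⟩, rfl⟩
    · intro hc
      have := congrArg Prod.snd hc
      simp only [Prod.snd_zero] at this
      omega
    · simp only [abs_le]; omega
  · rintro ⟨rfl, ⟨h1, h2, h3⟩, h4, rfl⟩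
    rw [abs_le] at h2 h3
    obtain ⟨h4, h5⟩ := h4
    refine ⟨(p.2 - 1).toNat, by omega, rfl, Prod.ext h4.symm ?_, rfl⟩
    dsimp only
    omega

theorem rootEvents_nodup (m : ℕ) : (rootEvents m).Nodup := by
  refine List.Nodup.map ?_ List.nodup_range
  intro a b h
  simp only [Event.mk.injEq, Prod.mk.injEq] at h
  omega

theorem enterEvent_injective : Function.Injective enterEvent := by
  intro p q h
  simpa [enterEvent] using h

theorem sortEvents_roots (m : ℕ) :
    (sortEvents (rootEvents m)).Perm (rootEvents m) ∧ EventSorted (sortEvents (rootEvents m)) :=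
  sortEvents_spec (fun _ he => (mem_rootEvents.1 he).2.1.1) (rootEvents_nodup m)

theorem sortEvents_cells (m : ℕ) :
    (sortEvents ((cells m).map enterEvent)).Perm ((cells m).map enterEvent) ∧
      EventSorted (sortEvents ((cells m).map enterEvent)) := by
  refine sortEvents_spec ?_ ((cells_nodup m).map enterEvent_injective)
  intro e he
  obtain ⟨p, hp, rfl⟩ := List.mem_map.1 he
  exact (mem_cells.1 hp).1

theorem enterOrder_map (m : ℕ) :
    (enterOrder m).map enterEvent = sortEvents ((cells m).map enterEvent) := by
  rw [enterOrder, List.map_map]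
  conv_rhs => rw [← List.map_id (sortEvents _)]
  refine List.map_congr_left fun e he => ?_
  obtain ⟨p, hp, rfl⟩ := List.mem_map.1 ((sortEvents_cells m).1.mem_iff.1 he)
  rfl

theorem enterOrder_perm (m : ℕ) : (enterOrder m).Perm (cells m) := by
  have := (sortEvents_cells m).1.map Event.pos
  rw [List.map_map] at this
  have h2 : (Event.pos ∘ enterEvent) = id := rfl
  rwa [h2, List.map_id] at this

theorem mem_enterOrder {m : ℕ} {p : ℤ × ℤ} : p ∈ enterOrder m ↔ InGrid m p := by
  rw [(enterOrder_perm m).mem_iff, mem_cells]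

theorem enterOrder_sorted (m : ℕ) :
    (enterOrder m).Pairwise fun p q => (enterEvent p).key < (enterEvent q).key := by
  have := (sortEvents_cells m).2
  rw [← enterOrder_map, EventSorted, List.pairwise_map] at this
  exact this

theorem enterOrder_length (m : ℕ) : (enterOrder m).length + 1 = gridSize m := by
  rw [(enterOrder_perm m).length_eq, cells_length]

theorem mem_enterEvents {m : ℕ} {e : Event} :
    e ∈ enterEvents m ↔
      e.kind = .enter ∧ InGrid m e.pos ∧ (e.turn = 0 ∨ e.turn = -1 ∧ Right e.pos) := by
  rw [enterEvents, List.mem_append, (sortEvents_roots m).1.mem_iff, mem_rootEvents, List.mem_map]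
  constructor
  · rintro (⟨h1, h2, h3, h4⟩ | ⟨p, hp, rfl⟩)
    · exact ⟨h1, h2, Or.inr ⟨h4, h3⟩⟩
    · exact ⟨rfl, mem_enterOrder.1 hp, Or.inl rfl⟩
  · rintro ⟨h1, h2, h3 | ⟨h3, h4⟩⟩
    · right
      refine ⟨e.pos, mem_enterOrder.2 h2, ?_⟩
      obtain ⟨k, p, t⟩ := e
      simp only at h1 h3
      rw [h1, h3]
      rfl
    · exact Or.inl ⟨h1, h2, h4, h3⟩

theorem Event.angle_neg_of_root {m : ℕ} {e : Event} (he : e ∈ rootEvents m) : e.angle < 0 := by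
  obtain ⟨h1, h2, h3, h4⟩ := mem_rootEvents.1 he
  have := dirKey_bounds (Event.vec_ne_zero (e := e) h2.1)
  rw [Event.angle, h4]
  push_cast
  linarith [this.2]

/-- The initial events have negative angles and the enter events of the main round positive ones. -/
theorem enterEvents_sorted (m : ℕ) : EventSorted (enterEvents m) := by
  unfold EventSorted enterEvents
  rw [List.pairwise_append]
  refine ⟨(sortEvents_roots m).2, ?_, ?_⟩
  · rw [enterOrder_map]
    exact (sortEvents_cells m).2
  · intro e he f hf
    rw [List.mem_map] at hf
    obtain ⟨p, hp, rfl⟩ := hf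
    apply Event.key_lt_of_angle_lt
    have h1 := Event.angle_neg_of_root ((sortEvents_roots m).1.mem_iff.1 he)
    have h2 := dirKey_enter_pos (mem_enterOrder.1 hp).1
    simp only [Event.angle, Event.vec, enterEvent] at h1 ⊢
    push_cast
    linarith

theorem sweepEvents_spec (m : ℕ) : EventSorted (sweepEvents m) ∧ ∀ e : Event, e ∈ sweepEvents m ↔
    InGrid m e.pos ∧ (e.turn = 0 ∨ e.kind = .enter ∧ e.turn = -1 ∧ Right e.pos) := by
  have hmem : ∀ e : Event, e ∈ (rootEvents m ++ ((cells m).map enterEvent ++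
    ((cells m).map (fun p => ⟨.center, p, 0⟩) ++ (cells m).map (fun p => ⟨.exit, p, 0⟩)))) ↔
    InGrid m e.pos ∧ (e.turn = 0 ∨ e.kind = .enter ∧ e.turn = -1 ∧ Right e.pos) := by
    intro e
    simp only [List.mem_append, mem_rootEvents, List.mem_map, mem_cells]
    obtain ⟨k, p, t⟩ := e
    simp only [enterEvent, Event.mk.injEq]
    constructor
    · rintro (⟨h1, h2, h3, h4⟩ | ⟨q, h1, h2, h3, h4⟩ | ⟨q, h1, h2, h3, h4⟩ | ⟨q, h1, h2, h3, h4⟩)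
      · exact ⟨h2, Or.inr ⟨h1, h4, h3⟩⟩
      all_goals subst h3; exact ⟨h1, Or.inl h4.symm⟩
    · rintro ⟨h1, rfl | ⟨h2, h3, h4⟩⟩
      · cases k
        · exact Or.inr (Or.inl ⟨p, h1, rfl, rfl, rfl⟩)
        · exact Or.inr (Or.inr (Or.inl ⟨p, h1, rfl, rfl, rfl⟩))
        · exact Or.inr (Or.inr (Or.inr ⟨p, h1, rfl, rfl, rfl⟩))
      · exact Or.inl ⟨h2, h1, h4, h3⟩
  have hspec := sortEvents_spec (l := rootEvents m ++ ((cells m).map enterEvent ++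
    ((cells m).map (fun p => ⟨.center, p, 0⟩) ++ (cells m).map (fun p => ⟨.exit, p, 0⟩))))
    (fun e he => ((hmem e).1 he).1.1) ?_
  · refine ⟨hspec.2, fun e => ?_⟩
    rw [← hmem]
    exact hspec.1.mem_iff
  · have hinj : ∀ k : Kind, Function.Injective (fun p : ℤ × ℤ => (⟨k, p, 0⟩ : Event)) := by
      intro k p q h
      simpa using h
    refine (rootEvents_nodup m).append (((cells_nodup m).map enterEvent_injective).append
      (((cells_nodup m).map (hinj _)).append ((cells_nodup m).map (hinj _)) ?_) ?_) ?_
    · rw [List.disjoint_left]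
      intro e he hf
      obtain ⟨p, -, rfl⟩ := List.mem_map.1 he
      obtain ⟨q, -, hq⟩ := List.mem_map.1 hf
      simp at hq
    · rw [List.disjoint_left]
      intro e he hf
      obtain ⟨p, -, rfl⟩ := List.mem_map.1 he
      rcases List.mem_append.1 hf with hf | hf <;> obtain ⟨q, -, hq⟩ := List.mem_map.1 hf <;>
        simp [enterEvent] at hq
    · rw [List.disjoint_left]
      intro e he
      have := (mem_rootEvents.1 he).2.2.2
      obtain ⟨k, p, t⟩ := e
      simp only at this
      simp [enterEvent, this]

theorem mem_sweepEvents {m : ℕ} {e : Event} : e ∈ sweepEvents m ↔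
    InGrid m e.pos ∧ (e.turn = 0 ∨ e.kind = .enter ∧ e.turn = -1 ∧ Right e.pos) :=
  (sweepEvents_spec m).2 e

theorem sweepEvents_sorted (m : ℕ) : EventSorted (sweepEvents m) := (sweepEvents_spec m).1

theorem sweepEvents_length (m : ℕ) : (sweepEvents m).length + 3 = m + 3 * gridSize m := by
  have h := (sortList_spec Event.totalOn_le (rootEvents m ++
    ((cells m).map enterEvent ++ ((cells m).map (fun p => (⟨.center, p, 0⟩ : Event)) ++
      (cells m).map (fun p => (⟨.exit, p, 0⟩ : Event))))) ?_).1
  · change (sweepEvents m).Perm _ at h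
    rw [h.length_eq]
    simp only [List.length_append, List.length_map, rootEvents, List.length_range]
    have := cells_length m
    omega
  · intro e he
    simp only [List.mem_append, mem_rootEvents, List.mem_map, mem_cells] at he
    rcases he with h | ⟨p, h, rfl⟩ | ⟨p, h, rfl⟩ | ⟨p, h, rfl⟩
    exacts [h.2.1.1, h.1, h.1, h.1]

/-- The first phase runs a queue of enter events only. It meets them in the same order as the sweep,
so the lists cut out in the first phase are consumed in order in the second. -/
theorem enterEvents_eq_filter (m : ℕ) :
    enterEvents m = (sweepEvents m).filter (fun e => e.kind = .enter) := by
  refine (enterEvents_sorted m).eq_of_perm ((sweepEvents_sorted m).filter _) ?_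
  rw [List.perm_ext_iff_of_nodup (enterEvents_sorted m).nodup
    ((sweepEvents_sorted m).nodup.filter _)]
  intro e
  simp only [mem_enterEvents, List.mem_filter, mem_sweepEvents, decide_eq_true_eq]
  tauto

theorem InGrid.next {m : ℕ} {p : ℤ × ℤ} (h : InGrid m p) : InGrid m (nextCell p) :=
  ⟨(prevCell_nextCell p h.1).1, nextCell_mem h.1 h.2⟩

theorem InGrid.prev {m : ℕ} {p : ℤ × ℤ} (h : InGrid m p) : InGrid m (prevCell p) :=
  ⟨(nextCell_prevCell p h.1).1, prevCell_mem h.1 h.2⟩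

theorem nextEnter_injective {e f : Event} (he : e.pos ≠ 0) (hf : f.pos ≠ 0) (h1 : e.kind = f.kind)
    (h : nextEnter e = nextEnter f) : e = f := by
  simp only [nextEnter, Event.mk.injEq, true_and] at h
  have h2 : e.pos = f.pos := by
    rw [← (prevCell_nextCell _ he).2, h.1, (prevCell_nextCell _ hf).2]
  obtain ⟨k, p, t⟩ := e
  obtain ⟨k', p', t'⟩ := f
  simp only at h1 h2
  subst h1 h2
  have h3 := h.2
  simp only [turnAfter_eq] at h3
  split_ifs at h3 <;> simp_all

theorem turnAfter_injective {e f : Event} (h1 : e.kind = f.kind) (h2 : e.pos = f.pos)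
    (h3 : turnAfter e = turnAfter f) : e = f := by
  obtain ⟨k, p, t⟩ := e
  obtain ⟨k', p', t'⟩ := f
  simp only at h1 h2
  subst h1 h2
  simp only [turnAfter_eq] at h3
  split_ifs at h3 <;> simp_all

theorem exists_prev_enter {m : ℕ} {e : Event} (he : e.kind = .enter) (hg : InGrid m e.pos)
    (ht : e.turn = 0) : ∃ x : Event, x.kind = .enter ∧ InGrid m x.pos ∧
      (x.turn = 0 ∨ x.turn = -1 ∧ Right x.pos) ∧ x.key < e.key ∧ e = nextEnter x := by
  obtain ⟨k, q, t⟩ := e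
  simp only at he hg ht
  subst he ht
  have hq := nextCell_prevCell q hg.1
  by_cases hr : Right (prevCell q)
  · refine ⟨⟨.enter, prevCell q, -1⟩, rfl, hg.prev, Or.inr ⟨rfl, hr⟩, ?_, ?_⟩
    · apply Event.key_lt_of_angle_lt
      have h1 := dirKey_bounds (enterCorner_ne_zero hq.1)
      have h2 := dirKey_bounds (enterCorner_ne_zero hg.1)
      simp only [Event.angle, Event.vec]
      push_cast
      linarith [h1.2, h2.1]
    · simp [nextEnter, hq.2, turnAfter_eq, hr]
  · refine ⟨⟨.enter, prevCell q, 0⟩, rfl, hg.prev, Or.inl rfl, ?_, ?_⟩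
    · apply Event.key_lt_of_angle_lt
      have := dirKey_enter_nextCell hq.1 hr
      rw [hq.2] at this
      simp only [Event.angle, Event.vec]
      linarith
    · simp [nextEnter, hq.2, turnAfter_eq, hr]

/-- For a cell straight to the right, the centre and exit events of the main round stem from its
initial enter event, in round `-1`; its enter event in the main round belongs to the stay after the
full turn. -/
theorem exists_enter_of_turn_zero {m : ℕ} {p : ℤ × ℤ} (hg : InGrid m p) :
    ∃ x : Event, x.kind = .enter ∧ x.pos = p ∧
      (x.turn = 0 ∨ x.turn = -1 ∧ Right x.pos) ∧ x.key < (⟨.center, p, 0⟩ : Event).key ∧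
        x.key < (⟨.exit, p, 0⟩ : Event).key ∧ turnAfter x = 0 := by
  by_cases hr : Right p
  · refine ⟨⟨.enter, p, -1⟩, rfl, rfl, Or.inr ⟨rfl, hr⟩, ?_, ?_, by simp [turnAfter_eq, hr]⟩
    all_goals
      apply Event.key_lt_of_angle_lt
      have h1 := dirKey_bounds (enterCorner_ne_zero hg.1)
      have h2 := dirKey_right hr
      simp only [Event.angle, Event.vec]
      push_cast
      linarith [h1.2, h2.1, h2.2.1, h2.2.2.1]
  · refine ⟨⟨.enter, p, 0⟩, rfl, rfl, Or.inl rfl, ?_, ?_, by simp [turnAfter_eq, hr]⟩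
    all_goals
      apply Event.key_lt_of_angle_lt
      have h1 := dirKey_corners hg.1 hr
      simp only [Event.angle, Event.vec]
      linarith [h1.1, h1.2]

theorem turnAfter_cases {x : Event}
    (ht : x.turn = 0 ∨ x.turn = -1 ∧ Right x.pos) : turnAfter x = 0 ∨ turnAfter x = 1 := by
  rw [turnAfter_eq]
  rcases ht with ht | ⟨ht, hr⟩ <;> split_ifs <;> omega

/-- Angles up to the full turn are below `4`, those of round `1` are not. This supplies the
condition `late` for both event systems. -/
theorem key_lt_of_turn_one {m : ℕ} {e f : Event} (he : e ∈ sweepEvents m) (hf : f.pos ≠ 0)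
    (ht : f.turn = 1) : e.key < f.key := by
  apply Event.key_lt_of_angle_lt
  rw [mem_sweepEvents] at he
  have h1 := dirKey_bounds (Event.vec_ne_zero (e := e) he.1.1)
  have h2 := dirKey_bounds (Event.vec_ne_zero hf)
  simp only [Event.angle, ht]
  have h3 : (e.turn : ℚ) ≤ 0 := by
    have : e.turn ≤ 0 := by omega
    exact_mod_cast this
  push_cast
  linarith [h1.2, h2.1]

theorem enter_system (m : ℕ) :
    EventSystem (enterEvents m) (rootEvents m) (fun e => [nextEnter e]) where
  sorted := enterEvents_sorted m
  roots_subset r hr := by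
    obtain ⟨h1, h2, h3, h4⟩ := mem_rootEvents.1 hr
    exact mem_enterEvents.2 ⟨h1, h2, Or.inr ⟨h4, h3⟩⟩
  roots_nodup := rootEvents_nodup m
  children_nodup x _ := by simp
  not_root x hx e he hc := by
    rw [List.mem_singleton] at he
    subst he
    obtain ⟨h1, h2, h3⟩ := mem_enterEvents.1 hx
    have := turnAfter_cases h3
    have := (mem_rootEvents.1 hc).2.2.2
    simp only [nextEnter] at this
    omega
  unique x hx y hy e he hc := by
    rw [List.mem_singleton] at he hc
    have h1 := mem_enterEvents.1 hx
    have h2 := mem_enterEvents.1 hy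
    exact nextEnter_injective h1.2.1.1 h2.2.1.1 (h1.1.trans h2.1.symm) (he.symm.trans hc)
  parent e he := by
    obtain ⟨h1, h2, h3 | ⟨h3, h4⟩⟩ := mem_enterEvents.1 he
    · obtain ⟨x, g1, g2, g3, g4, g5⟩ := exists_prev_enter h1 h2 h3
      exact Or.inr ⟨x, mem_enterEvents.2 ⟨g1, g2, g3⟩, g4, by simp [← g5]⟩
    · exact Or.inl (mem_rootEvents.2 ⟨h1, h2, h4, h3⟩)
  late x hx e he hc y hy := by
    rw [List.mem_singleton] at he
    subst he
    obtain ⟨h1, h2, h3⟩ := mem_enterEvents.1 hx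
    rw [mem_enterEvents] at hc
    have hy' : y ∈ sweepEvents m := by
      rw [enterEvents_eq_filter] at hy
      exact List.mem_of_mem_filter hy
    refine key_lt_of_turn_one hy' h2.next.1 ?_
    rcases turnAfter_cases h3 with h4 | h4
    · exact absurd ⟨rfl, h2.next, Or.inl h4⟩ hc
    · exact h4

theorem mem_sweepChildren {x e : Event} : e ∈ sweepChildren x ↔
    x.kind = .enter ∧ (e = centerOf x ∨ e = exitOf x ∨ e = nextEnter x) := by
  unfold sweepChildren
  split_ifs with h <;> simp [h]

theorem sweep_system (m : ℕ) : EventSystem (sweepEvents m) (rootEvents m) sweepChildren where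
  sorted := sweepEvents_sorted m
  roots_subset r hr := by
    obtain ⟨h1, h2, h3, h4⟩ := mem_rootEvents.1 hr
    exact mem_sweepEvents.2 ⟨h2, Or.inr ⟨h1, h4, h3⟩⟩
  roots_nodup := rootEvents_nodup m
  children_nodup x _ := by
    unfold sweepChildren
    split_ifs <;> simp [centerOf, exitOf, nextEnter]
  not_root x hx e he hc := by
    obtain ⟨h1, h2⟩ := mem_sweepEvents.1 hx
    obtain ⟨hk, he⟩ := mem_sweepChildren.1 he
    have := turnAfter_cases (x := x) (by tauto)
    have := (mem_rootEvents.1 hc).2.2.2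
    rcases he with rfl | rfl | rfl <;> simp only [nextEnter, centerOf, exitOf] at this <;> omega
  unique x hx y hy e he hc := by
    have h1 := mem_sweepEvents.1 hx
    have h2 := mem_sweepEvents.1 hy
    obtain ⟨hk, he⟩ := mem_sweepChildren.1 he
    obtain ⟨hk', hc⟩ := mem_sweepChildren.1 hc
    rcases he with rfl | rfl | rfl <;> rcases hc with hc | hc | hc <;>
      first
        | exact nextEnter_injective h1.1.1 h2.1.1 (hk.trans hk'.symm) hc
        | (simp only [nextEnter, centerOf, exitOf, Event.mk.injEq, reduceCtorEq, false_and,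
            true_and] at hc
           try exact turnAfter_injective (hk.trans hk'.symm) hc.1 hc.2)
  parent e he := by
    obtain ⟨h2, h3⟩ := mem_sweepEvents.1 he
    by_cases hroot : e.kind = .enter ∧ e.turn = -1 ∧ Right e.pos
    · exact Or.inl (mem_rootEvents.2 ⟨hroot.1, h2, hroot.2.2, hroot.2.1⟩)
    · right
      have h0 : e.turn = 0 := by tauto
      by_cases hk : e.kind = .enter
      · obtain ⟨x, g1, g2, g3, g4, g5⟩ := exists_prev_enter hk h2 h0
        refine ⟨x, mem_sweepEvents.2 ⟨g2, by tauto⟩, g4, mem_sweepChildren.2 ⟨g1, by tauto⟩⟩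
      · obtain ⟨x, g1, g2, g3, g4, g5, g6⟩ := exists_enter_of_turn_zero h2
        refine ⟨x, mem_sweepEvents.2 ⟨g2 ▸ h2, by tauto⟩, ?_, mem_sweepChildren.2 ⟨g1, ?_⟩⟩
        · obtain ⟨k, p, t⟩ := e
          simp only at h0 hk
          subst h0
          cases k
          · exact absurd rfl hk
          · exact g4
          · exact g5
        · obtain ⟨k, p, t⟩ := e
          simp only at h0 hk g2
          subst h0
          cases k
          · exact absurd rfl hk
          · exact Or.inl (by simp [centerOf, g2, g6])
          · exact Or.inr (Or.inl (by simp [exitOf, g2, g6]))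
  late x hx e he hc y hy := by
    obtain ⟨h1, h2⟩ := mem_sweepEvents.1 hx
    obtain ⟨hk, he⟩ := mem_sweepChildren.1 he
    rw [mem_sweepEvents] at hc
    have h4 := turnAfter_cases (x := x) (by tauto)
    rcases he with rfl | rfl | rfl
    · refine key_lt_of_turn_one hy h1.1 ?_
      exact h4.resolve_left fun h4 => hc ⟨h1, Or.inl h4⟩
    · refine key_lt_of_turn_one hy h1.1 ?_
      exact h4.resolve_left fun h4 => hc ⟨h1, Or.inl h4⟩
    · refine key_lt_of_turn_one hy h1.next.1 ?_
      exact h4.resolve_left fun h4 => hc ⟨h1.next, Or.inl h4⟩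

/-! ### Active cells -/

/-- The cell of `p` has been entered but not left after `N` events. -/
def ActiveAt (m N : ℕ) (p : ℤ × ℤ) : Prop :=
  ∃ x ∈ (sweepEvents m).take N, x.kind = .enter ∧ x.pos = p ∧ exitOf x ∉ (sweepEvents m).take N

theorem not_activeAt_zero (m : ℕ) (p : ℤ × ℤ) : ¬ActiveAt m 0 p := by
  simp [ActiveAt]

theorem ActiveAt.inGrid {m N : ℕ} {p : ℤ × ℤ} (h : ActiveAt m N p) : InGrid m p := by
  obtain ⟨x, hx, -, rfl, -⟩ := h
  exact (mem_sweepEvents.1 (List.mem_of_mem_take hx)).1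

theorem angle_le_of_exit_not_mem {m N : ℕ} (hN : N < (sweepEvents m).length) {x : Event}
    (hx : x ∈ sweepEvents m) (he : exitOf x ∉ (sweepEvents m).take N) :
    (sweepEvents m)[N].key ≤ (exitOf x).key := by
  have h0 : (sweepEvents m)[N] ∈ sweepEvents m := List.getElem_mem hN
  have h1 := mem_sweepEvents.1 hx
  rcases turnAfter_cases (x := x) (by tauto) with h | h
  · rw [(sweepEvents_sorted m).mem_take_iff hN] at he
    push Not at he
    exact he (mem_sweepEvents.2 ⟨h1.1, Or.inl h⟩)
  · exact (key_lt_of_turn_one (f := exitOf x) h0 h1.1.1 h).le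

/-- The azimuth of the current event lies between the enter and exit azimuths of the stay. This
holds at events of every type, and through `card_inCone_le` it bounds the size of the tree. -/
theorem ActiveAt.inCone {m N : ℕ} (hN : N < (sweepEvents m).length) {p : ℤ × ℤ}
    (h : ActiveAt m N p) : InCone p (sweepEvents m)[N].vec := by
  obtain ⟨x, hx, hk, rfl, he⟩ := h
  have hxm := List.mem_of_mem_take hx
  have h0 : (sweepEvents m)[N] ∈ sweepEvents m := List.getElem_mem hN
  have h1 := Event.angle_le_of_key_le ((sweepEvents_sorted m).key_lt hN hx).le
  have h2 := Event.angle_le_of_key_le (angle_le_of_exit_not_mem hN hxm he)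
  obtain ⟨g, gt⟩ := mem_sweepEvents.1 hxm
  obtain ⟨g', gt'⟩ := mem_sweepEvents.1 h0
  set e := (sweepEvents m)[N]
  have hv := Event.vec_ne_zero g'.1
  have b1 := dirKey_bounds hv
  have b2 := dirKey_bounds (enterCorner_ne_zero g.1)
  have hxv : x.vec = enterCorner x.pos := by simp [Event.vec, hk]
  have hev : (exitOf x).vec = exitCorner x.pos := rfl
  have het : (exitOf x).turn = turnAfter x := rfl
  simp only [Event.angle, hxv, hev, het] at h1 h2
  have ht' : e.turn = 0 ∨ e.turn = -1 := by tauto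
  by_cases hr : Right x.pos
  · rw [inCone_iff_of_right hv hr]
    simp only [turnAfter_eq, hr, if_true] at h2
    rcases gt with gt | ⟨-, gt, -⟩ <;> rcases ht' with ht' | ht' <;> rw [gt] at h1 h2 <;>
      rw [ht'] at h1 h2 <;> push_cast at h1 h2
    · left; linarith
    · left; linarith
    · right; linarith
    · left; linarith
  · rw [inCone_iff g.1 hv hr]
    have gt : x.turn = 0 := by tauto
    simp only [turnAfter_eq, hr, if_false] at h2
    rcases ht' with ht' | ht' <;> rw [gt] at h1 h2 <;> rw [ht'] at h1 h2 <;> push_cast at h1 h2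
    · constructor <;> linarith
    · linarith [b1.2, b2.1]

/-- At a center event in the main round, the active cells are those that meet the ray. -/
theorem activeAt_center_iff {m N : ℕ} (hN : N < (sweepEvents m).length) {p q : ℤ × ℤ}
    (he : (sweepEvents m)[N] = ⟨.center, p, 0⟩) (hq : InGrid m q) :
    ActiveAt m N q ↔ InCone q (centerVec p) := by
  have h0 : (sweepEvents m)[N] ∈ sweepEvents m := List.getElem_mem hN
  have hp : p ≠ 0 := by
    rw [he] at h0
    exact (mem_sweepEvents.1 h0).1.1
  have hv := centerVec_ne_zero hp
  constructor
  · intro h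
    have := h.inCone hN
    rwa [he] at this
  · intro h
    -- It suffices to find a stay whose closed interval of angles contains the azimuth of `p`: at
    -- equal azimuths, enter events precede the center event and exit events follow it.
    have key : ∀ x : Event, x ∈ sweepEvents m → x.kind = .enter → x.pos = q →
        x.angle ≤ dirKey (centerVec p) → dirKey (centerVec p) ≤ (exitOf x).angle →
        ActiveAt m N q := by
      intro x hx hk hxq h1 h2
      refine ⟨x, ?_, hk, hxq, ?_⟩
      · rw [(sweepEvents_sorted m).mem_take_iff hN]
        refine ⟨hx, Event.key_lt_of_order_lt ?_ ?_⟩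
        · rw [he]; simpa [Event.angle, Event.vec] using h1
        · rw [he, hk]; simp [Kind.order]
      · rw [(sweepEvents_sorted m).mem_take_iff hN]
        rintro ⟨-, h3⟩
        refine absurd h3 (Event.key_lt_of_order_lt ?_ ?_).not_gt
        · rw [he]; simpa [Event.angle, Event.vec] using h2
        · rw [he]; simp [Kind.order, exitOf]
    by_cases hr : Right q
    · rw [inCone_iff_of_right hv hr] at h
      have b1 := dirKey_bounds hv
      have b2 := dirKey_bounds (enterCorner_ne_zero hq.1)
      have b3 := dirKey_bounds (exitCorner_ne_zero hq.1)
      -- The first case is the stay that begins at the end of the main round, the second the initial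
      -- stay that ends early in it.
      rcases h with h | h
      · refine key ⟨.enter, q, 0⟩ (mem_sweepEvents.2 ⟨hq, Or.inl rfl⟩) rfl rfl ?_ ?_
        · simpa [Event.angle, Event.vec] using h
        · simp [Event.angle, Event.vec, exitOf, turnAfter_eq, hr]
          linarith [b1.2, b3.1]
      · refine key ⟨.enter, q, -1⟩ (mem_sweepEvents.2 ⟨hq, Or.inr ⟨rfl, rfl, hr⟩⟩) rfl rfl ?_ ?_
        · simp [Event.angle, Event.vec]
          linarith [b1.1, b2.2]
        · simpa [Event.angle, Event.vec, exitOf, turnAfter_eq, hr] using h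
    · rw [inCone_iff hq.1 hv hr] at h
      refine key ⟨.enter, q, 0⟩ (mem_sweepEvents.2 ⟨hq, Or.inl rfl⟩) rfl rfl ?_ ?_
      · simpa [Event.angle, Event.vec] using h.1
      · simpa [Event.angle, Event.vec, exitOf, turnAfter_eq, hr] using h.2

/-- Two stays of the sweep line in the same cell do not overlap. -/
theorem exit_lt_enter {m : ℕ} {x y : Event} (hx : x ∈ sweepEvents m) (hy : y ∈ sweepEvents m)
    (hkx : x.kind = .enter) (hky : y.kind = .enter) (hp : x.pos = y.pos) (hlt : x.key < y.key) :
    exitOf x ∈ sweepEvents m ∧ (exitOf x).key < y.key := by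
  obtain ⟨g, gt⟩ := mem_sweepEvents.1 hx
  obtain ⟨g', gt'⟩ := mem_sweepEvents.1 hy
  -- In the same round the two enter events would be equal. So the first is an initial one, and the
  -- cell lies straight to the right.
  have hne : x.turn ≠ y.turn := by
    intro hc
    have : x = y := by
      obtain ⟨k, p, t⟩ := x
      obtain ⟨k', p', t'⟩ := y
      simp_all
    rw [this] at hlt
    exact lt_irrefl _ hlt
  have hle := Event.angle_le_of_key_le hlt.le
  have hxv : x.vec = enterCorner y.pos := by simp [Event.vec, hkx, hp]
  have hyv : y.vec = enterCorner y.pos := by simp [Event.vec, hky]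
  simp only [Event.angle, hxv, hyv] at hle
  have hlt' : x.turn < y.turn := by
    refine lt_of_le_of_ne ?_ hne
    have : (x.turn : ℚ) ≤ y.turn := by linarith
    exact_mod_cast this
  have h1 : x.turn = -1 := by omega
  have hr : Right x.pos := by
    rcases gt with gt | gt
    · omega
    · exact gt.2.2
  have h2 : y.turn = 0 := by omega
  have h3 : turnAfter x = 0 := by simp [turnAfter_eq, hr, h1]
  refine ⟨mem_sweepEvents.2 ⟨g, Or.inl h3⟩, Event.key_lt_of_angle_lt ?_⟩
  have h4 := dirKey_right hr
  have hev : (exitOf x).vec = exitCorner x.pos := rfl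
  have het : (exitOf x).turn = turnAfter x := rfl
  simp only [Event.angle, hev, het, h3, h2, hyv, ← hp]
  linarith [h4.1, h4.2.2.2]

/-- Because stays in the same cell do not overlap, the tree never receives a point that it already
contains. -/
theorem activeAt_enter {m N : ℕ} (hN : N < (sweepEvents m).length)
    (he : (sweepEvents m)[N].kind = .enter) :
    ¬ActiveAt m N (sweepEvents m)[N].pos ∧
      ∀ q, ActiveAt m (N + 1) q ↔ q = (sweepEvents m)[N].pos ∨ ActiveAt m N q := by
  have h0 : (sweepEvents m)[N] ∈ sweepEvents m := List.getElem_mem hN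
  have hex : ∀ x : Event, exitOf x ∈ (sweepEvents m).take (N + 1) ↔
      exitOf x ∈ (sweepEvents m).take N := by
    intro x
    rw [mem_take_succ hN, or_iff_left]
    intro hc
    rw [← hc] at he
    simp [exitOf] at he
  constructor
  · rintro ⟨x, hx, hk, hp, hnx⟩
    have hlt := (sweepEvents_sorted m).key_lt hN hx
    obtain ⟨h1, h2⟩ := exit_lt_enter (List.mem_of_mem_take hx) h0 hk he hp hlt
    exact hnx (((sweepEvents_sorted m).mem_take_iff hN).2 ⟨h1, h2⟩)
  · intro q
    constructor
    · rintro ⟨x, hx, hk, hp, hnx⟩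
      rw [hex] at hnx
      rcases (mem_take_succ hN).1 hx with hx | rfl
      · exact Or.inr ⟨x, hx, hk, hp, hnx⟩
      · exact Or.inl hp.symm
    · rintro (rfl | ⟨x, hx, hk, hp, hnx⟩)
      · refine ⟨_, (mem_take_succ hN).2 (Or.inr rfl), he, rfl, ?_⟩
        rw [hex]
        intro hc
        have h1 := (sweepEvents_sorted m).key_lt hN hc
        obtain ⟨g, gt⟩ := mem_sweepEvents.1 h0
        set e := (sweepEvents m)[N]
        have hle := Event.angle_le_of_key_le h1.le
        have hxv : e.vec = enterCorner e.pos := by simp [Event.vec, he]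
        have hev : (exitOf e).vec = exitCorner e.pos := rfl
        have het : (exitOf e).turn = turnAfter e := rfl
        simp only [Event.angle, hxv, hev, het, turnAfter_eq] at hle
        have b2 := dirKey_bounds (enterCorner_ne_zero g.1)
        have b3 := dirKey_bounds (exitCorner_ne_zero g.1)
        split_ifs at hle with hr
        · push_cast at hle
          linarith [b2.2, b3.1]
        · have := dirKey_corners g.1 hr
          linarith [this.1, this.2]
      · exact ⟨x, (mem_take_succ hN).2 (Or.inl hx), hk, hp, by rwa [hex]⟩

theorem activeAt_center {m N : ℕ} (hN : N < (sweepEvents m).length)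
    (he : (sweepEvents m)[N].kind = .center) (q : ℤ × ℤ) :
    ActiveAt m (N + 1) q ↔ ActiveAt m N q := by
  have hex : ∀ x : Event, exitOf x ∈ (sweepEvents m).take (N + 1) ↔
      exitOf x ∈ (sweepEvents m).take N := by
    intro x
    rw [mem_take_succ hN, or_iff_left]
    intro hc
    rw [← hc] at he
    simp [exitOf] at he
  simp only [ActiveAt, hex]
  constructor
  · rintro ⟨x, hx, hk, hp, hnx⟩
    rcases (mem_take_succ hN).1 hx with hx | rfl
    · exact ⟨x, hx, hk, hp, hnx⟩
    · rw [he] at hk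
      simp at hk
  · rintro ⟨x, hx, hk, hp, hnx⟩
    exact ⟨x, (mem_take_succ hN).2 (Or.inl hx), hk, hp, hnx⟩

/-- The stay that is ending is the only open stay in its cell, so deleting the point from the tree
is right. -/
theorem activeAt_exit {m N : ℕ} (hN : N < (sweepEvents m).length)
    (he : (sweepEvents m)[N].kind = .exit) :
    ActiveAt m N (sweepEvents m)[N].pos ∧
      ∀ q, ActiveAt m (N + 1) q ↔ ActiveAt m N q ∧ q ≠ (sweepEvents m)[N].pos := by
  have h0 : (sweepEvents m)[N] ∈ sweepEvents m := List.getElem_mem hN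
  obtain ⟨x, hx, hlt, hc⟩ := ((sweep_system m).parent _ h0).resolve_left fun hc => by
    have := (mem_rootEvents.1 hc).1
    rw [he] at this
    simp at this
  obtain ⟨hxk, hxe⟩ := mem_sweepChildren.1 hc
  have hxe : (sweepEvents m)[N] = exitOf x := by
    rcases hxe with h | h | h
    · rw [h] at he; simp [centerOf] at he
    · exact h
    · rw [h] at he; simp [nextEnter] at he
  have hxN : x ∈ (sweepEvents m).take N := ((sweepEvents_sorted m).mem_take_iff hN).2 ⟨hx, hlt⟩
  constructor
  · refine ⟨x, hxN, hxk, by rw [hxe]; rfl, ?_⟩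
    rw [← hxe]
    exact fun hc => lt_irrefl _ ((sweepEvents_sorted m).key_lt hN hc)
  · intro q
    constructor
    · rintro ⟨y, hy, hk, hp, hny⟩
      rw [mem_take_succ hN, not_or] at hny
      have hy' : y ∈ (sweepEvents m).take N := by
        rcases (mem_take_succ hN).1 hy with hy | rfl
        · exact hy
        · rw [he] at hk
          simp at hk
      refine ⟨⟨y, hy', hk, hp, hny.1⟩, ?_⟩
      rintro rfl
      rcases lt_trichotomy x.key y.key with h | h | h
      · have := exit_lt_enter hx (List.mem_of_mem_take hy') hxk hk (by rw [hp, hxe]; rfl) h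
        rw [← hxe] at this
        exact absurd this.2 ((sweepEvents_sorted m).key_lt hN hy').not_gt
      · obtain rfl := Event.key_injective h
        exact hny.2 hxe.symm
      · have := exit_lt_enter (List.mem_of_mem_take hy') hx hk hxk (by rw [hp, hxe]; rfl) h
        exact hny.1 (((sweepEvents_sorted m).mem_take_iff hN).2 ⟨this.1, this.2.trans hlt⟩)
    · rintro ⟨⟨y, hy, hk, hp, hny⟩, hne⟩
      refine ⟨y, (mem_take_succ hN).2 (Or.inl hy), hk, hp, ?_⟩
      rw [mem_take_succ hN, not_or]
      refine ⟨hny, fun hc => hne ?_⟩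
      rw [← hc, ← hp]
      rfl

/-! ## Reasoning about programs -/

/-- The result and the final machine of a program satisfy `Q`. -/
def Holds {α : Type} (x : EM α) (s : Machine) (Q : α → Machine → Prop) : Prop :=
  Q (x.run s).1 (x.run s).2

theorem Holds.mono {α : Type} {x : EM α} {s : Machine} {Q R : α → Machine → Prop}
    (h : Holds x s Q) (hQR : ∀ a s', Q a s' → R a s') : Holds x s R := hQR _ _ h

theorem holds_pure {α : Type} {a : α} {s : Machine} {Q : α → Machine → Prop} :
    Holds (pure a) s Q ↔ Q a s := Iff.rfl

theorem holds_bind {α β : Type} {x : EM α} {f : α → EM β} {s : Machine} {Q : β → Machine → Prop} :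
    Holds (x >>= f) s Q ↔ Holds x s fun a s' => Holds (f a) s' Q := Iff.rfl

theorem Holds.bind {α β : Type} {x : EM α} {f : α → EM β} {s : Machine} {Q : β → Machine → Prop}
    {R : α → Machine → Prop} (h : Holds x s R) (h' : ∀ a s', R a s' → Holds (f a) s' Q) :
    Holds (x >>= f) s Q := h' _ _ h

/-- The machine after one more step. -/
def Machine.tick (s : Machine) : Machine := { s with time := s.time + 1 }

@[simp] theorem Machine.tick_disk (s : Machine) : s.tick.disk = s.disk := rfl
@[simp] theorem Machine.tick_time (s : Machine) : s.tick.time = s.time + 1 := rfl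
@[simp] theorem Machine.tick_ios (s : Machine) : s.tick.ios = s.ios := rfl
@[simp] theorem Machine.tick_peak (s : Machine) : s.tick.peak = s.peak := rfl

theorem holds_step {s : Machine} {Q : Unit → Machine → Prop} : Holds step s Q ↔ Q () s.tick :=
  Iff.rfl

theorem holds_use {k : ℕ} {s : Machine} {Q : Unit → Machine → Prop} :
    Holds (use k) s Q ↔ Q () { s with peak := max s.peak (k + 16) } := Iff.rfl

theorem holds_readBlock {f : File} {b : ℕ} {s : Machine} {Q : List Rec → Machine → Prop} :
    Holds (readBlock f b) s Q ↔
      Q ((s.disk f).getD b []) { s with time := s.time + 1, ios := s.ios + 1 } := Iff.rfl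

theorem holds_appendBlock {P : Params} {f : File} {blk : List Rec} {s : Machine}
    {Q : Unit → Machine → Prop} :
    Holds (appendBlock P f blk) s Q ↔
      Q () { s with
        disk := Function.update s.disk f (s.disk f ++ [blk.take P.B])
        time := s.time + 1
        ios := s.ios + 1 } := Iff.rfl

theorem holds_internal {α : Type} {x : Timed α} {s : Machine} {Q : α → Machine → Prop} :
    Holds (internal x) s Q ↔ Q x.val { s with time := s.time + x.cost } := Iff.rfl

theorem holds_forLoop {σ : Type} (Inv : ℕ → σ → Machine → Prop) {n : ℕ} {body : ℕ → σ → EM σ}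
    {s : σ} {m : Machine} (h0 : Inv 0 s m)
    (h : ∀ k < n, ∀ s m, Inv k s m → Holds (body k s) m.tick (Inv (k + 1))) :
    Holds (forLoop n body s) m (Inv n) := by
  induction n with
  | zero => exact h0
  | succ n ih =>
    unfold forLoop
    refine (ih fun k hk => h k (by omega)).bind fun a s' hs' => ?_
    rw [holds_bind, holds_step]
    exact h n (by omega) a s' hs'

/-- The invariant is indexed by the number of iterations, and whoever continues must show that this
number is below `K`. As `K` is less than the fuel, the loop ends because its condition fails; the
final `tick` is that last test. -/
theorem holds_whileLoop {σ : Type} (Inv : ℕ → σ → Machine → Prop) (K : ℕ) {cond : σ → Bool}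
    {body : σ → EM σ} {fuel : ℕ} {s : σ} {m : Machine} (h0 : Inv 0 s m) (hK : K < fuel)
    (h : ∀ k s m, Inv k s m → cond s = true →
      k < K ∧ Holds (body s) m.tick (Inv (k + 1))) :
    Holds (whileLoop cond body fuel s) m
      (fun s' m' => cond s' = false ∧ ∃ k m'', Inv k s' m'' ∧ m' = m''.tick) := by
  suffices H : ∀ k fuel s m, Inv k s m → K < fuel + k → k ≤ K →
      Holds (whileLoop cond body fuel s) m
      (fun s' m' => cond s' = false ∧ ∃ k m'', Inv k s' m'' ∧ m' = m''.tick) from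
    H 0 fuel s m h0 (by omega) (by omega)
  intro k fuel
  induction fuel generalizing k with
  | zero => intro s m _ h1 h2; omega
  | succ fuel ih =>
    intro s m hI h1 h2
    unfold whileLoop
    rw [holds_bind, holds_step]
    split_ifs with hc
    · obtain ⟨h3, h4⟩ := h k s m hI hc
      exact h4.bind fun s' m' hI' => ih (k + 1) s' m' hI' (by omega) (by omega)
    · rw [holds_pure]
      exact ⟨by simpa using hc, k, m, hI, rfl⟩

/-! ### Files -/

/-- A list cut into blocks. -/
def chunks {α : Type} (B : ℕ) (xs : List α) : List (List α) :=
  if _h : xs = [] ∨ B = 0 then [] else xs.take B :: chunks B (xs.drop B)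
  termination_by xs.length
  decreasing_by
    push Not at _h
    have := List.length_pos_of_ne_nil _h.1
    rw [List.length_drop]
    omega

theorem chunks_nil {α : Type} (B : ℕ) : chunks B ([] : List α) = [] := by
  rw [chunks]; simp

theorem chunks_cons {α : Type} {B : ℕ} (hB : 1 ≤ B) {xs : List α} (h : xs ≠ []) :
    chunks B xs = xs.take B :: chunks B (xs.drop B) := by
  rw [chunks, dif_neg]
  push Not
  exact ⟨h, by omega⟩

theorem chunks_of_length_lt {α : Type} {B : ℕ} {xs : List α} (h : xs.length < B) :
    chunks B xs = if xs = [] then [] else [xs] := by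
  split_ifs with hx
  · rw [hx, chunks_nil]
  · rw [chunks_cons (by omega) hx, List.take_of_length_le h.le, List.drop_of_length_le h.le,
      chunks_nil]

theorem chunks_append {α : Type} {B : ℕ} (hB : 1 ≤ B) {b xs : List α} (h : b.length = B) :
    chunks B (b ++ xs) = b :: chunks B xs := by
  have hb : b ≠ [] := by
    rintro rfl
    simp at h
    omega
  rw [chunks_cons hB (by simp [hb]), List.take_left' h, List.drop_left' h]

theorem chunks_flatten {α : Type} {B : ℕ} (hB : 1 ≤ B) {blocks : List (List α)} {buf : List α}
    (h : ∀ b ∈ blocks, b.length = B) (hbuf : buf.length < B) :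
    chunks B (blocks.flatten ++ buf) = blocks ++ if buf = [] then [] else [buf] := by
  induction blocks with
  | nil => simpa using chunks_of_length_lt hbuf
  | cons b blocks ih =>
    rw [List.flatten_cons, List.append_assoc, chunks_append hB (h b (by simp)),
      ih fun c hc => h c (by simp [hc]), List.cons_append]

/-- With the default `[]`, the formula also covers reading behind the end of a file. -/
theorem getD_chunks {α : Type} {B : ℕ} (hB : 1 ≤ B) (xs : List α) (b : ℕ) :
    (chunks B xs).getD b [] = (xs.drop (b * B)).take B := by
  induction b generalizing xs with
  | zero =>
    rcases eq_or_ne xs [] with rfl | h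
    · simp [chunks_nil]
    · rw [chunks_cons hB h]
      simp
  | succ b ih =>
    rcases eq_or_ne xs [] with rfl | h
    · simp [chunks_nil]
    · rw [chunks_cons hB h, List.getD_cons_succ, ih, List.drop_drop, add_mul, one_mul, add_comm]

/-- The accumulator is the current block: never empty, possibly full, and not yet moved to the
output. -/
theorem toChunks_go_eq {α : Type} {B : ℕ} (hB : 1 ≤ B) (xs : List α) (acc : Array α)
    (out : Array (List α)) (h1 : 1 ≤ acc.size) (h2 : acc.size ≤ B) :
    List.toChunks.go B xs acc out = out.toList ++ chunks B (acc.toList ++ xs) := by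
  induction xs generalizing acc out with
  | nil =>
    have h3 : acc.toList ≠ [] := by
      intro hc
      rw [← Array.length_toList, hc] at h1
      simp at h1
    rw [List.toChunks.go, List.append_nil, chunks_cons hB h3,
      List.take_of_length_le (by simpa using h2), List.drop_of_length_le (by simpa using h2),
      chunks_nil]
    simp
  | cons x xs ih =>
    rw [List.toChunks.go]
    split_ifs with h
    · have h : acc.size = B := by simpa using h
      rw [ih _ _ (by simp) (by simpa using hB), chunks_append hB (b := acc.toList) (by simpa using h)]
      simp
    · have h : acc.size ≠ B := by simpa using h
      rw [ih _ _ (by simp) (by simp; omega)]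
      simp

theorem toChunks_eq_chunks {α : Type} {B : ℕ} (hB : 1 ≤ B) (xs : List α) :
    xs.toChunks B = chunks B xs := by
  cases xs with
  | nil =>
    rw [chunks_nil]
    cases B <;> rfl
  | cons x xs =>
    obtain ⟨b, rfl⟩ : ∃ b, B = b + 1 := ⟨B - 1, by omega⟩
    have : (x :: xs).toChunks (b + 1) = List.toChunks.go (b + 1) xs #[x] #[] := rfl
    rw [this, toChunks_go_eq hB _ _ _ (by simp) (by simp)]
    simp

/-! ### Writing -/

/-- The blocks of a file and the buffer of its write stream contain the list `xs`. -/
structure Writing (B : ℕ) (blocks : List (List Rec)) (buf xs : List Rec) : Prop where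
  content : blocks.flatten ++ buf = xs
  full : ∀ b ∈ blocks, b.length = B
  short : buf.length < B

theorem writing_nil {B : ℕ} (hB : 1 ≤ B) : Writing B [] [] [] :=
  ⟨rfl, by simp, by simp; omega⟩

theorem Writing.length_le {B : ℕ} {blocks : List (List Rec)} {buf xs : List Rec}
    (h : Writing B blocks buf xs) : buf.length ≤ xs.length := by
  rw [← h.content]
  simp

/-- The amortisation of writing: `B * ios` plus the length of the buffer grows by exactly one per
record, whether or not a block is written. -/
theorem WriteStream.push_holds {P : Params} (hB : 1 ≤ P.B) {w : WriteStream} {x : Rec} {xs : List Rec}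
    {m : Machine} (h : Writing P.B (m.disk w.file) w.buf xs) :
    Holds (w.push P x) m fun w' m' => w'.file = w.file ∧
      Writing P.B (m'.disk w.file) w'.buf (xs ++ [x]) ∧ (∀ f ≠ w.file, m'.disk f = m.disk f) ∧
      m'.time ≤ m.time + 2 ∧ m'.peak = m.peak ∧
      P.B * m'.ios + w'.buf.length = P.B * m.ios + w.buf.length + 1 ∧
      w'.buf.length ≤ w.buf.length + 1 := by
  unfold WriteStream.push
  rw [holds_bind, holds_step]
  have hs := h.short
  split_ifs with hc
  · have hl : (w.buf ++ [x]).length = P.B := by simp; omega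
    rw [holds_bind, holds_appendBlock, holds_pure]
    refine ⟨rfl, ⟨?_, ?_, by simp; omega⟩, ?_, ?_, rfl, ?_, by simp⟩
    · simp only [Machine.tick_disk, Function.update_self, ← h.content]
      rw [List.take_of_length_le hl.le]
      simp
    · simp only [Machine.tick_disk, Function.update_self]
      intro b hb
      rcases List.mem_append.1 hb with hb | hb
      · exact h.full b hb
      · rw [List.mem_singleton.1 hb, List.take_of_length_le hl.le, hl]
    · intro f hf
      simp [Function.update_of_ne hf]
    · simp only [Machine.tick_time]; omega
    · simp only [Machine.tick_ios, List.length_nil]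
      rw [mul_add, mul_one]
      omega
  · rw [holds_pure]
    refine ⟨rfl, ⟨?_, h.full, ?_⟩, fun _ _ => rfl, ?_, rfl, ?_, by simp⟩
    · simp only [Machine.tick_disk, ← h.content]
      simp
    · simp; omega
    · simp
    · simp [add_assoc]

theorem WriteStream.close_holds {P : Params} (hB : 1 ≤ P.B) {w : WriteStream} {xs : List Rec}
    {m : Machine} (h : Writing P.B (m.disk w.file) w.buf xs) :
    Holds (w.close P) m fun _ m' => m'.disk w.file = chunks P.B xs ∧
      (∀ f ≠ w.file, m'.disk f = m.disk f) ∧ m'.time ≤ m.time + 2 ∧ m'.peak = m.peak ∧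
      m'.ios ≤ m.ios + 1 := by
  have hch := chunks_flatten hB h.full h.short
  rw [h.content] at hch
  unfold WriteStream.close
  rw [holds_bind, holds_step]
  split_ifs with hc
  · rw [holds_pure]
    rw [List.isEmpty_iff] at hc
    refine ⟨by simp [hch, hc], fun _ _ => rfl, by simp, rfl, by simp⟩
  · rw [List.isEmpty_iff] at hc
    rw [holds_appendBlock]
    refine ⟨?_, ?_, ?_, rfl, ?_⟩
    · simp [hch, hc, List.take_of_length_le h.short.le]
    · intro f hf
      simp [Function.update_of_ne hf]
    · simp
    · simp

theorem WriteStream.pushAll_holds {P : Params} (hB : 1 ≤ P.B) (ys : List Rec) {w : WriteStream}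
    {xs : List Rec} {m : Machine} (h : Writing P.B (m.disk w.file) w.buf xs) :
    Holds (w.pushAll P ys) m fun w' m' => w'.file = w.file ∧
      Writing P.B (m'.disk w.file) w'.buf (xs ++ ys) ∧ (∀ f ≠ w.file, m'.disk f = m.disk f) ∧
      m'.time ≤ m.time + 2 * ys.length ∧ m'.peak = m.peak ∧
      P.B * m'.ios + w'.buf.length = P.B * m.ios + w.buf.length + ys.length := by
  induction ys generalizing w xs m with
  | nil =>
    unfold WriteStream.pushAll
    rw [holds_pure]
    exact ⟨rfl, by simpa using h, fun _ _ => rfl, by simp, rfl, by simp⟩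
  | cons y ys ih =>
    unfold WriteStream.pushAll
    refine (WriteStream.push_holds hB h).bind ?_
    rintro w' m' ⟨h1, h2, h3, h4, h5, h6, -⟩
    rw [← h1] at h2
    refine (ih h2).mono ?_
    rintro w'' m'' ⟨g1, g2, g3, g4, g5, g6⟩
    rw [h1] at g1 g2 g3
    refine ⟨g1, by simpa using g2, fun f hf => (g3 f hf).trans (h3 f hf), ?_, g5.trans h5, ?_⟩
    · simp only [List.length_cons]; omega
    · simp only [List.length_cons]; omega

/-! ### Reading -/

/-- A read stream on a file with content `xs` still has to deliver `rest`. -/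
structure Reading (B : ℕ) (xs : List Rec) (r : ReadStream) (rest : List Rec) : Prop where
  content : r.buf ++ xs.drop (r.next * B) = rest
  eof : r.eof = true → rest = []
  short : r.buf.length ≤ B

/-- `B` times the number of I/Os that a read stream may still need. -/
def readPotential (B : ℕ) (xs : List Rec) (r : ReadStream) : ℕ :=
  if r.eof then 0
  else if xs.length ≤ r.next * B then B else (xs.length - r.next * B) + 2 * B

theorem reading_ofFile (B : ℕ) (xs : List Rec) (f : File) : Reading B xs (.ofFile f) xs :=
  ⟨by simp [ReadStream.ofFile], by simp [ReadStream.ofFile], by simp [ReadStream.ofFile]⟩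

theorem readPotential_ofFile (B : ℕ) (xs : List Rec) (f : File) :
    readPotential B xs (.ofFile f) ≤ xs.length + 2 * B := by
  simp only [readPotential, ReadStream.ofFile, zero_mul, Bool.false_eq_true, if_false]
  split_ifs <;> omega

theorem Reading.length_le {B : ℕ} {xs rest : List Rec} {r : ReadStream} (h : Reading B xs r rest) :
    r.buf.length ≤ rest.length := by
  rw [← h.content]
  simp

theorem ReadStream.fill_holds {P : Params} (hB : 1 ≤ P.B) {r : ReadStream} {xs rest : List Rec}
    {m : Machine} (hf : m.disk r.file = chunks P.B xs) (h : Reading P.B xs r rest) :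
    Holds r.fill m fun r' m' => r'.file = r.file ∧ Reading P.B xs r' rest ∧
      (r'.buf = [] → rest = []) ∧ m'.disk = m.disk ∧ m'.time ≤ m.time + 2 ∧ m'.peak = m.peak ∧
      P.B * m'.ios + readPotential P.B xs r' ≤ P.B * m.ios + readPotential P.B xs r := by
  unfold ReadStream.fill
  rw [holds_bind, holds_step]
  split_ifs with hc
  · simp only [Bool.and_eq_true, List.isEmpty_iff, Bool.not_eq_true'] at hc
    rw [holds_bind, holds_readBlock, holds_pure]
    simp only [Machine.tick_disk, hf, getD_chunks hB]
    have hcont := h.content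
    rw [hc.1, List.nil_append] at hcont
    have hr : (List.take P.B (List.drop (r.next * P.B) xs)) = [] → rest = [] := by
      intro he
      rw [List.take_eq_nil_iff] at he
      rw [← hcont]
      exact he.resolve_left (by omega)
    refine ⟨by trivial, ⟨?_, ?_, ?_⟩, hr, by trivial, ?_, by trivial, ?_⟩
    · dsimp only
      rw [add_mul, one_mul, ← List.drop_drop, List.take_append_drop, hcont]
    · intro he
      exact hr (by simpa using he)
    · simp only [List.length_take]
      omega
    · simp
    · have hlen : rest.length = xs.length - r.next * P.B := by rw [← hcont, List.length_drop]
      simp only [readPotential, hc.2, Machine.tick_ios]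
      rw [mul_add, mul_one, add_mul, one_mul]
      -- A read behind the end uses up the last `B` units of potential and sets `eof`. Any other
      -- read lowers the potential by at least `B`: the summand `2 * B` allows for one incomplete
      -- block and for the final empty read.
      by_cases hx : xs.length ≤ r.next * P.B
      · have : (List.take P.B (List.drop (r.next * P.B) xs)).isEmpty = true := by
          rw [List.drop_of_length_le hx]
          simp
        simp only [this, if_true, hx]
        simp
      · simp only [hx, if_false, Bool.false_eq_true]
        split_ifs <;> omega
  · rw [holds_pure]
    refine ⟨rfl, h, ?_, rfl, by simp, rfl, by simp⟩
    intro hb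
    rw [hb] at hc
    exact h.eof (by simpa using hc)

theorem Reading.skip {B : ℕ} {xs : List Rec} {r : ReadStream} {x : Rec} {buf rest : List Rec}
    (h : Reading B xs r rest) (hb : r.buf = x :: buf) :
    ∃ rest', rest = x :: rest' ∧ Reading B xs r.skip rest' := by
  have hc := h.content
  rw [hb, List.cons_append] at hc
  refine ⟨_, hc.symm, ?_, ?_, ?_⟩
  · simp [ReadStream.skip, hb]
  · intro he
    have := h.eof he
    rw [← hc] at this
    simp at this
  · have := h.short
    simp [ReadStream.skip, hb] at this ⊢
    omega

theorem readPotential_skip (B : ℕ) (xs : List Rec) (r : ReadStream) :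
    readPotential B xs r.skip = readPotential B xs r := rfl

/-! ## Parameters -/

/-- The assumptions on the parameters. -/
structure Params.Admissible (P : Params) : Prop where
  one_le : 1 ≤ P.B
  two_mul_le : 2 * P.B ≤ P.M
  large : 2 ^ 20 * P.n * P.B ≤ P.M ^ 2

namespace Params

variable {P : Params}

theorem n_eq (P : Params) : P.n = (2 * P.m + 1) ^ 2 := rfl

theorem width_le_n (P : Params) : 2 * P.m + 1 ≤ P.n := by
  rw [n_eq, sq]
  exact Nat.le_mul_of_pos_left _ (by omega)

theorem n_pos (P : Params) : 1 ≤ P.n := by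
  have := P.width_le_n
  omega

/-- Take square roots in `2 ^ 20 * n * B ≤ M ^ 2`, with `B ≥ 1` and `n = (2 * m + 1) ^ 2`. -/
theorem Admissible.width_le (h : P.Admissible) : 1024 * (2 * P.m + 1) ≤ P.M := by
  have h1 : (1024 * (2 * P.m + 1)) ^ 2 ≤ P.M ^ 2 := by
    refine le_trans ?_ h.large
    calc (1024 * (2 * P.m + 1)) ^ 2 = 2 ^ 20 * P.n * 1 := by rw [n_eq]; ring
      _ ≤ _ := Nat.mul_le_mul_left _ h.one_le
  exact (Nat.pow_le_pow_iff_left (by norm_num)).1 h1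

/-- Since `B` may be as large as `M / 2`, memory need not have room for several full blocks. But if
`M < 64 * B`, then `M ^ 2 ≥ 2 ^ 20 * n * B` gives `M ≥ 2 ^ 14 * n`, and buffers are bounded by the
size of the input instead. -/
theorem Admissible.small_blocks_or_small_input (h : P.Admissible) :
    64 * P.B ≤ P.M ∨ 2 ^ 14 * P.n ≤ P.M := by
  by_cases h1 : 64 * P.B ≤ P.M
  · exact Or.inl h1
  · right
    have h2 : P.M * (2 ^ 14 * P.n) ≤ P.M * P.M := by
      calc P.M * (2 ^ 14 * P.n) ≤ (64 * P.B) * (2 ^ 14 * P.n) := Nat.mul_le_mul_right _ (by omega)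
        _ = 2 ^ 20 * P.n * P.B := by ring
        _ ≤ P.M ^ 2 := h.large
        _ = _ := sq _
    have := h.width_le
    exact Nat.le_of_mul_le_mul_left h2 (by omega)

theorem Admissible.M_le_cap (h : P.Admissible) : P.M ≤ 32 * P.sectorCap := by
  have := h.width_le
  unfold sectorCap
  omega

theorem Admissible.width_le_cap (h : P.Admissible) : 64 * (2 * P.m + 1) ≤ P.sectorCap := by
  have := h.width_le
  unfold sectorCap
  omega

/-- The number of boundaries between sectors. -/
def numBounds (P : Params) : ℕ := (P.n - 1 - 1) / P.sectorCap

theorem numBounds_mul_le (P : Params) : P.numBounds * P.sectorCap ≤ P.n := by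
  have := Nat.div_mul_le_self (P.n - 1 - 1) P.sectorCap
  unfold numBounds
  omega

theorem Admissible.numBounds_mul_M (h : P.Admissible) : P.numBounds * P.M ≤ 32 * P.n := by
  calc P.numBounds * P.M ≤ P.numBounds * (32 * P.sectorCap) := Nat.mul_le_mul_left _ h.M_le_cap
    _ = 32 * (P.numBounds * P.sectorCap) := by ring
    _ ≤ _ := Nat.mul_le_mul_left _ P.numBounds_mul_le

/-- Makes a constant number of blocks per sector affordable within `O(n / B)` I/Os. -/
theorem Admissible.numBounds_mul_B (h : P.Admissible) : P.numBounds * P.B ≤ 16 * P.n := by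
  have h1 := h.numBounds_mul_M
  have h2 : P.numBounds * (2 * P.B) ≤ P.numBounds * P.M := Nat.mul_le_mul_left _ h.two_mul_le
  rw [mul_left_comm] at h2
  omega

/-- Makes one write buffer per sector affordable. There are at most `32 * n / M` boundaries, and `32
* n * B / M` is a small fraction of `M` by the hypothesis on `M ^ 2 / B`. -/
theorem Admissible.numBounds_mul_B_le_M (h : P.Admissible) :
    2 ^ 15 * (P.numBounds * P.B) ≤ P.M := by
  have h2 : P.M * (2 ^ 15 * (P.numBounds * P.B)) ≤ P.M * P.M := by
    calc P.M * (2 ^ 15 * (P.numBounds * P.B)) = 2 ^ 15 * P.B * (P.numBounds * P.M) := by ring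
      _ ≤ 2 ^ 15 * P.B * (32 * P.n) := Nat.mul_le_mul_left _ h.numBounds_mul_M
      _ = 2 ^ 20 * P.n * P.B := by ring
      _ ≤ P.M ^ 2 := h.large
      _ = _ := sq _
  have := h.width_le
  exact Nat.le_of_mul_le_mul_left h2 (by omega)

theorem Admissible.numBounds_le_M (h : P.Admissible) : 2 ^ 15 * P.numBounds ≤ P.M := by
  have h1 := h.numBounds_mul_B_le_M
  have h2 : P.numBounds * 1 ≤ P.numBounds * P.B := Nat.mul_le_mul_left _ h.one_le
  omega

theorem Admissible.numBounds_le_n (h : P.Admissible) : P.numBounds ≤ P.n := by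
  have h1 : P.numBounds * 1 ≤ P.numBounds * P.sectorCap :=
    Nat.mul_le_mul_left _ (by have := h.width_le_cap; omega)
  have := P.numBounds_mul_le
  omega

/-- A common bound for the logarithms of the sizes of all data structures. -/
def logSize (P : Params) : ℕ := Nat.log 2 (64 * P.n)

end Params

/-! ## First phase: the sector boundaries -/

theorem EventSystem.pop {U roots : List Event} {children : Event → List Event}
    (h : EventSystem U roots children) {N : ℕ} {Q : Heap Event}
    (hg : Q.Good Event.le (fun e => e.pos ≠ 0))
    (hQ : Pending U roots children N Q.elems) (hN : N < U.length) {s : ℕ}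
    (hs : Multiset.card Q.elems + 1 ≤ s) :
    ∃ Q' : Heap Event, (Heap.deleteMin Event.le Q).val = some (U[N], Q') ∧
      Q.elems = U[N] ::ₘ Q'.elems ∧ Q'.Good Event.le (fun e => e.pos ≠ 0) ∧
      (Heap.deleteMin Event.le Q).cost ≤ 2 * Nat.log 2 s + 2 := by
  obtain ⟨h1, h2⟩ := h.next hQ hN
  obtain ⟨h3 | ⟨x, Q', h3, h4, h5, h6, h7⟩, h8⟩ := Heap.deleteMin_spec Event.totalOn_le hg
  · rw [h3.1] at h1
    simp at h1
  · have hx : x = U[N] := by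
      apply Event.key_injective
      refine le_antisymm ((Event.le_iff h6 (hg.valid _ h1)).1 (h7 _ h1)) (h2 x ?_)
      rw [h4]
      exact Multiset.mem_cons_self _ _
    subst hx
    exact ⟨Q', h3, h4, h5, h8 s hs⟩

theorem schedule_holds {e : Event} {Q : Heap Event} {m : Machine} {s : ℕ}
    (hg : Q.Good Event.le (fun e => e.pos ≠ 0)) (he : e.pos ≠ 0)
    (hs : Multiset.card Q.elems + 1 ≤ s) :
    Holds (schedule e Q) m fun Q' m' => Q'.Good Event.le (fun e => e.pos ≠ 0) ∧
      Q'.elems = e ::ₘ Q.elems ∧ m'.disk = m.disk ∧ m'.time ≤ m.time + Nat.log 2 s + 3 ∧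
      m'.ios = m.ios ∧ m'.peak = m.peak := by
  obtain ⟨h1, h2, h3⟩ := Heap.insert_spec Event.totalOn_le hg he
  unfold schedule
  rw [holds_internal]
  refine ⟨h1, h2, rfl, ?_, rfl, rfl⟩
  have := h3 s hs
  dsimp only
  omega

theorem rootEvents_succ (k : ℕ) :
    rootEvents (k + 1) = rootEvents k ++ [⟨.enter, (0, (k : ℤ) + 1), -1⟩] := by
  simp [rootEvents, List.range_succ]

theorem rootEvents_length (m : ℕ) : (rootEvents m).length = m := by simp [rootEvents]

theorem initialQueue_holds (P : Params) (m : Machine) :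
    Holds (initialQueue P) m fun (Q : Heap Event) m' => Q.Good Event.le (fun e => e.pos ≠ 0) ∧
      Q.elems = rootEvents P.m ∧ m'.disk = m.disk ∧
      m'.time ≤ m.time + P.m * (P.logSize + 4) ∧ m'.ios = m.ios ∧ m'.peak = m.peak := by
  unfold initialQueue
  refine holds_forLoop (fun k (Q : Heap Event) m' => Q.Good Event.le (fun e => e.pos ≠ 0) ∧
      Q.elems = rootEvents k ∧ m'.disk = m.disk ∧
      m'.time ≤ m.time + k * (P.logSize + 4) ∧ m'.ios = m.ios ∧ m'.peak = m.peak) ?_ ?_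
  · exact ⟨Heap.good_leaf _ _, by simp [rootEvents], rfl, by simp, rfl, rfl⟩
  · rintro k hk Q m' ⟨h1, h2, h3, h4, h5, h6⟩
    have hw := P.width_le_n
    refine (schedule_holds (s := 64 * P.n) h1 ?_ ?_).mono ?_
    · intro hc
      have := congrArg Prod.snd hc
      simp only [Prod.snd_zero] at this
      omega
    · rw [h2, Multiset.coe_card, rootEvents_length]
      omega
    · rintro Q' m'' ⟨g1, g2, g3, g4, g5, g6⟩
      refine ⟨g1, ?_, g3.trans h3, ?_, g5.trans h5, g6.trans h6⟩
      · rw [g2, h2, rootEvents_succ, ← Multiset.coe_add, ← Multiset.singleton_add,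
          add_comm {_} (rootEvents k : Multiset Event)]
        rfl
      · simp only [Machine.tick_time] at g4
        change _ ≤ _ + P.logSize + 3 at g4
        rw [add_mul, one_mul]
        omega

/-- The point whose enter event is the `a`-th in the main round. -/
def nthEntered (m a : ℕ) : ℤ × ℤ := (enterOrder m).getD a 0

/-- The sector boundaries that are found among the first `c` enter events of the main round. -/
def boundaries (P : Params) (c : ℕ) : List Azimuth :=
  (List.range ((c - 1) / P.sectorCap)).map fun j =>
    (enterEvent (nthEntered P.m ((j + 1) * P.sectorCap))).azimuth

/-- The quotient `(c - 1) / P.sectorCap` counts the positive multiples of the capacity below `c`, so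
it grows exactly when `c` itself is such a multiple. -/
theorem boundaries_succ {P : Params} (c : ℕ) :
    boundaries P (c + 1) = if 0 < c ∧ c % P.sectorCap = 0 then
      boundaries P c ++ [(enterEvent (nthEntered P.m c)).azimuth] else boundaries P c := by
  rcases Nat.eq_zero_or_pos c with rfl | hc
  · simp [boundaries]
  · obtain ⟨d, rfl⟩ : ∃ d, c = d + 1 := ⟨c - 1, by omega⟩
    simp only [boundaries, Nat.add_sub_cancel, Nat.succ_div, Nat.dvd_iff_mod_eq_zero]
    split_ifs with h1 h2 h2
    · rw [List.range_succ, List.map_append]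
      simp only [List.map_cons, List.map_nil]
      have : (d / P.sectorCap + 1) * P.sectorCap = d + 1 := by
        have h3 := Nat.div_mul_cancel (Nat.dvd_of_mod_eq_zero h1)
        rwa [Nat.succ_div, if_pos (Nat.dvd_of_mod_eq_zero h1)] at h3
      rw [this]
    · exact absurd ⟨hc, h1⟩ h2
    · exact absurd h2.2 h1
    · rfl

theorem getElem_enterEvents_of_lt {m N : ℕ} (h : N < m) (hN : N < (enterEvents m).length) :
    (enterEvents m)[N].turn = -1 := by
  have h1 : N < (sortEvents (rootEvents m)).length := by
    rw [(sortEvents_roots m).1.length_eq, rootEvents_length]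
    exact h
  have h2 : (enterEvents m)[N] = (sortEvents (rootEvents m))[N] := by
    simp only [enterEvents]
    rw [List.getElem_append_left]
  rw [h2]
  exact (mem_rootEvents.1 ((sortEvents_roots m).1.mem_iff.1 (List.getElem_mem h1))).2.2.2

theorem getElem_enterEvents_of_le {m N : ℕ} (h : m ≤ N) (hN : N < (enterEvents m).length) :
    (enterEvents m)[N] = enterEvent (nthEntered m (N - m)) := by
  have hl : (sortEvents (rootEvents m)).length = m := by
    rw [(sortEvents_roots m).1.length_eq, rootEvents_length]
  have hN' : N - m < (enterOrder m).length := by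
    simp only [enterEvents, List.length_append, hl, List.length_map] at hN
    omega
  simp only [enterEvents]
  rw [List.getElem_append_right (by omega), List.getElem_map]
  congr 1
  rw [nthEntered, List.getD_eq_getElem _ _ hN']
  congr 1
  omega

theorem enterEvents_length (P : Params) :
    (enterEvents P.m).length = P.m + (P.n - 1) := by
  have := enterOrder_length P.m
  simp only [enterEvents, List.length_append, (sortEvents_roots P.m).1.length_eq, rootEvents_length,
    List.length_map]
  unfold Params.n
  omega

/-- Every iteration exchanges an enter event for its successor in the same layer, so the queue
always has `P.m` elements. The first `P.m` events are the initial ones; therefore the truncated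
difference `N - P.m` is the number of events of the main round so far. -/
theorem sectorBounds_holds {P : Params} (hP : P.Admissible) (m : Machine) (hm : m.peak ≤ P.M) :
    Holds (sectorBounds P) m fun bounds m' => bounds = boundaries P (P.n - 1) ∧
      m'.disk = m.disk ∧ m'.time ≤ m.time + P.n * (8 * P.logSize + 20) ∧ m'.ios = m.ios ∧
      m'.peak ≤ P.M := by
  unfold sectorBounds
  refine (initialQueue_holds P m).bind ?_
  rintro Q m₀ ⟨q1, q2, q3, q4, q5, q6⟩
  have hw := P.width_le_n
  have key := holds_forLoop (n := P.m + (P.n - 1)) (s := (⟨Q, 0, []⟩ : BoundaryState)) (m := m₀)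
    (body := fun _ s => do
      use s.footprint
      match ← internal (Heap.deleteMin Event.le s.queue) with
      | none => pure s
      | some (e, Q) =>
        let Q ← schedule ⟨.enter, nextCell e.pos, turnAfter e⟩ Q
        if e.turn < 0 then pure { s with queue := Q }
        else
          let bounds :=
            if 0 < s.count ∧ s.count % P.sectorCap = 0 then s.bounds ++ [e.azimuth] else s.bounds
          pure ⟨Q, s.count + 1, bounds⟩)
    (fun N s m' =>
      s.queue.Good Event.le (fun e => e.pos ≠ 0) ∧
      Pending (enterEvents P.m) (rootEvents P.m) (fun e => [nextEnter e]) N s.queue.elems ∧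
      Multiset.card s.queue.elems = P.m ∧ s.count = N - P.m ∧ s.bounds = boundaries P (N - P.m) ∧
      m'.disk = m.disk ∧ m'.time ≤ m₀.time + N * (3 * P.logSize + 6) ∧ m'.ios = m.ios ∧
      m'.peak ≤ P.M) ?_ ?_
  · refine key.bind ?_
    rintro s m' ⟨-, -, -, -, h5, h6, h7, h8, h9⟩
    rw [holds_pure]
    refine ⟨by rw [h5]; congr 1; omega, h6, ?_, h8, h9⟩
    have e1 : (P.m + (P.n - 1)) * (3 * P.logSize + 6) ≤ (2 * P.n) * (3 * P.logSize + 6) :=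
      Nat.mul_le_mul_right _ (by omega)
    have e2 : P.m * (P.logSize + 4) ≤ P.n * (P.logSize + 4) := Nat.mul_le_mul_right _ (by omega)
    have e3 : P.n * (P.logSize + 4) + (2 * P.n) * (3 * P.logSize + 6) ≤
        P.n * (8 * P.logSize + 20) := by
      have : P.n * (P.logSize + 4) + (2 * P.n) * (3 * P.logSize + 6) =
        P.n * (7 * P.logSize + 16) := by ring
      rw [this]
      exact Nat.mul_le_mul_left _ (by omega)
    omega
  · refine ⟨q1, ?_, ?_, by simp, by simp [boundaries], q3, by simp, q5, q6.trans_le hm⟩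
    · rw [q2]; exact (enter_system P.m).pending_zero
    · simp [q2, rootEvents_length]
  · rintro N hN s m' ⟨h1, h2, h3, h4, h5, h6, h7, h8, h9⟩
    have hN' : N < (enterEvents P.m).length := by rwa [enterEvents_length]
    obtain ⟨Q', d1, d2, d3, d4⟩ := (enter_system P.m).pop (s := 64 * P.n) h1 h2 hN'
      (by rw [h3]; omega)
    rw [holds_bind, holds_use, holds_bind, holds_internal, d1]
    dsimp only
    have hmem := mem_enterEvents.1 (List.getElem_mem hN')
    have hcard : Multiset.card Q'.elems + 1 = P.m := by
      rw [d2, Multiset.card_cons] at h3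
      exact h3
    refine (schedule_holds (s := 64 * P.n) d3 hmem.2.1.next.1 (by omega)).bind ?_
    rintro Q'' m'' ⟨g1, g2, g3, g4, g5, g6⟩
    have hpend : Pending (enterEvents P.m) (rootEvents P.m) (fun e => [nextEnter e]) (N + 1)
        Q''.elems := by
      rw [d2] at h2
      have := (enter_system P.m).step hN' h2
      rw [g2, ← Multiset.singleton_add, add_comm {_} Q'.elems]
      exact this
    have hcard' : Multiset.card Q''.elems = P.m := by
      rw [g2, Multiset.card_cons, hcard]
    have htime : m''.time ≤ m₀.time + (N + 1) * (3 * P.logSize + 6) := by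
      simp only [Machine.tick_time] at g4
      change _ ≤ _ + P.logSize + 3 at g4
      change _ ≤ 2 * P.logSize + 2 at d4
      rw [add_mul, one_mul]
      omega
    have hpeak : m''.peak ≤ P.M := by
      rw [g6]
      refine max_le h9 ?_
      have hb : s.bounds.length ≤ P.numBounds := by
        rw [h5, boundaries, List.length_map, List.length_range]
        exact Nat.div_le_div_right (by omega)
      have := hP.numBounds_le_M
      have := hP.width_le
      rw [BoundaryState.footprint, Heap.size_eq, h3]
      omega
    by_cases hlt : N < P.m
    · have ht := getElem_enterEvents_of_lt hlt hN'
      rw [if_pos (by rw [ht]; norm_num), holds_pure]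
      refine ⟨g1, hpend, hcard', ?_, ?_, g3.trans h6, htime, g5.trans h8, hpeak⟩
      · rw [h4]; omega
      · rw [h5]
        congr 1
        omega
    · have he := getElem_enterEvents_of_le (by omega) hN'
      rw [if_neg (by rw [he]; simp [enterEvent]), holds_pure]
      refine ⟨g1, hpend, hcard', ?_, ?_, g3.trans h6, htime, g5.trans h8, hpeak⟩
      · dsimp only
        rw [h4]; omega
      · dsimp only
        rw [show N + 1 - P.m = N - P.m + 1 by omega, boundaries_succ, h4, h5, he]

/-- The exponent `k` bounds the depth of the recursion, as the window is at least halved each time.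
Monotonicity is needed only inside the window. -/
theorem countBounds_spec (bounds : List Azimuth) (a : Azimuth) (k lo len : ℕ) (hk : len < 2 ^ k)
    (hmono : ∀ i j, lo ≤ i → i ≤ j → j < lo + len → a.lt (bounds.getD i a) = true →
      a.lt (bounds.getD j a) = true) :
    lo ≤ (countBounds bounds a lo len).val ∧ (countBounds bounds a lo len).val ≤ lo + len ∧
      (∀ j, lo ≤ j → j < lo + len →
        (a.lt (bounds.getD j a) = false ↔ j < (countBounds bounds a lo len).val)) ∧
      (countBounds bounds a lo len).cost ≤ k + 1 := by
  induction k generalizing lo len with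
  | zero =>
    have : len = 0 := by simpa using hk
    subst this
    rw [countBounds]
    simp
    intro j h1 h2
    omega
  | succ k ih =>
    rw [pow_succ] at hk
    rw [countBounds]
    by_cases h0 : len = 0
    · subst h0
      simp
      intro j h1 h2
      omega
    · rw [if_neg h0]
      simp only [Timed.val_bind, Timed.cost_bind, tick_cost]
      by_cases hlt : a.lt (bounds.getD (lo + len / 2) a) = true
      · rw [if_pos hlt]
        obtain ⟨h1, h2, h3, h4⟩ := ih lo (len / 2) (by omega)
          fun i j hi hj hl => hmono i j hi hj (by omega)
        refine ⟨h1, by omega, fun j hj1 hj2 => ?_, by omega⟩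
        by_cases hj : j < lo + len / 2
        · exact h3 j hj1 hj
        · have := hmono _ j (by omega) (not_lt.1 hj) hj2 hlt
          rw [this]
          simp
          omega
      · rw [if_neg hlt]
        obtain ⟨h1, h2, h3, h4⟩ := ih (lo + len / 2 + 1) (len - len / 2 - 1) (by omega)
          fun i j hi hj hl => hmono i j (by omega) hj (by omega)
        refine ⟨by omega, by omega, fun j hj1 hj2 => ?_, by omega⟩
        by_cases hj : lo + len / 2 + 1 ≤ j
        · exact h3 j hj (by omega)
        · have : a.lt (bounds.getD j a) = false := by
            rw [← Bool.not_eq_true]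
            exact fun hc => hlt (hmono j _ hj1 (by omega) (by omega) hc)
          rw [this]
          simp
          omega

/-! ## The sectors -/

theorem boundaries_length (P : Params) : (boundaries P (P.n - 1)).length = P.numBounds := by
  simp [boundaries, Params.numBounds]

theorem getD_boundaries {P : Params} {j : ℕ} (hj : j < P.numBounds) (a : Azimuth) :
    (boundaries P (P.n - 1)).getD j a =
      (enterEvent (nthEntered P.m ((j + 1) * P.sectorCap))).azimuth := by
  have h1 : j < (boundaries P (P.n - 1)).length := by rwa [boundaries_length]
  rw [List.getD_eq_getElem _ _ h1]
  simp [boundaries]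

theorem Params.boundary_lt {P : Params} (hn : 2 ≤ P.n) {j : ℕ} (hj : j ≤ P.numBounds) :
    j * P.sectorCap < (enterOrder P.m).length := by
  have h1 := enterOrder_length P.m
  have h2 : P.n = gridSize P.m := rfl
  have h3 := Nat.div_mul_le_self (P.n - 1 - 1) P.sectorCap
  have h4 : j * P.sectorCap ≤ P.numBounds * P.sectorCap := Nat.mul_le_mul_right _ hj
  unfold Params.numBounds at h4
  omega

theorem Params.two_le_n {P : Params} (h : 1 ≤ P.numBounds) : 2 ≤ P.n := by
  by_contra hc
  have : P.numBounds = 0 := by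
    unfold Params.numBounds
    rw [show P.n - 1 - 1 = 0 by omega, Nat.zero_div]
  omega

theorem nthEntered_eq {m a : ℕ} (ha : a < (enterOrder m).length) :
    nthEntered m a = (enterOrder m)[a] := by
  rw [nthEntered, List.getD_eq_getElem _ _ ha]

theorem nthEntered_inGrid {m a : ℕ} (ha : a < (enterOrder m).length) :
    InGrid m (nthEntered m a) := by
  rw [nthEntered_eq ha]
  exact mem_enterOrder.1 (List.getElem_mem ha)

theorem angle_nthEntered_mono {m a b : ℕ} (hab : a ≤ b) (hb : b < (enterOrder m).length) :
    (enterEvent (nthEntered m a)).angle ≤ (enterEvent (nthEntered m b)).angle := by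
  rw [nthEntered_eq (hab.trans_lt hb), nthEntered_eq hb]
  rcases hab.eq_or_lt with rfl | h
  · exact le_rfl
  · exact Event.angle_le_of_key_le
      (List.pairwise_iff_getElem.1 (enterOrder_sorted m) _ _ (hab.trans_lt hb) hb h).le

/-- The index of the sector of a grid point. -/
def sectorOf (P : Params) (p : ℤ × ℤ) : ℕ :=
  (countBounds (boundaries P (P.n - 1)) (enterEvent p).azimuth 0
    (boundaries P (P.n - 1)).length).val

/-- The boundaries are azimuths taken at increasing positions of a sorted list, so they are
nondecreasing and binary search applies. -/
theorem sectorOf_spec {P : Params} (hP : P.Admissible) {p : ℤ × ℤ} (hp : p ≠ 0) :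
    sectorOf P p ≤ P.numBounds ∧
    (∀ j < P.numBounds, j < sectorOf P p ↔
      (enterEvent (nthEntered P.m ((j + 1) * P.sectorCap))).angle ≤ (enterEvent p).angle) ∧
    (countBounds (boundaries P (P.n - 1)) (enterEvent p).azimuth 0
      (boundaries P (P.n - 1)).length).cost ≤ P.logSize + 2 := by
  have hlt : ∀ j < P.numBounds, (enterEvent p).azimuth.lt
      ((boundaries P (P.n - 1)).getD j (enterEvent p).azimuth) = true ↔
      (enterEvent p).angle < (enterEvent (nthEntered P.m ((j + 1) * P.sectorCap))).angle := by
    intro j hj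
    rw [getD_boundaries hj]
    exact Event.azimuth_lt_iff hp
      (nthEntered_inGrid (P.boundary_lt (Params.two_le_n (by omega)) hj)).1
  have hlog : (boundaries P (P.n - 1)).length < 2 ^ (P.logSize + 1) := by
    rw [boundaries_length]
    have h1 := hP.numBounds_le_n
    have h2 : 64 * P.n < 2 ^ (P.logSize + 1) := Nat.lt_pow_succ_log_self (by norm_num) _
    omega
  obtain ⟨-, h2, h3, h4⟩ := countBounds_spec (boundaries P (P.n - 1)) (enterEvent p).azimuth
    (P.logSize + 1) 0 (boundaries P (P.n - 1)).length hlog (by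
      rw [boundaries_length]
      intro i j _ hij hj
      rw [zero_add] at hj
      rw [hlt i (by omega), hlt j hj]
      intro h
      refine h.trans_le (angle_nthEntered_mono (Nat.mul_le_mul_right _ (by omega)) ?_)
      exact P.boundary_lt (Params.two_le_n (by omega)) hj)
  rw [boundaries_length, zero_add] at h2 h3
  refine ⟨by rwa [sectorOf, boundaries_length], fun j hj => ?_, h4⟩
  have := h3 j (Nat.zero_le _) hj
  rw [sectorOf, boundaries_length, ← this, ← Bool.not_eq_true, hlt j hj, not_lt]

theorem sectorOf_mono {P : Params} (hP : P.Admissible) {p q : ℤ × ℤ} (hp : p ≠ 0) (hq : q ≠ 0)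
    (h : (enterEvent p).angle ≤ (enterEvent q).angle) : sectorOf P p ≤ sectorOf P q := by
  obtain ⟨h1, h2, -⟩ := sectorOf_spec hP hp
  obtain ⟨-, h3, -⟩ := sectorOf_spec hP hq
  by_contra hc
  push Not at hc
  exact lt_irrefl _ ((h3 _ (by omega)).2 (((h2 _ (by omega)).1 hc).trans h))

theorem enterOrder_sectorOf {P : Params} (hP : P.Admissible) :
    (enterOrder P.m).Pairwise fun p q => sectorOf P p ≤ sectorOf P q := by
  refine List.Pairwise.imp_of_mem ?_ (enterOrder_sorted P.m)
  intro a b ha hb h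
  exact sectorOf_mono hP (mem_enterOrder.1 ha).1 (mem_enterOrder.1 hb).1
    (Event.angle_le_of_key_le h.le)

/-- The points straight to the right, and then all points, in the order of their enter events. -/
def enterPoints (m : ℕ) : List (ℤ × ℤ) := (enterEvents m).map Event.pos

/-- The points straight to the right in the order of their enter events. -/
def rootPoints (m : ℕ) : List (ℤ × ℤ) := (sortEvents (rootEvents m)).map Event.pos

theorem enterPoints_eq (m : ℕ) : enterPoints m = rootPoints m ++ enterOrder m := by
  have : Event.pos ∘ enterEvent = id := rfl
  rw [enterPoints, enterEvents, List.map_append, List.map_map, this, List.map_id]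
  rfl

theorem rootPoints_length (m : ℕ) : (rootPoints m).length = m := by
  rw [rootPoints, List.length_map, (sortEvents_roots m).1.length_eq, rootEvents_length]

/-- The points of each sector list in the order of their enter events. -/
def sectorPoints (P : Params) : ℕ → List (ℤ × ℤ)
  | 0 => rootPoints P.m
  | k + 1 => (enterOrder P.m).filter fun p => sectorOf P p = k

/-- The position in `enterPoints` where the list `E_k` ends. -/
def sectorEnd (P : Params) (k : ℕ) : ℕ :=
  P.m + (enterOrder P.m).countP fun p => sectorOf P p < k

/-- If `f` is nondecreasing along a list, its level sets are contiguous segments, delimited by the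
numbers of elements with smaller values. -/
theorem filter_eq_take_countP {α : Type} {f : α → ℕ} {l : List α}
    (h : l.Pairwise fun a b => f a ≤ f b) (k : ℕ) :
    l.filter (fun a => f a = k) =
      (l.take (l.countP fun a => f a < k + 1)).drop (l.countP fun a => f a < k) ∧
    l.countP (fun a => f a < k + 1) =
      l.countP (fun a => f a < k) + (l.filter fun a => f a = k).length := by
  induction l with
  | nil => simp
  | cons a l ih =>
    obtain ⟨h1, h2⟩ := List.pairwise_cons.1 h
    obtain ⟨ih1, ih2⟩ := ih h2
    by_cases hk : f a < k
    · rw [List.countP_cons_of_pos (by simp; omega), List.countP_cons_of_pos (by simp; omega),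
        List.filter_cons_of_neg (by simp; omega), List.take_succ_cons, List.drop_succ_cons]
      exact ⟨ih1, by omega⟩
    · have hz : l.countP (fun a => f a < k) = 0 := by
        rw [List.countP_eq_zero]
        intro b hb
        have := h1 b hb
        simp; omega
      rw [List.countP_cons_of_neg (p := fun a => decide (f a < k)) (by simp; omega), hz,
        List.drop_zero]
      rw [hz, List.drop_zero] at ih1
      by_cases hk' : f a = k
      · rw [List.countP_cons_of_pos (by simp; omega), List.filter_cons_of_pos (by simp; omega),
          List.take_succ_cons, List.length_cons]
        exact ⟨by rw [ih1], by omega⟩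
      · have hz' : l.countP (fun a => f a < k + 1) = 0 := by
          rw [List.countP_eq_zero]
          intro b hb
          have := h1 b hb
          simp; omega
        rw [hz', List.take_zero] at ih1
        rw [List.countP_cons_of_neg (by simp; omega), List.filter_cons_of_neg (by simp; omega),
          hz', ih1]
        simp

theorem sectorEnd_zero (P : Params) : sectorEnd P 0 = P.m := by
  simp [sectorEnd]

theorem sectorEnd_succ {P : Params} (hP : P.Admissible) (k : ℕ) :
    sectorEnd P (k + 1) = sectorEnd P k + (sectorPoints P (k + 1)).length := by
  have := (filter_eq_take_countP (enterOrder_sectorOf hP) k).2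
  simp only [sectorEnd, sectorPoints, this]
  omega

theorem take_sectorEnd_zero (P : Params) :
    (enterPoints P.m).take (sectorEnd P 0) = sectorPoints P 0 := by
  rw [sectorEnd_zero, enterPoints_eq, List.take_left' (rootPoints_length _)]
  rfl

/-- The lists `E_0`, `E_1`, … laid end to end are the points in the order in which the sweep enters
them. So the sweep can go on to the next list when the current one is used up. -/
theorem take_sectorEnd_succ {P : Params} (hP : P.Admissible) (k : ℕ) :
    ((enterPoints P.m).take (sectorEnd P (k + 1))).drop (sectorEnd P k) =
      sectorPoints P (k + 1) := by
  have h := (filter_eq_take_countP (enterOrder_sectorOf hP) k).1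
  have hl := rootPoints_length P.m
  simp only [sectorPoints, h, sectorEnd, enterPoints_eq]
  rw [List.take_append, List.drop_append, List.take_of_length_le (by omega),
    List.drop_of_length_le (by omega), List.nil_append, hl]
  congr 1
  · omega
  · congr 1
    omega

theorem enterPoints_length (P : Params) : (enterPoints P.m).length = P.m + (P.n - 1) := by
  rw [enterPoints, List.length_map, enterEvents_length]

theorem sectorEnd_le (P : Params) (k : ℕ) : sectorEnd P k ≤ (enterPoints P.m).length := by
  rw [enterPoints_eq, List.length_append, rootPoints_length]
  exact Nat.add_le_add_left List.countP_le_length _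

theorem sectorEnd_last {P : Params} (hP : P.Admissible) :
    sectorEnd P (P.numBounds + 1) = (enterPoints P.m).length := by
  rw [enterPoints_eq, List.length_append, rootPoints_length, sectorEnd, List.countP_eq_length.2]
  intro a ha
  have := (sectorOf_spec hP (mem_enterOrder.1 ha).1).1
  simp
  omega

theorem enterOrder_nodup (m : ℕ) : (enterOrder m).Nodup :=
  (enterOrder_perm m).nodup_iff.2 (cells_nodup m)

theorem card_enter_angle_le {m : ℕ} (θ : ℚ) (l : List (ℤ × ℤ)) (hl : l.Nodup)
    (h : ∀ p ∈ l, InGrid m p ∧ (enterEvent p).angle = θ) : l.length ≤ 4 * m + 3 := by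
  rw [← List.toFinset_card_of_nodup hl]
  refine card_enter_eq_le θ _ fun q hq => ?_
  obtain ⟨⟨h1, h2, h3⟩, h4⟩ := h q (List.mem_toFinset.1 hq)
  refine ⟨h1, h2, h3, ?_⟩
  rw [← h4]
  simp [Event.angle, enterEvent, Event.vec]

/-- No sector is empty, so loading a single list always provides the next record. The sector
contains the point whose enter event is its lower boundary: otherwise the next boundary would have
the same azimuth, and `sectorCap` enter events would be tied, more than the `4 * m + 3` that are
possible. -/
theorem sectorEnd_lt {P : Params} (hP : P.Admissible) (hn : 2 ≤ P.n) {k : ℕ}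
    (hk : k ≤ P.numBounds) : sectorEnd P k < sectorEnd P (k + 1) := by
  have hlt := P.boundary_lt hn hk
  have hcap := hP.width_le_cap
  have hg := nthEntered_inGrid hlt
  rw [sectorEnd_succ hP]
  have hmem : nthEntered P.m (k * P.sectorCap) ∈ sectorPoints P (k + 1) := by
    obtain ⟨h1, h2, -⟩ := sectorOf_spec hP hg.1
    simp only [sectorPoints, List.mem_filter, decide_eq_true_eq]
    refine ⟨mem_enterOrder.2 hg, le_antisymm ?_ ?_⟩
    · by_contra hc
      push Not at hc
      have hk' : k < P.numBounds := by omega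
      have h3 := (h2 k hk').1 hc
      have hlt' : (k + 1) * P.sectorCap < _ := P.boundary_lt hn hk'
      have := card_enter_angle_le (m := P.m) (enterEvent (nthEntered P.m (k * P.sectorCap))).angle
        (((enterOrder P.m).take ((k + 1) * P.sectorCap)).drop (k * P.sectorCap))
        (((enterOrder_nodup P.m).sublist (List.take_sublist _ _)).sublist (List.drop_sublist _ _))
        ?_
      · rw [List.length_drop, List.length_take, min_eq_left hlt'.le, add_mul, one_mul,
          Nat.add_sub_cancel_left] at this
        omega
      · intro p hp
        obtain ⟨i, hi, rfl⟩ := List.getElem_of_mem hp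
        simp only [List.length_drop, List.length_take] at hi
        rw [List.getElem_drop, List.getElem_take, ← nthEntered_eq (by omega)]
        refine ⟨nthEntered_inGrid (by omega), le_antisymm ?_ ?_⟩
        · refine le_trans (angle_nthEntered_mono ?_ hlt') h3
          omega
        · exact angle_nthEntered_mono (by omega) (by omega)
    · by_contra hc
      push Not at hc
      obtain ⟨j, rfl⟩ : ∃ j, k = j + 1 := ⟨k - 1, by omega⟩
      have := (h2 j (by omega)).2 le_rfl
      omega
  have := List.length_pos_of_mem hmem
  omega

/-- Between consecutive boundaries lie `sectorCap` positions of the enter order. The only other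
points of the sector are tied with its lower boundary but precede it in the order, and ties are
bounded by `4 * m + 3`. -/
theorem sectorPoints_length_le {P : Params} (hP : P.Admissible) {k : ℕ} (hk : k ≤ P.numBounds + 1) :
    (sectorPoints P k).length ≤ P.sectorCap + (4 * P.m + 3) := by
  have hcap := hP.width_le_cap
  rcases k with _ | k
  · simp only [sectorPoints, rootPoints_length]
    omega
  · have hsub : sectorPoints P (k + 1) ⊆
        ((enterOrder P.m).drop (k * P.sectorCap)).take P.sectorCap ++ (enterOrder P.m).filter
          fun p => (enterEvent p).angle = (enterEvent (nthEntered P.m (k * P.sectorCap))).angle := by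
      intro p hp
      simp only [sectorPoints, List.mem_filter, decide_eq_true_eq] at hp
      obtain ⟨hp, hs⟩ := hp
      obtain ⟨h1, h2, -⟩ := sectorOf_spec hP (mem_enterOrder.1 hp).1
      obtain ⟨a, ha, hpa⟩ := List.getElem_of_mem hp
      rw [← nthEntered_eq ha] at hpa
      rw [List.mem_append, List.mem_filter]
      -- Points at or behind the next boundary belong to a later sector. In the last sector there is
      -- no next boundary, and the bound comes from the total number of points.
      have hup : a < (k + 1) * P.sectorCap := by
        by_contra hc
        push Not at hc
        rcases Nat.lt_or_ge k P.numBounds with hk' | hk'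
        · have := (h2 k hk').2 (by rw [← hpa]; exact angle_nthEntered_mono hc ha)
          omega
        · have hke : k = P.numBounds := by omega
          subst hke
          have h5 := enterOrder_length P.m
          have h6 : P.n = gridSize P.m := rfl
          have h7 := Nat.div_add_mod (P.n - 1 - 1) P.sectorCap
          have h8 := Nat.mod_lt (P.n - 1 - 1) (y := P.sectorCap) (by omega)
          rw [add_mul, one_mul, mul_comm] at hc
          unfold Params.numBounds at hc
          omega
      by_cases hlo : k * P.sectorCap ≤ a
      · left
        rw [List.mem_take_iff_getElem]
        rw [add_mul, one_mul] at hup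
        refine ⟨a - k * P.sectorCap, ?_, ?_⟩
        · rw [List.length_drop, lt_min_iff]
          omega
        · rw [List.getElem_drop, ← hpa, nthEntered_eq ha]
          congr 1
          omega
      · right
        refine ⟨hp, ?_⟩
        push Not at hlo
        obtain ⟨j, rfl⟩ : ∃ j, k = j + 1 := ⟨k - 1, by
          rcases k with _ | k
          · simp at hlo
          · omega⟩
        have h5 := (h2 j (by omega)).1 (by omega)
        simp only [decide_eq_true_eq]
        refine le_antisymm ?_ h5
        rw [← hpa]
        exact angle_nthEntered_mono hlo.le
          (P.boundary_lt (Params.two_le_n (by omega)) (by omega : j + 1 ≤ P.numBounds))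
    have hnd : (sectorPoints P (k + 1)).Nodup := (enterOrder_nodup P.m).filter _
    have h1 := (hnd.subperm hsub).length_le
    have h2 := card_enter_angle_le (m := P.m)
      (enterEvent (nthEntered P.m (k * P.sectorCap))).angle ((enterOrder P.m).filter
        fun p => (enterEvent p).angle = (enterEvent (nthEntered P.m (k * P.sectorCap))).angle)
      ((enterOrder_nodup P.m).filter _) (by
        intro p hp
        rw [List.mem_filter, decide_eq_true_eq] at hp
        exact ⟨mem_enterOrder.1 hp.1, hp.2⟩)
    rw [List.length_append, List.length_take] at h1
    omega

/-! ### Sorting a sector -/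

/-- The record of a grid point. -/
def pointRec (Z : ℤ → ℤ → ℝ) (p : ℤ × ℤ) : Rec := .point p.1 p.2 (Z p.1 p.2)

/-- Is a point in the list `E_k`? -/
def inSector (P : Params) : ℕ → ℤ × ℤ → Bool
  | 0, p => decide (Right p)
  | k + 1, p => decide (p ≠ 0 ∧ sectorOf P p = k)

/-- The part of the list `E_k` that comes from the points `l`. -/
def sectorRecs (P : Params) (Z : ℤ → ℤ → ℝ) (k : ℕ) (l : List (ℤ × ℤ)) : List Rec :=
  (l.filter (inSector P k)).map (pointRec Z)

/-- The list `E_0` is sorted by enter events of the main round but consumed in round `-1`. Shifting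
all angles by a full turn does not change the order. -/
theorem rootPoints_sorted (m : ℕ) :
    (rootPoints m).Pairwise fun p q => (enterEvent p).key < (enterEvent q).key := by
  rw [rootPoints, List.pairwise_map]
  refine List.Pairwise.imp_of_mem ?_ (sortEvents_roots m).2
  intro a b ha hb h
  obtain ⟨h1, -, -, h4⟩ := mem_rootEvents.1 ((sortEvents_roots m).1.mem_iff.1 ha)
  obtain ⟨g1, -, -, g4⟩ := mem_rootEvents.1 ((sortEvents_roots m).1.mem_iff.1 hb)
  simp only [Event.key, Prod.Lex.toLex_lt_toLex, Event.angle, Event.vec, h1, h4, g1, g4,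
    enterEvent] at h ⊢
  push_cast at h ⊢
  simpa using h

theorem mem_rootPoints {m : ℕ} {p : ℤ × ℤ} : p ∈ rootPoints m ↔ InGrid m p ∧ Right p := by
  simp only [rootPoints, List.mem_map, (sortEvents_roots m).1.mem_iff, mem_rootEvents]
  constructor
  · rintro ⟨e, ⟨-, h2, h3, -⟩, rfl⟩
    exact ⟨h2, h3⟩
  · rintro ⟨h1, h2⟩
    exact ⟨⟨.enter, p, -1⟩, ⟨rfl, h1, h2, rfl⟩, rfl⟩

theorem sectorPoints_sorted (P : Params) (k : ℕ) :
    (sectorPoints P k).Pairwise fun p q => (enterEvent p).key < (enterEvent q).key := by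
  rcases k with _ | k
  · exact rootPoints_sorted P.m
  · exact (enterOrder_sorted P.m).filter _

theorem mem_sectorPoints {P : Params} {k : ℕ} {p : ℤ × ℤ} :
    p ∈ sectorPoints P k ↔ p ∈ gridPoints P.m ∧ inSector P k p = true := by
  rcases k with _ | k
  · simp only [sectorPoints, mem_rootPoints, InGrid, inSector, mem_gridPoints, decide_eq_true_eq]
    refine ⟨fun h => ⟨h.1.2, h.2⟩, fun h => ⟨⟨?_, h.1⟩, h.2⟩⟩
    rintro rfl
    simp [Right] at h
  · simp only [sectorPoints, List.mem_filter, mem_enterOrder, InGrid, inSector, mem_gridPoints,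
      decide_eq_true_eq]
    tauto

theorem sectorPoints_ne_zero {P : Params} {k : ℕ} {p : ℤ × ℤ} (h : p ∈ sectorPoints P k) :
    p ≠ 0 := by
  rcases k with _ | k
  · exact (mem_rootPoints.1 h).1.1
  · exact (mem_enterOrder.1 (List.mem_filter.1 h).1).1

theorem sectorPoints_perm (P : Params) (k : ℕ) :
    (sectorPoints P k).Perm ((gridPoints P.m).filter (inSector P k)) := by
  rw [List.perm_ext_iff_of_nodup ?_ ((gridPoints_nodup P.m).filter _)]
  · intro p
    rw [mem_sectorPoints, List.mem_filter]
  · refine List.Pairwise.imp ?_ (sectorPoints_sorted P k)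
    rintro a _ h rfl
    exact lt_irrefl _ h

/-- The order in which a sector is sorted. -/
def enterLe (a b : Rec) : Bool := Event.le (enterEvent a.pos) (enterEvent b.pos)

theorem totalOn_enterLe : TotalOn enterLe (fun r => r.pos ≠ 0) where
  total _ _ ha hb := Event.totalOn_le.total _ _ ha hb
  trans _ _ _ ha hb hc := Event.totalOn_le.trans _ _ _ ha hb hc

/-- The order of records is antisymmetric on this list, because the elevation is a function of the
position. So the sorted list is unique, whatever the order of distribution. -/
theorem sort_sectorRecs (P : Params) (Z : ℤ → ℤ → ℝ) (k : ℕ) :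
    (sortList enterLe (sectorRecs P Z k (gridPoints P.m))).val =
        (sectorPoints P k).map (pointRec Z) ∧
      ∀ s, (sectorPoints P k).length + 1 ≤ s →
        (sortList enterLe (sectorRecs P Z k (gridPoints P.m))).cost ≤
          (sectorPoints P k).length * (3 * Nat.log 2 s + 5) := by
  have hperm := (sectorPoints_perm P k).map (pointRec Z)
  have hlen : (sectorRecs P Z k (gridPoints P.m)).length = (sectorPoints P k).length := by
    rw [sectorRecs, ← hperm.length_eq, List.length_map]
  obtain ⟨h1, h2, h3⟩ := sortList_spec totalOn_enterLe (sectorRecs P Z k (gridPoints P.m)) (by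
    intro x hx
    obtain ⟨p, hp, rfl⟩ := List.mem_map.1 (hperm.mem_iff.2 hx)
    exact sectorPoints_ne_zero hp)
  rw [hlen] at h3
  refine ⟨?_, h3⟩
  have h4 := h1.trans hperm.symm
  refine List.Perm.eq_of_pairwise (le := fun x y => enterLe x y = true) ?_ h2 ?_ h4
  · intro a b ha hb hab hba
    obtain ⟨p, hp, rfl⟩ := List.mem_map.1 (h4.mem_iff.1 ha)
    obtain ⟨q, hq, rfl⟩ := List.mem_map.1 hb
    have e1 := (Event.le_iff (sectorPoints_ne_zero hp) (sectorPoints_ne_zero hq)).1 hab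
    have e2 := (Event.le_iff (sectorPoints_ne_zero hq) (sectorPoints_ne_zero hp)).1 hba
    have e3 := enterEvent_injective (Event.key_injective (le_antisymm e1 e2))
    have e4 : p = q := e3
    rw [e4]
  · rw [List.pairwise_map]
    refine List.Pairwise.imp_of_mem ?_ (sectorPoints_sorted P k)
    intro a b ha hb h
    exact (Event.le_iff (sectorPoints_ne_zero ha) (sectorPoints_ne_zero hb)).2 h.le

/-! ## First phase: distribution -/

/-- The records of the input file that belong to a list of points. -/
def elevRecs (Z : ℤ → ℤ → ℝ) (l : List (ℤ × ℤ)) : List Rec := l.map fun p => .elev (Z p.1 p.2)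

/-- The number of records in the first `K` write buffers. -/
def DistState.bufTotal (K : ℕ) (s : DistState) : ℕ := ∑ k ∈ Finset.range K, (s.bufs k).length

theorem DistState.send_holds {P : Params} (hB : 1 ≤ P.B) {s : DistState} {k K : ℕ} {x : Rec}
    {xs : List Rec} {m : Machine} (hk : k < K)
    (h : Writing P.B (m.disk (.sector k)) (s.bufs k) xs) :
    Holds (s.send P k x) m fun s' m' => s'.input = s.input ∧
      Writing P.B (m'.disk (.sector k)) (s'.bufs k) (xs ++ [x]) ∧
      (∀ j ≠ k, s'.bufs j = s.bufs j) ∧ (∀ f ≠ File.sector k, m'.disk f = m.disk f) ∧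
      m'.time ≤ m.time + 2 ∧ m'.peak = m.peak ∧
      P.B * m'.ios + s'.bufTotal K = P.B * m.ios + s.bufTotal K + 1 ∧
      s'.bufTotal K ≤ s.bufTotal K + 1 := by
  unfold DistState.send
  refine (WriteStream.push_holds (w := ⟨.sector k, s.bufs k⟩) hB h).bind ?_
  rintro w m' ⟨h1, h2, h3, h4, h5, h6, h7⟩
  rw [holds_pure]
  have hsum : DistState.bufTotal K { s with bufs := Function.update s.bufs k w.buf } +
      (s.bufs k).length = s.bufTotal K + w.buf.length := by
    unfold DistState.bufTotal
    have hm : k ∈ Finset.range K := Finset.mem_range.2 hk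
    rw [← Finset.add_sum_erase _ _ hm, ← Finset.add_sum_erase _ _ hm]
    simp only [Function.update_self]
    rw [Finset.sum_congr rfl (g := fun j => (s.bufs j).length)]
    · omega
    · intro j hj
      rw [Function.update_of_ne (Finset.ne_of_mem_erase hj)]
  refine ⟨rfl, by simpa using h2, fun j hj => by simp [Function.update_of_ne hj], h3, h4, h5, ?_, ?_⟩
  · dsimp only at h6
    omega
  · dsimp only at h7
    omega

theorem sectorRecs_append (P : Params) (Z : ℤ → ℤ → ℝ) (k : ℕ) (l : List (ℤ × ℤ)) (p : ℤ × ℤ) :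
    sectorRecs P Z k (l ++ [p]) =
      sectorRecs P Z k l ++ if inSector P k p = true then [pointRec Z p] else [] := by
  simp only [sectorRecs, List.filter_append, List.map_append]
  split_ifs with h <;> simp [h]

/-- The invariant of the distribution after the points of the list `l`. -/
structure DistInv (P : Params) (Z : ℤ → ℤ → ℝ) (m₀ : Machine) (idx : ℕ) (s : DistState)
    (m : Machine) : Prop where
  file : s.input.file = .input
  reading : Reading P.B (elevRecs Z (gridPoints P.m)) s.input
    (elevRecs Z ((gridPoints P.m).drop idx))
  writing : ∀ k, Writing P.B (m.disk (.sector k)) (s.bufs k)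
    (sectorRecs P Z k ((gridPoints P.m).take idx))
  other : ∀ f, (∀ k, f ≠ .sector k) → m.disk f = m₀.disk f
  total_le : s.bufTotal (P.numBounds + 2) ≤ 2 * idx
  time_le : m.time ≤ m₀.time + idx * (P.logSize + 12)
  peak_le : m.peak ≤ P.M
  ios_le : P.B * m.ios + readPotential P.B (elevRecs Z (gridPoints P.m)) s.input +
    s.bufTotal (P.numBounds + 2) ≤ P.B * m₀.ios + (P.n + 2 * P.B) + 2 * idx

/-- The write buffers hold at most a block per list, and also at most two records per point read. If
blocks are small the first bound fits in memory, and otherwise the second one does. -/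
theorem DistInv.footprint_le {P : Params} (hP : P.Admissible) {Z : ℤ → ℤ → ℝ} {m₀ m : Machine}
    {idx : ℕ} {s : DistState} (h : DistInv P Z m₀ idx s m) (hidx : idx ≤ P.n) :
    s.footprint (boundaries P (P.n - 1)) + 16 ≤ P.M := by
  have h1 := h.reading.length_le
  have h2 := h.reading.short
  have h3 : (gridPoints P.m).length = P.n := gridPoints_length _
  have h4 : s.bufTotal (P.numBounds + 2) ≤ (P.numBounds + 2) * P.B := by
    refine (Finset.sum_le_card_nsmul _ _ P.B fun k _ => (h.writing k).short.le).trans ?_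
    simp
  have h5 := h.total_le
  have h6 := hP.numBounds_le_M
  have h7 := hP.numBounds_mul_B_le_M
  have h8 := hP.width_le
  rw [elevRecs, List.length_map, List.length_drop, h3] at h1
  have h9 : s.footprint (boundaries P (P.n - 1)) =
      s.input.buf.length + P.numBounds + s.bufTotal (P.numBounds + 2) := by
    rw [DistState.footprint, boundaries_length]
    rfl
  rw [h9]
  rw [add_mul] at h4
  rcases hP.small_blocks_or_small_input with hc | hc <;> omega

theorem distStep_holds {P : Params} (hP : P.Admissible) (Z : ℤ → ℤ → ℝ) {m₀ m : Machine}
    (hin : m₀.disk .input = chunks P.B (elevRecs Z (gridPoints P.m)))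
    {idx : ℕ} (hidx : idx < P.n) {s : DistState} (h : DistInv P Z m₀ idx s m) :
    Holds (do
      let p := pointAt P.m idx
      let r ← s.input.fill
      let s := { s with input := r }
      use (s.footprint (boundaries P (P.n - 1)))
      match r.buf with
      | [] => pure s
      | z :: _ =>
        let s := { s with input := r.skip }
        if p = (0, 0) then pure s
        else
          let c ← internal (countBounds (boundaries P (P.n - 1)) (enterEvent p).azimuth 0
            (boundaries P (P.n - 1)).length)
          let s ← s.send P (c + 1) (.point p.1 p.2 z.height)
          if p.1 = 0 ∧ 0 < p.2 then s.send P 0 (.point p.1 p.2 z.height) else pure s) m.tick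
      (DistInv P Z m₀ (idx + 1)) := by
  have hlen : (gridPoints P.m).length = P.n := gridPoints_length _
  have hget : (gridPoints P.m)[idx]'(by omega) = pointAt P.m idx := by simp [gridPoints]
  have htake : (gridPoints P.m).take (idx + 1) = (gridPoints P.m).take idx ++ [pointAt P.m idx] := by
    rw [List.take_add_one, List.getElem?_eq_getElem (by omega), hget]
    rfl
  have hdrop : (gridPoints P.m).drop idx = pointAt P.m idx :: (gridPoints P.m).drop (idx + 1) := by
    rw [List.drop_eq_getElem_cons (by omega), hget]
  set p := pointAt P.m idx with hp
  have hfile : m.tick.disk s.input.file = chunks P.B (elevRecs Z (gridPoints P.m)) := by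
    rw [h.file, ← hin]
    exact h.other _ (by simp)
  refine (ReadStream.fill_holds hP.one_le hfile h.reading).bind ?_
  rintro r m₁ ⟨r1, r2, r3, r4, r5, r6, r7⟩
  simp only [Machine.tick_time, Machine.tick_disk, Machine.tick_peak, Machine.tick_ios] at r4 r5 r6 r7
  have hinv : DistInv P Z m₀ idx { s with input := r } { m₁ with time := m.time } := by
    refine ⟨r1.trans h.file, r2, ?_, ?_, h.total_le, h.time_le, by rw [r6]; exact h.peak_le, ?_⟩
    · intro k
      rw [r4]
      exact h.writing k
    · intro f hf
      rw [r4]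
      exact h.other f hf
    · have := h.ios_le
      change P.B * m₁.ios + _ + s.bufTotal _ ≤ _
      dsimp only
      omega
  have hfoot := hinv.footprint_le hP hidx.le
  rw [holds_bind, holds_use]
  rcases hbuf : r.buf with _ | ⟨z, buf⟩
  · have := r3 hbuf
    rw [hdrop] at this
    simp [elevRecs] at this
  · obtain ⟨rest, e1, e2⟩ := r2.skip hbuf
    rw [hdrop, elevRecs, List.map_cons, List.cons.injEq] at e1
    obtain ⟨rfl, rfl⟩ := e1
    have hpeak : max m₁.peak (DistState.footprint (boundaries P (P.n - 1)) { s with input := r } + 16) ≤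
        P.M := max_le hinv.peak_le hfoot
    have hpot := h.ios_le
    have htot := h.total_le
    have htime := h.time_le
    have hmul : (idx + 1) * (P.logSize + 12) = idx * (P.logSize + 12) + (P.logSize + 12) := by ring
    dsimp only
    by_cases hp0 : p = 0
    · rw [if_pos (show p = (0, 0) from hp0), holds_pure]
      refine ⟨r1.trans h.file, e2, ?_, ?_, ?_, ?_, hpeak, ?_⟩
      · intro k
        rw [htake, sectorRecs_append, if_neg, List.append_nil]
        · change Writing _ (m₁.disk _) _ _
          rw [r4]
          exact h.writing k
        · rw [hp0]
          rcases k with _ | k <;> simp [inSector, Right]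
      · intro f hf
        change m₁.disk f = _
        rw [r4]
        exact h.other f hf
      · change s.bufTotal _ ≤ _
        omega
      · change m₁.time ≤ _
        omega
      · change P.B * m₁.ios + readPotential _ _ r + s.bufTotal _ ≤ _
        omega
    · obtain ⟨c1, c2, c3⟩ := sectorOf_spec hP hp0
      rw [if_neg (by exact hp0), holds_bind, holds_internal]
      change Holds (DistState.send P _ (sectorOf P p + 1) _ >>= _) _ _
      have hw : ∀ k, Writing P.B (m₁.disk (.sector k)) (s.bufs k)
          (sectorRecs P Z k ((gridPoints P.m).take idx)) := by
        intro k
        rw [r4]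
        exact h.writing k
      refine (DistState.send_holds (s := ⟨r.skip, s.bufs⟩) (K := P.numBounds + 2)
        (xs := sectorRecs P Z (sectorOf P p + 1) ((gridPoints P.m).take idx)) hP.one_le (by omega)
        (by exact hw _)).bind ?_
      rintro s₂ m₂ ⟨d1, d2, d3, d4, d5, d6, d7, d8⟩
      change m₂.time ≤ m₁.time + _ + 2 at d5
      change P.B * m₂.ios + _ = P.B * m₁.ios + s.bufTotal _ + 1 at d7
      change _ ≤ s.bufTotal _ + 1 at d8
      dsimp only at d1 d3 d4 d6
      have hrec : (Rec.point p.1 p.2 (Rec.elev (Z p.1 p.2)).height) = pointRec Z p := rfl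
      rw [hrec] at d2 ⊢
      have hoth : ∀ k, k ≠ 0 → Writing P.B (m₂.disk (.sector k)) (s₂.bufs k)
          (sectorRecs P Z k ((gridPoints P.m).take (idx + 1))) := by
        intro k hk
        obtain ⟨k, rfl⟩ := Nat.exists_eq_succ_of_ne_zero hk
        rw [htake, sectorRecs_append]
        by_cases hkc : sectorOf P p = k
        · rw [if_pos (by simp [inSector, hp0, hkc])]
          subst hkc
          exact d2
        · rw [if_neg (by simp [inSector, hkc]), List.append_nil, d3 _ (by omega), d4 _ (by
            simp; omega)]
          exact hw _
      have h0 : Writing P.B (m₂.disk (.sector 0)) (s₂.bufs 0)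
          (sectorRecs P Z 0 ((gridPoints P.m).take idx)) := by
        rw [d3 _ (by omega), d4 _ (by simp)]
        exact hw 0
      have hpot2 : readPotential P.B (elevRecs Z (gridPoints P.m)) s₂.input =
          readPotential P.B (elevRecs Z (gridPoints P.m)) r := by rw [d1, readPotential_skip]
      by_cases hr : p.1 = 0 ∧ 0 < p.2
      · rw [if_pos hr]
        refine (DistState.send_holds (K := P.numBounds + 2) hP.one_le (by omega) h0).mono ?_
        rintro s₃ m₃ ⟨g1, g2, g3, g4, g5, g6, g7, g8⟩
        refine ⟨by rw [g1, d1]; exact r1.trans h.file, by rw [g1, d1]; exact e2, ?_, ?_, by omega,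
          by omega, by rw [g6, d6]; exact hpeak, ?_⟩
        · intro k
          rcases Nat.eq_zero_or_pos k with rfl | hk
          · rw [htake, sectorRecs_append, if_pos (by simp only [inSector, decide_eq_true_eq]; exact hr)]
            exact g2
          · rw [g3 _ (by omega), g4 _ (by simp; omega)]
            exact hoth k (by omega)
        · intro f hf
          rw [g4 _ (hf _), d4 _ (hf _), r4]
          exact h.other f hf
        · rw [g1, hpot2]
          omega
      · rw [if_neg hr, holds_pure]
        refine ⟨by rw [d1]; exact r1.trans h.file, by rw [d1]; exact e2, ?_, ?_, by omega,
          by omega, by rw [d6]; exact hpeak, ?_⟩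
        · intro k
          rcases Nat.eq_zero_or_pos k with rfl | hk
          · rw [htake, sectorRecs_append, if_neg (by simp only [inSector, decide_eq_true_eq]; exact hr),
              List.append_nil]
            exact h0
          · exact hoth k (by omega)
        · intro f hf
          rw [d4 _ (hf _), r4]
          exact h.other f hf
        · rw [hpot2]
          omega

theorem closeAll_holds {P : Params} (hB : 1 ≤ P.B) {bufs : ℕ → List Rec} {content : ℕ → List Rec}
    {m : Machine} (K : ℕ) (h : ∀ k, Writing P.B (m.disk (.sector k)) (bufs k) (content k)) :
    Holds (forLoop K (fun k _ => (⟨.sector k, bufs k⟩ : WriteStream).close P) ()) m fun _ m' =>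
      (∀ k < K, m'.disk (.sector k) = chunks P.B (content k)) ∧
      (∀ f, (∀ k, f ≠ .sector k) → m'.disk f = m.disk f) ∧
      m'.time ≤ m.time + K * 3 ∧ m'.peak = m.peak ∧ m'.ios ≤ m.ios + K := by
  have := holds_forLoop (n := K) (m := m) (s := ())
    (body := fun k _ => (⟨.sector k, bufs k⟩ : WriteStream).close P) (fun k _ m' =>
      ((∀ j < k, m'.disk (.sector j) = chunks P.B (content j)) ∧
      (∀ j, k ≤ j → m'.disk (.sector j) = m.disk (.sector j)) ∧
      (∀ f, (∀ k, f ≠ .sector k) → m'.disk f = m.disk f) ∧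
      m'.time ≤ m.time + k * 3 ∧ m'.peak = m.peak ∧ m'.ios ≤ m.ios + k)) ?_ ?_
  · exact this.mono fun _ m' ⟨h1, h2, h3⟩ => ⟨h1, h3⟩
  · exact ⟨by simp, fun _ _ => rfl, fun _ _ => rfl, by simp, rfl, by simp⟩
  · rintro k hk _ m' ⟨h1, h2, h3, h4, h5, h6⟩
    have hw := h k
    rw [← h2 k le_rfl] at hw
    refine (WriteStream.close_holds (m := m'.tick) (w := ⟨.sector k, bufs k⟩) hB hw).mono ?_
    rintro _ m'' ⟨g1, g2, g3, g4, g5⟩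
    refine ⟨?_, ?_, ?_, ?_, g4.trans h5, ?_⟩
    · intro j hj
      rcases Nat.lt_succ_iff_lt_or_eq.1 hj with hj | rfl
      · rw [g2 _ (by simp; omega)]
        exact h1 j hj
      · exact g1
    · intro j hj
      rw [g2 _ (by simp; omega)]
      exact h2 j (by omega)
    · intro f hf
      rw [g2 _ (hf _)]
      exact h3 f hf
    · simp only [Machine.tick_time] at g3
      omega
    · simp only [Machine.tick_ios] at g5
      omega

theorem distribute_holds {P : Params} (hP : P.Admissible) (Z : ℤ → ℤ → ℝ) {m : Machine}
    (hin : m.disk .input = chunks P.B (elevRecs Z (gridPoints P.m)))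
    (hsec : ∀ k, m.disk (.sector k) = []) (hpk : m.peak ≤ P.M) :
    Holds (distribute P (boundaries P (P.n - 1))) m fun _ m' =>
      (∀ k ≤ P.numBounds + 1,
        m'.disk (.sector k) = chunks P.B (sectorRecs P Z k (gridPoints P.m))) ∧
      (∀ f, (∀ k, f ≠ .sector k) → m'.disk f = m.disk f) ∧
      m'.time ≤ m.time + P.n * (P.logSize + 21) ∧ m'.peak ≤ P.M ∧
      P.B * m'.ios ≤ P.B * m.ios + 19 * P.n + 4 * P.B := by
  have hlen : (gridPoints P.m).length = P.n := gridPoints_length _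
  have hstart : DistInv P Z m 0 ⟨.ofFile .input, fun _ => []⟩ m := by
    refine ⟨rfl, by simpa using reading_ofFile _ _ _, ?_, fun _ _ => rfl, ?_, by simp, hpk, ?_⟩
    · intro k
      rw [hsec]
      simpa [sectorRecs] using writing_nil hP.one_le
    · simp [DistState.bufTotal]
    · have := readPotential_ofFile P.B (elevRecs Z (gridPoints P.m)) .input
      rw [elevRecs, List.length_map, hlen] at this
      simp only [DistState.bufTotal, List.length_nil, Finset.sum_const_zero]
      dsimp only [elevRecs]
      omega
  unfold distribute
  refine (holds_forLoop (DistInv P Z m) hstart fun idx hidx s m' h =>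
    distStep_holds hP Z hin hidx h).bind ?_
  intro s m' h
  refine (closeAll_holds hP.one_le _ h.writing).mono ?_
  rintro _ m'' ⟨g1, g2, g3, g4, g5⟩
  rw [boundaries_length] at g1 g3 g5
  have h1 := hP.numBounds_le_n
  have h2 := hP.numBounds_mul_B
  have h3 := h.ios_le
  have h4 := h.time_le
  have h5 := P.n_pos
  rw [List.take_of_length_le hlen.le] at g1
  refine ⟨fun k hk => g1 k (by omega), fun f hf => (g2 f hf).trans (h.other f hf), ?_,
    g4.trans_le h.peak_le, ?_⟩
  · have : P.n * (P.logSize + 21) = P.n * (P.logSize + 12) + 9 * P.n := by ring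
    omega
  · have h6 : P.B * m''.ios ≤ P.B * (m'.ios + (P.numBounds + 2)) := Nat.mul_le_mul_left _ g5
    have h7 : P.B * (m'.ios + (P.numBounds + 2)) =
        P.B * m'.ios + P.numBounds * P.B + 2 * P.B := by ring
    omega

/-! ## Second phase: the data structures of the sweep -/

/-- The elevation angle of a grid point. -/
def angleAt (Z : ℤ → ℤ → ℝ) (p : ℤ × ℤ) : ℝ := elevAngle p.1 p.2 (Z p.1 p.2)

/-- The active structure contains the active cells after `N` events. -/
structure ActiveInv (m : ℕ) (Z : ℤ → ℤ → ℝ) (N : ℕ) (A : Active) : Prop where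
  good : A.Good
  mem_iff : ∀ x, x ∈ A.toList ↔ ActiveAt m N x.1 ∧ x.2 = angleAt Z x.1

namespace ActiveInv

variable {m N : ℕ} {Z : ℤ → ℤ → ℝ} {A : Active}

theorem leaf (m : ℕ) (Z : ℤ → ℤ → ℝ) : ActiveInv m Z 0 .leaf :=
  ⟨Active.good_leaf, fun x => by simp [not_activeAt_zero]⟩

theorem keys_nodup (h : A.Good) : (A.toList.map Prod.fst).Nodup := by
  rw [List.nodup_iff_pairwise_ne, List.pairwise_map]
  refine List.Pairwise.imp ?_ h.sorted
  rintro a b h hc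
  rw [hc] at h
  exact lt_irrefl _ h

theorem length_le (h : ActiveInv m Z N A) (hN : N < (sweepEvents m).length) :
    A.toList.length ≤ 3 * (2 * m + 1) := by
  rw [← List.length_map (f := Prod.fst), ← List.toFinset_card_of_nodup (keys_nodup h.good)]
  have h0 := (mem_sweepEvents.1 (List.getElem_mem hN)).1.1
  refine card_inCone_le (Event.vec_ne_zero h0) _ fun q hq => ?_
  obtain ⟨x, hx, rfl⟩ := List.mem_map.1 (List.mem_toFinset.1 hq)
  have h1 := ((h.mem_iff x).1 hx).1
  exact ⟨h1.inGrid.1, h1.inGrid.2.1, h1.inGrid.2.2, h1.inCone hN⟩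

theorem insert (h : ActiveInv m Z N A) (hN : N < (sweepEvents m).length)
    (he : (sweepEvents m)[N].kind = .enter) :
    let x := Active.insert (sweepEvents m)[N].pos (angleAt Z (sweepEvents m)[N].pos) A
    ActiveInv m Z (N + 1) x.val ∧ x.val.toList.length = A.toList.length + 1 ∧
      x.cost ≤ A.ht + 1 := by
  obtain ⟨h1, h2⟩ := activeAt_enter hN he
  obtain ⟨g1, g2, -, -, g3⟩ := Active.insert_spec (sweepEvents m)[N].pos
    (angleAt Z (sweepEvents m)[N].pos) A h.good (by
      intro x hx hc
      exact h1 (hc ▸ ((h.mem_iff x).1 hx).1))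
  refine ⟨⟨g1, fun x => ?_⟩, by simpa using g2.length_eq, g3⟩
  rw [g2.mem_iff, List.mem_cons, h2, h.mem_iff]
  constructor
  · rintro (rfl | ⟨h3, h4⟩)
    · exact ⟨Or.inl rfl, rfl⟩
    · exact ⟨Or.inr h3, h4⟩
  · rintro ⟨h3 | h3, h4⟩
    · left
      refine Prod.ext h3 ?_
      rw [h4, h3]
    · exact Or.inr ⟨h3, h4⟩

theorem delete (h : ActiveInv m Z N A) (hN : N < (sweepEvents m).length)
    (he : (sweepEvents m)[N].kind = .exit) :
    let x := Active.delete (sweepEvents m)[N].pos A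
    ActiveInv m Z (N + 1) x.val ∧ x.val.toList.length ≤ A.toList.length ∧ x.cost ≤ A.ht + 1 := by
  obtain ⟨h1, h2⟩ := activeAt_exit hN he
  obtain ⟨g1, g2, -, -, g3⟩ := Active.delete_spec (sweepEvents m)[N].pos
    (angleAt Z (sweepEvents m)[N].pos) A h.good ((h.mem_iff _).2 ⟨h1, rfl⟩)
  have hnd := (g2.map Prod.fst).nodup_iff.1 (keys_nodup h.good)
  rw [List.map_cons, List.nodup_cons] at hnd
  refine ⟨⟨g1, fun x => ?_⟩, by rw [g2.length_eq]; simp, g3⟩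
  have h3 : x ∈ A.toList ↔ _ := g2.mem_iff
  rw [h.mem_iff, List.mem_cons] at h3
  rw [h2]
  constructor
  · intro hx
    obtain ⟨h4, h5⟩ := h3.2 (Or.inr hx)
    refine ⟨⟨h4, ?_⟩, h5⟩
    intro hc
    exact hnd.1 (List.mem_map.2 ⟨x, hx, hc⟩)
  · rintro ⟨⟨h4, h5⟩, h6⟩
    refine (h3.1 ⟨h4, h6⟩).resolve_left ?_
    rintro rfl
    exact h5 rfl

theorem center (h : ActiveInv m Z N A) (hN : N < (sweepEvents m).length)
    (he : (sweepEvents m)[N].kind = .center) : ActiveInv m Z (N + 1) A :=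
  ⟨h.good, fun x => by rw [h.mem_iff, activeAt_center hN he]⟩

/-- At the center event of `p`, the tree consists of the cells that meet the ray through `p`,
including that of `p` itself. By `blocks_iff` the strictly closer ones among them are exactly the
possible obstructions. -/
theorem isVisible (h : ActiveInv m Z N A) (hN : N < (sweepEvents m).length)
    (he : (sweepEvents m)[N].kind = .center) :
    ((Active.isVisible (sweepEvents m)[N].pos A).val = true ↔
      Visible m Z (sweepEvents m)[N].pos) ∧
    (Active.isVisible (sweepEvents m)[N].pos A).cost ≤ 2 * A.ht + 3 := by
  obtain ⟨hg, ht⟩ := mem_sweepEvents.1 (List.getElem_mem hN)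
  have heq : (sweepEvents m)[N] = ⟨.center, (sweepEvents m)[N].pos, 0⟩ := by
    have h1 : (sweepEvents m)[N].turn = 0 := ht.resolve_right (by simp [he])
    rcases hx : (sweepEvents m)[N] with ⟨k, p, t⟩
    rw [hx] at he h1
    simp only at he h1
    rw [he, h1]
  have hact : ∀ {q}, InGrid m q → (ActiveAt m N q ↔ _) := fun hq => activeAt_center_iff hN heq hq
  generalize (sweepEvents m)[N].pos = p at *
  have hself : ActiveAt m N p :=
    (hact hg).2 ⟨(cross_enter_center_pos hg.1).le, (cross_center_exit_pos hg.1).le⟩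
  obtain ⟨h1, h2⟩ := Active.isVisible_spec p (angleAt Z p) A h.good ((h.mem_iff _).2 ⟨hself, rfl⟩)
  refine ⟨h1.trans ?_, h2⟩
  rw [Visible, mem_gridPoints]
  constructor
  · intro hx
    refine ⟨hg.2, hg.1, fun q hq h0 hne hb => ?_⟩
    rw [blocks_iff hg.1 h0 hne] at hb
    exact hx (q, angleAt Z q) ((h.mem_iff _).2
      ⟨(hact ⟨h0, mem_gridPoints.1 hq⟩).2 hb.1, rfl⟩) hb.2
  · rintro ⟨-, -, hx⟩ x hxA hd
    obtain ⟨h3, h4⟩ := (h.mem_iff x).1 hxA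
    rw [h4]
    have hne : x.1 ≠ p := by
      intro hc
      rw [hc] at hd
      exact lt_irrefl _ hd
    refine hx x.1 (mem_gridPoints.2 h3.inGrid.2) h3.inGrid.1 hne ?_
    rw [blocks_iff hg.1 h3.inGrid.1 hne]
    exact ⟨(hact h3.inGrid).1 h3, hd⟩

end ActiveInv

/-- The queue contains the pending events after `N` events, with one enter event per layer. -/
structure QueueInv (m N : ℕ) (Q : Heap Event) : Prop where
  good : Q.Good Event.le (fun e => e.pos ≠ 0)
  pending : Pending (sweepEvents m) (rootEvents m) sweepChildren N Q.elems
  enters : Multiset.countP (fun e : Event => e.kind = .enter) Q.elems = m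

theorem dirKey_center_lt_exit {q : ℤ × ℤ} (hq : q ≠ 0) :
    dirKey (centerVec q) < dirKey (exitCorner q) := by
  by_cases hr : Right q
  · obtain ⟨-, h1, h2, -⟩ := dirKey_right hr
    rwa [h1]
  · exact (dirKey_corners hq hr).2

/-- A pending exit event belongs to an open stay. So does a pending center event, because the centre
of a cell is passed before the cell is left. -/
theorem activeAt_of_pending {m N : ℕ} {Q : Heap Event} (h : QueueInv m N Q) {e : Event}
    (he : e ∈ Q.elems) (hk : e.kind ≠ .enter) :
    ActiveAt m N e.pos ∧ (e.turn = 0 ∨ e.turn = 1) := by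
  obtain ⟨h1, h2⟩ := (h.pending.2 e).1 he
  obtain ⟨x, hx, hxe⟩ := h2.resolve_left fun hc => hk (mem_rootEvents.1 hc).1
  obtain ⟨hxk, hxe⟩ := mem_sweepChildren.1 hxe
  have hxU := List.mem_of_mem_take hx
  obtain ⟨hg, ht⟩ := mem_sweepEvents.1 hxU
  have hturn := turnAfter_cases (x := x) (by tauto)
  rcases hxe with rfl | rfl | rfl
  · refine ⟨⟨x, hx, hxk, rfl, fun hc => h1 ?_⟩, hturn⟩
    obtain ⟨i, hi, hi'⟩ := List.mem_take_iff_getElem.1 hc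
    have hexU := List.mem_of_mem_take hc
    obtain ⟨-, het⟩ := mem_sweepEvents.1 hexU
    have ht0 : turnAfter x = 0 := het.resolve_right (by simp [exitOf])
    have hcU : centerOf x ∈ sweepEvents m := mem_sweepEvents.2 ⟨hg, Or.inl ht0⟩
    obtain ⟨j, hj, hj'⟩ := List.getElem_of_mem hcU
    rw [List.mem_take_iff_getElem]
    refine ⟨j, ?_, hj'⟩
    rw [lt_min_iff] at hi ⊢
    refine ⟨?_, hj⟩
    by_contra hc2
    push Not at hc2
    have hlt : (exitOf x).key < (centerOf x).key := by
      rw [← hi', ← hj']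
      exact List.pairwise_iff_getElem.1 (sweepEvents_sorted m) _ _ hi.2 hj (by omega)
    have hlt' : (centerOf x).key < (exitOf x).key := by
      apply Event.key_lt_of_angle_lt
      simp only [Event.angle, centerOf, exitOf, Event.vec]
      have := (dirKey_center_lt_exit hg.1)
      linarith
    exact lt_irrefl _ (hlt.trans hlt')
  · exact ⟨⟨x, hx, hxk, rfl, h1⟩, hturn⟩
  · exact absurd rfl hk

/-- Besides one enter event per layer, the queue contains only center and exit events of active
cells, in round `0` or `1`: at most four per cell. -/
theorem QueueInv.card_le {m N : ℕ} {Q : Heap Event} (h : QueueInv m N Q) {Z : ℤ → ℤ → ℝ}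
    {A : Active} (hA : ActiveInv m Z N A) :
    Multiset.card Q.elems ≤ m + 4 * A.toList.length := by
  classical
  rw [Multiset.card_eq_countP_add_countP (fun e : Event => e.kind = .enter), h.enters]
  refine Nat.add_le_add_left ?_ m
  have hnd : (Q.elems.filter fun e : Event => ¬e.kind = .enter).Nodup := h.pending.1.filter _
  rw [Multiset.countP_eq_card_filter, ← Multiset.toFinset_card_of_nodup hnd]
  have hcard : ((({Kind.center, Kind.exit} : Finset Kind) ×ˢ ((A.toList.map Prod.fst).toFinset ×ˢ
      ({0, 1} : Finset ℤ)))).card ≤ 4 * A.toList.length := by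
    rw [Finset.card_product, Finset.card_product]
    have h1 := List.toFinset_card_le (A.toList.map Prod.fst)
    rw [List.length_map] at h1
    have h2 : ({Kind.center, Kind.exit} : Finset Kind).card = 2 := by decide
    have h3 : ({0, 1} : Finset ℤ).card = 2 := by decide
    rw [h2, h3]
    omega
  refine le_trans ?_ hcard
  refine Finset.card_le_card_of_injOn (fun e => (e.kind, e.pos, e.turn)) ?_ ?_
  · intro e he
    rw [Finset.mem_coe, Multiset.mem_toFinset, Multiset.mem_filter] at he
    obtain ⟨h1, h2⟩ := activeAt_of_pending h he.1 he.2
    rw [Finset.mem_coe, Finset.mem_product, Finset.mem_product]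
    refine ⟨?_, ?_, by simpa using h2⟩
    · have := he.2
      rcases e with ⟨k, p, t⟩
      cases k <;> simp at this ⊢
    · rw [List.mem_toFinset]
      exact List.mem_map.2 ⟨(e.pos, angleAt Z e.pos), (hA.mem_iff _).2 ⟨h1, rfl⟩, rfl⟩
  · intro e _ f _ hef
    simp only [Prod.mk.injEq] at hef
    rcases e with ⟨k, p, t⟩
    rcases f with ⟨k', p', t'⟩
    simp only at hef
    rw [hef.1, hef.2.1, hef.2.2]

theorem QueueInv.init {m : ℕ} {Q : Heap Event} (h1 : Q.Good Event.le (fun e => e.pos ≠ 0))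
    (h2 : Q.elems = rootEvents m) : QueueInv m 0 Q := by
  refine ⟨h1, by rw [h2]; exact (sweep_system m).pending_zero, ?_⟩
  rw [h2, Multiset.coe_countP, List.countP_eq_length.2, rootEvents_length]
  intro e he
  simpa using (mem_rootEvents.1 he).1

/-- An enter event is replaced by exactly one other enter event, and the other types have no
children, so the number of enter events is constant. -/
theorem QueueInv.step {m N : ℕ} {Q Q' Q'' : Heap Event} (h : QueueInv m N Q)
    (hN : N < (sweepEvents m).length) (h1 : Q.elems = (sweepEvents m)[N] ::ₘ Q'.elems)
    (h2 : Q''.Good Event.le (fun e => e.pos ≠ 0))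
    (h3 : Q''.elems = Q'.elems + sweepChildren (sweepEvents m)[N]) : QueueInv m (N + 1) Q'' := by
  refine ⟨h2, ?_, ?_⟩
  · rw [h3]
    exact (sweep_system m).step hN (h1 ▸ h.pending)
  · have h4 := h.enters
    rw [h1, Multiset.countP_cons] at h4
    rw [h3, Multiset.countP_add, Multiset.coe_countP]
    refine Eq.trans ?_ h4
    congr 1
    unfold sweepChildren
    split_ifs with hk
    · simp [centerOf, exitOf, nextEnter]
    · rfl

theorem schedule_children {m N : ℕ} {Q Q' : Heap Event} (h : QueueInv m N Q)
    (hN : N < (sweepEvents m).length) (h1 : Q.elems = (sweepEvents m)[N] ::ₘ Q'.elems)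
    (hQ' : Q'.Good Event.le (fun e => e.pos ≠ 0)) (he : (sweepEvents m)[N].kind = .enter)
    {s : ℕ} (hs : Multiset.card Q'.elems + 3 ≤ s) (mm : Machine) :
    Holds (do
      let Q ← schedule ⟨.center, (sweepEvents m)[N].pos, turnAfter (sweepEvents m)[N]⟩ Q'
      let Q ← schedule ⟨.exit, (sweepEvents m)[N].pos, turnAfter (sweepEvents m)[N]⟩ Q
      schedule ⟨.enter, nextCell (sweepEvents m)[N].pos, turnAfter (sweepEvents m)[N]⟩ Q) mm
      fun Q'' m' => QueueInv m (N + 1) Q'' ∧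
        Multiset.card Q''.elems = Multiset.card Q'.elems + 3 ∧ m'.disk = mm.disk ∧
        m'.time ≤ mm.time + 3 * Nat.log 2 s + 9 ∧ m'.ios = mm.ios ∧ m'.peak = mm.peak := by
  have hg := (mem_sweepEvents.1 (List.getElem_mem hN)).1
  refine (schedule_holds (e := ⟨.center, (sweepEvents m)[N].pos, turnAfter (sweepEvents m)[N]⟩)
    (s := s) hQ' hg.1 (by omega)).bind ?_
  rintro Q₁ m₁ ⟨a1, a2, a3, a4, a5, a6⟩
  refine (schedule_holds (e := ⟨.exit, (sweepEvents m)[N].pos, turnAfter (sweepEvents m)[N]⟩)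
    (s := s) a1 hg.1 (by rw [a2, Multiset.card_cons]; omega)).bind ?_
  rintro Q₂ m₂ ⟨b1, b2, b3, b4, b5, b6⟩
  refine (schedule_holds (s := s) b1 hg.next.1 (by
    rw [b2, Multiset.card_cons, a2, Multiset.card_cons]; omega)).mono ?_
  rintro Q₃ m₃ ⟨c1, c2, c3, c4, c5, c6⟩
  refine ⟨h.step hN h1 c1 ?_, ?_, c3.trans (b3.trans a3), by omega, c5.trans (b5.trans a5),
    c6.trans (b6.trans a6)⟩
  · rw [c2, b2, a2, sweepChildren, if_pos he]
    change nextEnter _ ::ₘ exitOf _ ::ₘ centerOf _ ::ₘ Q'.elems = _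
    rw [add_comm, ← Multiset.cons_coe, ← Multiset.cons_coe, ← Multiset.cons_coe, Multiset.coe_nil,
      Multiset.cons_add, Multiset.cons_add, Multiset.cons_add, zero_add,
      Multiset.cons_swap (nextEnter _), Multiset.cons_swap (nextEnter _),
      Multiset.cons_swap (exitOf _)]
  · rw [c2, b2, a2]
    simp

/-! ### Counting events -/

/-- The position of an element in a filtered list is the number of accepted elements before it. This
finds the enter events of the sweep in the sequence of stored records. -/
theorem getElem_filter_countP {α : Type} {p : α → Bool} {l : List α} {N : ℕ} (hN : N < l.length)
    (hp : p l[N] = true) : ∃ h : (l.take N).countP p < (l.filter p).length,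
      (l.filter p)[(l.take N).countP p] = l[N] := by
  have h1 : l.filter p = (l.take N).filter p ++ l[N] :: (l.drop (N + 1)).filter p := by
    conv_lhs => rw [← List.take_append_drop N l, List.drop_eq_getElem_cons hN, List.filter_append,
      List.filter_cons_of_pos hp]
  have h2 : (l.take N).countP p = ((l.take N).filter p).length := List.countP_eq_length_filter
  refine ⟨?_, ?_⟩
  · rw [h1, h2]
    simp
  · simp only [h1, h2]
    simp

/-- The number of enter events among the first `N` events. -/
def enterCount (m N : ℕ) : ℕ := ((sweepEvents m).take N).countP fun e => e.kind = .enter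

/-- The points whose center events are among the first `N` events. -/
def passed (m N : ℕ) : List (ℤ × ℤ) :=
  (((sweepEvents m).take N).filter fun e => e.kind = .center).map Event.pos

theorem enterCount_succ {m N : ℕ} (hN : N < (sweepEvents m).length) :
    enterCount m (N + 1) = enterCount m N + if (sweepEvents m)[N].kind = .enter then 1 else 0 := by
  rw [enterCount, List.take_add_one, List.getElem?_eq_getElem hN, List.countP_append]
  simp [enterCount, List.countP_cons]

theorem passed_succ {m N : ℕ} (hN : N < (sweepEvents m).length) :
    passed m (N + 1) =
      passed m N ++ if (sweepEvents m)[N].kind = .center then [(sweepEvents m)[N].pos] else [] := by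
  rw [passed, List.take_add_one, List.getElem?_eq_getElem hN, List.filter_append, List.map_append]
  split_ifs with h <;> simp [passed, h]

theorem getElem_enterPoints {m N : ℕ} (hN : N < (sweepEvents m).length)
    (he : (sweepEvents m)[N].kind = .enter) :
    ∃ h : enterCount m N < (enterPoints m).length,
      (enterPoints m)[enterCount m N] = (sweepEvents m)[N].pos := by
  obtain ⟨h1, h2⟩ := getElem_filter_countP (p := fun e : Event => e.kind = .enter) hN (by simpa using he)
  have h3 : enterPoints m = ((sweepEvents m).filter fun e => e.kind = .enter).map Event.pos := by
    rw [enterPoints, enterEvents_eq_filter]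
  refine ⟨by rw [h3, List.length_map]; exact h1, ?_⟩
  simp only [h3, List.getElem_map]
  exact congrArg Event.pos h2

theorem passed_all_perm (m : ℕ) : (passed m (sweepEvents m).length).Perm (cells m) := by
  have hnd : (passed m (sweepEvents m).length).Nodup := by
    rw [passed, List.take_length]
    refine List.Nodup.map_on ?_ ((sweepEvents_sorted m).nodup.filter _)
    intro e he f hf hef
    simp only [List.mem_filter, mem_sweepEvents, decide_eq_true_eq] at he hf
    obtain ⟨⟨-, h1⟩, h2⟩ := he
    obtain ⟨⟨-, g1⟩, g2⟩ := hf
    have h3 := h1.resolve_right (by simp [h2])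
    have g3 := g1.resolve_right (by simp [g2])
    rcases e with ⟨k, p, t⟩
    rcases f with ⟨k', p', t'⟩
    simp only at *
    rw [h2, g2, h3, g3, hef]
  rw [List.perm_ext_iff_of_nodup hnd (cells_nodup m)]
  intro p
  rw [mem_cells, passed, List.take_length, List.mem_map]
  constructor
  · rintro ⟨e, he, rfl⟩
    exact (mem_sweepEvents.1 (List.mem_filter.1 he).1).1
  · intro h
    exact ⟨⟨.center, p, 0⟩, by simp [mem_sweepEvents, h], rfl⟩

theorem passed_length_le (m N : ℕ) : (passed m N).length + 1 ≤ gridSize m := by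
  have h1 := (passed_all_perm m).length_eq
  have h2 := cells_length m
  have h3 : (passed m N).length ≤ (passed m (sweepEvents m).length).length := by
    rw [passed, passed, List.length_map, List.length_map, List.take_length]
    exact ((List.take_sublist N (sweepEvents m)).filter _).length_le
  omega

theorem passed_eq_of_length {m N : ℕ} (h : (passed m N).length + 1 = gridSize m) :
    (passed m N).Perm (cells m) := by
  have h1 : (passed m N).Sublist (passed m (sweepEvents m).length) := by
    rw [passed, passed, List.take_length]
    exact ((List.take_sublist N (sweepEvents m)).filter _).map _
  have h2 : passed m N = passed m (sweepEvents m).length := by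
    refine h1.eq_of_length ?_
    have := (passed_all_perm m).length_eq
    have := cells_length m
    omega
  rw [h2]
  exact passed_all_perm m

/-- All center events of the main round are in the list, so as long as one is missing the list is
not exhausted. The sweep thus never gets to events beyond the full turn. -/
theorem lt_length_of_passed {m N : ℕ} (h : (passed m N).length + 1 < gridSize m) :
    N < (sweepEvents m).length := by
  by_contra hc
  push Not at hc
  have h1 := (passed_all_perm m).length_eq
  have h2 := cells_length m
  rw [passed, List.take_of_length_le hc] at h
  rw [passed, List.take_length] at h1
  omega

/-! ## Second phase: the sweep -/

theorem sectorPoints_length_lt (P : Params) (k : ℕ) : (sectorPoints P k).length + 1 ≤ P.n := by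
  have h1 := enterOrder_length P.m
  have h2 : P.n = gridSize P.m := rfl
  rcases k with _ | k
  · have := P.width_le_n
    rw [sectorPoints, rootPoints_length]
    omega
  · have := List.length_filter_le (fun p => decide (sectorOf P p = k)) (enterOrder P.m)
    rw [sectorPoints]
    omega

theorem sectorRecs_length (P : Params) (Z : ℤ → ℤ → ℝ) (k : ℕ) :
    (sectorRecs P Z k (gridPoints P.m)).length = (sectorPoints P k).length := by
  rw [sectorRecs, List.length_map, (sectorPoints_perm P k).length_eq]

/-- The list takes `len / B` reads, rounded up, and one more that finds the end; multiplied by `B`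
this is at most `len + 2 * B`. The doubled space for records covers sorting. -/
theorem loadSector_holds {P : Params} (hP : P.Admissible) {Z : ℤ → ℤ → ℝ} {k : ℕ}
    (hk : k ≤ P.numBounds + 1) {s : SweepState} {m : Machine}
    (hfile : m.disk (.sector k) = chunks P.B (sectorRecs P Z k (gridPoints P.m)))
    (hspace : 2 * s.queue.size + 2 * s.active.size + 2 * (P.sectorCap + (4 * P.m + 3)) +
      s.out.buf.length + 16 ≤ P.M) (hpeak : m.peak ≤ P.M) :
    Holds (loadSector P k s) m fun s' m' =>
      s' = { s with sector := k, unread := (sectorPoints P k).map (pointRec Z) } ∧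
      m'.disk = m.disk ∧
      m'.time ≤ m.time + (sectorPoints P k).length * (3 * P.logSize + 7) + 5 ∧ m'.peak ≤ P.M ∧
      P.B * m'.ios ≤ P.B * m.ios + (sectorPoints P k).length + 2 * P.B := by
  have hB := hP.one_le
  set recs := sectorRecs P Z k (gridPoints P.m) with hrecs
  have hlen : recs.length = (sectorPoints P k).length := sectorRecs_length P Z k
  have hlen1 := sectorPoints_length_lt P k
  have hlen2 := sectorPoints_length_le hP hk
  set len := (sectorPoints P k).length
  unfold loadSector
  refine (holds_whileLoop (fun i (x : SweepState × ℕ × Bool) m' =>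
    x.1 = { s with sector := k, unread := recs.take (i * P.B) } ∧ x.2.1 = i ∧
    (x.2.2 = true → len ≤ i * P.B) ∧ (x.2.2 = false → P.B * i ≤ len + P.B) ∧
    P.B * i ≤ len + 2 * P.B ∧ m'.disk = m.disk ∧ m'.time = m.time + 2 * i ∧
    m'.ios = m.ios + i ∧ m'.peak ≤ P.M) (len + 2) ?_ (by omega) ?_).bind ?_
  · exact ⟨by simp, rfl, by simp, by simp, by omega, rfl, rfl, rfl, hpeak⟩
  · rintro i ⟨st, b, fin⟩ m' ⟨h1, h2, -, h4, h5, h6, h7, h8, h9⟩ hc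
    simp only at h1 h2 h4 hc
    subst h1 h2
    have hfin : fin = false := by simpa using hc
    have hi := h4 hfin
    refine ⟨?_, ?_⟩
    · by_contra hcon
      push Not at hcon
      have : P.B * (len + 2) ≤ P.B * b := Nat.mul_le_mul_left _ hcon
      have h10 : len ≤ P.B * len := Nat.le_mul_of_pos_left _ hB
      rw [mul_add] at this
      omega
    · rw [holds_bind, holds_readBlock]
      simp only [Machine.tick_disk, h6, hfile, getD_chunks hB]
      rw [holds_bind, holds_use, holds_pure]
      have htake : recs.take (b * P.B) ++ (recs.drop (b * P.B)).take P.B =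
          recs.take ((b + 1) * P.B) := by
        rw [add_mul, one_mul, List.take_add]
      have hmul : P.B * (b + 1) = P.B * b + P.B := by ring
      have hmul' : (b + 1) * P.B = P.B * b + P.B := by ring
      have hmul'' : b * P.B = P.B * b := mul_comm _ _
      refine ⟨by dsimp only; rw [htake], rfl, ?_, ?_, by omega, rfl, ?_, ?_, ?_⟩
      · intro h
        simp only [List.isEmpty_iff, List.take_eq_nil_iff, List.drop_eq_nil_iff] at h
        have := h.resolve_left (by omega)
        omega
      · intro h
        by_contra hcon
        have : recs.length ≤ b * P.B := by omega
        simp only [List.drop_of_length_le this, List.take_nil, List.isEmpty_nil] at h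
        exact absurd h (by simp)
      · simp only [Machine.tick_time, h7]; omega
      · simp only [Machine.tick_ios, h8]; omega
      · refine max_le h9 ?_
        simp only [SweepState.footprint, htake, List.length_take]
        omega
  · rintro ⟨st, b, fin⟩ m' ⟨hc, i, m'', ⟨h1, h2, h3, -, h5, h6, h7, h8, h9⟩, rfl⟩
    simp only at h1 h2 h3 hc
    have hfin : fin = true := by simpa using hc
    have hi := h3 hfin
    subst h1
    obtain ⟨g1, g2⟩ := sort_sectorRecs P Z k
    rw [← hrecs] at g1 g2
    have htake : recs.take (i * P.B) = recs := List.take_of_length_le (by omega)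
    rw [holds_bind, holds_internal, holds_pure]
    dsimp only
    change (SweepState.mk _ _ _ (sortList enterLe (recs.take (i * P.B))).val _ _) = _ ∧ _ ∧
      _ + (sortList enterLe (recs.take (i * P.B))).cost ≤ _ ∧ _ ∧ _
    rw [htake, g1]
    have hn := P.n_pos
    have hcost := g2 (64 * P.n) (by omega)
    change _ ≤ len * (3 * P.logSize + 5) at hcost
    refine ⟨rfl, h6, ?_, h9, ?_⟩
    · simp only [Machine.tick_time, h7]
      have h10 : i ≤ len + 2 := by
        by_contra hcon
        push Not at hcon
        have : P.B * (len + 3) ≤ P.B * i := Nat.mul_le_mul_left _ hcon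
        have h10 : len ≤ P.B * len := Nat.le_mul_of_pos_left _ hB
        rw [mul_add] at this
        omega
      have : len * (3 * P.logSize + 7) = len * (3 * P.logSize + 5) + 2 * len := by ring
      omega
    · simp only [Machine.tick_ios, h8]
      rw [mul_add]
      omega

open Classical in
/-- The visible points of a list. -/
def visiblePoints (m : ℕ) (Z : ℤ → ℤ → ℝ) (l : List (ℤ × ℤ)) : List (ℤ × ℤ) :=
  l.filter fun p => decide (Visible m Z p)

/-- The output record of a visible point. -/
def coordRec (p : ℤ × ℤ) : Rec := .coord p.1 p.2

/-- The invariant of the sweep after `N` events. -/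
structure SweepInv (P : Params) (Z : ℤ → ℤ → ℝ) (m₀ : Machine) (N : ℕ) (s : SweepState)
    (m : Machine) : Prop where
  queue : QueueInv P.m N s.queue
  active : ActiveInv P.m Z N s.active
  sector_le : s.sector ≤ P.numBounds + 1
  unread : s.unread = (((enterPoints P.m).take (sectorEnd P s.sector)).drop
    (enterCount P.m N)).map (pointRec Z)
  count_le : enterCount P.m N ≤ sectorEnd P s.sector
  unread_le : s.unread.length ≤ P.sectorCap + (4 * P.m + 3)
  queue_le : Multiset.card s.queue.elems ≤ 13 * (2 * P.m + 1) + 2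
  active_le : s.active.toList.length ≤ 3 * (2 * P.m + 1) + 1
  file : s.out.file = .visible
  writing : Writing P.B (m.disk .visible) s.out.buf
    ((visiblePoints P.m Z (passed P.m N)).map coordRec)
  other : ∀ f ≠ .visible, m.disk f = m₀.disk f
  remaining : s.remaining + (passed P.m N).length + 1 = P.n
  time_le : m.time ≤ m₀.time + N * (7 * P.logSize + 20) +
    sectorEnd P s.sector * (3 * P.logSize + 7) + (s.sector + 1) * 6
  peak_le : m.peak ≤ P.M
  ios_le : P.B * m.ios + s.out.buf.length ≤ P.B * m₀.ios + sectorEnd P s.sector +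
    2 * P.B * (s.sector + 1) + (visiblePoints P.m Z (passed P.m N)).length

/-- The queue has at most `m + 4 * 3 * (2 * m + 1)` elements before an event, and an enter event
adds at most two more. All this is small against `M ≥ 1024 * (2 * m + 1)`; the sector takes about `M
/ 8` and the write buffer at most `M / 2`. -/
theorem Params.Admissible.sweep_space {P : Params} (hP : P.Admissible) {q a b : ℕ}
    (hq : q ≤ 13 * (2 * P.m + 1) + 2) (ha : a ≤ 3 * (2 * P.m + 1) + 1) (hb : b < P.B) :
    2 * q + 2 * a + 2 * (P.sectorCap + (4 * P.m + 3)) + b + 16 ≤ P.M := by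
  have h1 := hP.width_le
  have h2 := hP.two_mul_le
  unfold Params.sectorCap
  omega

theorem SweepInv.footprint_le {P : Params} (hP : P.Admissible) {Z : ℤ → ℤ → ℝ} {m₀ m : Machine}
    {N : ℕ} {s : SweepState} (h : SweepInv P Z m₀ N s m) : s.footprint + 16 ≤ P.M := by
  have h1 := hP.sweep_space h.queue_le h.active_le h.writing.short
  have h2 := h.unread_le
  rw [SweepState.footprint, Heap.size_eq, Active.size_eq]
  omega

/-- Allows the continuation behind a conditional to be treated once instead of in both branches. -/
theorem holds_ite_bind {α β : Type} {c : Prop} [Decidable c] {x y : EM α} {f : α → EM β}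
    {m : Machine} {Q : β → Machine → Prop} (h : Holds ((if c then x else y) >>= f) m Q) :
    Holds (if c then x >>= f else y >>= f) m Q := by
  split_ifs at h ⊢ <;> exact h

/-- Before an enter event, the first unread record is the one of the entered point. If there is
none, the current list has been used up exactly and the next one starts with this record. Time and
I/Os of loading are charged to the growth of `sectorEnd` and of the sector number. -/
theorem refill_holds {P : Params} (hP : P.Admissible) {Z : ℤ → ℤ → ℝ} {m₀ m m₁ : Machine}
    (hsec : ∀ k ≤ P.numBounds + 1,
      m₀.disk (.sector k) = chunks P.B (sectorRecs P Z k (gridPoints P.m)))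
    {N : ℕ} {s : SweepState} (h : SweepInv P Z m₀ N s m) (hN : N < (sweepEvents P.m).length)
    (he : (sweepEvents P.m)[N].kind = .enter) {Q : Heap Event}
    (hQ : Multiset.card Q.elems ≤ Multiset.card s.queue.elems) (hd : m₁.disk = m.disk)
    (hpk : m₁.peak ≤ P.M) :
    Holds (if s.unread.isEmpty then loadSector P (s.sector + 1) { s with queue := Q }
      else pure { s with queue := Q }) m₁ fun s' m' => ∃ k l,
      s' = { s with queue := Q, sector := k, unread := pointRec Z (sweepEvents P.m)[N].pos :: l } ∧
      k ≤ P.numBounds + 1 ∧ enterCount P.m N < sectorEnd P k ∧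
      l = (((enterPoints P.m).take (sectorEnd P k)).drop (enterCount P.m N + 1)).map (pointRec Z) ∧
      l.length + 1 ≤ P.sectorCap + (4 * P.m + 3) ∧ m'.disk = m.disk ∧
      m'.time + sectorEnd P s.sector * (3 * P.logSize + 7) + s.sector * 6 ≤
        m₁.time + sectorEnd P k * (3 * P.logSize + 7) + k * 6 ∧
      m'.peak ≤ P.M ∧
      P.B * m'.ios + sectorEnd P s.sector + 2 * P.B * s.sector ≤
        P.B * m₁.ios + sectorEnd P k + 2 * P.B * k := by
  obtain ⟨hc, hget⟩ := getElem_enterPoints hN he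
  have hcons : ∀ k, enterCount P.m N < sectorEnd P k →
      (((enterPoints P.m).take (sectorEnd P k)).drop (enterCount P.m N)).map (pointRec Z) =
        pointRec Z (sweepEvents P.m)[N].pos ::
        (((enterPoints P.m).take (sectorEnd P k)).drop (enterCount P.m N + 1)).map (pointRec Z) := by
    intro k hk
    rw [List.drop_eq_getElem_cons (by rw [List.length_take, lt_min_iff]; exact ⟨hk, hc⟩),
      List.getElem_take, hget, List.map_cons]
  have hlen := congrArg List.length h.unread
  rw [List.length_map, List.length_drop, List.length_take, min_eq_left (sectorEnd_le P _)] at hlen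
  split_ifs with hem
  · rw [List.isEmpty_iff] at hem
    rw [hem, List.length_nil] at hlen
    have hle := sectorEnd_le P s.sector
    -- The last list ends with the last enter event, so a further enter event shows that the current
    -- list is not the last one.
    have hne : s.sector ≠ P.numBounds + 1 := by
      intro hcon
      have := sectorEnd_last hP
      rw [hcon] at hlen hle
      omega
    have hk : s.sector ≤ P.numBounds := by have := h.sector_le; omega
    have hn : 2 ≤ P.n := by
      have h1 := enterPoints_length P
      have h2 := P.width_le_n
      omega
    have hlt := sectorEnd_lt hP hn hk
    have hsucc := sectorEnd_succ hP s.sector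
    have hcle := h.count_le
    refine (loadSector_holds (k := s.sector + 1) hP (by omega) (Z := Z) ?_ ?_ hpk).mono ?_
    · rw [hd, h.other _ (by simp)]
      exact hsec _ (by omega)
    · rw [Heap.size_eq, Active.size_eq]
      exact hP.sweep_space (hQ.trans h.queue_le) h.active_le h.writing.short
    · rintro s' m' ⟨g1, g2, g3, g4, g5⟩
      have hceq : enterCount P.m N = sectorEnd P s.sector := by omega
      have hun := congrArg (List.map (pointRec Z)) (take_sectorEnd_succ hP s.sector).symm
      rw [← hceq, hcons _ (by omega)] at hun
      have hl := congrArg List.length hun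
      rw [List.length_map, List.length_cons] at hl
      have := sectorPoints_length_le hP (k := s.sector + 1) (by omega)
      refine ⟨s.sector + 1, _, ?_, by omega, by omega, rfl, by omega, g2.trans hd, ?_, g4, ?_⟩
      · rw [g1, hun]
      · rw [hsucc, add_mul (sectorEnd P s.sector), add_mul s.sector]
        omega
      · rw [hsucc, mul_add (2 * P.B)]
        omega
  · rw [holds_pure]
    rw [List.isEmpty_iff] at hem
    have hpos := List.length_pos_of_ne_nil hem
    have hun := h.unread.trans (hcons s.sector (by omega))
    have hl := congrArg List.length hun
    rw [List.length_cons] at hl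
    have := h.unread_le
    refine ⟨s.sector, _, ?_, h.sector_le, by omega, rfl, by omega, hd, le_rfl, hpk, le_rfl⟩
    rw [← hun]

theorem visiblePoints_append (m : ℕ) (Z : ℤ → ℤ → ℝ) (l l' : List (ℤ × ℤ)) :
    visiblePoints m Z (l ++ l') = visiblePoints m Z l ++ visiblePoints m Z l' := by
  simp [visiblePoints]

theorem SweepInv.ht_le {P : Params} {Z : ℤ → ℤ → ℝ} {m₀ m : Machine}
    {N : ℕ} {s : SweepState} (h : SweepInv P Z m₀ N s m) :
    s.active.ht ≤ 2 * (P.logSize + 1) := by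
  refine Active.ht_le_log h.active.good.balanced ?_
  have h1 := h.active_le
  have h2 := P.width_le_n
  omega

theorem sweepStep_holds {P : Params} (hP : P.Admissible) {Z : ℤ → ℤ → ℝ} {m₀ m : Machine}
    (hsec : ∀ k ≤ P.numBounds + 1,
      m₀.disk (.sector k) = chunks P.B (sectorRecs P Z k (gridPoints P.m)))
    {N : ℕ} {s : SweepState} (h : SweepInv P Z m₀ N s m) (hN : N < (sweepEvents P.m).length) :
    Holds (sweepStep P s) m.tick (SweepInv P Z m₀ (N + 1)) := by
  have hfoot := h.footprint_le hP
  -- The geometric size bounds need a current event to give the direction of the ray. They are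
  -- applied before the event; the invariant for the state after it only allows for the growth
  -- caused by one event, so that it also makes sense at the end of the list.
  have hactive := h.active.length_le hN
  have hqueue := h.queue.card_le h.active
  have hht := h.ht_le
  have hw := P.width_le_n
  obtain ⟨Q, d1, d2, d3, d4⟩ := (sweep_system P.m).pop (s := 64 * P.n) h.queue.good h.queue.pending hN
    (by omega)
  change _ ≤ 2 * P.logSize + 2 at d4
  have hcard : Multiset.card Q.elems + 1 = Multiset.card s.queue.elems := by
    rw [d2, Multiset.card_cons]
  have hcount := enterCount_succ hN
  have hpass := passed_succ hN
  have htime := h.time_le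
  have hmul : (N + 1) * (7 * P.logSize + 20) = N * (7 * P.logSize + 20) + (7 * P.logSize + 20) := by
    ring
  have hpeak := h.peak_le
  have hios := h.ios_le
  have hun := h.unread_le
  have hrem := h.remaining
  unfold sweepStep
  rw [holds_bind, holds_use, holds_bind, holds_internal, d1]
  dsimp only
  suffices H : Holds (match (sweepEvents P.m)[N].kind with
      | .enter => processEnter P (sweepEvents P.m)[N] { s with queue := Q }
      | .center => processCenter P (sweepEvents P.m)[N] { s with queue := Q }
      | .exit => processExit (sweepEvents P.m)[N] { s with queue := Q })
      { m.tick with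
        time := m.tick.time + (Heap.deleteMin Event.le s.queue).cost
        peak := max m.tick.peak (s.footprint + 16) } (SweepInv P Z m₀ (N + 1)) by
    -- The measurement of memory after the event is the same for all three types.
    have H' : ∀ s' m', SweepInv P Z m₀ (N + 1) s' m' →
        Holds (do use s'.footprint; pure s') m' (SweepInv P Z m₀ (N + 1)) := by
      intro s' m' h'
      rw [holds_bind, holds_use, holds_pure]
      exact { h' with peak_le := max_le h'.peak_le (h'.footprint_le hP) }
    revert H
    rcases (sweepEvents P.m)[N].kind with _ | _ | _ <;> intro H <;> exact H.bind H'
  have hpeak' : max m.tick.peak (s.footprint + 16) ≤ P.M := max_le h.peak_le hfoot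
  rcases hk : (sweepEvents P.m)[N].kind with _ | _ | _
  · -- a cell is entered
    rw [if_pos hk] at hcount
    rw [if_neg (by rw [hk]; simp), List.append_nil] at hpass
    dsimp only
    unfold processEnter
    rw [holds_bind, holds_step]
    have hR := fun mm (h1 : mm.disk = m.disk) (h2 : mm.peak ≤ P.M) =>
      refill_holds hP hsec h hN hk (Q := Q) (m₁ := mm) (by omega) h1 h2
    refine holds_ite_bind (Holds.bind (hR _ ?_ ?_) ?_)
    · rfl
    · exact hpeak'
    rintro _ m₂ ⟨k, l, rfl, e2, e0, e3, e4, e5, e6, e7, e8⟩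
    simp only [Machine.tick_time, Machine.tick_ios] at e6 e8
    obtain ⟨a1, a2, a3⟩ := h.active.insert hN hk
    dsimp only
    rw [holds_bind, holds_internal]
    have hch := schedule_children h.queue hN d2 d3 hk (s := 64 * P.n) (by omega)
      { m₂ with time := m₂.time + (Active.insert (sweepEvents P.m)[N].pos
        (angleAt Z (sweepEvents P.m)[N].pos) s.active).cost }
    simp only [← bind_assoc] at hch ⊢
    refine hch.bind ?_
    rintro Q₃ m₃ ⟨c1, c2, c3, c4, c5, c6⟩
    change _ ≤ _ + 3 * P.logSize + 9 at c4
    rw [holds_pure]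
    refine ⟨c1, a1, e2, ?_, ?_, ?_, ?_, ?_, h.file, ?_, ?_, ?_, ?_, ?_, ?_⟩
    · rw [hcount]; exact e3
    · rw [hcount]; exact e0
    · dsimp only; omega
    · dsimp only; omega
    · change (Active.insert _ (angleAt Z (sweepEvents P.m)[N].pos) _).val.toList.length ≤ _
      omega
    · rw [hpass, c3, e5]; exact h.writing
    · intro f hf
      rw [c3, e5]; exact h.other f hf
    · rw [hpass]; exact hrem
    · dsimp only; omega
    · rw [c6]; exact e7
    · rw [hpass, c5]
      dsimp only
      rw [mul_add] at hios ⊢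
      omega
  · -- the centre of a cell is passed
    rw [if_neg (by rw [hk]; simp), Nat.add_zero] at hcount
    rw [if_pos hk] at hpass
    have hlen := passed_length_le P.m (N + 1)
    change _ ≤ P.n at hlen
    rw [hpass, List.length_append, List.length_singleton] at hlen
    dsimp only
    unfold processCenter
    rw [holds_bind, holds_step, holds_bind, holds_internal]
    obtain ⟨v1, v2⟩ := h.active.isVisible hN hk
    have hq : QueueInv P.m (N + 1) Q := h.queue.step hN d2 d3 (by simp [sweepChildren, hk])
    have ha := h.active.center hN hk
    have hremaining : s.remaining - 1 + (passed P.m (N + 1)).length + 1 = P.n := by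
      rw [hpass, List.length_append, List.length_singleton]
      omega
    dsimp only
    by_cases hvis : Visible P.m Z (sweepEvents P.m)[N].pos
    · rw [if_pos (v1.2 hvis)]
      have hvp : visiblePoints P.m Z (passed P.m (N + 1)) =
          visiblePoints P.m Z (passed P.m N) ++ [(sweepEvents P.m)[N].pos] := by
        rw [hpass, visiblePoints_append]
        simp [visiblePoints, hvis]
      refine (WriteStream.push_holds (w := s.out)
        (xs := (visiblePoints P.m Z (passed P.m N)).map coordRec) hP.one_le
        (by rw [h.file]; exact h.writing)).bind ?_
      rintro w m₂ ⟨w1, w2, w3, w4, w5, w6, w7⟩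
      rw [h.file] at w1 w2 w3
      simp only [Machine.tick_time, Machine.tick_ios] at w4 w6
      rw [holds_pure]
      refine ⟨hq, ha, h.sector_le, by rw [hcount]; exact h.unread, by rw [hcount]; exact h.count_le,
        hun, by dsimp only; omega, h.active_le, w1, ?_, fun f hf => (w3 f hf).trans (h.other f hf),
        hremaining, ?_, ?_, ?_⟩
      · rw [hvp, List.map_append]
        exact w2
      · dsimp only; omega
      · rw [w5]; exact hpeak'
      · rw [hvp, List.length_append, List.length_singleton]
        dsimp only
        omega
    · rw [if_neg (by rw [v1]; exact hvis), holds_bind, holds_pure, holds_pure]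
      have hvp : visiblePoints P.m Z (passed P.m (N + 1)) =
          visiblePoints P.m Z (passed P.m N) := by
        rw [hpass, visiblePoints_append]
        simp [visiblePoints, hvis]
      refine ⟨hq, ha, h.sector_le, by rw [hcount]; exact h.unread, by rw [hcount]; exact h.count_le,
        hun, by dsimp only; omega, h.active_le, h.file, by rw [hvp]; exact h.writing, h.other,
        hremaining, ?_, hpeak', by rw [hvp]; exact hios⟩
      simp only [Machine.tick_time]
      omega
  · -- a cell is left
    rw [if_neg (by rw [hk]; simp), Nat.add_zero] at hcount
    rw [if_neg (by rw [hk]; simp), List.append_nil] at hpass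
    dsimp only
    unfold processExit
    rw [holds_bind, holds_step, holds_bind, holds_internal, holds_pure]
    obtain ⟨a1, a2, a3⟩ := h.active.delete hN hk
    refine ⟨h.queue.step hN d2 d3 (by simp [sweepChildren, hk]), a1, h.sector_le,
      by rw [hcount]; exact h.unread, by rw [hcount]; exact h.count_le, hun, by dsimp only; omega,
      by dsimp only; omega, h.file, by rw [hpass]; exact h.writing, h.other,
      by rw [hpass]; exact hrem, ?_, hpeak', by rw [hpass]; exact hios⟩
    simp only [Machine.tick_time]
    omega

theorem sweepInv_init {P : Params} (hP : P.Admissible) {Z : ℤ → ℤ → ℝ} {m₀ m : Machine}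
    {Q : Heap Event} (h1 : Q.Good Event.le (fun e => e.pos ≠ 0)) (h2 : Q.elems = rootEvents P.m)
    (hvis : m₀.disk .visible = []) (hdisk : m.disk = m₀.disk)
    (htime : m.time ≤ m₀.time + (sectorPoints P 0).length * (3 * P.logSize + 7) + 5)
    (hpeak : m.peak ≤ P.M)
    (hios : P.B * m.ios ≤ P.B * m₀.ios + (sectorPoints P 0).length + 2 * P.B) :
    SweepInv P Z m₀ 0
      ⟨Q, .leaf, 0, (sectorPoints P 0).map (pointRec Z), ⟨.visible, []⟩, P.n - 1⟩ m := by
  have hn := P.n_pos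
  have hlen : (sectorPoints P 0).length = P.m := rootPoints_length _
  have hend := sectorEnd_zero P
  have hpass : passed P.m 0 = [] := by simp [passed]
  have hcount : enterCount P.m 0 = 0 := by simp [enterCount]
  rw [hlen] at htime hios
  refine ⟨QueueInv.init h1 h2, ActiveInv.leaf _ _, Nat.zero_le _, ?_, ?_, ?_, ?_, ?_, rfl, ?_, ?_,
    ?_, ?_, hpeak, ?_⟩
  · dsimp only
    rw [take_sectorEnd_zero, hcount, List.drop_zero]
  · rw [hcount]; exact Nat.zero_le _
  · rw [List.length_map]
    exact sectorPoints_length_le hP (Nat.zero_le _)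
  · rw [h2, Multiset.coe_card, rootEvents_length]
    omega
  · simp
  · rw [hdisk, hvis, hpass]
    simpa [visiblePoints] using writing_nil hP.one_le
  · intro f _
    rw [hdisk]
  · rw [hpass]
    dsimp only [List.length_nil]
    omega
  · rw [hend]
    omega
  · rw [hend, hpass]
    simp only [visiblePoints, List.filter_nil, List.length_nil]
    omega

theorem visiblePoints_cells (m : ℕ) (Z : ℤ → ℤ → ℝ) :
    visiblePoints m Z (cells m) = visiblePoints m Z (gridPoints m) := by
  rw [visiblePoints, visiblePoints, cells, List.filter_filter]
  refine List.filter_congr fun p _ => ?_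
  have : Visible m Z p → p ≠ 0 := fun h => h.2.1
  by_cases hv : Visible m Z p <;> simp_all

/-- There are `m + 3 * n - 3` events up to the full turn, less than the fuel `4 * n`, and the loop
stops when all centres have been passed. The visible points come out in the order of the sweep, so
only their list up to permutation is specified. -/
theorem sweep_holds {P : Params} (hP : P.Admissible) {Z : ℤ → ℤ → ℝ} {m : Machine}
    (hsec : ∀ k ≤ P.numBounds + 1,
      m.disk (.sector k) = chunks P.B (sectorRecs P Z k (gridPoints P.m)))
    (hvis : m.disk .visible = []) (hpk : m.peak ≤ P.M) :
    Holds (sweep P) m fun _ m' =>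
      (∃ L : List (ℤ × ℤ), L.Perm (visiblePoints P.m Z (gridPoints P.m)) ∧
        m'.disk .visible = chunks P.B (L.map coordRec)) ∧
      (∀ f ≠ .visible, m'.disk f = m.disk f) ∧
      m'.time ≤ m.time + P.n * (35 * P.logSize + 130) ∧ m'.peak ≤ P.M ∧
      P.B * m'.ios ≤ P.B * m.ios + 35 * P.n + 5 * P.B := by
  have hn := P.n_pos
  have hw := P.width_le_n
  have hlenU : (sweepEvents P.m).length + 3 = P.m + 3 * P.n := sweepEvents_length P.m
  unfold sweep
  refine (initialQueue_holds P m).bind ?_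
  rintro Q m₀ ⟨q1, q2, q3, q4, q5, q6⟩
  refine (loadSector_holds (k := 0) (s := ⟨Q, .leaf, 0, [], ⟨.visible, []⟩, P.n - 1⟩) hP
    (Nat.zero_le _) (by rw [q3]; exact hsec 0 (Nat.zero_le _)) ?_ (q6.trans_le hpk)).bind ?_
  · rw [Heap.size_eq, q2, Multiset.coe_card, rootEvents_length]
    exact hP.sweep_space (q := P.m) (a := 0) (b := 0) (by omega) (by omega)
      (by have := hP.one_le; omega)
  rintro _ m₁ ⟨rfl, l2, l3, l4, l5⟩
  have hinit := sweepInv_init hP (Z := Z) q1 q2 (by rw [q3]; exact hvis) l2 l3 l4 l5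
  refine (holds_whileLoop (fun N s m' => N ≤ (sweepEvents P.m).length ∧ SweepInv P Z m₀ N s m')
    (sweepEvents P.m).length ⟨Nat.zero_le _, hinit⟩ (by omega) ?_).bind ?_
  · rintro N s m' ⟨-, h⟩ hc
    have hrem := h.remaining
    have hN := lt_length_of_passed (m := P.m) (N := N) (by
      change _ < P.n
      have : 0 < s.remaining := by simpa using hc
      omega)
    exact ⟨hN, (sweepStep_holds hP (fun k hk => by rw [q3]; exact hsec k hk) h hN).mono
      fun _ _ h' => ⟨hN, h'⟩⟩
  · rintro s _ ⟨hc, N, m', ⟨hN, h⟩, rfl⟩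
    have hrem := h.remaining
    have hz : s.remaining = 0 := by simpa using hc
    have hperm := passed_eq_of_length (m := P.m) (N := N) (by change _ = P.n; omega)
    have hwr : Writing P.B (m'.tick.disk s.out.file) s.out.buf
        ((visiblePoints P.m Z (passed P.m N)).map coordRec) := by
      rw [h.file]
      exact h.writing
    refine (WriteStream.close_holds hP.one_le hwr).mono ?_
    rintro _ m'' ⟨c1, c2, c3, c4, c5⟩
    rw [h.file] at c1 c2
    have hend : sectorEnd P s.sector ≤ 2 * P.n := by
      have := sectorEnd_le P s.sector
      rw [enterPoints_length] at this
      omega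
    have hsl := h.sector_le
    have hnb := hP.numBounds_le_n
    have hnB := hP.numBounds_mul_B
    refine ⟨⟨_, ?_, c1⟩, ?_, ?_, ?_, ?_⟩
    · rw [← visiblePoints_cells]
      exact hperm.filter _
    · intro f hf
      rw [c2 f hf]
      exact (h.other f hf).trans (by rw [q3])
    · have ht := h.time_le
      have e1 : N * (7 * P.logSize + 20) ≤ (4 * P.n) * (7 * P.logSize + 20) :=
        Nat.mul_le_mul_right _ (by omega)
      have e2 : sectorEnd P s.sector * (3 * P.logSize + 7) ≤ (2 * P.n) * (3 * P.logSize + 7) :=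
        Nat.mul_le_mul_right _ hend
      have e3 : P.m * (P.logSize + 4) ≤ P.n * (P.logSize + 4) := Nat.mul_le_mul_right _ (by omega)
      have e4 : P.n * (P.logSize + 4) + ((4 * P.n) * (7 * P.logSize + 20) +
          (2 * P.n) * (3 * P.logSize + 7)) + 32 * P.n = P.n * (35 * P.logSize + 130) := by ring
      simp only [Machine.tick_time] at c3
      omega
    · rw [c4]
      exact h.peak_le
    · have hi := h.ios_le
      have e1 : P.B * m''.ios ≤ P.B * (m'.ios + 1) := Nat.mul_le_mul_left _ c5
      -- Two extra blocks per list amount to at most `32 * n + 4 * B`. Together with at most `2 * n`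
      -- records read, `n` written and one last block this makes `35 * n + 5 * B`.
      have e2 : 2 * P.B * (s.sector + 1) ≤ 2 * P.B * (P.numBounds + 2) :=
        Nat.mul_le_mul_left _ (by omega)
      have e3 : 2 * P.B * (P.numBounds + 2) = 2 * (P.numBounds * P.B) + 4 * P.B := by ring
      have e4 : (visiblePoints P.m Z (passed P.m N)).length ≤ (passed P.m N).length :=
        List.length_filter_le _ _
      rw [q5] at hi
      rw [mul_add, mul_one] at e1
      omega

/-! ## Third phase: the initial runs -/

theorem coordLe_iff (a b : Rec) : coordLe a b = true ↔
    toLex (a.pos.1, a.pos.2) ≤ toLex (b.pos.1, b.pos.2) := by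
  rw [← not_lt, Prod.Lex.toLex_lt_toLex]
  simp [coordLe, ← Bool.not_eq_true, lexLt_cons, lexLt_nil]

theorem totalOn_coordLe : TotalOn coordLe (fun _ => True) :=
  .of_key (fun a => toLex (a.pos.1, a.pos.2)) fun a b _ _ => coordLe_iff a b

/-- Number of records per initial run. -/
def Params.runSize (P : Params) : ℕ := P.runBlocks * P.B

/-- The content of an initial run, if the list of visible points is `xs`. -/
def initialRun (P : Params) (xs : List Rec) (k : ℕ) : List Rec :=
  (sortList coordLe ((xs.drop (k * P.runSize)).take P.runSize)).val

theorem initialRun_spec (P : Params) (xs : List Rec) (k : ℕ) :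
    (initialRun P xs k).Perm ((xs.drop (k * P.runSize)).take P.runSize) ∧
    (initialRun P xs k).Pairwise (fun x y => coordLe x y = true) ∧
    ∀ s, ((xs.drop (k * P.runSize)).take P.runSize).length + 1 ≤ s →
      (sortList coordLe ((xs.drop (k * P.runSize)).take P.runSize)).cost ≤
        ((xs.drop (k * P.runSize)).take P.runSize).length * (3 * Nat.log 2 s + 5) :=
  sortList_spec totalOn_coordLe _ fun _ _ => trivial

theorem Params.B_le_runSize (P : Params) : P.B ≤ P.runSize :=
  Nat.le_mul_of_pos_left _ (by unfold Params.runBlocks; omega)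

/-- With small blocks a run has at most `M / 16` records. With large blocks a run may be a single
block of about `M / 2` records, but then its content is bounded by `n`. -/
theorem Params.Admissible.run_space {P : Params} (hP : P.Admissible) {l : ℕ} (h1 : l ≤ P.runSize)
    (h2 : l ≤ P.n) : 2 * l + 16 ≤ P.M := by
  have hw := hP.width_le
  rcases hP.small_blocks_or_small_input with hc | hc
  · have h3 : 1 ≤ P.M / 16 / P.B := by
      rw [Nat.one_le_div_iff (by have := hP.one_le; omega)]
      omega
    have h4 : P.runSize ≤ P.M / 16 := by
      rw [Params.runSize, Params.runBlocks, max_eq_right h3]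
      exact Nat.div_mul_le_self _ _
    omega
  · omega

/-- The program that reads the records of one run. -/
theorem readRun_holds {P : Params} (hP : P.Admissible) {xs : List Rec} {m : Machine} (k : ℕ)
    (hfile : m.disk .visible = chunks P.B xs) (hxs : xs.length ≤ P.n) (hpk : m.peak ≤ P.M) :
    Holds (whileLoop
        (fun y : List Rec × ℕ × Bool => decide (y.2.1 < P.runBlocks) && !y.2.2) (fun y => do
          let blk ← readBlock .visible (k * P.runBlocks + y.2.1)
          let l := y.1 ++ blk
          use (2 * l.length)
          pure (l, y.2.1 + 1, decide (blk.length < P.B)))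
        (P.n + 2) ([], 0, false)) m fun y m' =>
      y.1 = (xs.drop (k * P.runSize)).take P.runSize ∧ m'.disk = m.disk ∧ m'.peak ≤ P.M ∧
      m'.time ≤ m.time + 2 * y.1.length + 3 ∧ P.B * m'.ios ≤ P.B * m.ios + y.1.length + P.B := by
  have hB := hP.one_le
  set ys := xs.drop (k * P.runSize) with hys
  have hlen : ys.length ≤ P.n := by
    rw [hys, List.length_drop]; omega
  have hdrop : ∀ i, xs.drop ((k * P.runBlocks + i) * P.B) = ys.drop (i * P.B) := by
    intro i
    rw [hys, List.drop_drop, Params.runSize]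
    congr 1
    ring
  have hrun : P.runSize = P.runBlocks * P.B := rfl
  refine (holds_whileLoop (fun i (y : List Rec × ℕ × Bool) m' =>
    y.1 = ys.take (i * P.B) ∧ y.2.1 = i ∧ i ≤ P.runBlocks ∧
    (y.2.2 = true → ys.length ≤ i * P.B) ∧
    (y.2.2 = false → i * P.B ≤ ys.length) ∧
    i * P.B ≤ y.1.length + P.B ∧ m'.disk = m.disk ∧ m'.time = m.time + 2 * i ∧
    m'.ios = m.ios + i ∧ m'.peak ≤ P.M) (P.n + 1) ?_ (by omega) ?_).mono ?_
  · exact ⟨by simp, rfl, Nat.zero_le _, by simp, by simp, by simp, rfl, rfl, rfl, hpk⟩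
  · rintro i ⟨l, b, fin⟩ m' ⟨h1, h2, h3, -, h5, h6, h7, h8, h9, h10⟩ hc
    simp only at h1 h2 h5 hc
    subst h1 h2
    simp only [Bool.and_eq_true, decide_eq_true_eq, Bool.not_eq_true'] at hc
    have hb := h5 hc.2
    refine ⟨?_, ?_⟩
    · have : b * 1 ≤ b * P.B := Nat.mul_le_mul_left _ hB
      omega
    · rw [holds_bind, holds_readBlock]
      simp only [Machine.tick_disk, h7, hfile, getD_chunks hB, hdrop]
      rw [holds_bind, holds_use, holds_pure]
      have htake : ys.take (b * P.B) ++ (ys.drop (b * P.B)).take P.B =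
          ys.take ((b + 1) * P.B) := by
        rw [add_mul, one_mul, List.take_add]
      have hmul : (b + 1) * P.B = b * P.B + P.B := by ring
      have hle : (b + 1) * P.B ≤ P.runBlocks * P.B := Nat.mul_le_mul_right _ hc.1
      refine ⟨htake, rfl, hc.1, ?_, ?_, ?_, rfl, ?_, ?_, ?_⟩
      · intro h
        simp only [List.length_take, List.length_drop, decide_eq_true_eq] at h
        omega
      · intro h
        simp only [List.length_take, List.length_drop, decide_eq_false_iff_not] at h
        omega
      · dsimp only
        rw [htake, List.length_take]
        omega
      · simp only [Machine.tick_time, h8]; omega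
      · simp only [Machine.tick_ios, h9]; omega
      · refine max_le h10 ?_
        rw [htake]
        refine hP.run_space ?_ ?_
        · rw [List.length_take]; omega
        · rw [List.length_take]; omega
  · rintro ⟨l, b, fin⟩ m' ⟨hc, i, m'', ⟨h1, h2, h3, h4, h5, h6, h7, h8, h9, h10⟩, rfl⟩
    simp only at h1 h2 h4 h5 h6 hc
    subst h2
    have hl : l = ys.take P.runSize := by
      rw [h1]
      by_cases hf : fin = true
      · have h11 := h4 hf
        have h12 : b * P.B ≤ P.runBlocks * P.B := Nat.mul_le_mul_right _ h3
        rw [List.take_of_length_le h11, List.take_of_length_le (by omega)]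
      · have : b = P.runBlocks := by
          simp only [Bool.and_eq_false_iff, decide_eq_false_iff_not, Bool.not_eq_false'] at hc
          have := hc.resolve_right hf
          omega
        rw [this, hrun]
    refine ⟨hl, h7, h10, ?_, ?_⟩
    · simp only [Machine.tick_time, h8]
      have h11 : b ≤ l.length + 1 := by
        have h12 : (b - 1) * 1 ≤ (b - 1) * P.B := Nat.mul_le_mul_left _ hB
        rw [mul_one, Nat.sub_mul, one_mul] at h12
        omega
      omega
    · simp only [Machine.tick_ios, h9]
      rw [mul_add, mul_comm P.B b]
      omega

/-- The number `xs.length - k * runSize` of records not yet in a run serves as potential: each run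
pays for its own records and a constant, and the last, empty attempt pays separately, which is the
summand guarded by the flag. -/
theorem formRuns_holds {P : Params} (hP : P.Admissible) {xs : List Rec} {m : Machine}
    (hfile : m.disk .visible = chunks P.B xs) (hxs : xs.length ≤ P.n) (hpk : m.peak ≤ P.M)
    (hruns : ∀ k, m.disk (.run 0 k) = []) :
    Holds (formRuns P) m fun k m' =>
      (∀ j < k, m'.disk (.run 0 j) = chunks P.B (initialRun P xs j)) ∧
      (∀ f, (∀ j < k, f ≠ .run 0 j) → m'.disk f = m.disk f) ∧
      xs.length ≤ k * P.runSize ∧ (k = 0 ∨ (k - 1) * P.runSize < xs.length) ∧ k ≤ P.n ∧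
      m'.time ≤ m.time + P.n * (3 * P.logSize + 30) ∧ m'.peak ≤ P.M ∧
      P.B * m'.ios ≤ P.B * m.ios + 4 * P.n + 3 * P.B := by
  have hB := hP.one_le
  have hR := P.B_le_runSize
  have hn := P.n_pos
  set R := P.runSize with hRdef
  unfold formRuns
  refine Holds.bind (R := fun x m' => ∃ k, x = (k, true) ∧
      (∀ j < k, m'.disk (.run 0 j) = chunks P.B (initialRun P xs j)) ∧
      (∀ f, (∀ j < k, f ≠ .run 0 j) → m'.disk f = m.disk f) ∧
      xs.length ≤ k * R ∧ (k = 0 ∨ (k - 1) * R < xs.length) ∧ k ≤ P.n ∧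
      m'.time ≤ m.time + xs.length * (3 * P.logSize + 9) + k * 8 + 6 ∧ m'.peak ≤ P.M ∧
      P.B * m'.ios ≤ P.B * m.ios + 2 * xs.length + 2 * (P.B * k) + P.B) ?_ ?_
  · refine (holds_whileLoop (fun i (x : ℕ × Bool) m' =>
      (x.2 = false → x.1 = i) ∧ (x.2 = true → xs.length ≤ x.1 * R) ∧
      (∀ j < x.1, m'.disk (.run 0 j) = chunks P.B (initialRun P xs j)) ∧
      (∀ f, (∀ j < x.1, f ≠ .run 0 j) → m'.disk f = m.disk f) ∧
      (x.1 = 0 ∨ (x.1 - 1) * R < xs.length) ∧ x.1 ≤ xs.length ∧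
      m'.time + (xs.length - x.1 * R) * (3 * P.logSize + 9) ≤
        m.time + xs.length * (3 * P.logSize + 9) + x.1 * 8 + (if x.2 = true then 5 else 0) ∧
      m'.peak ≤ P.M ∧
      P.B * m'.ios + 2 * (xs.length - x.1 * R) ≤
        P.B * m.ios + 2 * xs.length + 2 * (P.B * x.1) + (if x.2 = true then P.B else 0))
      (P.n + 1) ?_ (by omega) ?_).mono ?_
    · refine ⟨fun _ => rfl, by simp, by simp, fun _ _ => rfl, Or.inl rfl, Nat.zero_le _, ?_, hpk, ?_⟩
      · simp
      · simp
    · rintro i ⟨k, fin⟩ m₁ ⟨h1, -, h3, h4, h5, h6, h7, h8, h9⟩ hc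
      have hfin : fin = false := by simpa using hc
      subst hfin
      have hk : k = i := h1 rfl
      subst hk
      simp only [Bool.false_eq_true, if_false, Nat.add_zero] at h3 h4 h5 h6 h7 h9
      refine ⟨by omega, ?_⟩
      have hvis : m₁.tick.disk .visible = chunks P.B xs := by
        rw [← hfile]
        exact h4 _ (by simp)
      refine (readRun_holds hP k hvis hxs h8).bind ?_
      rintro ⟨l, b, fin⟩ m₂ ⟨r1, r2, r3, r4, r5⟩
      simp only at r1 r4 r5 ⊢
      simp only [Machine.tick_time, Machine.tick_ios] at r4 r5
      obtain ⟨s1, s2, s3⟩ := initialRun_spec P xs k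
      rw [← hRdef, ← r1] at s1 s3
      have hll : l.length = min R (xs.length - k * R) := by
        rw [r1, List.length_take, List.length_drop]
      have hlog : P.logSize = Nat.log 2 (64 * P.n) := rfl
      have hcost := s3 (64 * P.n) (by omega)
      rw [← hlog] at hcost
      split_ifs with hl
      · rw [holds_pure]
        rw [List.isEmpty_iff] at hl
        rw [hl, List.length_nil] at hll r4 r5
        refine ⟨by simp, fun _ => by dsimp only; omega, fun j hj => ?_, fun f hf => ?_, h5, h6, ?_,
          r3, ?_⟩
        · rw [r2]; exact h3 j hj
        · rw [r2]; exact h4 f hf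
        · simp only [if_true]
          omega
        · simp only [if_true]
          omega
      · rw [List.isEmpty_iff] at hl
        have hpos := List.length_pos_of_ne_nil hl
        rw [holds_bind, holds_internal]
        have hrun : (sortList coordLe l).val = initialRun P xs k := by rw [r1]; rfl
        rw [hrun]
        have hold : m₂.disk (.run 0 k) = [] := by
          rw [r2, ← hruns k]
          refine h4 _ fun j hj => ?_
          simp
          omega
        refine (WriteStream.pushAll_holds hB (initialRun P xs k) (w := ⟨.run 0 k, []⟩) (xs := [])
          (by rw [hold]; exact writing_nil hB)).bind ?_
        rintro w m₃ ⟨w1, w2, w3, w4, w5, w6⟩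
        rw [List.nil_append] at w2
        dsimp only at w1 w2 w3 w4 w5 w6
        refine (WriteStream.close_holds hB (w := w) (by rw [w1]; exact w2)).bind ?_
        rintro _ m₄ ⟨c1, c2, c3, c4, c5⟩
        rw [w1] at c1 c2
        rw [holds_pure]
        have hmul : (k + 1) * R = k * R + R := by ring
        have hmulB : P.B * (k + 1) = P.B * k + P.B := by ring
        have hlen : (initialRun P xs k).length = l.length := s1.length_eq
        have hk1 : k * 1 ≤ k * R := Nat.mul_le_mul_left _ (by omega)
        rw [hlen] at w4 w6
        refine ⟨fun _ => rfl, by simp, fun j hj => ?_, fun f hf => ?_, Or.inr ?_, ?_, ?_, ?_, ?_⟩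
        · rcases Nat.lt_succ_iff_lt_or_eq.1 hj with hj' | rfl
          · have hne : File.run 0 j ≠ .run 0 k := by simp; omega
            rw [c2 _ hne, w3 _ hne, r2]
            exact h3 j hj'
          · exact c1
        · have hne : f ≠ .run 0 k := hf k (Nat.lt_succ_self k)
          rw [c2 _ hne, w3 _ hne, r2]
          exact h4 f fun j hj => hf j (Nat.lt_succ_of_lt hj)
        · dsimp only
          rw [Nat.add_sub_cancel]
          omega
        · dsimp only
          omega
        · have e1 : xs.length - k * R = (xs.length - (k + 1) * R) + l.length := by omega
          rw [e1, add_mul] at h7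
          have e2 : l.length * (3 * P.logSize + 9) = l.length * (3 * P.logSize + 5) + 4 * l.length := by
            ring
          simp only [Bool.false_eq_true, if_false]
          omega
        · rw [c4, w5]
          exact r3
        · have e3 : P.B * m₄.ios ≤ P.B * (m₃.ios + 1) := Nat.mul_le_mul_left _ c5
          rw [mul_add, mul_one] at e3
          simp only [List.length_nil] at w6
          simp only [Bool.false_eq_true, if_false]
          omega
    · rintro ⟨k, fin⟩ _ ⟨hc, i, m', ⟨-, h2, h3, h4, h5, h6, h7, h8, h9⟩, rfl⟩
      have hfin : fin = true := by simpa using hc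
      subst hfin
      simp only [if_true] at h7 h9
      refine ⟨k, rfl, h3, h4, h2 rfl, h5, by dsimp only at h6; omega, ?_, h8, ?_⟩
      · simp only [Machine.tick_time]
        omega
      · simp only [Machine.tick_ios]
        omega
  · rintro _ m' ⟨k, rfl, h1, h2, h3, h4, h5, h6, h7, h8⟩
    rw [holds_pure]
    refine ⟨h1, h2, h3, h4, h5, ?_, h7, ?_⟩
    · have e1 : xs.length * (3 * P.logSize + 9) ≤ P.n * (3 * P.logSize + 9) :=
        Nat.mul_le_mul_right _ hxs
      have e2 : P.n * (3 * P.logSize + 30) = P.n * (3 * P.logSize + 9) + 21 * P.n := by ring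
      omega
    · have e1 : (k - 1) * P.B ≤ (k - 1) * R := Nat.mul_le_mul_left _ hR
      have e2 : P.B * k ≤ P.n + P.B := by
        rw [mul_comm]
        rcases h4 with rfl | h4
        · simp
        · rw [Nat.sub_mul, one_mul] at e1
          omega
      omega

/-! ## Third phase: merging -/

theorem headLe_cons {a b : ReadStream} {x y : Rec} {l l' : List Rec} (ha : a.buf = x :: l)
    (hb : b.buf = y :: l') : headLe a b = coordLe x y := by
  rw [headLe, ha, hb]

theorem totalOn_headLe : TotalOn headLe (fun r => r.buf ≠ []) where
  total a b ha hb h := by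
    obtain ⟨x, l, ha⟩ := List.exists_cons_of_ne_nil ha
    obtain ⟨y, l', hb⟩ := List.exists_cons_of_ne_nil hb
    rw [headLe_cons ha hb] at h
    rw [headLe_cons hb ha]
    exact totalOn_coordLe.total _ _ trivial trivial h
  trans a b c ha hb hc h h' := by
    obtain ⟨x, l, ha⟩ := List.exists_cons_of_ne_nil ha
    obtain ⟨y, l', hb⟩ := List.exists_cons_of_ne_nil hb
    obtain ⟨z, l'', hc⟩ := List.exists_cons_of_ne_nil hc
    rw [headLe_cons ha hb] at h
    rw [headLe_cons hb hc] at h'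
    rw [headLe_cons ha hc]
    exact totalOn_coordLe.trans _ _ _ trivial trivial trivial h h'

/-- The records that a stream still has to deliver. -/
def remainder (B : ℕ) (content : File → List Rec) (r : ReadStream) : List Rec :=
  r.buf ++ (content r.file).drop (r.next * B)

/-- A stream on a sorted file among those whose content is `content`. -/
structure Sound (B : ℕ) (content : File → List Rec) (valid : File → Prop) (r : ReadStream) :
    Prop where
  reading : Reading B (content r.file) r (remainder B content r)
  sorted : (remainder B content r).Pairwise fun x y => coordLe x y = true
  valid : valid r.file

/-- All records that the streams of a heap still have to deliver. -/
def Heap.remainders (B : ℕ) (content : File → List Rec) (h : Heap ReadStream) : Multiset Rec :=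
  (h.elems.map fun r => (remainder B content r : Multiset Rec)).sum

/-- The potential of all streams of a heap. -/
def Heap.potential (B : ℕ) (content : File → List Rec) (h : Heap ReadStream) : ℕ :=
  (h.elems.map fun r => readPotential B (content r.file) r).sum

/-- The streams of a merge are in a correct state. -/
structure HeadsInv (B : ℕ) (content : File → List Rec) (valid : File → Prop)
    (h : Heap ReadStream) : Prop where
  good : h.Good headLe (fun r => r.buf ≠ [])
  sound : ∀ r ∈ h.elems, Sound B content valid r

theorem HeadsInv.total_le {B : ℕ} {content : File → List Rec} {valid : File → Prop}
    {h : Heap ReadStream} (hh : HeadsInv B content valid h) :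
    h.total (fun r => r.buf.length + 2) ≤ Multiset.card h.elems * (B + 2) := by
  rw [Heap.total_eq, ← smul_eq_mul, ← Multiset.card_map (fun r : ReadStream => r.buf.length + 2)]
  refine Multiset.sum_le_card_nsmul _ _ fun x hx => ?_
  obtain ⟨r, hr, rfl⟩ := Multiset.mem_map.1 hx
  have := (hh.sound r hr).reading.short
  omega

/-- The content of the input files is a fixed function, so what a stream still has to deliver
depends only on its position. Filling the buffer leaves this remainder unchanged, and a stream with
an empty buffer afterwards has nothing left and is dropped. -/
theorem MergeState.add_holds {P : Params} (hB : 1 ≤ P.B) {content : File → List Rec}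
    {valid : File → Prop} {s : MergeState} {r : ReadStream} {m : Machine} {K : ℕ}
    (hs : HeadsInv P.B content valid s.heads) (hr : Sound P.B content valid r)
    (hvalid : ∀ f, valid f → m.disk f = chunks P.B (content f))
    (hcard : Multiset.card s.heads.elems < K) (hbuf : s.out.buf.length ≤ P.B) (hK : K ≤ P.n)
    (hspace : K * (P.B + 2) + P.B + 16 ≤ P.M) (hpk : m.peak ≤ P.M) :
    Holds (s.add r) m fun s' m' => s'.out = s.out ∧ HeadsInv P.B content valid s'.heads ∧
      s'.heads.remainders P.B content =
        s.heads.remainders P.B content + (remainder P.B content r : Multiset Rec) ∧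
      Multiset.card s'.heads.elems ≤ Multiset.card s.heads.elems + 1 ∧ m'.disk = m.disk ∧
      m'.time ≤ m.time + P.logSize + 5 ∧ m'.peak ≤ P.M ∧
      P.B * m'.ios + s'.heads.potential P.B content ≤
        P.B * m.ios + s.heads.potential P.B content + readPotential P.B (content r.file) r := by
  unfold MergeState.add
  refine (ReadStream.fill_holds hB (hvalid _ hr.valid) hr.reading).bind ?_
  rintro r' m₁ ⟨f1, f2, f3, f4, f5, f6, f7⟩
  have hrem : remainder P.B content r' = remainder P.B content r := by
    rw [← f2.content, remainder, f1]
  have hr' : Sound P.B content valid r' :=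
    ⟨by rw [hrem, f1]; exact f2, by rw [hrem]; exact hr.sorted, by rw [f1]; exact hr.valid⟩
  dsimp only
  split_ifs with hem
  · rw [List.isEmpty_iff] at hem
    rw [holds_pure]
    refine ⟨rfl, hs, ?_, by omega, f4, by omega, by omega, by omega⟩
    rw [f3 hem]
    simp
  · rw [List.isEmpty_iff] at hem
    obtain ⟨i1, i2, i3⟩ := Heap.insert_spec (h := s.heads) totalOn_headLe hs.good hem
    have hcost := i3 (64 * P.n) (by omega)
    change _ ≤ P.logSize + 3 at hcost
    rw [holds_bind, holds_internal, holds_bind, holds_use, holds_pure]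
    have hs' : HeadsInv P.B content valid (Heap.insert headLe r' s.heads).val := by
      refine ⟨i1, fun q hq => ?_⟩
      rw [i2, Multiset.mem_cons] at hq
      rcases hq with rfl | hq
      · exact hr'
      · exact hs.sound q hq
    have htot := hs'.total_le
    have hc : Multiset.card (Heap.insert headLe r' s.heads).val.elems =
        Multiset.card s.heads.elems + 1 := by rw [i2, Multiset.card_cons]
    refine ⟨rfl, hs', ?_, hc.le, f4, ?_, max_le (by rw [f6]; exact hpk) ?_, ?_⟩
    · simp only [Heap.remainders, i2, Multiset.map_cons, Multiset.sum_cons, hrem]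
      rw [add_comm]
    · dsimp only
      omega
    · rw [MergeState.footprint]
      dsimp only
      have : Multiset.card (Heap.insert headLe r' s.heads).val.elems * (P.B + 2) ≤
        K * (P.B + 2) := Nat.mul_le_mul_right _ (by omega)
      omega
    · simp only [Heap.potential, i2, Multiset.map_cons, Multiset.sum_cons, f1]
      omega

/-- The head of a sorted stream is its least record, so comparing heads compares with everything
that is still to come. -/
theorem coordLe_of_headLe {B : ℕ} {content : File → List Rec} {valid : File → Prop}
    {r q : ReadStream} {x : Rec} {l : List Rec} (hr : r.buf = x :: l) (hq : Sound B content valid q)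
    (hne : q.buf ≠ []) (h : headLe r q = true) : ∀ y ∈ remainder B content q, coordLe x y = true := by
  obtain ⟨z, l', hz⟩ := List.exists_cons_of_ne_nil hne
  rw [headLe_cons hr hz] at h
  have hs := hq.sorted
  rw [remainder, hz, List.cons_append] at hs ⊢
  intro y hy
  rcases List.mem_cons.1 hy with rfl | hy
  · exact h
  · exact totalOn_coordLe.trans _ _ _ trivial trivial trivial h ((List.pairwise_cons.1 hs).1 y hy)

/-- Invariant: the output is sorted, every record of it is at most every record still to come, and
the two together form `T`. Each iteration moves one record, so there are as many iterations as
elements of `T`. Reading and writing cost one unit of `1 / B` per record each, apart from two blocks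
per stream and the last block of output. -/
theorem mergeRuns_holds {P : Params} (hP : P.Admissible) {content : File → List Rec}
    {level first count k : ℕ} {m : Machine} {T : Multiset Rec}
    (hvalid : ∀ a < count, m.disk (.run level (first + a)) =
      chunks P.B (content (.run level (first + a))))
    (hsorted : ∀ a < count,
      (content (.run level (first + a))).Pairwise fun x y => coordLe x y = true)
    (hT : ∑ a ∈ Finset.range count, (content (.run level (first + a)) : Multiset Rec) = T)
    (hcard : Multiset.card T ≤ P.n) (hcount : count ≤ P.n)
    (hspace : count * (P.B + 2) + P.B + 16 ≤ P.M) (hout : m.disk (.run (level + 1) k) = [])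
    (hpk : m.peak ≤ P.M) :
    Holds (mergeRuns P level first count k) m fun _ m' => ∃ O : List Rec, (O : Multiset Rec) = T ∧
      O.Pairwise (fun x y => coordLe x y = true) ∧ m'.disk (.run (level + 1) k) = chunks P.B O ∧
      (∀ f ≠ .run (level + 1) k, m'.disk f = m.disk f) ∧
      m'.time ≤ m.time + P.n * (4 * P.logSize + 25) ∧ m'.peak ≤ P.M ∧
      P.B * m'.ios ≤ P.B * m.ios + 2 * P.n + 2 * (P.B * count) + P.B := by
  have hB := hP.one_le
  have hn := P.n_pos
  set target : File := .run (level + 1) k with htarget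
  set valid : File → Prop := fun f => ∃ a < count, f = .run level (first + a) with hv
  have hvalid' : ∀ f, valid f → m.disk f = chunks P.B (content f) := by
    rintro f ⟨a, ha, rfl⟩
    exact hvalid a ha
  have hne : ∀ f, valid f → f ≠ target := by
    rintro f ⟨a, ha, rfl⟩
    simp [htarget]
  unfold mergeRuns
  refine (holds_forLoop (fun a (s : MergeState) m' => s.out = ⟨target, []⟩ ∧
    HeadsInv P.B content valid s.heads ∧ s.heads.remainders P.B content =
      ∑ a ∈ Finset.range a, (content (.run level (first + a)) : Multiset Rec) ∧
    Multiset.card s.heads.elems ≤ a ∧ m'.disk = m.disk ∧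
    m'.time ≤ m.time + a * (P.logSize + 6) ∧ m'.peak ≤ P.M ∧
    P.B * m'.ios + s.heads.potential P.B content ≤ P.B * m.ios +
      Multiset.card (s.heads.remainders P.B content) + 2 * (P.B * a)) ?_ ?_).bind ?_
  · refine ⟨rfl, ⟨Heap.good_leaf _ _, by simp⟩, by simp [Heap.remainders], by simp, rfl, by simp,
      hpk, by simp [Heap.potential]⟩
  · rintro a ha s m' ⟨h1, h2, h3, h4, h5, h6, h7, h8⟩
    have hr : Sound P.B content valid (.ofFile (.run level (first + a))) := by
      have hrem : remainder P.B content (.ofFile (.run level (first + a))) =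
          content (.run level (first + a)) := by simp [remainder, ReadStream.ofFile]
      refine ⟨?_, ?_, a, ha, rfl⟩
      · rw [hrem]
        exact reading_ofFile _ _ _
      · rw [hrem]
        exact hsorted a ha
    refine (MergeState.add_holds (K := count) (m := m'.tick) hB h2 hr
      (fun f hf => by rw [← hvalid' f hf, ← h5]; rfl) (by omega) (by rw [h1]; simp) hcount hspace
      h7).mono ?_
    rintro s' m'' ⟨g1, g2, g3, g4, g5, g6, g7, g8⟩
    have hrem : remainder P.B content (.ofFile (.run level (first + a))) =
        content (.run level (first + a)) := by simp [remainder, ReadStream.ofFile]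
    have hpot := readPotential_ofFile P.B (content (.run level (first + a)))
      (.run level (first + a))
    rw [hrem] at g3
    refine ⟨g1.trans h1, g2, ?_, by omega, g5.trans h5, ?_, g7, ?_⟩
    · rw [g3, h3, Finset.sum_range_succ]
    · simp only [Machine.tick_time] at g6
      rw [add_mul, one_mul]
      omega
    · rw [g3, Multiset.card_add, Multiset.coe_card, mul_add, mul_one]
      simp only [Machine.tick_ios] at g8
      change _ ≤ _ + readPotential _ (content (.run level (first + a))) _ at g8
      omega
  · rintro s₀ m₀ ⟨h1, h2, h3, h4, h5, h6, h7, h8⟩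
    rw [hT] at h3
    rw [h3] at h8
    refine (holds_whileLoop (fun i (s : MergeState) m' => ∃ O : List Rec, O.length = i ∧
      O.Pairwise (fun x y => coordLe x y = true) ∧
      (∀ x ∈ O, ∀ y ∈ s.heads.remainders P.B content, coordLe x y = true) ∧
      (O : Multiset Rec) + s.heads.remainders P.B content = T ∧
      HeadsInv P.B content valid s.heads ∧ Multiset.card s.heads.elems ≤ count ∧
      s.out.file = target ∧ Writing P.B (m'.disk target) s.out.buf O ∧
      (∀ f ≠ target, m'.disk f = m.disk f) ∧
      m'.time ≤ m₀.time + i * (3 * P.logSize + 11) ∧ m'.peak ≤ P.M ∧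
      P.B * m'.ios + s.out.buf.length + s.heads.potential P.B content ≤
        P.B * m.ios + Multiset.card T + 2 * (P.B * count) + i) (Multiset.card T) ?_ (by omega)
      ?_).bind ?_
    · refine ⟨[], rfl, List.Pairwise.nil, by simp, by simpa using h3, h2, h4, by rw [h1], ?_, ?_,
        by simp, h7, ?_⟩
      · rw [h1, h5, hout]
        exact writing_nil hB
      · intro f _
        rw [h5]
      · rw [h1]
        simp only [List.length_nil]
        omega
    · rintro i s m' ⟨O, g1, g2, g3, g4, g5, g6, g7, g8, g9, g10, g11, g12⟩ hc
      obtain ⟨d1, d2⟩ := Heap.deleteMin_spec totalOn_headLe g5.good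
      have hcost := d2 (64 * P.n) (by omega)
      change _ ≤ 2 * P.logSize + 2 at hcost
      have hnon : s.heads.elems ≠ 0 := by
        intro hcon
        rw [(Heap.isEmpty_iff _).2 hcon] at hc
        simp at hc
      obtain ⟨r, h', e1, e2, e3, e4, e5⟩ := d1.resolve_left fun hcon => hnon hcon.1
      obtain ⟨x, l, hx⟩ := List.exists_cons_of_ne_nil e4
      have hrs := g5.sound r (by rw [e2]; exact Multiset.mem_cons_self _ _)
      have hh' : HeadsInv P.B content valid h' :=
        ⟨e3, fun q hq => g5.sound q (by rw [e2]; exact Multiset.mem_cons_of_mem hq)⟩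
      obtain ⟨rest, hrest, hskip⟩ := hrs.reading.skip hx
      have hskiprem : remainder P.B content r.skip = rest := by
        have := hskip.content
        exact this
      have hremr : s.heads.remainders P.B content =
          x ::ₘ ((rest : Multiset Rec) + h'.remainders P.B content) := by
        simp only [Heap.remainders, e2, Multiset.map_cons, Multiset.sum_cons, hrest]
        rw [← Multiset.cons_coe, Multiset.cons_add]
      have hpotr : s.heads.potential P.B content =
          readPotential P.B (content r.file) r + h'.potential P.B content := by
        simp only [Heap.potential, e2, Multiset.map_cons, Multiset.sum_cons]
      have hcardr : Multiset.card s.heads.elems = Multiset.card h'.elems + 1 := by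
        rw [e2, Multiset.card_cons]
      have hi : i < Multiset.card T := by
        rw [← g4, hremr, Multiset.card_add, Multiset.coe_card, g1, Multiset.card_cons]
        omega
      refine ⟨hi, ?_⟩
      rw [holds_bind, holds_internal, e1]
      dsimp only
      rw [hx]
      dsimp only
      refine (WriteStream.push_holds (w := s.out) (xs := O) hB (by rw [g7]; exact g8)).bind ?_
      rintro w m₁ ⟨w1, w2, w3, w4, w5, w6, w7⟩
      rw [g7] at w1 w2 w3
      simp only [Machine.tick_time, Machine.tick_ios] at w4 w6
      have hsorted_r := hrs.sorted
      rw [hrest, List.pairwise_cons] at hsorted_r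
      have hskipSound : Sound P.B content valid r.skip := by
        refine ⟨by rw [hskiprem]; exact hskip, ?_, hrs.valid⟩
        rw [hskiprem]
        exact hsorted_r.2
      refine (MergeState.add_holds (s := ⟨h', w⟩) (K := count) hB hh' hskipSound ?_
        (by dsimp only; omega) w2.short.le hcount hspace (by rw [w5]; exact g11)).mono ?_
      · intro f hf
        rw [w3 f (hne f hf), ← hvalid' f hf]
        exact g9 f (hne f hf)
      · rintro s' m₂ ⟨a1, a2, a3, a4, a5, a6, a7, a8⟩
        dsimp only at a1 a3 a4 a8
        rw [hskiprem] at a3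
        have hrem' : x ::ₘ s'.heads.remainders P.B content = s.heads.remainders P.B content := by
          rw [a3, hremr, add_comm]
        refine ⟨O ++ [x], by simp [g1], ?_, ?_, ?_, a2, by omega, by rw [a1]; exact w1, ?_, ?_, ?_,
          a7, ?_⟩
        · rw [List.pairwise_append]
          refine ⟨g2, List.pairwise_singleton _ _, fun o ho y hy => ?_⟩
          rw [List.mem_singleton.1 hy]
          exact g3 o ho x (by rw [hremr]; exact Multiset.mem_cons_self _ _)
        · intro o ho y hy
          rcases List.mem_append.1 ho with ho | ho
          · exact g3 o ho y (by rw [← hrem']; exact Multiset.mem_cons_of_mem hy)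
          · rw [List.mem_singleton.1 ho]
            rw [a3, Multiset.mem_add] at hy
            rcases hy with hy | hy
            · change y ∈ Multiset.join _ at hy
              rw [Multiset.mem_join] at hy
              obtain ⟨_, hmem, hyq⟩ := hy
              obtain ⟨q, hq, rfl⟩ := Multiset.mem_map.1 hmem
              exact coordLe_of_headLe hx (hh'.sound q hq) (e3.valid q hq)
                (e5 q (by rw [e2]; exact Multiset.mem_cons_of_mem hq)) y hyq
            · exact hsorted_r.1 y hy
        · rw [← g4, ← hrem', ← Multiset.coe_add, add_assoc]
          rfl
        · rw [a1, a5]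
          exact w2
        · intro f hf
          rw [a5, w3 f hf]
          exact g9 f hf
        · rw [add_mul, one_mul]
          omega
        · rw [a1]
          change _ ≤ _ + readPotential _ (content r.file) r at a8
          omega
    · rintro s _ ⟨hc, i, m', ⟨O, g1, g2, g3, g4, g5, g6, g7, g8, g9, g10, g11, g12⟩, rfl⟩
      have hzero : s.heads.elems = 0 := by
        rw [← Heap.isEmpty_iff]
        simpa using hc
      have hrem : s.heads.remainders P.B content = 0 := by simp [Heap.remainders, hzero]
      rw [hrem, add_zero] at g4
      have hi : i ≤ P.n := by
        rw [← g4, Multiset.coe_card] at hcard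
        omega
      refine (WriteStream.close_holds (m := m'.tick) hB (w := s.out) (by rw [g7]; exact g8)).mono ?_
      rintro _ m'' ⟨c1, c2, c3, c4, c5⟩
      rw [g7] at c1 c2
      refine ⟨O, g4, g2, c1, fun f hf => (c2 f hf).trans (g9 f hf), ?_, by rw [c4]; exact g11, ?_⟩
      · simp only [Machine.tick_time] at c3
        have e1 : i * (3 * P.logSize + 11) ≤ P.n * (3 * P.logSize + 11) := Nat.mul_le_mul_right _ hi
        have e2 : count * (P.logSize + 6) ≤ P.n * (P.logSize + 6) := Nat.mul_le_mul_right _ hcount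
        have e3 : P.n * (4 * P.logSize + 25) =
          P.n * (3 * P.logSize + 11) + P.n * (P.logSize + 6) + 8 * P.n := by ring
        omega
      · simp only [Machine.tick_ios] at c5
        have e1 : P.B * m''.ios ≤ P.B * (m'.ios + 1) := Nat.mul_le_mul_left _ c5
        rw [mul_add, mul_one] at e1
        omega

/-! ## Third phase: the visibility map -/

/-- The content of the initial runs. -/
def runContent (P : Params) (xs : List Rec) : File → List Rec
  | .run _ j => initialRun P xs j
  | _ => []

theorem sum_initialRun (P : Params) (xs : List Rec) (k : ℕ) :
    ∑ a ∈ Finset.range k, (initialRun P xs a : Multiset Rec) =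
      (xs.take (k * P.runSize) : Multiset Rec) := by
  induction k with
  | zero => simp
  | succ k ih =>
    rw [Finset.sum_range_succ, ih, add_mul, one_mul, List.take_add, ← Multiset.coe_add]
    congr 1
    exact Multiset.coe_eq_coe.2 (initialRun_spec P xs k).1

/-- The hypothesis on `M ^ 2 / B` makes one merge pass sufficient. More than one run means `B ≤ n`,
so blocks are small, and then both the fan-in and the number of blocks per run are `q = M / (16 *
B)`. More than `q` runs would need `n ≥ q ^ 2 * B`, and as `M ≤ 32 * B * q` this gives `M ^ 2 ≤ 1024
* n * B`, too small. -/
theorem Params.Admissible.run_count {P : Params} (hP : P.Admissible) {k : ℕ} (hk : 1 < k)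
    (h : (k - 1) * P.runSize < P.n) :
    k ≤ P.fanIn ∧ k * (P.B + 2) + P.B + 16 ≤ P.M := by
  have hB := hP.one_le
  have hR := P.B_le_runSize
  have hw := hP.width_le
  have h1 : 1 * P.runSize ≤ (k - 1) * P.runSize := Nat.mul_le_mul_right _ (by omega)
  have hc : 64 * P.B ≤ P.M := by
    rcases hP.small_blocks_or_small_input with hc | hc
    · exact hc
    · omega
  set q := P.M / (16 * P.B) with hq
  have hq4 : 4 ≤ q := by
    rw [hq, Nat.le_div_iff_mul_le (by omega)]
    omega
  have hqle : q * (16 * P.B) ≤ P.M := Nat.div_mul_le_self _ _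
  have hqlt : P.M < (q + 1) * (16 * P.B) := by
    rw [mul_comm]
    exact Nat.lt_mul_div_succ _ (by omega)
  have hrun : P.runSize = q * P.B := by
    rw [Params.runSize, Params.runBlocks, Nat.div_div_eq_div_mul, ← hq, max_eq_right (by omega)]
  have hfan : P.fanIn = q := by
    rw [Params.fanIn, ← hq, max_eq_right (by omega)]
  have hkq : k ≤ q := by
    by_contra hcon
    push Not at hcon
    have h2 : q * (q * P.B) ≤ P.n := by
      rw [← hrun]
      exact (Nat.mul_le_mul_right _ (by omega)).trans h.le
    have h3 : P.M ≤ 32 * P.B * q := by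
      have : (q + 1) * (16 * P.B) ≤ (2 * q) * (16 * P.B) := Nat.mul_le_mul_right _ (by omega)
      calc P.M ≤ (2 * q) * (16 * P.B) := hqlt.le.trans this
        _ = _ := by ring
    have h4 : P.M ^ 2 ≤ 1024 * P.n * P.B := by
      calc P.M ^ 2 ≤ (32 * P.B * q) ^ 2 := Nat.pow_le_pow_left h3 2
        _ = 1024 * P.B * (q * (q * P.B)) := by ring
        _ ≤ 1024 * P.B * P.n := Nat.mul_le_mul_left _ h2
        _ = _ := by ring
    have h5 := hP.large
    have h6 : 1 ≤ P.n * P.B := Nat.mul_pos P.n_pos hB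
    rw [mul_assoc] at h4 h5
    omega
  refine ⟨by omega, ?_⟩
  have h2 : k * P.B ≤ q * P.B := Nat.mul_le_mul_right _ hkq
  have h3 : k * 1 ≤ k * P.B := Nat.mul_le_mul_left _ hB
  have h4 : q * (16 * P.B) = 16 * (q * P.B) := by ring
  rw [mul_add]
  omega

theorem sortVisible_holds {P : Params} (hP : P.Admissible) {xs : List Rec} {m : Machine}
    (hfile : m.disk .visible = chunks P.B xs) (hxs : xs.length ≤ P.n) (hpk : m.peak ≤ P.M)
    (hruns : ∀ l k, m.disk (.run l k) = []) :
    Holds (sortVisible P) m fun f m' => (∃ O : List Rec, O.Perm xs ∧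
        O.Pairwise (fun x y => coordLe x y = true) ∧ m'.disk f = chunks P.B O) ∧
      (∃ l k, f = .run l k) ∧ (∀ f, (∀ l k, f ≠ .run l k) → m'.disk f = m.disk f) ∧
      m'.time ≤ m.time + P.n * (7 * P.logSize + 60) ∧ m'.peak ≤ P.M ∧
      P.B * m'.ios ≤ P.B * m.ios + 8 * P.n + 6 * P.B := by
  have hB := hP.one_le
  have hn := P.n_pos
  have hR := P.B_le_runSize
  unfold sortVisible
  refine (formRuns_holds hP hfile hxs hpk (hruns 0)).bind ?_
  rintro k m₁ ⟨f1, f2, f3, f4, f5, f6, f7, f8⟩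
  have hoth : ∀ f, (∀ l k, f ≠ .run l k) → m₁.disk f = m.disk f :=
    fun f hf => f2 f fun j _ => hf 0 j
  refine Holds.bind (R := fun x m' => (∃ O : List Rec, O.Perm xs ∧
        O.Pairwise (fun x y => coordLe x y = true) ∧ m'.disk (.run x.1 0) = chunks P.B O) ∧
      (∀ f, (∀ l k, f ≠ .run l k) → m'.disk f = m.disk f) ∧
      m'.time ≤ m.time + P.n * (7 * P.logSize + 60) ∧ m'.peak ≤ P.M ∧
      P.B * m'.ios ≤ P.B * m.ios + 8 * P.n + 6 * P.B) ?_ ?_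
  -- The loop makes at most one iteration: either no merge has taken place, or one merge has turned
  -- `k > 1` runs into a single one.
  · refine (holds_whileLoop (fun i (x : ℕ × ℕ) m' => (i = 0 ∧ x = (0, k) ∧ m' = m₁) ∨
      (i = 1 ∧ 1 < k ∧ x = (1, 1) ∧ (∃ O : List Rec, O.Perm xs ∧
          O.Pairwise (fun x y => coordLe x y = true) ∧ m'.disk (.run 1 0) = chunks P.B O) ∧
        (∀ f, (∀ l k, f ≠ .run l k) → m'.disk f = m.disk f) ∧
        m'.time ≤ m₁.time + P.n * (4 * P.logSize + 25) + 2 ∧ m'.peak ≤ P.M ∧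
        P.B * m'.ios ≤ P.B * m₁.ios + 4 * P.n + 3 * P.B)) 1 (Or.inl ⟨rfl, rfl, rfl⟩) (by omega)
      ?_).mono ?_
    · rintro i x m' (⟨rfl, rfl, rfl⟩ | ⟨-, -, rfl, -⟩) hc
      · have hk : 1 < k := by simpa using hc
        refine ⟨Nat.one_pos, ?_⟩
        have hkn : (k - 1) * P.runSize < P.n := by
          rcases f4 with rfl | h <;> omega
        obtain ⟨c1, c2⟩ := hP.run_count hk hkn
        have hgroups : (k + P.fanIn - 1) / P.fanIn = 1 :=
          Nat.div_eq_of_lt_le (by omega) (by omega)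
        dsimp only
        rw [hgroups, holds_bind]
        have hmin : min P.fanIn (k - 0 * P.fanIn) = k := by
          rw [zero_mul, Nat.sub_zero, min_eq_right c1]
        simp only [forLoop]
        rw [holds_bind, holds_pure, holds_bind, holds_step, hmin, zero_mul]
        refine (mergeRuns_holds hP (content := runContent P xs) (T := (xs : Multiset Rec)) ?_ ?_ ?_
          (by simpa using hxs) f5 c2 ?_ (by exact f7)).mono ?_
        · intro a ha
          rw [zero_add]
          exact f1 a ha
        · intro a _
          exact (initialRun_spec P xs _).2.1
        · simp only [zero_add, runContent]
          rw [sum_initialRun, List.take_of_length_le f3]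
        · rw [← hruns (0 + 1) 0]
          exact f2 _ (by simp)
        · rintro _ m₂ ⟨O, o1, o2, o3, o4, o5, o6, o7⟩
          rw [holds_pure]
          refine Or.inr ⟨trivial, hk, rfl, ⟨O, Multiset.coe_eq_coe.1 o1, o2, o3⟩, ?_, ?_, o6, ?_⟩
          · intro f hf
            rw [o4 f (hf _ _)]
            exact hoth f hf
          · simp only [Machine.tick_time] at o5
            omega
          · simp only [Machine.tick_ios] at o7
            have e1 : (k - 1) * P.B ≤ (k - 1) * P.runSize := Nat.mul_le_mul_left _ hR
            rw [Nat.sub_mul, one_mul, mul_comm k] at e1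
            omega
      · simp at hc
    · rintro x _ ⟨hc, i, m', (⟨-, rfl, rfl⟩ | ⟨-, hk, rfl, h1, h2, h3, h4, h5⟩), rfl⟩
      · have hk : k ≤ 1 := by simpa using hc
        refine ⟨?_, hoth, ?_, f7, by simp only [Machine.tick_ios]; omega⟩
        -- If no point is visible there are no runs, and the file that is returned has never been
        -- written; an empty file is a correct result.
        · rcases Nat.eq_zero_or_pos k with rfl | hpos
          · have hx : xs = [] := List.length_eq_zero_iff.1 (by omega)
            refine ⟨[], by rw [hx], List.Pairwise.nil, ?_⟩
            rw [chunks_nil, ← hruns 0 0]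
            exact f2 _ (by simp)
          · have hk1 : k = 1 := by omega
            subst hk1
            obtain ⟨s1, s2, -⟩ := initialRun_spec P xs 0
            refine ⟨initialRun P xs 0, ?_, s2, f1 0 Nat.one_pos⟩
            rwa [zero_mul, List.drop_zero, List.take_of_length_le (by omega)] at s1
        · simp only [Machine.tick_time]
          have e1 : P.n * (7 * P.logSize + 60) =
            P.n * (3 * P.logSize + 30) + 4 * (P.n * P.logSize) + 30 * P.n := by ring
          omega
      · refine ⟨h1, h2, ?_, h4, by simp only [Machine.tick_ios]; omega⟩
        simp only [Machine.tick_time]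
        have e1 : P.n * (7 * P.logSize + 60) =
          P.n * (3 * P.logSize + 30) + P.n * (4 * P.logSize + 25) + 5 * P.n := by ring
        omega
  · rintro x m' ⟨h1, h2, h3, h4, h5⟩
    rw [holds_pure]
    exact ⟨h1, ⟨_, _, rfl⟩, h2, h3, h4, h5⟩

/-- The grid points are enumerated row by row, so the visible ones among them form a sorted list.
Coordinates determine the record, so a sorted list with the same elements is the same list. -/
theorem eq_of_sorted_visible {m : ℕ} {Z : ℤ → ℤ → ℝ} {O : List Rec}
    (h : O.Perm ((visiblePoints m Z (gridPoints m)).map coordRec))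
    (hs : O.Pairwise fun x y => coordLe x y = true) :
    O = (visiblePoints m Z (gridPoints m)).map coordRec := by
  refine List.Perm.eq_of_pairwise (le := fun x y => coordLe x y = true) ?_ hs ?_ h
  · intro a b ha hb hab hba
    obtain ⟨p, -, rfl⟩ := List.mem_map.1 (h.mem_iff.1 ha)
    obtain ⟨q, -, rfl⟩ := List.mem_map.1 hb
    rw [coordLe_iff] at hab hba
    have h1 := toLex.injective (le_antisymm hab hba)
    simp only [coordRec, Rec.pos, Prod.mk.injEq] at h1
    simp only [coordRec, h1.1, h1.2]
  · rw [List.pairwise_map]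
    refine List.Pairwise.imp ?_ ((gridPoints_sorted m).filter _)
    intro p q hpq
    rw [coordLe_iff]
    refine le_of_lt ?_
    rw [Prod.Lex.toLex_lt_toLex]
    exact hpq

open Classical in
/-- The records of the visibility map. -/
def visibilityRecs (m : ℕ) (Z : ℤ → ℤ → ℝ) (l : List (ℤ × ℤ)) : List Rec :=
  l.map fun p => Rec.bit (decide (Visible m Z p))

/-- Two full blocks might fill the memory without room for the scalar variables. If blocks are that
large, the bound by `n` helps. -/
theorem Params.Admissible.scan_space {P : Params} (hP : P.Admissible) {a b : ℕ} (ha : a ≤ P.B)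
    (hb : b ≤ P.B) (ha' : a ≤ P.n) (hb' : b ≤ P.n) : a + b + 16 ≤ P.M := by
  have := hP.width_le
  rcases hP.small_blocks_or_small_input with hc | hc <;> omega

/-- The sorted list is a subsequence of the grid points in the order of the scan. What is unread is
the list of visible points among those not yet scanned, so its head is the current point exactly if
the current point is visible. -/
theorem produceMap_holds {P : Params} (hP : P.Admissible) {Z : ℤ → ℤ → ℝ} {m : Machine}
    {sorted : File} (hne : sorted ≠ .output)
    (hfile : m.disk sorted = chunks P.B ((visiblePoints P.m Z (gridPoints P.m)).map coordRec))
    (hout : m.disk .output = []) (hpk : m.peak ≤ P.M) :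
    Holds (produceMap P sorted) m fun _ m' =>
      m'.disk .output = chunks P.B (visibilityRecs P.m Z (gridPoints P.m)) ∧
      m'.time ≤ m.time + 7 * P.n ∧ m'.peak ≤ P.M ∧
      P.B * m'.ios ≤ P.B * m.ios + 2 * P.n + 3 * P.B := by
  have hB := hP.one_le
  have hn := P.n_pos
  have hlen : (gridPoints P.m).length = P.n := gridPoints_length _
  set xs := (visiblePoints P.m Z (gridPoints P.m)).map coordRec with hxs
  have hvlen : ∀ l, (visiblePoints P.m Z l).length ≤ l.length := fun l => List.length_filter_le _ _
  unfold produceMap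
  refine (holds_forLoop (fun idx (s : ReadStream × WriteStream) m' => s.1.file = sorted ∧
    s.2.file = .output ∧
    Reading P.B xs s.1 ((visiblePoints P.m Z ((gridPoints P.m).drop idx)).map coordRec) ∧
    Writing P.B (m'.disk .output) s.2.buf (visibilityRecs P.m Z ((gridPoints P.m).take idx)) ∧
    m'.disk sorted = chunks P.B xs ∧ m'.time ≤ m.time + 5 * idx ∧ m'.peak ≤ P.M ∧
    P.B * m'.ios + readPotential P.B xs s.1 + s.2.buf.length ≤
      P.B * m.ios + (P.n + 2 * P.B) + idx) ?_ ?_).bind ?_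
  · refine ⟨rfl, rfl, by simpa using reading_ofFile _ _ _, ?_, hfile, by simp, hpk, ?_⟩
    · rw [hout]
      simpa [visibilityRecs] using writing_nil hB
    · have h1 := readPotential_ofFile P.B xs sorted
      have h2 := hvlen (gridPoints P.m)
      have h3 : xs.length = (visiblePoints P.m Z (gridPoints P.m)).length := by simp [hxs]
      simp only [List.length_nil]
      omega
  · rintro idx hidx ⟨r, w⟩ m' ⟨h1, h2, h3, h4, h5, h6, h7, h8⟩
    dsimp only at h1 h2 h3 h4 h8
    have hget : (gridPoints P.m)[idx]'(by omega) = pointAt P.m idx := by simp [gridPoints]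
    have htake : (gridPoints P.m).take (idx + 1) =
        (gridPoints P.m).take idx ++ [pointAt P.m idx] := by
      rw [List.take_add_one, List.getElem?_eq_getElem (by omega), hget]
      rfl
    have hdrop : (gridPoints P.m).drop idx =
        pointAt P.m idx :: (gridPoints P.m).drop (idx + 1) := by
      rw [List.drop_eq_getElem_cons (by omega), hget]
    -- A later visible point at the head of the stream must not be mistaken for the current one.
    have hnd : pointAt P.m idx ∉ (gridPoints P.m).drop (idx + 1) := by
      have := (gridPoints_nodup P.m).sublist (List.drop_sublist idx _)
      rw [hdrop, List.nodup_cons] at this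
      exact this.1
    generalize pointAt P.m idx = p at hget htake hdrop hnd ⊢
    dsimp only
    refine (ReadStream.fill_holds (m := m'.tick) (xs := xs) hB (by rw [h1]; exact h5) h3).bind ?_
    rintro r' m₁ ⟨r1, r2, r3, r4, r5, r6, r7⟩
    have hw1 : Writing P.B (m₁.disk w.file) w.buf
        (visibilityRecs P.m Z ((gridPoints P.m).take idx)) := by
      rw [h2, r4]
      exact h4
    simp only [Machine.tick_time, Machine.tick_ios] at r5 r7
    have hspace : r'.buf.length + w.buf.length + 16 ≤ P.M := by
      refine hP.scan_space r2.short h4.short.le ?_ ?_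
      · have := r2.length_le
        have h9 := hvlen ((gridPoints P.m).drop idx)
        rw [List.length_map] at this
        rw [List.length_drop] at h9
        omega
      · have := h4.length_le
        simp only [visibilityRecs, List.length_map, List.length_take] at this
        omega
    have hrecs : ∀ b : Bool, (b = true ↔ Visible P.m Z p) →
        visibilityRecs P.m Z ((gridPoints P.m).take (idx + 1)) =
          visibilityRecs P.m Z ((gridPoints P.m).take idx) ++ [.bit b] := by
      intro b hb
      rw [htake, visibilityRecs, List.map_append]
      congr 1
      simp only [List.map_cons, List.map_nil]
      congr 2
      by_cases hv : Visible P.m Z p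
      · simp [hv, hb.2 hv]
      · have : b = false := by
          rw [← Bool.not_eq_true, hb]
          exact hv
        simp [hv, this]
    have hfin : ∀ b : Bool, (b = true ↔ Visible P.m Z p) → ∀ r'' : ReadStream, r''.file = r'.file →
        Reading P.B xs r'' ((visiblePoints P.m Z ((gridPoints P.m).drop (idx + 1))).map coordRec) →
        readPotential P.B xs r'' = readPotential P.B xs r' →
        Holds (do let w ← w.push P (.bit b); pure (r'', w))
          { m₁ with peak := max m₁.peak (r'.buf.length + w.buf.length + 16) }
          (fun (s : ReadStream × WriteStream) m' => s.1.file = sorted ∧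
            s.2.file = .output ∧
            Reading P.B xs s.1
              ((visiblePoints P.m Z ((gridPoints P.m).drop (idx + 1))).map coordRec) ∧
            Writing P.B (m'.disk .output) s.2.buf
              (visibilityRecs P.m Z ((gridPoints P.m).take (idx + 1))) ∧
            m'.disk sorted = chunks P.B xs ∧ m'.time ≤ m.time + 5 * (idx + 1) ∧ m'.peak ≤ P.M ∧
            P.B * m'.ios + readPotential P.B xs s.1 + s.2.buf.length ≤
              P.B * m.ios + (P.n + 2 * P.B) + (idx + 1)) := by
      intro b hb r'' hr1 hr2 hr3
      refine (WriteStream.push_holds (x := .bit b)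
        (m := { m₁ with peak := max m₁.peak (r'.buf.length + w.buf.length + 16) }) hB hw1).bind ?_
      rintro w' m₂ ⟨w1, w2, w3, w4, w5, w6, -⟩
      rw [h2] at w1 w2 w3
      dsimp only at w4 w5 w6
      rw [holds_pure]
      refine ⟨hr1.trans (r1.trans h1), w1, hr2, by rw [hrecs b hb]; exact w2, ?_, by omega, ?_, ?_⟩
      · rw [w3 _ hne]
        change m₁.disk sorted = _
        rw [r4]
        exact h5
      · rw [w5]
        exact max_le (by rw [r6]; exact h7) hspace
      · dsimp only
        rw [hr3]
        omega
    rw [holds_bind, holds_use]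
    by_cases hv : Visible P.m Z p
    · have hvp : visiblePoints P.m Z ((gridPoints P.m).drop idx) =
          p :: visiblePoints P.m Z ((gridPoints P.m).drop (idx + 1)) := by
        rw [hdrop, visiblePoints, visiblePoints, List.filter_cons_of_pos (by simpa using hv)]
      rw [hvp, List.map_cons] at r2 r3
      rcases hbuf : r'.buf with _ | ⟨x, buf⟩
      · exact absurd (r3 hbuf) (by simp)
      · obtain ⟨rest, e1, e2⟩ := r2.skip hbuf
        rw [List.cons.injEq] at e1
        obtain ⟨rfl, rfl⟩ := e1
        dsimp only
        rw [if_pos (show (coordRec p).pos = p from rfl)]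
        rw [hbuf] at hfin
        exact hfin true (by simp [hv]) r'.skip rfl e2 (readPotential_skip _ _ _)
    · have hvp : visiblePoints P.m Z ((gridPoints P.m).drop idx) =
          visiblePoints P.m Z ((gridPoints P.m).drop (idx + 1)) := by
        rw [hdrop, visiblePoints, visiblePoints, List.filter_cons_of_neg (by simpa using hv)]
      rw [hvp] at r2
      have hf := hfin false (by simp [hv]) r' rfl r2 rfl
      rcases hbuf : r'.buf with _ | ⟨x, buf⟩
      · rw [hbuf] at hf
        exact hf
      · obtain ⟨rest, e1, -⟩ := r2.skip hbuf
        have hx : x ∈ (visiblePoints P.m Z ((gridPoints P.m).drop (idx + 1))).map coordRec := by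
          rw [e1]
          exact List.mem_cons_self
        obtain ⟨q, hq, rfl⟩ := List.mem_map.1 hx
        have hqp : q ≠ p := by
          rintro rfl
          exact hnd (List.mem_filter.1 hq).1
        dsimp only
        rw [if_neg (show ¬(coordRec q).pos = p from hqp)]
        rw [hbuf] at hf
        exact hf
  · rintro ⟨r, w⟩ m' ⟨h1, h2, h3, h4, h5, h6, h7, h8⟩
    dsimp only at h1 h2 h3 h4 h8 ⊢
    refine (WriteStream.close_holds hB (w := w) (by rw [h2]; exact h4)).mono ?_
    rintro _ m'' ⟨c1, -, c3, c4, c5⟩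
    rw [h2, List.take_of_length_le hlen.le] at c1
    refine ⟨c1, by omega, by rw [c4]; exact h7, ?_⟩
    have e1 : P.B * m''.ios ≤ P.B * (m'.ios + 1) := Nat.mul_le_mul_left _ c5
    rw [mul_add, mul_one] at e1
    omega

/-! ## The whole algorithm -/

/-- The constants for the I/Os are the sums `19 + 35 + 8 + 2` and `4 + 5 + 6 + 3` over distribution,
sweep, sorting and output; the boundaries are computed without I/O. -/
theorem sectoredSweep_holds {P : Params} (hP : P.Admissible) (Z : ℤ → ℤ → ℝ) :
    Holds (sectoredSweep P) (initialMachine P.m P.B Z) fun _ m' =>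
      m'.disk .output = visibilityMapFile P.m P.B Z ∧ m'.peak ≤ P.M ∧
      m'.time ≤ P.n * (51 * P.logSize + 250) ∧ P.B * m'.ios ≤ 64 * P.n + 18 * P.B := by
  have hB := hP.one_le
  have hn := P.n_pos
  have hlen : (gridPoints P.m).length = P.n := gridPoints_length _
  unfold sectoredSweep
  refine (sectorBounds_holds hP _ (Nat.zero_le _)).bind ?_
  rintro _ m₁ ⟨rfl, a2, a3, a4, a5⟩
  refine (distribute_holds hP Z (by rw [a2]; exact toChunks_eq_chunks hB _)
    (fun k => by rw [a2]; rfl) a5).bind ?_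
  rintro _ m₂ ⟨b1, b2, b3, b4, b5⟩
  refine (sweep_holds hP b1 (by rw [b2 _ (by simp), a2]; rfl) b4).bind ?_
  rintro _ m₃ ⟨⟨L, c1, c1'⟩, c2, c3, c4, c5⟩
  have hL : (L.map coordRec).length ≤ P.n := by
    rw [List.length_map, c1.length_eq, ← hlen]
    exact List.length_filter_le _ _
  refine (sortVisible_holds hP c1' hL c4 fun l k => by
    rw [c2 _ (by simp), b2 _ (by simp), a2]; rfl).bind ?_
  rintro sorted m₄ ⟨⟨O, d1, d1', d1''⟩, ⟨l, k, rfl⟩, d3, d4, d5, d6⟩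
  rw [eq_of_sorted_visible (d1.trans (c1.map _)) d1'] at d1''
  refine (produceMap_holds hP (by simp) d1'' (by
    rw [d3 _ (by simp), c2 _ (by simp), b2 _ (by simp), a2]; rfl) d5).mono ?_
  rintro _ m₅ ⟨e1, e2, e3, e4⟩
  have ht : (initialMachine P.m P.B Z).time = 0 := rfl
  have hi : (initialMachine P.m P.B Z).ios = 0 := rfl
  rw [ht] at a3
  rw [hi] at a4
  rw [a4, mul_zero] at b5
  refine ⟨?_, e3, ?_, by omega⟩
  · rw [e1]
    exact (toChunks_eq_chunks hB _).symm
  · have h1 : P.n * (51 * P.logSize + 250) = P.n * (8 * P.logSize + 20) + P.n * (P.logSize + 21) +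
      P.n * (35 * P.logSize + 130) + P.n * (7 * P.logSize + 60) + 19 * P.n := by ring
    omega

/-! ### From counts of steps and blocks to the asymptotic bounds. -/

theorem Holds.of_snd {x : EM Unit} {s : Machine} {Q : Machine → Prop}
    (h : Holds x s fun _ m => Q m) : Q (x.run s).2 := h

theorem finalMachine_spec {m M B : ℕ} (hP : (⟨m, M, B⟩ : Params).Admissible) (Z : ℤ → ℤ → ℝ) :
    (finalMachine m M B Z).disk .output = visibilityMapFile m B Z ∧
    (finalMachine m M B Z).peak ≤ M ∧
    (finalMachine m M B Z).time ≤ gridSize m * (51 * Nat.log 2 (64 * gridSize m) + 250) ∧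
    B * (finalMachine m M B Z).ios ≤ 64 * gridSize m + 18 * B := by
  have h := (sectoredSweep_holds hP Z).of_snd
  dsimp only at h
  unfold finalMachine
  generalize ((sectoredSweep ⟨m, M, B⟩).run (initialMachine m B Z)).2 = s at h ⊢
  exact h

/-- The left side is at most `6 + log n / log 2`, and `1 / log 2 < 2`. -/
theorem log_size_le {n : ℕ} (hn : 1 ≤ n) :
    (Nat.log 2 (64 * n) : ℝ) ≤ 8 * max 1 (Real.log n) := by
  have h1 : (Nat.log 2 (64 * n) : ℝ) ≤ Real.logb 2 ((64 * n : ℕ) : ℝ) := Real.natLog_le_logb _ _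
  have hn' : (0 : ℝ) < n := by exact_mod_cast hn
  have h2 : Real.logb 2 ((64 * n : ℕ) : ℝ) = 6 + Real.log n / Real.log 2 := by
    push_cast
    rw [Real.logb_mul (by norm_num) hn'.ne', show (64 : ℝ) = 2 ^ (6 : ℕ) by norm_num,
      Real.logb_pow, Real.logb_self_eq_one (by norm_num), Real.logb]
    norm_num
  have h3 : Real.log n / Real.log 2 ≤ 2 * Real.log n := by
    have h4 := Real.log_two_gt_d9
    have h5 : 0 ≤ Real.log n := Real.log_nonneg (by exact_mod_cast hn)
    rw [div_le_iff₀ (by linarith)]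
    nlinarith
  have h6 := le_max_left 1 (Real.log n)
  have h7 := le_max_right 1 (Real.log n)
  linarith

end SectoredSweep

end

theorem mainTheorem7 :
    ∃ c C : ℝ, 0 < c ∧ 0 < C ∧
      ∀ (m M B : ℕ) (Z : ℤ → ℤ → ℝ), 1 ≤ B → 2 * B ≤ M →
        c * (SectoredSweep.gridSize m : ℝ) ≤ (M : ℝ) ^ 2 / (B : ℝ) →
          (SectoredSweep.finalMachine m M B Z).disk SectoredSweep.File.output
              = SectoredSweep.visibilityMapFile m B Z ∧
          (SectoredSweep.finalMachine m M B Z).peak ≤ M ∧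
          ((SectoredSweep.finalMachine m M B Z).time : ℝ)
              ≤ C * ((SectoredSweep.gridSize m : ℝ)
                  * max 1 (Real.log (SectoredSweep.gridSize m : ℝ))) ∧
          ((SectoredSweep.finalMachine m M B Z).ios : ℝ)
              ≤ C * (SectoredSweep.scanIOs B (SectoredSweep.gridSize m)
                  + SectoredSweep.sortIOs M B (SectoredSweep.visibleCount m Z)) := by
  -- The first constant is the one in `Params.Admissible`. The second has to be at least `51 * 8 +
  -- 250` for the time and `64 + 18` for the I/Os.
  refine ⟨2 ^ 20, 1000, by norm_num, by norm_num, fun m M B Z hB hM hc => ?_⟩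
  have hB' : (0 : ℝ) < B := by exact_mod_cast hB
  have hP : (⟨m, M, B⟩ : SectoredSweep.Params).Admissible := by
    refine ⟨hB, hM, ?_⟩
    rw [le_div_iff₀ hB'] at hc
    exact_mod_cast hc
  obtain ⟨h1, h2, h3, h4⟩ := SectoredSweep.finalMachine_spec hP Z
  have hn : 1 ≤ SectoredSweep.gridSize m := (⟨m, M, B⟩ : SectoredSweep.Params).n_pos
  generalize SectoredSweep.finalMachine m M B Z = s at h1 h2 h3 h4 ⊢
  generalize SectoredSweep.visibleCount m Z = t
  refine ⟨h1, h2, ?_, ?_⟩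
  · have hlog := SectoredSweep.log_size_le hn
    generalize SectoredSweep.gridSize m = n at *
    have hmax := le_max_left 1 (Real.log (n : ℝ))
    have h5 : (s.time : ℝ) ≤ n * (51 * (Nat.log 2 (64 * n) : ℝ) + 250) := by exact_mod_cast h3
    have h6 : (0 : ℝ) ≤ n := n.cast_nonneg
    calc (s.time : ℝ) ≤ n * (51 * (Nat.log 2 (64 * n) : ℝ) + 250) := h5
      _ ≤ n * (1000 * max 1 (Real.log (n : ℝ))) := by
        refine mul_le_mul_of_nonneg_left ?_ h6
        linarith
      _ = _ := by ring
  · generalize SectoredSweep.gridSize m = n at *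
    -- There is at most one merge pass, so `scan(n)` alone bounds the I/Os and the sorting term only
    -- has to be nonnegative. The additive constant is absorbed because `scan(n) ≥ 1`.
    have hsort : 0 ≤ SectoredSweep.sortIOs M B t := by
      unfold SectoredSweep.sortIOs
      positivity
    have hscan : (n : ℝ) / B ≤ SectoredSweep.scanIOs B n := Nat.le_ceil _
    have hone : 1 ≤ SectoredSweep.scanIOs B n := by
      have : 0 < ⌈(n : ℝ) / B⌉₊ := Nat.ceil_pos.2 (div_pos (by exact_mod_cast hn) hB')
      unfold SectoredSweep.scanIOs
      exact_mod_cast this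
    have h5 : (B : ℝ) * s.ios ≤ 64 * n + 18 * B := by exact_mod_cast h4
    have h6 : (s.ios : ℝ) ≤ 64 * ((n : ℝ) / B) + 18 := by
      rw [← mul_le_mul_iff_right₀ hB']
      have : (B : ℝ) * (64 * ((n : ℝ) / B) + 18) = 64 * n + 18 * B := by
        field_simp
      rw [this]
      exact h5
    linarith
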